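/- A *multicategory* has $k$-morphisms $(a_1,\dots,a_k)\to b$ for all $k\ge 0$, units, compositions, and actions of the symmetric groups that permute sources, satisfying the usual unit, associativity and equivariance axioms. A *based multicategory* is a small multicategory $M$ with a multifunctor $*\to M$ from the terminal multicategory (one object, one $k$-morphism for each $k\ge0$). An object or morphism of $M$ *comes from the basepoint* if it is in the image of $*$. *Based multicategories.* A based $k$-linear map $f:(M_1,\dots,M_k)\to N$ is a function on objects $\prod_i \mathrm{Ob}\,M_i\to\mathrm{Ob}\,N$ together with, for each $m$-morphism $\phi:(a_1,\dots,a_m)\to a'$ of $M_j$ and objects $b_i$ of $M_i$ ($i\neq j$), an $m$-morphism $f(\phi;b):(f(a_1;b),\dots,f(a_m;b))\to f(a';b)$ of $N$, such that $f$ is a multifunctor in each variable separately; for each pair of variables, $m$-morphism $\phi$ and $n$-morphism $\psi$, the composites $f(a',\psi)\circ(f(\phi,b_s))_s$ and $f(\phi,b')\circ(f(a_r,\psi))_r$ agree up to the permutation that reverses the priority of the two indices (the other variables being fixed); and the output comes from the basepoint whenever one of the inputs does. A morphism $f\to g$ of such maps is a family of $1$-morphisms $\xi_x:f(x)\to g(x)$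 of $N$, indexed by the object tuples $x$, that is natural with respect to the multimorphisms in each variable and such that $\xi_x$ comes from the basepoint if some $x_i$ does. For $k=0$ these are the objects and $1$-morphisms of $N$. *Permutative categories.* A permutative category is a category with a strictly associative, strictly unital sum $(\oplus,0)$ and a symmetry $\gamma_{a,b}:a\oplus b\cong b\oplus a$ with $\gamma_{b,a}\gamma_{a,b}=1$, $\gamma_{a,0}=1$ and $\gamma_{a\oplus b,c}=(\gamma_{a,c}\oplus1)(1\oplus\gamma_{b,c})$. For small permutative categories, $\mathbf P_k(C_1,\dots,C_k;D)$ is the category whose objects are functors $f:C_1\times\dots\times C_k\to D$ with $f(c_1,\dots,c_k)=0$ if some $c_i=0$ and $f(u_1,\dots,u_k)=\mathrm{id}_0$ if some $u_i=\mathrm{id}_0$, together with natural maps $\delta_i:f(\dots,c_i,\dots)\oplus f(\dots,c_i',\dots)\to f(\dots,c_i\oplus c_i',\dots)$ for $1\le i\le k$. Each $\delta_i$ is the identity if $c_i$, $c_i'$ or some other $c_j$ is $0$; it is associative, $\delta_i(\delta_i\oplus1)=\delta_i(1\oplus\delta_i)$, and compatible with $\gamma$, $f(\gamma)\,\delta_i=\delta_i\,\gamma$;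 and for $i\ne j$ $$\delta_j(\delta_i\oplus\delta_i)=\delta_i(\delta_j\oplus\delta_j)(1\oplus\gamma\oplus1).$$ Morphisms are the natural transformations that commute with all $\delta_i$ and are $\mathrm{id}_0$ whenever some $c_i=0$. *Underlying based multicategory.* For a permutative category $C$, let $UC$ have the same objects, the morphisms $a_1\oplus\dots\oplus a_n\to b$ of $C$ as $n$-morphisms $(a_1,\dots,a_n)\to b$, composition and symmetric group actions induced from $\oplus$ and $\gamma$, and the basepoint $0$ with the identifications $0\oplus\dots\oplus0=0$. **Theorem.** (a) Small permutative categories with the categories $\mathbf P_k$ form a multicategory $\mathbf P$ enriched over $\mathbf{Cat}$, where the units are the identity functors with identity maps $\delta$, permutations permute the variables, $g(f_1,\dots,f_n)=g\circ(f_1\times\dots\times f_n)$, and $\delta_s$ of the composite, for the $i$-th variable of $f_j$, is $$g(f_j(c_{ji}))\oplus g(f_j(c'_{ji}))\xrightarrow{\ \delta^g_j\ } g(f_j(c_{ji})\oplus f_j(c'_{ji}))\xrightarrow{\ g(\delta_i^{f_j})\ } g(f_j(c_{ji}\oplus c'_{ji})).$$ Based multicategories, with the categories of based $k$-linear maps,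 the identities, permutation of variables and composition of multilinear maps, form a multicategory $\mathbf{Mult}_*$ enriched over $\mathbf{Cat}$. In both, $2$-cells are composed horizontally in the standard way. (b) For each permutative category $C$, $UC$ is a based multicategory, and $C\mapsto UC$ extends to a multifunctor $U:\mathbf P\to\mathbf{Mult}_*$ enriched over $\mathbf{Cat}$: $Uf$ is $f$ on objects, it takes $\phi:a_1\oplus\dots\oplus a_m\to a'$ in the $j$-th variable to the composite $$f(a_1)\oplus\dots\oplus f(a_m)\longrightarrow f(a_1\oplus\dots\oplus a_m)\xrightarrow{\ f(\phi)\ }f(a')$$ of the iterated $\delta_j$ and $f(\phi)$ (other variables fixed and suppressed), and $U$ of a natural transformation has the same components. (c) $U$ is full and faithful: for all $k\ge0$ and all $C_1,\dots,C_k,D$, the functor $$U:\mathbf P_k(C_1,\dots,C_k;D)\longrightarrow(\mathbf{Mult}_*)_k(UC_1,\dots,UC_k;UD)$$ is an isomorphism of categories. -/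

import Mathlib

open CategoryTheory

set_option linter.checkUnivs false

universe v u v' u' w w'

namespace PermMult

/-! ### Concatenation of tuples

A family of tuples `a i : Fin (k i) → α`, `i : Fin n`, is concatenated to a tuple indexed by
`Fin (∑ i, k i)` through Mathlib's lexicographic bijection `finSigmaFinEquiv`. -/

section Indices

/-- The block in which a position of a concatenation lies. -/
abbrev blk {n : ℕ} {k : Fin n → ℕ} (x : Fin (∑ i, k i)) : Fin n :=
  (finSigmaFinEquiv.symm x).1

/-- The place inside its block of a position of a concatenation. -/
abbrev pos {n : ℕ} {k : Fin n → ℕ} (x : Fin (∑ i, k i)) : Fin (k (blk x)) :=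
  (finSigmaFinEquiv.symm x).2

/-- Concatenation of a family of (dependent) tuples. -/
abbrev flat {n : ℕ} {k : Fin n → ℕ} {α : ∀ i, Fin (k i) → Type*} (a : ∀ i j, α i j)
    (x : Fin (∑ i, k i)) : α (blk x) (pos x) :=
  a (blk x) (pos x)

theorem flat_mk {n : ℕ} {k : Fin n → ℕ} {α : Type*} (a : ∀ i, Fin (k i) → α) (i : Fin n)
    (j : Fin (k i)) : a (blk (finSigmaFinEquiv ⟨i, j⟩)) (pos (finSigmaFinEquiv ⟨i, j⟩)) = a i j := by
  have h := finSigmaFinEquiv.symm_apply_apply (⟨i, j⟩ : (i : Fin n) × Fin (k i))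
  exact congrArg (fun p : (i : Fin n) × Fin (k i) => a p.1 p.2) h

/-- `n` blocks of length one. -/
def unitR (n : ℕ) : Fin (∑ _ : Fin n, 1) ≃ Fin n :=
  finSigmaFinEquiv.symm.trans (Equiv.sigmaUnique (Fin n) (fun _ => Fin 1))

/-- One block of length `k`. -/
def unitL (k : ℕ) : Fin (∑ _ : Fin 1, k) ≃ Fin k :=
  finSigmaFinEquiv.symm.trans
    ((Equiv.sigmaEquivProd (Fin 1) (Fin k)).trans (Equiv.uniqueProd (Fin k) (Fin 1)))

/-- Concatenating a family of families of tuples in either order. -/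
def assocEquiv {n : ℕ} {k : Fin n → ℕ} (l : ∀ i, Fin (k i) → ℕ) :
    Fin (∑ x : Fin (∑ i, k i), l (blk x) (pos x)) ≃ Fin (∑ i, ∑ j, l i j) :=
  finSigmaFinEquiv.symm.trans <|
    (Equiv.sigmaCongrLeft (β := fun y : (i : Fin n) × Fin (k i) => Fin (l y.1 y.2))
      finSigmaFinEquiv.symm).trans <|
    (Equiv.sigmaAssoc (fun i j => Fin (l i j))).trans <|
    (Equiv.sigmaCongrRight fun _ => finSigmaFinEquiv).trans finSigmaFinEquiv

/-- The block permutation: permuting the blocks of a concatenation. -/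
def outerEquiv {m n : ℕ} (e : Fin m ≃ Fin n) (k : Fin n → ℕ) :
    Fin (∑ i, k (e i)) ≃ Fin (∑ j, k j) :=
  finSigmaFinEquiv.symm.trans <|
    (Equiv.sigmaCongrLeft (β := fun j => Fin (k j)) e).trans finSigmaFinEquiv

/-- The block sum of permutations: permuting inside each block of a concatenation. -/
def innerEquiv {n : ℕ} {k l : Fin n → ℕ} (e : ∀ i, Fin (k i) ≃ Fin (l i)) :
    Fin (∑ i, k i) ≃ Fin (∑ i, l i) :=
  finSigmaFinEquiv.symm.trans <| (Equiv.sigmaCongrRight e).trans finSigmaFinEquiv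

/-- The permutation that reverses the priority of two indices: it takes `n` blocks of `m` entries
to `m` blocks of `n` entries. -/
def swapEquiv (m n : ℕ) : Fin (∑ _ : Fin n, m) ≃ Fin (∑ _ : Fin m, n) :=
  finSigmaFinEquiv.symm.trans <|
    ((Equiv.sigmaEquivProd (Fin n) (Fin m)).trans
      ((Equiv.prodComm (Fin n) (Fin m)).trans (Equiv.sigmaEquivProd (Fin m) (Fin n)).symm)).trans
    finSigmaFinEquiv

theorem flat_assocEquiv {n : ℕ} {k : Fin n → ℕ} {l : ∀ i, Fin (k i) → ℕ} {α : Type*}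
    (a : ∀ i j, Fin (l i j) → α) (z : Fin (∑ x : Fin (∑ i, k i), l (blk x) (pos x))) :
    flat (fun x => a (blk x) (pos x)) z = flat (fun i => flat (a i)) (assocEquiv l z) := by
  refine Eq.trans ?_ (flat_mk (fun i => flat (a i)) _ _).symm
  exact (flat_mk (a (blk (blk z))) (pos (blk z)) (pos z)).symm

theorem flat_outerEquiv {m n : ℕ} (e : Fin m ≃ Fin n) {k : Fin n → ℕ} {α : Type*}
    (a : ∀ j, Fin (k j) → α) (z : Fin (∑ i, k (e i))) :
    flat (fun i => a (e i)) z = flat a (outerEquiv e k z) :=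
  (flat_mk a (e (blk z)) (pos z)).symm

theorem flat_innerEquiv {n : ℕ} {k l : Fin n → ℕ} (e : ∀ i, Fin (k i) ≃ Fin (l i)) {α : Type*}
    {a : ∀ i, Fin (l i) → α} {a' : ∀ i, Fin (k i) → α} (h : ∀ i j, a' i j = a i (e i j))
    (z : Fin (∑ i, k i)) : flat a' z = flat a (innerEquiv e z) :=
  (h _ _).trans (flat_mk a (blk z) (e _ (pos z))).symm

theorem flat_swapEquiv {m n : ℕ} {α : Type*} (a : Fin n → Fin m → α) (z : Fin (∑ _ : Fin n, m)) :
    flat a z = flat (fun r s => a s r) (swapEquiv m n z) :=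
  (flat_mk (fun r s => a s r) (pos z) (blk z)).symm

theorem flat_unitR {n : ℕ} {α : Type*} (a : Fin n → α) (z : Fin (∑ _ : Fin n, 1)) :
    flat (fun i (_ : Fin 1) => a i) z = a (unitR n z) := rfl

theorem flat_unitL {k : ℕ} {α : Type*} (a : Fin k → α) (z : Fin (∑ _ : Fin 1, k)) :
    flat (fun (_ : Fin 1) => a) z = a (unitL k z) := rfl

theorem flat_unitR_symm {n : ℕ} {α : Type*} (a : Fin n → α) (i : Fin n) :
    a i = flat (fun i (_ : Fin 1) => a i) ((unitR n).symm i) :=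
  (flat_mk (fun i (_ : Fin 1) => a i) i 0).symm

theorem flat_unitL_symm {k : ℕ} {α : Type*} (a : Fin k → α) (i : Fin k) :
    a i = flat (fun (_ : Fin 1) => a) ((unitL k).symm i) :=
  (flat_mk (fun (_ : Fin 1) => a) 0 i).symm

theorem unitL_symm (k : ℕ) (i : Fin k) : (unitL k).symm i = finSigmaFinEquiv ⟨0, i⟩ := rfl

theorem unitR_symm (n : ℕ) (i : Fin n) : (unitR n).symm i = finSigmaFinEquiv ⟨i, 0⟩ := rfl

end Indices

/-! ### Multicategories -/

/-- The operations of a (symmetric) multicategory. The symmetric group action is written as an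
action of the bijections `e : Fin m ≃ Fin n` (so `m = n`), and the source of `reindex e f` may be
any tuple that is equal to the permuted one: for `m = n` this is
`σ^* : M_k(a_1, …, a_k; b) → M_k(a_{σ(1)}, …, a_{σ(k)}; b)`, and for `e` the identity it is the
transport along an equality of source tuples (see `reindex_refl`). -/
structure MulticategoryData where
  Obj : Type u
  Hom : (k : ℕ) → (Fin k → Obj) → Obj → Type v
  reindex : ∀ {m n : ℕ} (e : Fin m ≃ Fin n) {a : Fin n → Obj} {a' : Fin m → Obj} {b : Obj},
    (∀ i, a' i = a (e i)) → Hom n a b → Hom m a' b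
  id : ∀ a : Obj, Hom 1 (fun _ => a) a
  comp : ∀ {n : ℕ} {b : Fin n → Obj} {c : Obj} {k : Fin n → ℕ} {a : ∀ i, Fin (k i) → Obj},
    Hom n b c → (∀ i, Hom (k i) (a i) (b i)) → Hom (∑ i, k i) (flat a) c

/-- The axioms of a multicategory: a group action, units, associativity and equivariance. -/
structure MulticategoryData.IsMulticategory (M : MulticategoryData.{v, u}) : Prop where
  reindex_refl : ∀ {n : ℕ} {a : Fin n → M.Obj} {b : M.Obj} (f : M.Hom n a b),
    M.reindex (Equiv.refl _) (fun _ => rfl) f = f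
  reindex_trans : ∀ {l m n : ℕ} (e : Fin l ≃ Fin m) (e' : Fin m ≃ Fin n) {a : Fin n → M.Obj}
    {a' : Fin m → M.Obj} {a'' : Fin l → M.Obj} {b : M.Obj} (h : ∀ i, a'' i = a' (e i))
    (h' : ∀ i, a' i = a (e' i)) (f : M.Hom n a b),
    M.reindex e h (M.reindex e' h' f) =
      M.reindex (e.trans e') (fun i => (h i).trans (h' (e i))) f
  comp_id : ∀ {n : ℕ} {b : Fin n → M.Obj} {c : M.Obj} (g : M.Hom n b c),
    M.comp g (fun i => M.id (b i)) = M.reindex (unitR n) (flat_unitR b) g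
  id_comp : ∀ {k : ℕ} {a : Fin k → M.Obj} {b : M.Obj} (f : M.Hom k a b),
    M.comp (M.id b) (fun _ => f) = M.reindex (unitL k) (flat_unitL a) f
  assoc : ∀ {n : ℕ} {c : Fin n → M.Obj} {d : M.Obj} {k : Fin n → ℕ} {b : ∀ i, Fin (k i) → M.Obj}
    {l : ∀ i, Fin (k i) → ℕ} {a : ∀ i j, Fin (l i j) → M.Obj} (h : M.Hom n c d)
    (g : ∀ i, M.Hom (k i) (b i) (c i)) (f : ∀ i j, M.Hom (l i j) (a i j) (b i j)),
    M.comp (M.comp h g) (fun x => f (blk x) (pos x)) =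
      M.reindex (assocEquiv l) (flat_assocEquiv a) (M.comp h (fun i => M.comp (g i) (f i)))
  comp_reindex_outer : ∀ {m n : ℕ} (e : Fin m ≃ Fin n) {b : Fin n → M.Obj} {c : M.Obj}
    {k : Fin n → ℕ} {a : ∀ j, Fin (k j) → M.Obj} (g : M.Hom n b c)
    (f : ∀ j, M.Hom (k j) (a j) (b j)),
    M.comp (M.reindex e (a' := fun i => b (e i)) (fun _ => rfl) g) (fun i => f (e i)) =
      M.reindex (outerEquiv e k) (flat_outerEquiv e a) (M.comp g f)
  comp_reindex_inner : ∀ {n : ℕ} {b : Fin n → M.Obj} {c : M.Obj} {k l : Fin n → ℕ}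
    (e : ∀ i, Fin (k i) ≃ Fin (l i)) {a : ∀ i, Fin (l i) → M.Obj} {a' : ∀ i, Fin (k i) → M.Obj}
    (h : ∀ i j, a' i j = a i (e i j)) (g : M.Hom n b c) (f : ∀ i, M.Hom (l i) (a i) (b i)),
    M.comp g (fun i => M.reindex (e i) (h i) (f i)) =
      M.reindex (innerEquiv e) (flat_innerEquiv e h) (M.comp g f)

/-- The operations of a multicategory together with the values of a map from the terminal
multicategory (one object, one `n`-morphism for each `n`): an object and an `n`-morphism
`pt, …, pt → pt` for each `n`. -/
structure BasedMulticategoryData extends MulticategoryData.{v, u} where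
  pt : Obj
  ptHom : ∀ n : ℕ, Hom n (fun _ => pt) pt

/-- The axioms of a based multicategory: those of a multicategory, and that the given map from the
terminal multicategory is a multifunctor. -/
structure BasedMulticategoryData.IsBased (M : BasedMulticategoryData.{v, u}) : Prop extends
    M.toMulticategoryData.IsMulticategory where
  reindex_ptHom : ∀ {m n : ℕ} (e : Fin m ≃ Fin n),
    M.reindex e (fun _ => rfl) (M.ptHom n) = M.ptHom m
  ptHom_one : M.ptHom 1 = M.id M.pt
  comp_ptHom : ∀ {n : ℕ} (k : Fin n → ℕ),
    M.comp (M.ptHom n) (fun i => M.ptHom (k i)) = M.ptHom (∑ i, k i)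

/-- A (small) based multicategory. -/
structure BasedMulticategory extends BasedMulticategoryData.{v, u} where
  isBased : toBasedMulticategoryData.IsBased

namespace BasedMulticategory

variable (M : BasedMulticategory.{v, u})

/-- A morphism comes from the basepoint if it is in the image of the map from the terminal
multicategory. -/
inductive FromBase : ∀ {n : ℕ} {a : Fin n → M.Obj} {b : M.Obj}, M.Hom n a b → Prop
  | mk (n : ℕ) : FromBase (M.ptHom n)

variable {M}

/-- Composition of an `m`-morphism with a `1`-morphism out of its target. -/
def post {m : ℕ} {a : Fin m → M.Obj} {b c : M.Obj} (u : M.Hom 1 (fun _ => b) c)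
    (f : M.Hom m a b) : M.Hom m a c :=
  M.reindex (unitL m).symm (flat_unitL_symm a) (M.comp u (fun _ => f))

/-- Composition of an `m`-morphism with `1`-morphisms into its sources. -/
def pre {m : ℕ} {a b : Fin m → M.Obj} {c : M.Obj} (f : M.Hom m b c)
    (u : ∀ i, M.Hom 1 (fun _ => a i) (b i)) : M.Hom m a c :=
  M.reindex (unitR m).symm (flat_unitR_symm a) (M.comp f u)

end BasedMulticategory

section IndexLemmas

theorem innerEquiv_mk {n : ℕ} {k l : Fin n → ℕ} (e : ∀ i, Fin (k i) ≃ Fin (l i)) (i : Fin n)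
    (j : Fin (k i)) : innerEquiv e (finSigmaFinEquiv ⟨i, j⟩) = finSigmaFinEquiv ⟨i, e i j⟩ := by
  simp [innerEquiv]

theorem outerEquiv_mk {m n : ℕ} (e : Fin m ≃ Fin n) (k : Fin n → ℕ) (i : Fin m)
    (j : Fin (k (e i))) :
    outerEquiv e k (finSigmaFinEquiv ⟨i, j⟩) = finSigmaFinEquiv ⟨e i, j⟩ := by
  simp [outerEquiv, Equiv.sigmaCongrLeft]

theorem assocEquiv_mk {n : ℕ} {k : Fin n → ℕ} (l : ∀ i, Fin (k i) → ℕ) (x : Fin (∑ i, k i))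
    (p : Fin (l (blk x) (pos x))) : assocEquiv l (finSigmaFinEquiv ⟨x, p⟩) =
      finSigmaFinEquiv ⟨blk x, finSigmaFinEquiv ⟨pos x, p⟩⟩ := by
  have h := finSigmaFinEquiv.symm_apply_apply
    (⟨x, p⟩ : (x : Fin (∑ i, k i)) × Fin (l (blk x) (pos x)))
  exact congrArg (fun q : (x : Fin (∑ i, k i)) × Fin (l (blk x) (pos x)) =>
    (finSigmaFinEquiv ⟨blk q.1, finSigmaFinEquiv ⟨pos q.1, q.2⟩⟩ : Fin (∑ i, ∑ j, l i j))) h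

end IndexLemmas

namespace BasedMulticategory

variable {M : BasedMulticategory.{v, u}}

theorem reindex_congr {m n : ℕ} {e e' : Fin m ≃ Fin n} (he : e = e') {a : Fin n → M.Obj}
    {a' : Fin m → M.Obj} {b : M.Obj} (h : ∀ i, a' i = a (e i)) (f : M.Hom n a b) :
    M.reindex e h f = M.reindex e' (fun i => he ▸ h i) f := by
  subst he; rfl

theorem reindex_self {n : ℕ} (e : Fin n ≃ Fin n) (he : ∀ i, e i = i) {a : Fin n → M.Obj} {b : M.Obj}
    (h : ∀ i, a i = a (e i)) (f : M.Hom n a b) : M.reindex e h f = f := by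
  have : e = Equiv.refl _ := Equiv.ext he
  subst this
  exact M.isBased.reindex_refl f

theorem post_id {m : ℕ} {a : Fin m → M.Obj} {b : M.Obj} (f : M.Hom m a b) :
    post (M.id b) f = f := by
  unfold post
  rw [M.isBased.id_comp, M.isBased.reindex_trans]
  exact reindex_self _ (fun i => by simp) _ _

theorem pre_id {m : ℕ} {a : Fin m → M.Obj} {b : M.Obj} (f : M.Hom m a b) :
    pre f (fun i => M.id (a i)) = f := by
  unfold pre
  rw [M.isBased.comp_id, M.isBased.reindex_trans]
  exact reindex_self _ (fun i => by simp) _ _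

theorem post_id_right {a b : M.Obj} (u : M.Hom 1 (fun _ => a) b) : post u (M.id a) = u := by
  unfold post
  rw [M.isBased.comp_id u, M.isBased.reindex_trans]
  exact reindex_self _ (fun i => Subsingleton.elim _ _) _ _

theorem post_post {m : ℕ} {a : Fin m → M.Obj} {b c d : M.Obj} (w : M.Hom 1 (fun _ => c) d)
    (u : M.Hom 1 (fun _ => b) c) (f : M.Hom m a b) : post w (post u f) = post (post w u) f := by
  unfold post
  rw [M.isBased.comp_reindex_inner (k := fun _ => m) (fun _ => (unitL m).symm) _ w
    (fun _ => M.comp u (fun _ => f)), M.isBased.reindex_trans]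
  have := M.isBased.comp_reindex_outer (k := fun _ => m) (unitL 1).symm
    (M.comp w (fun _ => u)) (fun _ => f)
  erw [this]
  have h3 := M.isBased.assoc w (fun _ => u) (fun _ _ => f)
  rw [h3]
  rw [M.isBased.reindex_trans, M.isBased.reindex_trans]
  apply reindex_congr
  refine Equiv.ext fun i => ?_
  rw [Equiv.trans_apply, Equiv.trans_apply, Equiv.trans_apply, unitL_symm, innerEquiv_mk,
    outerEquiv_mk (unitL 1).symm (fun _ => m), assocEquiv_mk (fun _ _ => m), unitL_symm]
  have key : ∀ p q : Fin 1, (finSigmaFinEquiv ⟨0, finSigmaFinEquiv ⟨0, i⟩⟩ :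
      Fin (∑ _ : Fin 1, ∑ _ : Fin 1, m)) = finSigmaFinEquiv ⟨p, finSigmaFinEquiv ⟨q, i⟩⟩ := by
    intro p q
    rw [Subsingleton.elim p 0, Subsingleton.elim q 0]
  exact key _ _

/-- Outer equivariance for blocks of equal length, with a flexible presentation of the tuples. -/
theorem comp_reindex_const {m n l : ℕ} (e : Fin m ≃ Fin n) {b : Fin n → M.Obj} {c : M.Obj}
    {a : Fin n → Fin l → M.Obj} (g : M.Hom n b c) (f : ∀ j, M.Hom l (a j) (b j))
    {b' : Fin m → M.Obj} {a' : Fin m → Fin l → M.Obj} (f' : ∀ i, M.Hom l (a' i) (b' i))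
    (h : ∀ i, b' i = b (e i))
    (H : ∀ i, (⟨a' i, b' i, f' i⟩ : (a : Fin l → M.Obj) × (b : M.Obj) × M.Hom l a b) =
      ⟨a (e i), b (e i), f (e i)⟩)
    (h' : ∀ z, flat a' z = flat a (outerEquiv e (fun _ => l) z)) :
    M.comp (M.reindex e h g) f' = M.reindex (outerEquiv e (fun _ => l)) h' (M.comp g f) := by
  obtain rfl : a' = fun i => a (e i) := funext fun i => congrArg (·.1) (H i)
  obtain rfl : b' = fun i => b (e i) := funext h
  obtain rfl : f' = fun i => f (e i) := funext fun i => by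
    have := H i
    simp only [Sigma.mk.injEq, heq_eq_eq, true_and] at this
    exact this
  exact M.isBased.comp_reindex_outer e g f

theorem post_pre {m : ℕ} {a b : Fin m → M.Obj} {c d : M.Obj} (w : M.Hom 1 (fun _ => c) d)
    (g : M.Hom m b c) (u : ∀ i, M.Hom 1 (fun _ => a i) (b i)) :
    post w (pre g u) = pre (post w g) u := by
  unfold post pre
  rw [M.isBased.comp_reindex_inner (k := fun _ => m) (fun _ => (unitR m).symm) _ w
    (fun _ => M.comp g u), M.isBased.reindex_trans]
  have hF : ∀ i, (⟨fun _ => a i, b i, u i⟩ :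
      (a : Fin 1 → M.Obj) × (b : M.Obj) × M.Hom 1 a b) =
      ⟨fun _ => a (pos ((unitL m).symm i)), b (pos ((unitL m).symm i)),
        u (pos ((unitL m).symm i))⟩ := fun i =>
    (flat_mk (fun (_ : Fin 1) i => (⟨fun _ => a i, b i, u i⟩ :
      (a : Fin 1 → M.Obj) × (b : M.Obj) × M.Hom 1 a b)) 0 i).symm
  rw [comp_reindex_const (l := 1) (unitL m).symm (M.comp w (fun _ => g)) (fun x => u (pos x)) u
    (flat_unitL_symm b) hF
    (fun z => congrArg (fun s : (a : Fin 1 → M.Obj) × (b : M.Obj) × M.Hom 1 a b => s.1 0)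
      (hF (blk z)) |>.trans
        (flat_mk (fun x (_ : Fin 1) => a (pos x)) ((unitL m).symm (blk z)) (pos z)).symm),
    M.isBased.assoc w (fun _ => g) (fun _ i => u i),
    M.isBased.reindex_trans, M.isBased.reindex_trans]
  apply reindex_congr
  refine Equiv.ext fun i => ?_
  rw [Equiv.trans_apply, Equiv.trans_apply, Equiv.trans_apply, unitL_symm, innerEquiv_mk,
    unitR_symm,
    outerEquiv_mk (unitL m).symm (fun _ => 1), assocEquiv_mk (fun _ _ => 1), unitL_symm]
  exact (flat_mk (fun p q => (finSigmaFinEquiv ⟨p, finSigmaFinEquiv ⟨q, 0⟩⟩ :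
      Fin (∑ _ : Fin 1, ∑ _ : Fin m, 1))) 0 i).symm

theorem pre_pre {m : ℕ} {a b c : Fin m → M.Obj} {d : M.Obj} (g : M.Hom m c d)
    (u : ∀ i, M.Hom 1 (fun _ => b i) (c i)) (t : ∀ i, M.Hom 1 (fun _ => a i) (b i)) :
    pre (pre g u) t = pre g (fun i => post (u i) (t i)) := by
  unfold post pre
  rw [M.isBased.comp_reindex_inner (k := fun _ => 1) (fun _ => (unitL 1).symm) _ g
    (fun i => M.comp (u i) (fun _ => t i)), M.isBased.reindex_trans]
  have hF : ∀ i, (⟨fun _ => a i, b i, t i⟩ :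
      (a : Fin 1 → M.Obj) × (b : M.Obj) × M.Hom 1 a b) =
      ⟨fun _ => a (blk ((unitR m).symm i)), b (blk ((unitR m).symm i)),
        t (blk ((unitR m).symm i))⟩ := fun i =>
    (flat_mk (fun i (_ : Fin 1) => (⟨fun _ => a i, b i, t i⟩ :
      (a : Fin 1 → M.Obj) × (b : M.Obj) × M.Hom 1 a b)) i 0).symm
  rw [comp_reindex_const (l := 1) (unitR m).symm (M.comp g u) (fun x => t (blk x)) t
    (flat_unitR_symm b) hF
    (fun z => congrArg (fun s : (a : Fin 1 → M.Obj) × (b : M.Obj) × M.Hom 1 a b => s.1 0)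
      (hF (blk z)) |>.trans
        (flat_mk (fun x (_ : Fin 1) => a (blk x)) ((unitR m).symm (blk z)) (pos z)).symm),
    M.isBased.assoc g u (fun i _ => t i),
    M.isBased.reindex_trans, M.isBased.reindex_trans]
  apply reindex_congr
  refine Equiv.ext fun i => ?_
  rw [Equiv.trans_apply, Equiv.trans_apply, Equiv.trans_apply, unitR_symm, innerEquiv_mk,
    outerEquiv_mk (unitR m).symm (fun _ => 1), assocEquiv_mk (fun _ _ => 1), unitR_symm, unitL_symm]
  exact (flat_mk (fun p q => (finSigmaFinEquiv ⟨p, finSigmaFinEquiv ⟨q, 0⟩⟩ :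
      Fin (∑ _ : Fin m, ∑ _ : Fin 1, 1))) i 0)

theorem FromBase.id_pt : M.FromBase (M.id M.pt) := by
  rw [← M.isBased.ptHom_one]; exact .mk 1

theorem FromBase.id {a : M.Obj} (h : a = M.pt) : M.FromBase (M.id a) := by
  subst h; exact .id_pt

theorem post_ptHom {n : ℕ} : post (M.ptHom 1) (M.ptHom n) = M.ptHom n := by
  rw [M.isBased.ptHom_one, post_id]

theorem FromBase.target {n : ℕ} {a : Fin n → M.Obj} {b : M.Obj} {f : M.Hom n a b}
    (h : M.FromBase f) : b = M.pt := by cases h; rfl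

theorem FromBase.heq {n : ℕ} {a : Fin n → M.Obj} {b : M.Obj} {f : M.Hom n a b}
    (h : M.FromBase f) : HEq f (M.ptHom n) := by cases h; rfl

theorem FromBase.post {n : ℕ} {a : Fin n → M.Obj} {b c : M.Obj} {u : M.Hom 1 (fun _ => b) c}
    {f : M.Hom n a b} (hu : M.FromBase u) (hf : M.FromBase f) :
    M.FromBase (BasedMulticategory.post u f) := by
  cases hf
  obtain rfl := hu.target
  obtain rfl := eq_of_heq hu.heq
  rw [post_ptHom]
  exact .mk n

end BasedMulticategory

/-! ### Multilinear maps of based multicategories -/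

/-- A based `k`-linear map `(M_1, …, M_k) → N` of based multicategories: a function on objects,
and, for an `m`-morphism `φ : (a_1, …, a_m) → a'` of `M_j` and objects of the other `M_i`, an
`m`-morphism of `N`. The choice of the other objects is recorded in the tuple `x'`, which has `a'`
in the place `j`; the tuples `x r` are obtained from `x'` by putting `a_r` in the place `j`. (All
hypotheses on tuples in the fields only say which tuples are meant.) -/
structure MultiLin {k : ℕ} (M : Fin k → BasedMulticategory.{v, u})
    (N : BasedMulticategory.{v', u'}) where
  obj : (∀ i, (M i).Obj) → N.Obj
  map : ∀ (j : Fin k) {m : ℕ} {a : Fin m → (M j).Obj} {a' : (M j).Obj} (_ : (M j).Hom m a a')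
    (x : Fin m → ∀ i, (M i).Obj) (x' : ∀ i, (M i).Obj)
    (_ : ∀ r, x r = Function.update x' j (a r)) (_ : x' j = a'),
    N.Hom m (fun r => obj (x r)) (obj x')
  /-- `f` is multifunctorial in each variable: identities. -/
  map_id : ∀ (j : Fin k) (x : ∀ i, (M i).Obj) (h : ∀ _ : Fin 1, x = Function.update x j (x j)),
    map j ((M j).id (x j)) (fun _ => x) x h rfl = N.id (obj x)
  /-- `f` is multifunctorial in each variable: composition. -/
  map_comp : ∀ (j : Fin k) {n : ℕ} {b : Fin n → (M j).Obj} {c : (M j).Obj} {l : Fin n → ℕ}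
    {a : ∀ i, Fin (l i) → (M j).Obj} (ψ : (M j).Hom n b c)
    (φ : ∀ i, (M j).Hom (l i) (a i) (b i))
    (x : ∀ i, Fin (l i) → ∀ i, (M i).Obj) (y : Fin n → ∀ i, (M i).Obj) (z : ∀ i, (M i).Obj)
    (hx : ∀ i r, x i r = Function.update (y i) j (a i r)) (hy : ∀ i, y i j = b i)
    (hy' : ∀ i, y i = Function.update z j (b i)) (hz : z j = c)
    (hxz : ∀ s, flat x s = Function.update z j (flat a s)),
    map j ((M j).comp ψ φ) (flat x) z hxz hz =
      N.comp (map j ψ y z hy' hz) (fun i => map j (φ i) (x i) (y i) (hx i) (hy i))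
  /-- `f` is multifunctorial in each variable: symmetric group actions. -/
  map_reindex : ∀ (j : Fin k) {m n : ℕ} (e : Fin m ≃ Fin n) {a : Fin n → (M j).Obj}
    {a' : Fin m → (M j).Obj} {b : (M j).Obj} (h : ∀ i, a' i = a (e i)) (φ : (M j).Hom n a b)
    (x : Fin n → ∀ i, (M i).Obj) (y : ∀ i, (M i).Obj)
    (hx : ∀ r, x r = Function.update y j (a r)) (hy : y j = b)
    (hx' : ∀ r, x (e r) = Function.update y j (a' r)),
    map j ((M j).reindex e h φ) (fun r => x (e r)) y hx' hy =
      N.reindex e (fun _ => rfl) (map j φ x y hx hy)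
  /-- `f` is bilinear in each pair of variables. -/
  bilinear : ∀ (i j : Fin k), i ≠ j → ∀ {m n : ℕ} {a : Fin m → (M i).Obj} {a' : (M i).Obj}
    {b : Fin n → (M j).Obj} {b' : (M j).Obj} (φ : (M i).Hom m a a') (ψ : (M j).Hom n b b')
    (x : Fin m → Fin n → ∀ i, (M i).Obj) (p : Fin n → ∀ i, (M i).Obj)
    (q : Fin m → ∀ i, (M i).Obj) (t : ∀ i, (M i).Obj)
    (hi : t i = a') (hj : t j = b') (hp : ∀ s, p s = Function.update t j (b s))
    (hq : ∀ r, q r = Function.update t i (a r))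
    (hpx : ∀ s r, x r s = Function.update (p s) i (a r))
    (hqx : ∀ r s, x r s = Function.update (q r) j (b s))
    (hpi : ∀ s, p s i = a') (hqj : ∀ r, q r j = b'),
    N.comp (map j ψ p t hp hj) (fun s => map i φ (fun r => x r s) (p s) (hpx s) (hpi s)) =
      N.reindex (swapEquiv m n) (flat_swapEquiv (fun s r => obj (x r s)))
        (N.comp (map i φ q t hq hi) (fun r => map j ψ (x r) (q r) (hqx r) (hqj r)))
  /-- If an input object is the base object, then so is the output. -/
  obj_base : ∀ x : ∀ i, (M i).Obj, (∃ i, x i = (M i).pt) → obj x = N.pt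
  /-- If an input morphism or one of the other input objects comes from the basepoint, then so does
  the output. -/
  map_base : ∀ (j : Fin k) {m : ℕ} {a : Fin m → (M j).Obj} {a' : (M j).Obj} (φ : (M j).Hom m a a')
    (x : Fin m → ∀ i, (M i).Obj) (x' : ∀ i, (M i).Obj)
    (hx : ∀ r, x r = Function.update x' j (a r)) (hx' : x' j = a'),
    ((M j).FromBase φ ∨ ∃ i, i ≠ j ∧ x' i = (M i).pt) → N.FromBase (map j φ x x' hx hx')

namespace MultiLin

variable {k : ℕ} {M : Fin k → BasedMulticategory.{v, u}} {N : BasedMulticategory.{v', u'}}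

open BasedMulticategory

/-- A morphism of based `k`-linear maps: a based multinatural transformation, natural with respect
to the multimorphisms in each variable. -/
@[ext]
structure Trans (f g : MultiLin M N) where
  app : ∀ x : ∀ i, (M i).Obj, N.Hom 1 (fun _ => f.obj x) (g.obj x)
  naturality : ∀ (j : Fin k) {m : ℕ} {a : Fin m → (M j).Obj} {a' : (M j).Obj}
    (φ : (M j).Hom m a a') (x : Fin m → ∀ i, (M i).Obj) (x' : ∀ i, (M i).Obj)
    (hx : ∀ r, x r = Function.update x' j (a r)) (hx' : x' j = a'),
    pre (g.map j φ x x' hx hx') (fun r => app (x r)) = post (app x') (f.map j φ x x' hx hx')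
  app_base : ∀ x : ∀ i, (M i).Obj, (∃ i, x i = (M i).pt) → N.FromBase (app x)

/-- The category of based `k`-linear maps. -/
instance : Category (MultiLin M N) where
  Hom f g := Trans f g
  id f :=
    { app := fun x => N.id (f.obj x)
      naturality := fun j m a a' φ x x' hx hx' => by rw [pre_id, post_id]
      app_base := fun x hx => .id (f.obj_base x hx) }
  comp ξ η :=
    { app := fun x => post (η.app x) (ξ.app x)
      naturality := fun j m a a' φ x x' hx hx' => by
        rw [← pre_pre, η.naturality, ← post_pre, ξ.naturality, post_post]
      app_base := fun x hx => (η.app_base x hx).post (ξ.app_base x hx) }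
  id_comp ξ := Trans.ext (funext fun x => post_id_right _)
  comp_id ξ := Trans.ext (funext fun x => post_id _)
  assoc ξ η ζ := Trans.ext (funext fun x => post_post _ _ _)

end MultiLin

/-! ### Permutative categories -/

/-- A (small) permutative category. -/
structure PermCat where
  Obj : Type u
  [cat : Category.{v} Obj]
  /-- the functor `⊕` on objects -/
  add : Obj → Obj → Obj
  /-- the functor `⊕` on morphisms -/
  addMap : ∀ {a a' b b' : Obj}, (a ⟶ a') → (b ⟶ b') → (add a b ⟶ add a' b')
  addMap_id : ∀ a b : Obj, addMap (𝟙 a) (𝟙 b) = 𝟙 (add a b)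
  addMap_comp : ∀ {a a' a'' b b' b'' : Obj} (f : a ⟶ a') (f' : a' ⟶ a'') (g : b ⟶ b')
    (g' : b' ⟶ b''), addMap (f ≫ f') (g ≫ g') = addMap f g ≫ addMap f' g'
  zero : Obj
  add_assoc : ∀ a b c : Obj, add (add a b) c = add a (add b c)
  add_zero : ∀ a : Obj, add a zero = a
  zero_add : ∀ a : Obj, add zero a = a
  addMap_assoc : ∀ {a a' b b' c c' : Obj} (f : a ⟶ a') (g : b ⟶ b') (h : c ⟶ c'),
    addMap (addMap f g) h =
      eqToHom (add_assoc a b c) ≫ addMap f (addMap g h) ≫ eqToHom (add_assoc a' b' c').symm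
  addMap_zero : ∀ {a a' : Obj} (f : a ⟶ a'),
    addMap f (𝟙 zero) = eqToHom (add_zero a) ≫ f ≫ eqToHom (add_zero a').symm
  zero_addMap : ∀ {a a' : Obj} (f : a ⟶ a'),
    addMap (𝟙 zero) f = eqToHom (zero_add a) ≫ f ≫ eqToHom (zero_add a').symm
  /-- the symmetry -/
  γ : ∀ a b : Obj, add a b ⟶ add b a
  γ_naturality : ∀ {a a' b b' : Obj} (f : a ⟶ a') (g : b ⟶ b'),
    addMap f g ≫ γ a' b' = γ a b ≫ addMap g f
  γ_zero : ∀ a : Obj, γ a zero = eqToHom ((add_zero a).trans (zero_add a).symm)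
  γ_γ : ∀ a b : Obj, γ a b ≫ γ b a = 𝟙 (add a b)
  γ_add : ∀ a b c : Obj, γ (add a b) c =
    eqToHom (add_assoc a b c) ≫ addMap (𝟙 a) (γ b c) ≫ eqToHom (add_assoc a c b).symm ≫
      addMap (γ a c) (𝟙 b) ≫ eqToHom (add_assoc c a b)

namespace PermCat

attribute [instance] PermCat.cat

variable (C : PermCat.{v, u})

/-- The map `1 ⊕ γ ⊕ 1`. -/
def interchange (a b c d : C.Obj) :
    C.add (C.add a b) (C.add c d) ⟶ C.add (C.add a c) (C.add b d) :=
  eqToHom ((C.add_assoc a b (C.add c d)).trans (congrArg (C.add a) (C.add_assoc b c d).symm)) ≫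
    C.addMap (𝟙 a) (C.addMap (C.γ b c) (𝟙 d)) ≫
    eqToHom ((congrArg (C.add a) (C.add_assoc c b d)).trans (C.add_assoc a c (C.add b d)).symm)

/-- The iterated sum `a_1 ⊕ ⋯ ⊕ a_n` of a tuple (the empty sum is `0`). -/
def sum : ∀ {n : ℕ}, (Fin n → C.Obj) → C.Obj
  | 0, _ => C.zero
  | _ + 1, a => C.add (a 0) (sum fun i => a i.succ)

/-- The iterated sum of a tuple of morphisms. -/
def sumMap : ∀ {n : ℕ} {a b : Fin n → C.Obj}, (∀ i, a i ⟶ b i) → (C.sum a ⟶ C.sum b)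
  | 0, _, _, _ => 𝟙 C.zero
  | _ + 1, _, _, f => C.addMap (f 0) (sumMap fun i => f i.succ)

theorem sum_zero (n : ℕ) : C.sum (fun _ : Fin n => C.zero) = C.zero := by
  induction n with
  | zero => rfl
  | succ n ih => exact (C.zero_add _).trans ih

theorem sum_one (a : Fin 1 → C.Obj) : C.sum a = a 0 := C.add_zero _

theorem sum_cast {n n' : ℕ} (h : n' = n) (b : Fin n → C.Obj) :
    C.sum (b ∘ Fin.cast h) = C.sum b := by
  subst h; rfl

theorem sum_append {m n : ℕ} (a : Fin m → C.Obj) (b : Fin n → C.Obj) :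
    C.sum (Fin.append a b) = C.add (C.sum a) (C.sum b) := by
  induction m with
  | zero =>
    refine Eq.trans ?_ (C.zero_add _).symm
    have : Fin.append a b = b ∘ Fin.cast (by omega) := by
      rw [Subsingleton.elim a Fin.elim0, Fin.elim0_append]
    rw [this]
    exact C.sum_cast _ b
  | succ m ih =>
    rw [← C.sum_cast (show m + n + 1 = m + 1 + n by omega)]
    show C.add _ _ = C.add (C.add _ _) _
    rw [C.add_assoc, ← ih]
    congr 1
    congr 1
    funext i
    refine Fin.addCases (fun i => ?_) (fun i => ?_) i
    · rw [Fin.append_left]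
      show Fin.append a b _ = _
      rw [show Fin.cast (show m + n + 1 = m + 1 + n by omega) (Fin.castAdd n i).succ =
        Fin.castAdd n i.succ from rfl, Fin.append_left]
    · rw [Fin.append_right]
      show Fin.append a b _ = _
      rw [show Fin.cast (show m + n + 1 = m + 1 + n by omega) (Fin.natAdd m i).succ =
        Fin.natAdd (m + 1) i from Fin.ext (by simp; omega), Fin.append_right]

/-- The iterated sum of a concatenation is the sum of the sums of the blocks. -/
theorem sum_flat {n : ℕ} {k : Fin n → ℕ} (a : ∀ i, Fin (k i) → C.Obj) :
    C.sum (flat a) = C.sum (fun i => C.sum (a i)) := by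
  induction n with
  | zero => rfl
  | succ n ih =>
    have hk : k 0 + ∑ i : Fin n, k i.succ = ∑ i, k i := (Fin.sum_univ_succ k).symm
    rw [← C.sum_cast hk]
    refine Eq.trans ?_ (congrArg (C.add (C.sum (a 0))) (ih fun i => a i.succ))
    rw [← sum_append]
    congr 1
    funext x
    refine Fin.addCases (fun i => ?_) (fun i => ?_) x
    · rw [Fin.append_left]
      refine Eq.trans ?_ (flat_mk a 0 i)
      refine congrArg (flat a) (Fin.ext ?_)
      rw [finSigmaFinEquiv_apply]
      simp
    · rw [Fin.append_right]
      obtain ⟨⟨i, j⟩, rfl⟩ := finSigmaFinEquiv.surjective i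
      refine Eq.trans ?_ ((flat_mk a i.succ j).trans (flat_mk (fun i => a i.succ) i j).symm)
      refine congrArg (flat a) (Fin.ext ?_)
      simp only [Fin.val_cast, Fin.val_natAdd, finSigmaFinEquiv_apply]
      have h2 := Fin.sum_univ_succ (fun r : Fin (i.val + 1) => k (Fin.castLE i.succ.2.le r))
      refine Eq.trans ?_ (congrArg (· + j.val) h2.symm)
      rw [← Nat.add_assoc]
      rfl

theorem sum_succAbove_zero {n : ℕ} (a : Fin (n + 1) → C.Obj) :
    C.add (a 0) (C.sum fun i => a ((0 : Fin (n + 1)).succAbove i)) = C.sum a := by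
  simp only [Fin.zero_succAbove]
  rfl

theorem sum_succAbove_succ {n : ℕ} (a : Fin (n + 2) → C.Obj) (q : Fin (n + 1)) :
    C.add (a q.succ) (C.sum fun i => a (q.succ.succAbove i)) =
      C.add (C.add (a q.succ) (a 0)) (C.sum fun i => a (q.succAbove i).succ) := by
  rw [C.add_assoc]
  show C.add _ (C.add _ _) = _
  simp only [Fin.succ_succAbove_zero, Fin.succ_succAbove_succ]

/-- The canonical map `a_p ⊕ (a_0 ⊕ ⋯ (omit a_p) ⋯ ⊕ a_n) ⟶ a_0 ⊕ ⋯ ⊕ a_n` that moves `a_p` to its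
place, past one summand after the other. -/
def insert : ∀ {n : ℕ} (p : Fin (n + 1)) (a : Fin (n + 1) → C.Obj),
    C.add (a p) (C.sum fun i => a (p.succAbove i)) ⟶ C.sum a
  | 0, p, a => eqToHom (by obtain rfl : p = 0 := Fin.fin_one_eq_zero p; rfl)
  | n + 1, p, a =>
    Fin.cases (motive := fun p => C.add (a p) (C.sum fun i => a (p.succAbove i)) ⟶ C.sum a)
      (eqToHom (C.sum_succAbove_zero a))
      (fun q => eqToHom (C.sum_succAbove_succ a q) ≫
        C.addMap (C.γ (a q.succ) (a 0)) (𝟙 (C.sum fun i => a (q.succAbove i).succ)) ≫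
        eqToHom (C.add_assoc (a 0) (a q.succ) (C.sum fun i => a (q.succAbove i).succ)) ≫
        C.addMap (𝟙 (a 0)) (insert q fun i => a i.succ))
      p

/-- The bijection `Fin m ≃ Fin n` that is left of a bijection `e : Fin (m + 1) ≃ Fin (n + 1)` when
`0` and `e 0` are removed. -/
def tailEquiv {m n : ℕ} (e : Fin (m + 1) ≃ Fin (n + 1)) : Fin m ≃ Fin n :=
  Equiv.removeNone ((finSuccEquiv m).symm.trans (e.trans (finSuccEquiv' (e 0))))

theorem succAbove_tailEquiv {m n : ℕ} (e : Fin (m + 1) ≃ Fin (n + 1)) (i : Fin m) :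
    (e 0).succAbove (tailEquiv e i) = e i.succ := by
  have h : some (tailEquiv e i) = finSuccEquiv' (e 0) (e i.succ) := by
    refine Equiv.removeNone_some _ ?_
    have hne : e 0 ≠ e i.succ := fun h => (Fin.succ_ne_zero i) (e.injective h).symm
    obtain ⟨j, hj⟩ := Fin.exists_succAbove_eq hne.symm
    refine ⟨j, ?_⟩
    simp [← hj]
  have h2 := congrArg (finSuccEquiv' (e 0)).symm h
  rwa [Equiv.symm_apply_apply, finSuccEquiv'_symm_some] at h2

/-- The canonical map `a_{e 0} ⊕ a_{e 1} ⊕ ⋯ ⟶ a_0 ⊕ a_1 ⊕ ⋯` that permutes the summands of an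
iterated sum, for a bijection `e`. -/
def perm : ∀ {m n : ℕ} (e : Fin m ≃ Fin n) (a : Fin n → C.Obj),
    C.sum (fun i => a (e i)) ⟶ C.sum a
  | 0, 0, _, _ => 𝟙 C.zero
  | 0, _ + 1, e, _ => (e.symm 0).elim0
  | _ + 1, 0, e, _ => (e 0).elim0
  | _ + 1, _ + 1, e, a =>
    eqToHom (congrArg (C.add (a (e 0))) (congrArg C.sum
      (funext fun i => congrArg a (succAbove_tailEquiv e i).symm))) ≫
    C.addMap (𝟙 (a (e 0))) (perm (tailEquiv e) fun i => a ((e 0).succAbove i)) ≫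
    C.insert (e 0) a

/-- The operations of the underlying based multicategory of a permutative category: an
`n`-morphism `(a_1, …, a_n) → b` is a morphism `a_1 ⊕ ⋯ ⊕ a_n ⟶ b`, and the basepoint is `0` with
the identifications `0 ⊕ ⋯ ⊕ 0 = 0`. -/
def underlyingData : BasedMulticategoryData.{v, u} where
  Obj := C.Obj
  Hom _ a b := C.sum a ⟶ b
  reindex {_} {_} e {a} {_} {_} h f := eqToHom (congrArg C.sum (funext h)) ≫ C.perm e a ≫ f
  id a := eqToHom (C.sum_one fun _ => a)
  comp g f := eqToHom (C.sum_flat _) ≫ C.sumMap f ≫ g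
  pt := C.zero
  ptHom n := eqToHom (C.sum_zero n)

end PermCat

/-- For an index `i`, the tuples `x`, `y`, `z` of objects agree in all places but `i`, and
`z_i = x_i ⊕ y_i`. -/
def AddAt {k : ℕ} {C : Fin k → PermCat.{v, u}} (i : Fin k) (x y z : ∀ i, (C i).Obj) : Prop :=
  z i = (C i).add (x i) (y i) ∧ ∀ l, l ≠ i → x l = z l ∧ y l = z l

/-- A morphism that is an identity (up to an equality of its source and target). -/
def IsId {A : Type u} [Category.{v} A] {a b : A} (f : a ⟶ b) : Prop :=
  ∃ h : a = b, f = eqToHom h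

/-- A `k`-linear map `C_1 × ⋯ × C_k → D` of permutative categories: a functor with distributivity
maps `δ_i : f(c_i) ⊕ f(c_i') → f(c_i ⊕ c_i')`. In `δ i x y z _` the tuples `x`, `y`, `z` are those
of all variables, with `c_i`, `c_i'`, `c_i ⊕ c_i'` in the place `i` and equal other entries. -/
structure PermLin {k : ℕ} (C : Fin k → PermCat.{v, u}) (D : PermCat.{v', u'}) where
  F : (∀ i, (C i).Obj) ⥤ D.Obj
  obj_zero : ∀ x : ∀ i, (C i).Obj, (∃ i, x i = (C i).zero) → F.obj x = D.zero
  /-- If a variable is constant `0` (with the identity of `0` as morphism), then so is `f`. -/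
  map_zero : ∀ {x y : ∀ i, (C i).Obj} (s : x ⟶ y),
    (∃ i, x i = (C i).zero ∧ IsId (s i)) → IsId (F.map s)
  δ : ∀ (i : Fin k) (x y z : ∀ i, (C i).Obj), AddAt i x y z →
    (D.add (F.obj x) (F.obj y) ⟶ F.obj z)
  /-- `δ_i` is natural in all variables. -/
  δ_naturality : ∀ (i : Fin k) {x y z x' y' z' : ∀ i, (C i).Obj} (h : AddAt i x y z)
    (h' : AddAt i x' y' z') (f : x ⟶ x') (g : y ⟶ y') (s : z ⟶ z'),
    HEq (s i) ((C i).addMap (f i) (g i)) → (∀ l, l ≠ i → HEq (f l) (s l) ∧ HEq (g l) (s l)) →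
    D.addMap (F.map f) (F.map g) ≫ δ i x' y' z' h' = δ i x y z h ≫ F.map s
  δ_zero : ∀ (i : Fin k) (x y z : ∀ i, (C i).Obj) (h : AddAt i x y z),
    (x i = (C i).zero ∨ y i = (C i).zero ∨ ∃ l, l ≠ i ∧ z l = (C l).zero) → IsId (δ i x y z h)
  δ_assoc : ∀ (i : Fin k) (x y w xy yw z : ∀ i, (C i).Obj) (h₁ : AddAt i x y xy)
    (h₂ : AddAt i xy w z) (h₃ : AddAt i y w yw) (h₄ : AddAt i x yw z),
    D.addMap (δ i x y xy h₁) (𝟙 (F.obj w)) ≫ δ i xy w z h₂ =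
      eqToHom (D.add_assoc (F.obj x) (F.obj y) (F.obj w)) ≫
        D.addMap (𝟙 (F.obj x)) (δ i y w yw h₃) ≫ δ i x yw z h₄
  δ_symm : ∀ (i : Fin k) (x y z z' : ∀ i, (C i).Obj) (h : AddAt i x y z) (h' : AddAt i y x z')
    (s : z ⟶ z'), HEq (s i) ((C i).γ (x i) (y i)) → (∀ l, l ≠ i → IsId (s l)) →
    δ i x y z h ≫ F.map s = D.γ (F.obj x) (F.obj y) ≫ δ i y x z' h'
  /-- The pentagon that relates `δ_i` and `δ_j`. Here `x`, `y`, `x'`, `y'` stand for `(c_i, c_j)`,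
  `(c_i', c_j)`, `(c_i, c_j')`, `(c_i', c_j')`. -/
  δ_pentagon : ∀ (i j : Fin k), i ≠ j → ∀ (x y x' y' xy xy' xx yy z : ∀ i, (C i).Obj)
    (h₁ : AddAt i x y xy) (h₂ : AddAt i x' y' xy') (h₃ : AddAt j xy xy' z)
    (h₄ : AddAt j x x' xx) (h₅ : AddAt j y y' yy) (h₆ : AddAt i xx yy z),
    D.addMap (δ i x y xy h₁) (δ i x' y' xy' h₂) ≫ δ j xy xy' z h₃ =
      D.interchange (F.obj x) (F.obj y) (F.obj x') (F.obj y') ≫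
        D.addMap (δ j x x' xx h₄) (δ j y y' yy h₅) ≫ δ i xx yy z h₆

namespace PermLin

variable {k : ℕ} {C : Fin k → PermCat.{v, u}} {D : PermCat.{v', u'}}

/-- A morphism of `k`-linear maps: a natural transformation that commutes with the `δ_i` and is the
identity of `0` if one of the variables is `0`. -/
@[ext]
structure Trans (f g : PermLin C D) where
  τ : f.F ⟶ g.F
  δ_comm : ∀ (i : Fin k) (x y z : ∀ i, (C i).Obj) (h : AddAt i x y z),
    f.δ i x y z h ≫ τ.app z = D.addMap (τ.app x) (τ.app y) ≫ g.δ i x y z h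
  app_zero : ∀ x : ∀ i, (C i).Obj, (∃ i, x i = (C i).zero) → IsId (τ.app x)

/-- The category `P_k(C_1, …, C_k; D)`. -/
instance : Category (PermLin C D) where
  Hom f g := Trans f g
  id f :=
    { τ := 𝟙 f.F
      δ_comm := fun i x y z h => by simp [D.addMap_id]
      app_zero := fun x _ => ⟨rfl, rfl⟩ }
  comp ξ η :=
    { τ := ξ.τ ≫ η.τ
      δ_comm := fun i x y z h => by
        rw [NatTrans.comp_app, ← Category.assoc, ξ.δ_comm, Category.assoc, η.δ_comm,
          ← Category.assoc, ← D.addMap_comp]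
        rfl
      app_zero := fun x hx => by
        obtain ⟨h₁, e₁⟩ := ξ.app_zero x hx
        obtain ⟨h₂, e₂⟩ := η.app_zero x hx
        exact ⟨h₁.trans h₂, by rw [NatTrans.comp_app, e₁, e₂, eqToHom_trans]⟩ }
  id_comp ξ := Trans.ext (Category.id_comp ξ.τ)
  comp_id ξ := Trans.ext (Category.comp_id ξ.τ)
  assoc ξ η ζ := Trans.ext (Category.assoc ξ.τ η.τ ζ.τ)

end PermLin

/-! ### Multicategories enriched over `Cat` -/

/-- The operations of a multicategory enriched over `Cat`, with given objects and given categories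
of `k`-morphisms. As for `MulticategoryData`, the bijections `e : Fin m ≃ Fin n` act, and the source
may be any tuple that is equal to the permuted one. -/
structure CatMulticategoryData (Obj : Type u) (Hom : (k : ℕ) → (Fin k → Obj) → Obj → Type w)
    [∀ k a b, Category.{w'} (Hom k a b)] where
  reindex : ∀ {m n : ℕ} (e : Fin m ≃ Fin n) {a : Fin n → Obj} {a' : Fin m → Obj} {b : Obj},
    (∀ i, a' i = a (e i)) → (Hom n a b ⥤ Hom m a' b)
  id : ∀ a : Obj, Hom 1 (fun _ => a) a
  comp : ∀ {n : ℕ} {b : Fin n → Obj} {c : Obj} {k : Fin n → ℕ} {a : ∀ i, Fin (k i) → Obj},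
    (Hom n b c × (∀ i, Hom (k i) (a i) (b i))) ⥤ Hom (∑ i, k i) (flat a) c

namespace CatMulticategoryData

variable {Obj : Type u} {Hom : (k : ℕ) → (Fin k → Obj) → Obj → Type w}
  [∀ k a b, Category.{w'} (Hom k a b)] (M : CatMulticategoryData Obj Hom)
  {n : ℕ} {b : Fin n → Obj} {c : Obj} {k : Fin n → ℕ} {a : ∀ i, Fin (k i) → Obj}

/-- Composition of multimorphisms. -/
abbrev comp₁ (g : Hom n b c) (f : ∀ i, Hom (k i) (a i) (b i)) : Hom (∑ i, k i) (flat a) c :=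
  M.comp.obj (g, f)

/-- Composition of `2`-cells. -/
abbrev comp₂ {g g' : Hom n b c} {f f' : ∀ i, Hom (k i) (a i) (b i)} (σ : g ⟶ g')
    (τ : ∀ i, f i ⟶ f' i) : M.comp₁ g f ⟶ M.comp₁ g' f' :=
  M.comp.map (X := (g, f)) (Y := (g', f')) (σ, τ)

end CatMulticategoryData

/-- A multicategory enriched over `Cat`: the axioms of a multicategory hold for the multimorphisms
(`…₁`) and for the `2`-cells (`…₂`). -/
structure CatMulticategory (Obj : Type u) (Hom : (k : ℕ) → (Fin k → Obj) → Obj → Type w)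
    [∀ k a b, Category.{w'} (Hom k a b)] extends CatMulticategoryData Obj Hom where
  reindex_refl : ∀ {n : ℕ} {a : Fin n → Obj} {b : Obj},
    reindex (Equiv.refl _) (fun _ => rfl) = 𝟭 (Hom n a b)
  reindex_trans : ∀ {l m n : ℕ} (e : Fin l ≃ Fin m) (e' : Fin m ≃ Fin n) {a : Fin n → Obj}
    {a' : Fin m → Obj} {a'' : Fin l → Obj} {b : Obj} (h : ∀ i, a'' i = a' (e i))
    (h' : ∀ i, a' i = a (e' i)),
    reindex e' h' ⋙ reindex e h =
      reindex (b := b) (e.trans e') (fun i => (h i).trans (h' (e i)))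
  comp_id₁ : ∀ {n : ℕ} {b : Fin n → Obj} {c : Obj} (g : Hom n b c),
    toCatMulticategoryData.comp₁ g (fun i => id (b i)) = (reindex (unitR n) (flat_unitR b)).obj g
  comp_id₂ : ∀ {n : ℕ} {b : Fin n → Obj} {c : Obj} {g g' : Hom n b c} (σ : g ⟶ g'),
    HEq (toCatMulticategoryData.comp₂ σ (fun i => 𝟙 (id (b i))))
      ((reindex (unitR n) (flat_unitR b)).map σ)
  id_comp₁ : ∀ {k : ℕ} {a : Fin k → Obj} {b : Obj} (f : Hom k a b),
    toCatMulticategoryData.comp₁ (id b) (fun _ => f) = (reindex (unitL k) (flat_unitL a)).obj f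
  id_comp₂ : ∀ {k : ℕ} {a : Fin k → Obj} {b : Obj} {f f' : Hom k a b} (τ : f ⟶ f'),
    HEq (toCatMulticategoryData.comp₂ (𝟙 (id b)) (fun _ => τ))
      ((reindex (unitL k) (flat_unitL a)).map τ)
  assoc₁ : ∀ {n : ℕ} {c : Fin n → Obj} {d : Obj} {k : Fin n → ℕ} {b : ∀ i, Fin (k i) → Obj}
    {l : ∀ i, Fin (k i) → ℕ} {a : ∀ i j, Fin (l i j) → Obj} (h : Hom n c d)
    (g : ∀ i, Hom (k i) (b i) (c i)) (f : ∀ i j, Hom (l i j) (a i j) (b i j)),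
    toCatMulticategoryData.comp₁ (toCatMulticategoryData.comp₁ h g)
        (fun x => f (blk x) (pos x)) =
      (reindex (assocEquiv l) (flat_assocEquiv a)).obj
        (toCatMulticategoryData.comp₁ h (fun i => toCatMulticategoryData.comp₁ (g i) (f i)))
  assoc₂ : ∀ {n : ℕ} {c : Fin n → Obj} {d : Obj} {k : Fin n → ℕ} {b : ∀ i, Fin (k i) → Obj}
    {l : ∀ i, Fin (k i) → ℕ} {a : ∀ i j, Fin (l i j) → Obj} {h h' : Hom n c d}
    {g g' : ∀ i, Hom (k i) (b i) (c i)} {f f' : ∀ i j, Hom (l i j) (a i j) (b i j)}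
    (ρ : h ⟶ h') (σ : ∀ i, g i ⟶ g' i) (τ : ∀ i j, f i j ⟶ f' i j),
    HEq (toCatMulticategoryData.comp₂ (toCatMulticategoryData.comp₂ ρ σ)
        (fun x => τ (blk x) (pos x)))
      ((reindex (assocEquiv l) (flat_assocEquiv a)).map
        (toCatMulticategoryData.comp₂ ρ (fun i => toCatMulticategoryData.comp₂ (σ i) (τ i))))
  comp_reindex_outer₁ : ∀ {m n : ℕ} (e : Fin m ≃ Fin n) {b : Fin n → Obj} {c : Obj}
    {k : Fin n → ℕ} {a : ∀ j, Fin (k j) → Obj} (g : Hom n b c) (f : ∀ j, Hom (k j) (a j) (b j)),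
    toCatMulticategoryData.comp₁ ((reindex e (a' := fun i => b (e i)) (fun _ => rfl)).obj g)
        (fun i => f (e i)) =
      (reindex (outerEquiv e k) (flat_outerEquiv e a)).obj (toCatMulticategoryData.comp₁ g f)
  comp_reindex_outer₂ : ∀ {m n : ℕ} (e : Fin m ≃ Fin n) {b : Fin n → Obj} {c : Obj}
    {k : Fin n → ℕ} {a : ∀ j, Fin (k j) → Obj} {g g' : Hom n b c}
    {f f' : ∀ j, Hom (k j) (a j) (b j)} (σ : g ⟶ g') (τ : ∀ j, f j ⟶ f' j),
    HEq (toCatMulticategoryData.comp₂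
        ((reindex e (a' := fun i => b (e i)) (fun _ => rfl)).map σ) (fun i => τ (e i)))
      ((reindex (outerEquiv e k) (flat_outerEquiv e a)).map (toCatMulticategoryData.comp₂ σ τ))
  comp_reindex_inner₁ : ∀ {n : ℕ} {b : Fin n → Obj} {c : Obj} {k l : Fin n → ℕ}
    (e : ∀ i, Fin (k i) ≃ Fin (l i)) {a : ∀ i, Fin (l i) → Obj} {a' : ∀ i, Fin (k i) → Obj}
    (h : ∀ i j, a' i j = a i (e i j)) (g : Hom n b c) (f : ∀ i, Hom (l i) (a i) (b i)),
    toCatMulticategoryData.comp₁ g (fun i => (reindex (e i) (h i)).obj (f i)) =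
      (reindex (innerEquiv e) (flat_innerEquiv e h)).obj (toCatMulticategoryData.comp₁ g f)
  comp_reindex_inner₂ : ∀ {n : ℕ} {b : Fin n → Obj} {c : Obj} {k l : Fin n → ℕ}
    (e : ∀ i, Fin (k i) ≃ Fin (l i)) {a : ∀ i, Fin (l i) → Obj} {a' : ∀ i, Fin (k i) → Obj}
    (h : ∀ i j, a' i j = a i (e i j)) {g g' : Hom n b c} {f f' : ∀ i, Hom (l i) (a i) (b i)}
    (σ : g ⟶ g') (τ : ∀ i, f i ⟶ f' i),
    HEq (toCatMulticategoryData.comp₂ σ (fun i => (reindex (e i) (h i)).map (τ i)))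
      ((reindex (innerEquiv e) (flat_innerEquiv e h)).map (toCatMulticategoryData.comp₂ σ τ))

/-- A multifunctor enriched over `Cat` with the function `F` on objects. -/
structure CatMultifunctor {Obj : Type u} {Hom : (k : ℕ) → (Fin k → Obj) → Obj → Type w}
    [∀ k a b, Category.{w'} (Hom k a b)] {Obj' : Type u'}
    {Hom' : (k : ℕ) → (Fin k → Obj') → Obj' → Type v} [∀ k a b, Category.{v'} (Hom' k a b)]
    (P : CatMulticategory Obj Hom) (Q : CatMulticategory Obj' Hom') (F : Obj → Obj') where
  map : ∀ {k : ℕ} (a : Fin k → Obj) (b : Obj), Hom k a b ⥤ Hom' k (fun i => F (a i)) (F b)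
  map_id : ∀ a : Obj, (map _ _).obj (P.id a) = Q.id (F a)
  map_reindex : ∀ {m n : ℕ} (e : Fin m ≃ Fin n) {a : Fin n → Obj} {a' : Fin m → Obj} {b : Obj}
    (h : ∀ i, a' i = a (e i)),
    P.reindex e h ⋙ map a' b = map a b ⋙ Q.reindex e (fun i => congrArg F (h i))
  map_comp₁ : ∀ {n : ℕ} {b : Fin n → Obj} {c : Obj} {k : Fin n → ℕ} {a : ∀ i, Fin (k i) → Obj}
    (g : Hom n b c) (f : ∀ i, Hom (k i) (a i) (b i)),
    (map _ _).obj (P.comp₁ g f) = Q.comp₁ ((map _ _).obj g) (fun i => (map _ _).obj (f i))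
  map_comp₂ : ∀ {n : ℕ} {b : Fin n → Obj} {c : Obj} {k : Fin n → ℕ} {a : ∀ i, Fin (k i) → Obj}
    {g g' : Hom n b c} {f f' : ∀ i, Hom (k i) (a i) (b i)} (σ : g ⟶ g') (τ : ∀ i, f i ⟶ f' i),
    HEq ((map _ _).map (P.comp₂ σ τ))
      (Q.comp₂ ((map _ _).map σ) (fun i => (map _ _).map (τ i)))

/-- A multifunctor enriched over `Cat` is full and faithful if it induces isomorphisms on the
categories of `k`-morphisms. -/
def CatMultifunctor.IsFullyFaithful {Obj : Type u}
    {Hom : (k : ℕ) → (Fin k → Obj) → Obj → Type w}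
    [∀ k a b, Category.{w'} (Hom k a b)] {Obj' : Type u'}
    {Hom' : (k : ℕ) → (Fin k → Obj') → Obj' → Type v} [∀ k a b, Category.{v'} (Hom' k a b)]
    {P : CatMulticategory Obj Hom} {Q : CatMulticategory Obj' Hom'} {F : Obj → Obj'}
    (U : CatMultifunctor P Q F) : Prop :=
  ∀ (k : ℕ) (a : Fin k → Obj) (b : Obj), ∃ e : IsoCat (Hom k a b) (Hom' k (fun i => F (a i)) (F b)),
    e.functor = U.map a b

/-! ### The multicategory of permutative categories -/

/-- The multicategory structure on permutative categories and the categories of `k`-linear maps.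
As every tuple indexed by `Fin (∑ i, k i)` is a concatenation, and every tuple indexed by `Fin m` is
`fun i => x (e i)` for a unique `x`, the formulas determine all operations. -/
structure IsMulticategoryOfPermutativeCategories
    (P : CatMulticategory PermCat.{v, u} (fun _ C D => PermLin C D)) : Prop where
  /-- The unit of `C` is the identity functor with identity distributivity maps. -/
  id_obj : ∀ (C : PermCat.{v, u}) (x : Fin 1 → C.Obj), (P.id C).F.obj x = x 0
  id_map : ∀ (C : PermCat.{v, u}) {x y : Fin 1 → C.Obj} (f : x ⟶ y),
    HEq ((P.id C).F.map f) (f 0)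
  id_δ : ∀ (C : PermCat.{v, u}) (x y z : Fin 1 → C.Obj)
    (h : AddAt (C := fun _ => C) 0 x y z), IsId ((P.id C).δ 0 x y z h)
  /-- `(σ^* f)(c_{σ(1)}, …, c_{σ(k)}) = f(c_1, …, c_k)`, on objects and on morphisms. -/
  reindex_obj : ∀ {m n : ℕ} (e : Fin m ≃ Fin n) {C : Fin n → PermCat.{v, u}} {D : PermCat.{v, u}}
    (f : PermLin C D) (x : ∀ i, (C i).Obj),
    ((P.reindex e (a' := fun i => C (e i)) (fun _ => rfl)).obj f).F.obj (fun i => x (e i)) =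
      f.F.obj x
  reindex_map : ∀ {m n : ℕ} (e : Fin m ≃ Fin n) {C : Fin n → PermCat.{v, u}} {D : PermCat.{v, u}}
    (f : PermLin C D) {x y : ∀ i, (C i).Obj} (s : x ⟶ y),
    HEq (((P.reindex e (a' := fun i => C (e i)) (fun _ => rfl)).obj f).F.map
      (X := fun i => x (e i)) (Y := fun i => y (e i)) (fun i => s (e i))) (f.F.map s)
  /-- The distributivity maps of `σ^* f` are those of `f`, with permuted indices. -/
  reindex_δ : ∀ {m n : ℕ} (e : Fin m ≃ Fin n) {C : Fin n → PermCat.{v, u}} {D : PermCat.{v, u}}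
    (f : PermLin C D) (i : Fin m) (x y z : ∀ i, (C i).Obj) (h : AddAt (e i) x y z)
    (h' : AddAt (C := fun i => C (e i)) i (fun i => x (e i)) (fun i => y (e i)) (fun i => z (e i))),
    HEq (((P.reindex e (a' := fun i => C (e i)) (fun _ => rfl)).obj f).δ i _ _ _ h')
      (f.δ (e i) x y z h)
  reindex_app : ∀ {m n : ℕ} (e : Fin m ≃ Fin n) {C : Fin n → PermCat.{v, u}} {D : PermCat.{v, u}}
    {f g : PermLin C D} (ξ : f ⟶ g) (x : ∀ i, (C i).Obj),
    HEq (((P.reindex e (a' := fun i => C (e i)) (fun _ => rfl)).map ξ).τ.app (fun i => x (e i)))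
      (ξ.τ.app x)
  /-- The composite is `g ∘ (f_1 × ⋯ × f_n)`, on objects and on morphisms. -/
  comp_obj : ∀ {n : ℕ} {D : Fin n → PermCat.{v, u}} {E : PermCat.{v, u}} {k : Fin n → ℕ}
    {C : ∀ i, Fin (k i) → PermCat.{v, u}} (g : PermLin D E) (f : ∀ i, PermLin (C i) (D i))
    (x : ∀ i j, (C i j).Obj),
    (P.comp₁ g f).F.obj (flat x) = g.F.obj (fun i => (f i).F.obj (x i))
  comp_map : ∀ {n : ℕ} {D : Fin n → PermCat.{v, u}} {E : PermCat.{v, u}} {k : Fin n → ℕ}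
    {C : ∀ i, Fin (k i) → PermCat.{v, u}} (g : PermLin D E) (f : ∀ i, PermLin (C i) (D i))
    {x y : ∀ i j, (C i j).Obj} (s : ∀ i j, x i j ⟶ y i j),
    HEq ((P.comp₁ g f).F.map (X := flat x) (Y := flat y) (flat s))
      (g.F.map (X := fun i => (f i).F.obj (x i)) (Y := fun i => (f i).F.obj (y i))
        (fun i => (f i).F.map (X := x i) (Y := y i) (s i)))
  /-- The distributivity map in the place `s`, which is the place `i` of the block `j`, is
  `g(f_j(c_{ji})) ⊕ g(f_j(c'_{ji})) ⟶ g(f_j(c_{ji}) ⊕ f_j(c'_{ji})) ⟶ g(f_j(c_{ji} ⊕ c'_{ji}))`,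
  the composite of `δ_j` of `g` and of `g` of `δ_i` of `f_j`. -/
  comp_δ : ∀ {n : ℕ} {D : Fin n → PermCat.{v, u}} {E : PermCat.{v, u}} {k : Fin n → ℕ}
    {C : ∀ i, Fin (k i) → PermCat.{v, u}} (g : PermLin D E) (f : ∀ i, PermLin (C i) (D i))
    (s : Fin (∑ i, k i)) (x y z : ∀ i j, (C i j).Obj)
    (h : AddAt (C := flat C) s (flat x) (flat y) (flat z))
    (h' : AddAt (pos s) (x (blk s)) (y (blk s)) (z (blk s)))
    (w : ∀ i, (D i).Obj)
    (hw : AddAt (blk s) (fun i => (f i).F.obj (x i)) (fun i => (f i).F.obj (y i)) w)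
    (t : w ⟶ fun i => (f i).F.obj (z i)),
    HEq (t (blk s)) ((f (blk s)).δ (pos s) _ _ _ h') → (∀ i, i ≠ blk s → IsId (t i)) →
    HEq ((P.comp₁ g f).δ s _ _ _ h) (g.δ (blk s) _ _ w hw ≫ g.F.map t)
  comp_app : ∀ {n : ℕ} {D : Fin n → PermCat.{v, u}} {E : PermCat.{v, u}} {k : Fin n → ℕ}
    {C : ∀ i, Fin (k i) → PermCat.{v, u}} {g g' : PermLin D E} {f f' : ∀ i, PermLin (C i) (D i)}
    (σ : g ⟶ g') (ξ : ∀ i, f i ⟶ f' i) (x : ∀ i j, (C i j).Obj),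
    HEq ((P.comp₂ σ ξ).τ.app (flat x))
      (g.F.map (X := fun i => (f i).F.obj (x i)) (Y := fun i => (f' i).F.obj (x i))
        (fun i => (ξ i).τ.app (x i)) ≫ σ.τ.app _)

/-! ### The multicategory of based multicategories -/

/-- The multicategory structure on based multicategories and the categories of based `k`-linear
maps. The formulas determine all operations, as for permutative categories. -/
structure IsMulticategoryOfBasedMulticategories
    (Q : CatMulticategory BasedMulticategory.{v, u} (fun _ M N => MultiLin M N)) : Prop where
  /-- The unit of `M` is the identity multifunctor. -/
  id_obj : ∀ (M : BasedMulticategory.{v, u}) (x : Fin 1 → M.Obj), (Q.id M).obj x = x 0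
  id_map : ∀ (M : BasedMulticategory.{v, u}) {m : ℕ} {a : Fin m → M.Obj} {a' : M.Obj}
    (φ : M.Hom m a a') (x : Fin m → Fin 1 → M.Obj) (x' : Fin 1 → M.Obj)
    (hx : ∀ r, x r = Function.update x' 0 (a r)) (hx' : x' 0 = a'),
    HEq ((Q.id M).map 0 φ x x' hx hx') φ
  /-- `(σ^* f)(x_{σ(1)}, …, x_{σ(k)}) = f(x_1, …, x_k)`, on objects and in each variable. -/
  reindex_obj : ∀ {m n : ℕ} (e : Fin m ≃ Fin n) {M : Fin n → BasedMulticategory.{v, u}}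
    {N : BasedMulticategory.{v, u}} (f : MultiLin M N) (x : ∀ i, (M i).Obj),
    ((Q.reindex e (a' := fun i => M (e i)) (fun _ => rfl)).obj f).obj (fun i => x (e i)) = f.obj x
  reindex_map : ∀ {m n : ℕ} (e : Fin m ≃ Fin n) {M : Fin n → BasedMulticategory.{v, u}}
    {N : BasedMulticategory.{v, u}} (f : MultiLin M N) (j : Fin m) {l : ℕ}
    {a : Fin l → (M (e j)).Obj} {a' : (M (e j)).Obj} (φ : (M (e j)).Hom l a a')
    (x : Fin l → ∀ i, (M i).Obj) (x' : ∀ i, (M i).Obj)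
    (hx : ∀ r, x r = Function.update x' (e j) (a r)) (hx' : x' (e j) = a')
    (h : ∀ r, (fun i => x r (e i)) =
      Function.update (β := fun i => (M (e i)).Obj) (fun i => x' (e i)) j (a r)),
    HEq (((Q.reindex e (a' := fun i => M (e i)) (fun _ => rfl)).obj f).map j φ
      (fun r i => x r (e i)) (fun i => x' (e i)) h hx') (f.map (e j) φ x x' hx hx')
  reindex_app : ∀ {m n : ℕ} (e : Fin m ≃ Fin n) {M : Fin n → BasedMulticategory.{v, u}}
    {N : BasedMulticategory.{v, u}} {f g : MultiLin M N} (ξ : f ⟶ g) (x : ∀ i, (M i).Obj),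
    HEq (((Q.reindex e (a' := fun i => M (e i)) (fun _ => rfl)).map ξ).app (fun i => x (e i)))
      (ξ.app x)
  /-- The composite is `g ∘ (f_1, …, f_n)`, on objects and in each variable. -/
  comp_obj : ∀ {n : ℕ} {N : Fin n → BasedMulticategory.{v, u}} {L : BasedMulticategory.{v, u}}
    {k : Fin n → ℕ} {M : ∀ i, Fin (k i) → BasedMulticategory.{v, u}} (g : MultiLin N L)
    (f : ∀ i, MultiLin (M i) (N i)) (x : ∀ i j, (M i j).Obj),
    (Q.comp₁ g f).obj (flat x) = g.obj (fun i => (f i).obj (x i))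
  comp_map : ∀ {n : ℕ} {N : Fin n → BasedMulticategory.{v, u}} {L : BasedMulticategory.{v, u}}
    {k : Fin n → ℕ} {M : ∀ i, Fin (k i) → BasedMulticategory.{v, u}} (g : MultiLin N L)
    (f : ∀ i, MultiLin (M i) (N i)) (s : Fin (∑ i, k i)) {l : ℕ}
    {a : Fin l → (M (blk s) (pos s)).Obj} {a' : (M (blk s) (pos s)).Obj}
    (φ : (M (blk s) (pos s)).Hom l a a') (x : Fin l → ∀ i j, (M i j).Obj) (x' : ∀ i j, (M i j).Obj)
    (h : ∀ r, flat (x r) = Function.update (β := fun s => (flat M s).Obj) (flat x') s (a r))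
    (hf : ∀ r, x r (blk s) = Function.update (x' (blk s)) (pos s) (a r))
    (hx' : x' (blk s) (pos s) = a')
    (hg : ∀ r, (fun i => (f i).obj (x r i)) =
      Function.update (fun i => (f i).obj (x' i)) (blk s) ((f (blk s)).obj (x r (blk s)))),
    HEq ((Q.comp₁ g f).map s φ (fun r => flat (x r)) (flat x') h hx')
      (g.map (blk s) ((f (blk s)).map (pos s) φ (fun r => x r (blk s)) (x' (blk s)) hf hx')
        (fun r i => (f i).obj (x r i)) (fun i => (f i).obj (x' i)) hg rfl)
  /-- The composite of a `2`-cell `g ⟶ g'` with the identities of the `f_i`. -/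
  comp_app_left : ∀ {n : ℕ} {N : Fin n → BasedMulticategory.{v, u}} {L : BasedMulticategory.{v, u}}
    {k : Fin n → ℕ} {M : ∀ i, Fin (k i) → BasedMulticategory.{v, u}} {g g' : MultiLin N L}
    (f : ∀ i, MultiLin (M i) (N i)) (σ : g ⟶ g') (x : ∀ i j, (M i j).Obj),
    HEq ((Q.comp₂ σ (fun i => 𝟙 (f i))).app (flat x)) (σ.app (fun i => (f i).obj (x i)))
  /-- The composite of the identity of `g` with a `2`-cell `f_j ⟶ f'_j` and the identities of the
  other `f_i`. (A composite with any `2`-cells is a vertical composite of such ones.) -/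
  comp_app_right : ∀ {n : ℕ} {N : Fin n → BasedMulticategory.{v, u}} {L : BasedMulticategory.{v, u}}
    {k : Fin n → ℕ} {M : ∀ i, Fin (k i) → BasedMulticategory.{v, u}} (g : MultiLin N L)
    {f f' : ∀ i, MultiLin (M i) (N i)} (ξ : ∀ i, f i ⟶ f' i) (j : Fin n)
    (_ : ∀ i, i ≠ j → IsId (ξ i)) (x : ∀ i j, (M i j).Obj)
    (h : ∀ _ : Fin 1, (fun i => (f i).obj (x i)) =
      Function.update (fun i => (f' i).obj (x i)) j ((f j).obj (x j))),
    HEq ((Q.comp₂ (𝟙 g) ξ).app (flat x))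
      (g.map j ((ξ j).app (x j)) (fun _ i => (f i).obj (x i)) (fun i => (f' i).obj (x i)) h rfl)

/-! ### The formulas determine the two multicategory structures -/

section Uniqueness

theorem PermLin.ext' {k : ℕ} {C : Fin k → PermCat.{v, u}} {D : PermCat.{v', u'}}
    {f g : PermLin C D} (h₁ : ∀ x, f.F.obj x = g.F.obj x)
    (h₂ : ∀ {x y : ∀ i, (C i).Obj} (s : x ⟶ y), HEq (f.F.map s) (g.F.map s))
    (h₃ : ∀ i x y z h, HEq (f.δ i x y z h) (g.δ i x y z h)) : f = g := by
  obtain ⟨F, _, _, δ, _, _, _, _, _⟩ := f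
  obtain ⟨G, _, _, ε, _, _, _, _, _⟩ := g
  obtain rfl : F = G := CategoryTheory.Functor.hext h₁ fun _ _ s => h₂ s
  obtain rfl : δ = ε := by
    funext i x y z h
    exact eq_of_heq (h₃ i x y z h)
  rfl

theorem PermLin.hom_ext' {k : ℕ} {C : Fin k → PermCat.{v, u}} {D : PermCat.{v', u'}}
    {f g f' g' : PermLin C D} (hf : f = f') (hg : g = g') {ξ : f ⟶ g} {η : f' ⟶ g'}
    (h : ∀ x, HEq (ξ.τ.app x) (η.τ.app x)) : HEq ξ η := by
  subst hf hg
  refine heq_of_eq (PermLin.Trans.ext ?_)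
  ext x
  exact eq_of_heq (h x)

theorem CatMulticategory.ext' {Obj : Type u} {Hom : (k : ℕ) → (Fin k → Obj) → Obj → Type w}
    [∀ k a b, Category.{w'} (Hom k a b)] {P Q : CatMulticategory Obj Hom}
    (h₁ : ∀ a, P.id a = Q.id a)
    (h₂ : ∀ {m n : ℕ} (e : Fin m ≃ Fin n) {a : Fin n → Obj} {b : Obj},
      P.reindex (b := b) e (a := a) (a' := fun i => a (e i)) (fun _ => rfl) =
        Q.reindex e (fun _ => rfl))
    (h₃ : ∀ {n : ℕ} {b : Fin n → Obj} {c : Obj} {k : Fin n → ℕ} {a : ∀ i, Fin (k i) → Obj},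
      P.comp (b := b) (c := c) (a := a) = Q.comp) : P = Q := by
  obtain ⟨⟨r, i, c⟩, _⟩ := P
  obtain ⟨⟨r', i', c'⟩, _⟩ := Q
  obtain rfl : i = i' := funext h₁
  obtain rfl : @r = @r' := by
    funext m n e a a' b h
    obtain rfl : a' = fun i => a (e i) := funext h
    exact h₂ e
  obtain rfl : @c = @c' := by
    funext n b c k a
    exact h₃
  rfl

theorem unflat {n : ℕ} {k : Fin n → ℕ} {α : ∀ i, Fin (k i) → Type*}
    (x : ∀ s : Fin (∑ i, k i), α (blk s) (pos s)) : ∃ y : ∀ i j, α i j, x = flat y := by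
  let e : ((i : Fin n) × Fin (k i)) ≃ Fin (∑ i, k i) := finSigmaFinEquiv
  have : ∀ p : (i : Fin n) × Fin (k i), ∃ y : α p.1 p.2, ∀ s (h : e.symm s = p), HEq y (x s) := by
    intro p
    obtain ⟨s, rfl⟩ := e.symm.surjective p
    refine ⟨x s, fun t ht => ?_⟩
    obtain rfl := e.symm.injective ht
    rfl
  choose y hy using this
  exact ⟨fun i j => y ⟨i, j⟩, funext fun s => (eq_of_heq (hy (e.symm s) s rfl)).symm⟩

theorem unperm {m n : ℕ} (e : Fin m ≃ Fin n) {α : Fin n → Type*} (x : ∀ i, α (e i)) :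
    ∃ y : ∀ j, α j, x = fun i => y (e i) := by
  refine ⟨(Equiv.piCongrLeft α e) x, funext fun i => ?_⟩
  exact (Equiv.piCongrLeft_apply_apply α e x i).symm

variable {P P' : CatMulticategory PermCat.{v, u} (fun _ C D => PermLin C D)}

/-- There is at most one multicategory of permutative categories. -/
theorem IsMulticategoryOfPermutativeCategories.unique (h : IsMulticategoryOfPermutativeCategories P) (h' : IsMulticategoryOfPermutativeCategories P') :
    P = P' := by
  have hc : ∀ {n : ℕ} {D : Fin n → PermCat.{v, u}} {E : PermCat.{v, u}} {k : Fin n → ℕ}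
    {C : ∀ i, Fin (k i) → PermCat.{v, u}} (g : PermLin D E) (f : ∀ i, PermLin (C i) (D i)),
    P.comp₁ g f = P'.comp₁ g f := by
    intro n D E k C g f
    refine PermLin.ext' (fun x => ?_) (fun {x y} s => ?_) (fun s x y z hh => ?_)
    · obtain ⟨x, rfl⟩ := unflat (α := fun i j => (C i j).Obj) x
      rw [h.comp_obj, h'.comp_obj]
    · obtain ⟨x, rfl⟩ := unflat (α := fun i j => (C i j).Obj) x
      obtain ⟨y, rfl⟩ := unflat (α := fun i j => (C i j).Obj) y
      obtain ⟨s, rfl⟩ := unflat (α := fun i j => x i j ⟶ y i j) s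
      exact (h.comp_map g f s).trans (h'.comp_map g f s).symm
    · obtain ⟨x, rfl⟩ := unflat (α := fun i j => (C i j).Obj) x
      obtain ⟨y, rfl⟩ := unflat (α := fun i j => (C i j).Obj) y
      obtain ⟨z, rfl⟩ := unflat (α := fun i j => (C i j).Obj) z
      have hl : ∀ i j, (i = blk s → ¬ HEq j (pos s)) → x i j = z i j ∧ y i j = z i j := by
        intro i j hij
        have hne : finSigmaFinEquiv ⟨i, j⟩ ≠ s := by
          rintro rfl
          have := finSigmaFinEquiv.symm_apply_apply (⟨i, j⟩ : (i : Fin n) × Fin (k i))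
          have h1 : i = blk (finSigmaFinEquiv ⟨i, j⟩) := (congrArg Sigma.fst this).symm
          refine hij h1 ?_
          exact (Sigma.mk.inj this).2.symm
        have := hh.2 _ hne
        have key := finSigmaFinEquiv.symm_apply_apply (⟨i, j⟩ : (i : Fin n) × Fin (k i))
        have := (show (fun p : (i : Fin n) × Fin (k i) => x p.1 p.2 = z p.1 p.2 ∧ y p.1 p.2 = z p.1 p.2) (finSigmaFinEquiv.symm (finSigmaFinEquiv ⟨i,j⟩)) from this)
        rw [key] at this
        exact this
      have h1 : AddAt (pos s) (x (blk s)) (y (blk s)) (z (blk s)) := by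
        refine ⟨hh.1, fun j hj => hl _ j fun _ h => hj (eq_of_heq h)⟩
      have hlb : ∀ i, i ≠ blk s → x i = z i ∧ y i = z i := fun i hi =>
        ⟨funext fun j => (hl i j fun h => absurd h hi).1, funext fun j => (hl i j fun h => absurd h hi).2⟩
      let w : ∀ i, (D i).Obj := Function.update (fun i => (f i).F.obj (z i)) (blk s)
        ((D _).add ((f _).F.obj (x (blk s))) ((f _).F.obj (y (blk s))))
      have hw : AddAt (blk s) (fun i => (f i).F.obj (x i)) (fun i => (f i).F.obj (y i)) w := by
        refine ⟨Function.update_self .., fun i hi => ?_⟩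
        simp only [w]
        rw [Function.update_of_ne hi, (hlb i hi).1, (hlb i hi).2]
        exact ⟨rfl, rfl⟩
      have : ∀ i, ∃ t : w i ⟶ (f i).F.obj (z i), (∀ e : i = blk s, HEq t ((f (blk s)).δ (pos s) _ _ _ h1))
          ∧ (i ≠ blk s → IsId t) := by
        intro i
        by_cases hi : i = blk s
        · subst hi
          exact ⟨eqToHom (Function.update_self ..) ≫ (f (blk s)).δ (pos s) _ _ _ h1,
            fun _ => by simp, fun h => absurd rfl h⟩
        · exact ⟨eqToHom (Function.update_of_ne hi ..), fun h => absurd h hi, fun _ => ⟨_, rfl⟩⟩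
      choose t ht1 ht2 using this
      exact (h.comp_δ g f s x y z hh h1 w hw t (ht1 _ rfl) ht2).trans
        (h'.comp_δ g f s x y z hh h1 w hw t (ht1 _ rfl) ht2).symm
  have hr : ∀ {m n : ℕ} (e : Fin m ≃ Fin n) {a : Fin n → PermCat.{v, u}} {b : PermCat.{v, u}}
      (f : PermLin a b), (P.reindex (b := b) e (a := a) (a' := fun i => a (e i)) (fun _ => rfl)).obj f =
        (P'.reindex e (fun _ => rfl)).obj f := by
    intro m n e a b f
    refine PermLin.ext' (fun x => ?_) (fun {x y} s => ?_) (fun s x y z hh => ?_)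
    · obtain ⟨x, rfl⟩ := unperm e (α := fun i => (a i).Obj) x
      rw [h.reindex_obj, h'.reindex_obj]
    · obtain ⟨x, rfl⟩ := unperm e (α := fun i => (a i).Obj) x
      obtain ⟨y, rfl⟩ := unperm e (α := fun i => (a i).Obj) y
      obtain ⟨s, rfl⟩ := unperm e (α := fun i => x i ⟶ y i) s
      exact (h.reindex_map e f s).trans (h'.reindex_map e f s).symm
    · obtain ⟨x, rfl⟩ := unperm e (α := fun i => (a i).Obj) x
      obtain ⟨y, rfl⟩ := unperm e (α := fun i => (a i).Obj) y
      obtain ⟨z, rfl⟩ := unperm e (α := fun i => (a i).Obj) z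
      have h1 : AddAt (e s) x y z := by
        refine ⟨hh.1, fun l hl => ?_⟩
        obtain ⟨l, rfl⟩ := e.surjective l
        exact hh.2 l fun h => hl (h ▸ rfl)
      exact (h.reindex_δ e f s x y z h1 hh).trans (h'.reindex_δ e f s x y z h1 hh).symm
  refine CatMulticategory.ext' (fun a => ?_) (fun {m n} e {a b} => ?_) (fun {n b c k a} => ?_)
  · refine PermLin.ext' (fun x => ?_) (fun {x y} s => ?_) (fun s x y z hh => ?_)
    · rw [h.id_obj, h'.id_obj]
    · exact (h.id_map a s).trans (h'.id_map a s).symm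
    · obtain rfl : s = 0 := Subsingleton.elim _ _
      obtain ⟨e1, h1⟩ := h.id_δ a x y z hh
      obtain ⟨e2, h2⟩ := h'.id_δ a x y z hh
      rw [h1, h2]
      have a1 := h.id_obj a; have a2 := h'.id_obj a
      have : ∀ {p q p' q' : a.Obj} (e : p = q) (e' : p' = q'), p = p' → HEq (eqToHom e) (eqToHom e') := by
        intro p q p' q' e e' h; subst e e' h; rfl
      apply this
      rw [a1, a1, a2, a2]
  · refine CategoryTheory.Functor.hext (hr e) fun f g ξ => ?_
    refine PermLin.hom_ext' (hr e f) (hr e g) fun x => ?_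
    obtain ⟨x, rfl⟩ := unperm e (α := fun i => (a i).Obj) x
    exact (h.reindex_app e ξ x).trans (h'.reindex_app e ξ x).symm
  · refine CategoryTheory.Functor.hext (fun p => hc p.1 p.2) fun p q ξ => ?_
    refine PermLin.hom_ext' (hc p.1 p.2) (hc q.1 q.2) fun x => ?_
    obtain ⟨x, rfl⟩ := unflat (α := fun i j => (a i j).Obj) x
    exact (h.comp_app ξ.1 ξ.2 x).trans (h'.comp_app ξ.1 ξ.2 x).symm


theorem MultiLin.ext' {k : ℕ} {M : Fin k → BasedMulticategory.{v, u}}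
    {N : BasedMulticategory.{v', u'}}
    {f g : MultiLin M N} (h₁ : ∀ x, f.obj x = g.obj x)
    (h₂ : ∀ (j : Fin k) {m : ℕ} {a : Fin m → (M j).Obj} {a' : (M j).Obj}
      (φ : (M j).Hom m a a') x x' hx hx', HEq (f.map j φ x x' hx hx') (g.map j φ x x' hx hx')) :
    f = g := by
  obtain ⟨o, p, _, _, _, _, _, _⟩ := f
  obtain ⟨o', p', _, _, _, _, _, _⟩ := g
  obtain rfl : o = o' := funext h₁
  obtain rfl : @p = @p' := by
    funext j m a a' φ x x' hx hx'
    exact eq_of_heq (h₂ j φ x x' hx hx')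
  rfl

theorem MultiLin.hom_ext' {k : ℕ} {M : Fin k → BasedMulticategory.{v, u}}
    {N : BasedMulticategory.{v', u'}}
    {f g f' g' : MultiLin M N} (hf : f = f') (hg : g = g') {ξ : f ⟶ g} {η : f' ⟶ g'}
    (h : ∀ x, HEq (ξ.app x) (η.app x)) : HEq ξ η := by
  subst hf hg
  refine heq_of_eq (MultiLin.Trans.ext ?_)
  ext x
  exact eq_of_heq (h x)

theorem homFactor {n : ℕ} {X : Fin n → Type u} [∀ i, Category.{v} (X i)] {x y : ∀ i, X i} (f : x ⟶ y)
    (R : ∀ x y : (∀ i, X i), (x ⟶ y) → Prop) (hid : ∀ x, R x x (𝟙 x))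
    (hc : ∀ (x y z : ∀ i, X i) (f : x ⟶ y) (g : y ⟶ z), R x y f → R y z g → R x z (f ≫ g))
    (hs : ∀ (x y : ∀ i, X i) (f : x ⟶ y) j, (∀ i, i ≠ j → IsId (f i)) → R x y f) : R x y f := by
  have key : ∀ (s : Finset (Fin n)) (x y : ∀ i, X i) (f : x ⟶ y),
      (∀ i, i ∉ s → IsId (f i)) → R x y f := by
    intro s
    induction s using Finset.induction_on with
    | empty =>
      intro x y f hf
      have hxy : x = y := funext fun i => (hf i (by simp)).1
      subst hxy
      have : f = 𝟙 x := by
        funext i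
        obtain ⟨e, he⟩ := hf i (by simp)
        rw [he]; rfl
      rw [this]; exact hid x
    | insert j s hj ih =>
      intro x y f hf
      let w : ∀ i, X i := fun i => if i = j then y i else x i
      have hg : ∀ i, ∃ g : x i ⟶ w i, ∃ h : w i ⟶ y i, f i = g ≫ h ∧ (i = j → IsId h) ∧ (i ≠ j → IsId g)
          ∧ (i ≠ j → IsId (f i) → IsId h) := by
        intro i
        by_cases hi : i = j
        · have : w i = y i := if_pos hi
          exact ⟨f i ≫ eqToHom this.symm, eqToHom this, by simp, fun _ => ⟨_, rfl⟩, fun h => absurd hi h, fun h => absurd hi h⟩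
        · have : w i = x i := if_neg hi
          refine ⟨eqToHom this.symm, eqToHom this ≫ f i, by simp, fun h => absurd h hi, fun _ => ⟨_, rfl⟩, fun _ ⟨e, he⟩ => ⟨this.trans e, by rw [he]; simp⟩⟩
      choose g h e1 e2 e3 e4 using hg
      have : f = (show x ⟶ w from g) ≫ (show w ⟶ y from h) := funext e1
      rw [this]
      refine hc _ _ _ _ _ (hs _ _ _ j e3) (ih _ _ _ fun i hi => ?_)
      by_cases hij : i = j
      · exact e2 i hij
      · exact e4 i hij (hf i (by simp [hij, hi]))
  exact key Finset.univ x y f (by simp)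

variable {Q Q' : CatMulticategory BasedMulticategory.{v, u} (fun _ M N => MultiLin M N)}

/-- There is at most one multicategory of based multicategories. -/
theorem IsMulticategoryOfBasedMulticategories.unique (h : IsMulticategoryOfBasedMulticategories Q)
    (h' : IsMulticategoryOfBasedMulticategories Q') : Q = Q' := by
  have hc : ∀ {n : ℕ} {D : Fin n → BasedMulticategory.{v, u}} {E : BasedMulticategory.{v, u}}
    {k : Fin n → ℕ} {C : ∀ i, Fin (k i) → BasedMulticategory.{v, u}} (g : MultiLin D E)
    (f : ∀ i, MultiLin (C i) (D i)), Q.comp₁ g f = Q'.comp₁ g f := by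
    intro n D E k C g f
    refine MultiLin.ext' (fun x => ?_) (fun s {l a a'} φ x x' hx hx' => ?_)
    · obtain ⟨x, rfl⟩ := unflat (α := fun i j => (C i j).Obj) x
      rw [h.comp_obj, h'.comp_obj]
    · have : ∀ r, ∃ y : ∀ i j, (C i j).Obj, x r = flat y := fun r =>
        unflat (α := fun i j => (C i j).Obj) (x r)
      choose y hy using this
      obtain rfl : x = fun r => flat (y r) := funext hy
      obtain ⟨x', rfl⟩ := unflat (α := fun i j => (C i j).Obj) x'
      have hl : ∀ i j r, (i = blk s → ¬ HEq j (pos s)) → y r i j = x' i j := by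
        intro i j r hij
        have hne : finSigmaFinEquiv ⟨i, j⟩ ≠ s := by
          rintro rfl
          have := finSigmaFinEquiv.symm_apply_apply (⟨i, j⟩ : (i : Fin n) × Fin (k i))
          have h1 : i = blk (finSigmaFinEquiv ⟨i, j⟩) := (congrArg Sigma.fst this).symm
          refine hij h1 ?_
          exact (Sigma.mk.inj this).2.symm
        have := (congrFun (hx r) (finSigmaFinEquiv ⟨i, j⟩)).trans (Function.update_of_ne hne ..)
        have key := finSigmaFinEquiv.symm_apply_apply (⟨i, j⟩ : (i : Fin n) × Fin (k i))
        have := (show (fun p : (i : Fin n) × Fin (k i) => y r p.1 p.2 = x' p.1 p.2) (finSigmaFinEquiv.symm (finSigmaFinEquiv ⟨i,j⟩)) from this)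
        rw [key] at this
        exact this
      have hf : ∀ r, y r (blk s) = Function.update (x' (blk s)) (pos s) (a r) := by
        intro r
        funext j
        by_cases hj : j = pos s
        · subst hj
          rw [Function.update_self]
          exact (congrFun (hx r) s).trans (Function.update_self ..)
        · rw [Function.update_of_ne hj]
          exact hl _ _ _ fun _ h => hj (eq_of_heq h)
      have hg : ∀ r, (fun i => (f i).obj (y r i)) =
          Function.update (fun i => (f i).obj (x' i)) (blk s) ((f (blk s)).obj (y r (blk s))) := by
        intro r
        funext i
        by_cases hi : i = blk s
        · subst hi; rw [Function.update_self]
        · rw [Function.update_of_ne hi]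
          congr 1
          funext j
          exact hl _ _ _ fun h => absurd h hi
      exact (h.comp_map g f s φ y x' hx hf hx' hg).trans (h'.comp_map g f s φ y x' hx hf hx' hg).symm
  have hr : ∀ {m n : ℕ} (e : Fin m ≃ Fin n) {a : Fin n → BasedMulticategory.{v, u}} {b : BasedMulticategory.{v, u}}
      (f : MultiLin a b), (Q.reindex (b := b) e (a := a) (a' := fun i => a (e i)) (fun _ => rfl)).obj f =
        (Q'.reindex e (fun _ => rfl)).obj f := by
    intro m n e a b f
    refine MultiLin.ext' (fun x => ?_) (fun s {l c c'} φ x x' hx hx' => ?_)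
    · obtain ⟨x, rfl⟩ := unperm e (α := fun i => (a i).Obj) x
      rw [h.reindex_obj, h'.reindex_obj]
    · have : ∀ r, ∃ y : ∀ i, (a i).Obj, x r = fun i => y (e i) := fun r =>
        unperm e (α := fun i => (a i).Obj) (x r)
      choose y hy using this
      obtain rfl : x = fun r i => y r (e i) := funext hy
      obtain ⟨x', rfl⟩ := unperm e (α := fun i => (a i).Obj) x'
      have h1 : ∀ r, y r = Function.update x' (e s) (c r) := by
        intro r
        funext i
        obtain ⟨i, rfl⟩ := e.surjective i
        refine (congrFun (hx r) i).trans ?_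
        by_cases hi : i = s
        · subst hi; simp
        · rw [Function.update_of_ne hi, Function.update_of_ne (e.injective.ne hi)]
      exact (h.reindex_map e f s φ y x' h1 hx' hx).trans (h'.reindex_map e f s φ y x' h1 hx' hx).symm
  refine CatMulticategory.ext' (fun a => ?_) (fun {m n} e {a b} => ?_) (fun {n b c k a} => ?_)
  · refine MultiLin.ext' (fun x => ?_) (fun s {l b b'} φ x x' hx hx' => ?_)
    · rw [h.id_obj, h'.id_obj]
    · obtain rfl : s = 0 := Subsingleton.elim _ _
      exact (h.id_map a φ x x' hx hx').trans (h'.id_map a φ x x' hx hx').symm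
  · refine CategoryTheory.Functor.hext (hr e) fun f g ξ => ?_
    refine MultiLin.hom_ext' (hr e f) (hr e g) fun x => ?_
    obtain ⟨x, rfl⟩ := unperm e (α := fun i => (a i).Obj) x
    exact (h.reindex_app e ξ x).trans (h'.reindex_app e ξ x).symm
  · refine CategoryTheory.Functor.hext (fun p => hc p.1 p.2) fun p q ξ => ?_
    obtain ⟨g, f⟩ := p
    obtain ⟨g', f'⟩ := q
    obtain ⟨σ, ξ⟩ := ξ
    have comb : ∀ {X Y Z X' Y' Z' : MultiLin (flat a) c} {α : X ⟶ Y} {β : Y ⟶ Z} {α' : X' ⟶ Y'} {β' : Y' ⟶ Z'},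
        X = X' → Y = Y' → Z = Z' → HEq α α' → HEq β β' → HEq (α ≫ β) (α' ≫ β') := by
      intro X Y Z X' Y' Z' α β α' β' h1 h2 h3 h4 h5
      subst h1 h2 h3
      rw [eq_of_heq h4, eq_of_heq h5]
    have hleft : HEq (Q.comp₂ σ (fun i => 𝟙 (f i))) (Q'.comp₂ σ (fun i => 𝟙 (f i))) := by
      refine MultiLin.hom_ext' (hc _ _) (hc _ _) fun x => ?_
      obtain ⟨x, rfl⟩ := unflat (α := fun i j => (a i j).Obj) x
      exact (h.comp_app_left f σ x).trans (h'.comp_app_left f σ x).symm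
    have hright : HEq (Q.comp₂ (𝟙 g') ξ) (Q'.comp₂ (𝟙 g') ξ) := by
      refine homFactor (X := fun i => MultiLin (a i) (b i)) (x := f) (y := f') ξ
        (fun f f' ξ => HEq (Q.comp₂ (𝟙 g') ξ) (Q'.comp₂ (𝟙 g') ξ)) ?_ ?_ ?_
      · intro f
        have e1 : Q.comp₂ (𝟙 g') (𝟙 f : f ⟶ f) = 𝟙 _ := Q.comp.map_id (g', f)
        have e2 : Q'.comp₂ (𝟙 g') (𝟙 f : f ⟶ f) = 𝟙 _ := Q'.comp.map_id (g', f)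
        rw [e1, e2]
        rw [hc g' f]
      · intro f f' f'' ξ η h1 h2
        have e1 : ∀ Q : CatMulticategory BasedMulticategory.{v, u} (fun _ M N => MultiLin M N),
          Q.comp₂ (a := a) (𝟙 g') (ξ ≫ η : f ⟶ f'') = Q.comp₂ (𝟙 g') ξ ≫ Q.comp₂ (𝟙 g') η := by
          intro Q
          refine Eq.trans ?_ (Q.comp.map_comp (X := (g', f)) (Y := (g', f')) (Z := (g', f'')) (𝟙 g', ξ) (𝟙 g', η))
          refine congrArg (fun t : ((g', f) : MultiLin b c × (∀ i, MultiLin (a i) (b i))) ⟶ (g', f'') => Q.comp.map t) ?_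
          exact Prod.ext (Category.comp_id (𝟙 g')).symm rfl
        simp only [e1]
        exact comb (hc _ _) (hc _ _) (hc _ _) h1 h2
      · intro f f' ξ j hξ
        refine MultiLin.hom_ext' (hc _ _) (hc _ _) fun x => ?_
        obtain ⟨x, rfl⟩ := unflat (α := fun i j => (a i j).Obj) x
        have hh : ∀ _ : Fin 1, (fun i => (f i).obj (x i)) =
            Function.update (fun i => (f' i).obj (x i)) j ((f j).obj (x j)) := by
          intro _
          funext i
          by_cases hi : i = j
          · subst hi; rw [Function.update_self]
          · rw [Function.update_of_ne hi, (hξ i hi).1]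
        exact (h.comp_app_right g' ξ j hξ x hh).trans (h'.comp_app_right g' ξ j hξ x hh).symm
    have e1 : ∀ Q : CatMulticategory BasedMulticategory.{v, u} (fun _ M N => MultiLin M N),
          Q.comp₂ (a := a) σ ξ = Q.comp₂ σ (fun i => 𝟙 (f i)) ≫ Q.comp₂ (𝟙 g') ξ := by
      intro Q
      refine Eq.trans ?_ (Q.comp.map_comp (X := (g, f)) (Y := (g', f)) (Z := (g', f')) (σ, 𝟙 f) (𝟙 g', ξ))
      refine congrArg (fun t : ((g, f) : MultiLin b c × (∀ i, MultiLin (a i) (b i))) ⟶ (g', f') => Q.comp.map t) ?_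
      exact Prod.ext (Category.comp_id σ).symm (funext fun i => (Category.id_comp (ξ i)).symm)
    refine HEq.trans (heq_of_eq (e1 Q)) (HEq.trans ?_ (heq_of_eq (e1 Q').symm))
    exact comb (hc _ _) (hc _ _) (hc _ _) hleft hright

end Uniqueness

/-! ### The underlying based multicategory of a permutative category -/

/-- The tuples `x r` and `z` of objects agree in all places but `j`, and `z_j` is the iterated sum of
the `(x r)_j`. -/
def SumAt {k m : ℕ} {C : Fin k → PermCat.{v, u}} (j : Fin k) (x : Fin m → ∀ i, (C i).Obj)
    (z : ∀ i, (C i).Obj) : Prop :=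
  z j = (C j).sum (fun r => x r j) ∧ ∀ l, l ≠ j → ∀ r, x r l = z l

theorem SumAt.tail {k m : ℕ} {C : Fin k → PermCat.{v, u}} {j : Fin k}
    {x : Fin (m + 1) → ∀ i, (C i).Obj} {z : ∀ i, (C i).Obj} (h : SumAt j x z) :
    SumAt j (fun r => x r.succ)
      (Function.update z j ((C j).sum fun r => x r.succ j)) := by
  refine ⟨Function.update_self .., fun l hl r => ?_⟩
  exact (h.2 l hl r.succ).trans (Function.update_of_ne hl ..).symm

theorem SumAt.head {k m : ℕ} {C : Fin k → PermCat.{v, u}} {j : Fin k}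
    {x : Fin (m + 1) → ∀ i, (C i).Obj} {z : ∀ i, (C i).Obj} (h : SumAt j x z) :
    AddAt j (x 0) (Function.update z j ((C j).sum fun r => x r.succ j)) z := by
  refine ⟨?_, fun l hl => ⟨h.2 l hl 0, Function.update_of_ne hl ..⟩⟩
  rw [Function.update_self, h.1]
  rfl

/-- The iterated distributivity map `f(c_1) ⊕ ⋯ ⊕ f(c_m) ⟶ f(c_1 ⊕ ⋯ ⊕ c_m)` in the variable
`j` (with the other variables fixed and suppressed). -/
def PermLin.lam {k : ℕ} {C : Fin k → PermCat.{v, u}} {D : PermCat.{v', u'}} (f : PermLin C D)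
    (j : Fin k) : ∀ {m : ℕ} (x : Fin m → ∀ i, (C i).Obj) (z : ∀ i, (C i).Obj), SumAt j x z →
      (D.sum (fun r => f.F.obj (x r)) ⟶ f.F.obj z)
  | 0, _, z, h => eqToHom (f.obj_zero z ⟨j, h.1⟩).symm
  | _ + 1, x, z, h =>
    D.addMap (𝟙 (f.F.obj (x 0))) (f.lam j (fun r => x r.succ) _ h.tail) ≫ f.δ j (x 0) _ z h.head

/-- The underlying based multicategory of a permutative category; `h` says that the axioms of a based
multicategory hold for the operations `C.underlyingData`. -/
def PermCat.underlying (C : PermCat.{v, u}) (h : C.underlyingData.IsBased) :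
    BasedMulticategory.{v, u} :=
  { C.underlyingData with isBased := h }

/-- The multifunctor `U` given by the underlying based multicategory. -/
structure IsUnderlyingMultifunctor
    {P : CatMulticategory PermCat.{v, u} (fun _ C D => PermLin C D)}
    {Q : CatMulticategory BasedMulticategory.{v, u} (fun _ M N => MultiLin M N)}
    {hU : ∀ C : PermCat.{v, u}, C.underlyingData.IsBased}
    (U : CatMultifunctor P Q (fun C => C.underlying (hU C))) : Prop where
  /-- `U f` is `f` on objects. -/
  map_obj_obj : ∀ {k : ℕ} {C : Fin k → PermCat.{v, u}} {D : PermCat.{v, u}} (f : PermLin C D)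
    (x : ∀ i, (C i).Obj), ((U.map C D).obj f).obj x = f.F.obj x
  /-- For a morphism `φ : a_1 ⊕ ⋯ ⊕ a_m ⟶ a'` in the variable `j`, `U f (φ)` is the composite
  `f(a_1) ⊕ ⋯ ⊕ f(a_m) ⟶ f(a_1 ⊕ ⋯ ⊕ a_m) ⟶ f(a')` of the iterated distributivity map and of
  `f(φ)` (that is, of `f` at `φ` and the identities in the other variables). -/
  map_obj_map : ∀ {k : ℕ} {C : Fin k → PermCat.{v, u}} {D : PermCat.{v, u}} (f : PermLin C D)
    (j : Fin k) {m : ℕ} {a : Fin m → (C j).Obj} {a' : (C j).Obj} (φ : (C j).sum a ⟶ a')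
    (x : Fin m → ∀ i, (C i).Obj) (x' : ∀ i, (C i).Obj)
    (hx : ∀ r, x r = Function.update x' j (a r)) (hx' : x' j = a')
    (z : ∀ i, (C i).Obj) (hz : SumAt j x z) (s : z ⟶ x'),
    HEq (s j) φ → (∀ l, l ≠ j → IsId (s l)) →
    HEq (((U.map C D).obj f).map j φ x x' hx hx') (f.lam j x z hz ≫ f.F.map s)
  /-- `U` of a natural transformation has the same components. -/
  map_map : ∀ {k : ℕ} {C : Fin k → PermCat.{v, u}} {D : PermCat.{v, u}} {f g : PermLin C D}
    (ξ : f ⟶ g) (x : ∀ i, (C i).Obj),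
    HEq (((U.map C D).map ξ).app x) (eqToHom (D.sum_one fun _ => f.F.obj x) ≫ ξ.τ.app x)

end PermMult

open PermMult

/-!
The theorem rests on two facts: coherence for permutative categories, and the observation that a
multilinear map of underlying multicategories is determined by its action on `1`-morphisms and by
its values at the identities of the sums `a_1 ⊕ ⋯ ⊕ a_m`, seen as `m`-morphisms
`(a_1, …, a_m) ⟶ a_1 ⊕ ⋯ ⊕ a_m`.

Coherence. Every rearrangement of a list of labels by transpositions of neighbours gives a morphism
of iterated sums. Such a morphism can be brought into a normal form, in which the summands are
inserted one after the other; the normal forms are closed under composition with a transposition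
because `γ_{b,a} γ_{a,b} = 1` and because of the braid relation. If the labels are distinct, there
is only one normal form with given ends, so the morphism depends only on the permutation
(`PermCat.real_unique`, `PermCat.Realizes.unique`). The equations between permutations of
sums in the axioms of a multicategory follow by labelling the summands, and together with the
naturality of the symmetry they make `UC` a based multicategory (`PermCat.isBased_underlyingData`).

From permutative categories to multicategories. The iterated distributivity maps of a multilinear
map `f` are natural (`PermLin.lam_naturality`), compatible with permutations and concatenations of
the summands (`PermLin.tdist_perm`, `PermLin.tdist_flat`), and those of two different variables
commute up to interchange of the order of summation (`PermLin.lam_lam`). These are the axioms for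
`Uf` (`PermLin.toMultiLin`).

Multilinear maps of based multicategories. The actions of a multilinear map on the `1`-morphisms in
different variables commute, and so form a functor on the product of the categories of `1`-morphisms
(`MultiLin.onOne`). The horizontal composite of `2`-cells is defined with this functor; it is
natural because multilinear maps preserve commutative squares of `1`-morphisms and `n`-morphisms
(`MultiLin.onOne_naturality`). This yields the multicategory `basedMulticategories`.

Back to permutative categories. For a multilinear map `G` of underlying multicategories, every
`m`-morphism is the identity of a sum followed by a `1`-morphism, which gives the second fact above
(`MultiLin.same_map`). The functor and the values at identities of sums of two objects form a
multilinear map of permutative categories (`MultiLin.toPermLin`), and an induction shows that its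
iterated distributivity maps are the values of `G` at the identities of longer sums
(`MultiLin.same_lam_toPermLin`). Thus `U` is an isomorphism on each category of multilinear maps
(`PermLin.isoCat`). The multicategory of permutative categories and the multifunctor `U` are then
obtained from `basedMulticategories` by transport along these isomorphisms
(`CatMulticategory.transport`, `CatMulticategory.transportMultifunctor`), so that the axioms need
not be verified a second time; it remains to see that the transported operations are given by the
usual formulas (`isMulticategoryOfPermutativeCategories`).

Strict associativity and tuples of objects produce many equalities of objects that do not hold by
definition. Morphisms are therefore compared by the relation `Same`: equality after composition with
the morphisms given by equalities of the sources and of the targets.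
-/

namespace PermMult

/-! ### Morphisms up to equality of sources and targets -/

section Same

variable {A : Type u} [Category.{v} A]

/-- Two morphisms of a category agree up to equalities of their sources and of their targets. -/
def Same {a b a' b' : A} (f : a ⟶ b) (g : a' ⟶ b') : Prop :=
  ∃ (h : a = a') (h' : b = b'), f = eqToHom h ≫ g ≫ eqToHom h'.symm

namespace Same

variable {a b c a' b' c' a'' b'' : A}

theorem refl (f : a ⟶ b) : Same f f := ⟨rfl, rfl, by simp⟩

theorem of_eq {f g : a ⟶ b} (h : f = g) : Same f g := h ▸ refl f

theorem symm {f : a ⟶ b} {g : a' ⟶ b'} (h : Same f g) : Same g f := by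
  obtain ⟨rfl, rfl, rfl⟩ := h
  exact of_eq (by simp)

theorem trans {f : a ⟶ b} {g : a' ⟶ b'} {k : a'' ⟶ b''} (h : Same f g) (h' : Same g k) :
    Same f k := by
  obtain ⟨rfl, rfl, rfl⟩ := h
  obtain ⟨rfl, rfl, rfl⟩ := h'
  exact of_eq (by simp)

theorem eq {f g : a ⟶ b} (h : Same f g) : f = g := by
  obtain ⟨_, _, rfl⟩ := h
  simp

theorem heq {f : a ⟶ b} {g : a' ⟶ b'} (h : Same f g) : HEq f g := by
  obtain ⟨rfl, rfl, rfl⟩ := h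
  simp

theorem of_heq {f : a ⟶ b} {g : a' ⟶ b'} (h : a = a') (h' : b = b') (e : HEq f g) : Same f g := by
  subst h h'
  exact of_eq (eq_of_heq e)

theorem comp {f : a ⟶ b} {g : b ⟶ c} {f' : a' ⟶ b'} {g' : b' ⟶ c'} (h : Same f f')
    (h' : Same g g') : Same (f ≫ g) (f' ≫ g') := by
  obtain ⟨rfl, rfl, rfl⟩ := h
  obtain ⟨_, rfl, rfl⟩ := h'
  exact of_eq (by simp)

theorem eqToHom_comp (h : a = b) (g : b ⟶ c) : Same (eqToHom h ≫ g) g := by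
  subst h
  exact of_eq (by simp)

theorem comp_eqToHom (g : a ⟶ b) (h : b = c) : Same (g ≫ eqToHom h) g := by
  subst h
  exact of_eq (by simp)

theorem eqToHom_id (h : a = b) : Same (eqToHom h) (𝟙 a) := by
  subst h
  exact of_eq (by simp)

theorem eqToHom_id' (h : a = b) : Same (eqToHom h) (𝟙 b) := by
  subst h
  exact of_eq (by simp)

theorem id (h : a = b) : Same (𝟙 a) (𝟙 b) := by
  subst h
  exact refl _

theorem comp_id {f : a ⟶ b} {g : a' ⟶ b'} {k : b ⟶ c} (h : Same f g) (hk : Same k (𝟙 b)) :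
    Same (f ≫ k) g := by
  obtain ⟨rfl, rfl, rfl⟩ := h
  obtain ⟨_, rfl, rfl⟩ := hk
  exact of_eq (by simp)

theorem id_comp {f : a ⟶ b} {g : a' ⟶ b'} {k : c ⟶ a} (h : Same f g) (hk : Same k (𝟙 a)) :
    Same (k ≫ f) g := by
  obtain ⟨rfl, rfl, rfl⟩ := h
  obtain ⟨rfl, _, rfl⟩ := hk
  exact of_eq (by simp)

theorem isId {f : a ⟶ b} {g : a' ⟶ b'} (h : Same f g) (hg : IsId g) : IsId f := by
  obtain ⟨rfl, rfl, rfl⟩ := h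
  simpa using hg

theorem of_isId {f : a ⟶ b} {g : a' ⟶ b'} (hf : IsId f) (hg : IsId g) (h : a = a') :
    Same f g := by
  subst h
  obtain ⟨rfl, rfl⟩ := hf
  obtain ⟨rfl, rfl⟩ := hg
  exact refl _

end Same

theorem IsId.same {a b : A} {f : a ⟶ b} (h : IsId f) : Same f (𝟙 a) := by
  obtain ⟨h, rfl⟩ := h
  exact .eqToHom_id h

theorem IsId.same' {a b : A} {f : a ⟶ b} (h : IsId f) : Same f (𝟙 b) := by
  obtain ⟨h, rfl⟩ := h
  exact .eqToHom_id' h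

theorem IsId.of_same {a b c : A} {f : a ⟶ b} (h : Same f (𝟙 c)) : IsId f :=
  h.isId ⟨rfl, rfl⟩

theorem IsId.eqToHom {a b : A} (h : a = b) : IsId (eqToHom h) := ⟨h, rfl⟩

theorem IsId.comp {a b c : A} {f : a ⟶ b} {g : b ⟶ c} (hf : IsId f) (hg : IsId g) :
    IsId (f ≫ g) := by
  obtain ⟨rfl, rfl⟩ := hf
  obtain ⟨rfl, rfl⟩ := hg
  exact ⟨rfl, by simp⟩

end Same

/-! ### Coherence for permutative categories -/

namespace PermCat

variable (C : PermCat.{v, u})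

section

variable {C}

theorem same_addMap {a b c d a' b' c' d' : C.Obj} {f : a ⟶ b} {g : c ⟶ d} {f' : a' ⟶ b'}
    {g' : c' ⟶ d'} (h : Same f f') (h' : Same g g') : Same (C.addMap f g) (C.addMap f' g') := by
  obtain ⟨rfl, rfl, rfl⟩ := h
  obtain ⟨rfl, rfl, rfl⟩ := h'
  exact .of_eq (by simp)

theorem same_assoc {a a' b b' c c' : C.Obj} (f : a ⟶ a') (g : b ⟶ b') (h : c ⟶ c') :
    Same (C.addMap (C.addMap f g) h) (C.addMap f (C.addMap g h)) :=
  ⟨C.add_assoc .., C.add_assoc .., C.addMap_assoc f g h⟩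

theorem same_addMap_zero {a a' : C.Obj} (f : a ⟶ a') : Same (C.addMap f (𝟙 C.zero)) f :=
  ⟨C.add_zero .., C.add_zero .., C.addMap_zero f⟩

theorem same_zero_addMap {a a' : C.Obj} (f : a ⟶ a') : Same (C.addMap (𝟙 C.zero) f) f :=
  ⟨C.zero_add .., C.zero_add .., C.zero_addMap f⟩

theorem isId_addMap {a b c d : C.Obj} {f : a ⟶ b} {g : c ⟶ d} (h : IsId f) (h' : IsId g) :
    IsId (C.addMap f g) := by
  obtain ⟨rfl, rfl⟩ := h
  obtain ⟨rfl, rfl⟩ := h'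
  exact ⟨rfl, C.addMap_id _ _⟩

end

theorem id_addMap_comp (x : C.Obj) {a b c : C.Obj} (f : a ⟶ b) (g : b ⟶ c) :
    C.addMap (𝟙 x) (f ≫ g) = C.addMap (𝟙 x) f ≫ C.addMap (𝟙 x) g := by
  rw [← C.addMap_comp, Category.comp_id]

theorem addMap_comp_id (x : C.Obj) {a b c : C.Obj} (f : a ⟶ b) (g : b ⟶ c) :
    C.addMap (f ≫ g) (𝟙 x) = C.addMap f (𝟙 x) ≫ C.addMap g (𝟙 x) := by
  rw [← C.addMap_comp, Category.comp_id]

/-- The symmetry of two summands in front of a third one, `a ⊕ (b ⊕ x) ⟶ b ⊕ (a ⊕ x)`. -/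
def swap (a b x : C.Obj) : C.add a (C.add b x) ⟶ C.add b (C.add a x) :=
  eqToHom (C.add_assoc a b x).symm ≫ C.addMap (C.γ a b) (𝟙 x) ≫ eqToHom (C.add_assoc b a x)

theorem same_swap (a b x : C.Obj) : Same (C.swap a b x) (C.addMap (C.γ a b) (𝟙 x)) :=
  (Same.comp_eqToHom _ _).id_comp (.eqToHom_id' _)

variable {C} in
theorem swap_naturality {a a' b b' x x' : C.Obj} (f : a ⟶ a') (g : b ⟶ b') (h : x ⟶ x') :
    C.addMap f (C.addMap g h) ≫ C.swap a' b' x' = C.swap a b x ≫ C.addMap g (C.addMap f h) := by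
  refine Same.eq (((same_assoc f g h).symm.comp (C.same_swap a' b' x')).trans ?_)
  refine Same.trans (.of_eq ?_) (((C.same_swap a b x).comp (same_assoc g f h).symm).symm)
  rw [← C.addMap_comp, ← C.addMap_comp, C.γ_naturality, Category.comp_id, Category.id_comp]

theorem swap_swap (a b x : C.Obj) : C.swap a b x ≫ C.swap b a x = 𝟙 _ := by
  refine Same.eq (((C.same_swap a b x).comp (C.same_swap b a x)).trans ?_)
  rw [← C.addMap_comp, C.γ_γ, Category.comp_id, C.addMap_id]
  exact .id (C.add_assoc ..)

/-- Moving `c` past `a ⊕ b` is moving it past `b` and then past `a`. -/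
theorem same_γ_add (a b c x : C.Obj) : Same (C.addMap (𝟙 a) (C.swap b c x) ≫ C.swap a c (C.add b x))
    (C.addMap (C.γ (C.add a b) c) (𝟙 x)) := by
  rw [C.γ_add]
  refine Same.symm ?_
  simp only [C.addMap_comp_id]
  refine Same.id_comp ?_ (same_addMap (.eqToHom_id' _) (.refl _) |>.trans (.of_eq (C.addMap_id _ _)))
  refine Same.comp ?_ (Same.id_comp (Same.comp_id ?_
    (same_addMap (.eqToHom_id _) (.refl _) |>.trans (.of_eq (C.addMap_id _ _))))
    (same_addMap (.eqToHom_id' _) (.refl _) |>.trans (.of_eq (C.addMap_id _ _))))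
  · exact (same_assoc _ _ _).trans (same_addMap (.refl _) (C.same_swap b c x).symm)
  · refine (same_assoc _ _ _).trans (Same.trans ?_ (C.same_swap a c _).symm)
    rw [C.addMap_id]
    exact .refl _

/-- The braid relation for the symmetries of three summands in front of a fourth one. -/
theorem swap_braid (a b c x : C.Obj) :
    C.swap a b (C.add c x) ≫ C.addMap (𝟙 b) (C.swap a c x) ≫ C.swap b c (C.add a x) =
      C.addMap (𝟙 a) (C.swap b c x) ≫ C.swap a c (C.add b x) ≫ C.addMap (𝟙 c) (C.swap a b x) := by
  refine Same.eq (((?_ : Same (C.swap a b (C.add c x)) (C.addMap (C.addMap (C.γ a b) (𝟙 c)) (𝟙 x))).comp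
    (C.same_γ_add b a c x)).trans ?_)
  · refine (C.same_swap _ _ _).trans (Same.trans ?_ (same_assoc _ _ _).symm)
    rw [C.addMap_id]
    exact .refl _
  · rw [← C.addMap_comp, C.γ_naturality, C.addMap_comp, ← Category.assoc]
    exact (C.same_γ_add a b c x).symm.comp
      ((same_assoc _ _ _).trans (same_addMap (.refl _) (C.same_swap a b x).symm))

variable {C} {I : Type w}

/-- The iterated sum of the objects that are labelled by the entries of a list. -/
def lsum (A : I → C.Obj) : List I → C.Obj
  | [] => C.zero
  | x :: l => C.add (A x) (lsum A l)

end PermCat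

/-- A rearrangement of a list into another one, as a composite of interchanges of neighbours. -/
inductive Rearr {I : Type w} : List I → List I → Type w
  | refl (l : List I) : Rearr l l
  | swap (x y : I) (l : List I) : Rearr (x :: y :: l) (y :: x :: l)
  | cons (x : I) {l l' : List I} : Rearr l l' → Rearr (x :: l) (x :: l')
  | trans {l l' l'' : List I} : Rearr l l' → Rearr l' l'' → Rearr l l''

theorem Rearr.perm {I : Type w} {l l' : List I} (p : Rearr l l') : l.Perm l' := by
  induction p with
  | refl l => rfl
  | swap x y l => exact .swap y x l
  | cons x _ ih => exact ih.cons x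
  | trans _ _ ih ih' => exact ih.trans ih'

theorem Rearr.nonempty {I : Type w} {l l' : List I} (h : l.Perm l') : Nonempty (Rearr l l') := by
  induction h with
  | nil => exact ⟨.refl _⟩
  | cons x _ ih => exact ih.map (.cons x)
  | swap x y l => exact ⟨.swap y x l⟩
  | trans _ _ ih ih' => exact ih.elim fun p => ih'.map fun q => .trans p q

namespace PermCat

variable {C : PermCat.{v, u}} {I : Type w}

/-- The morphism between iterated sums that is given by a rearrangement of the labels. -/
def real (A : I → C.Obj) : ∀ {l l' : List I}, Rearr l l' → (lsum A l ⟶ lsum A l')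
  | _, _, .refl _ => 𝟙 _
  | _, _, .swap x y l => C.swap (A x) (A y) (lsum A l)
  | _, _, .cons x p => C.addMap (𝟙 (A x)) (real A p)
  | _, _, .trans p q => real A p ≫ real A q

/-- The morphism `A x ⊕ l ⟶ L` that moves the first summand past some of the others. -/
inductive Insertion (A : I → C.Obj) : ∀ (x : I) (l L : List I),
    (C.add (A x) (lsum A l) ⟶ lsum A L) → Prop
  | here (x : I) (l : List I) : Insertion A x l (x :: l) (𝟙 _)
  | there {x : I} (y : I) {l L : List I} {f : C.add (A x) (lsum A l) ⟶ lsum A L} :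
      Insertion A x l L f → Insertion A x (y :: l) (y :: L)
        (C.swap (A x) (A y) (lsum A l) ≫ C.addMap (𝟙 (A y)) f)

/-- The normal form of a rearrangement: the summands are inserted one after the other, beginning
with the last one. -/
inductive Normal (A : I → C.Obj) : ∀ l L : List I, (lsum A l ⟶ lsum A L) → Prop
  | nil : Normal A [] [] (𝟙 _)
  | cons {x : I} {l M L : List I} {f : lsum A l ⟶ lsum A M}
      {g : C.add (A x) (lsum A M) ⟶ lsum A L} : Normal A l M f → Insertion A x M L g →
      Normal A (x :: l) L (C.addMap (𝟙 (A x)) f ≫ g)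

variable {A : I → C.Obj}

theorem Insertion.perm {x : I} {l L : List I} {f : C.add (A x) (lsum A l) ⟶ lsum A L}
    (h : Insertion A x l L f) : (x :: l).Perm L := by
  induction h with
  | here => rfl
  | there y _ ih => exact (List.Perm.swap _ _ _).trans (ih.cons y)

theorem Insertion.unique {x : I} {l L : List I} {f : C.add (A x) (lsum A l) ⟶ lsum A L}
    (h : Insertion A x l L f) (hL : L.Nodup) {l' : List I}
    {f' : C.add (A x) (lsum A l') ⟶ lsum A L} (h' : Insertion A x l' L f') :
    l = l' ∧ HEq f f' := by
  induction h generalizing l' with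
  | here =>
    cases h' with
    | here => exact ⟨rfl, HEq.rfl⟩
    | there y h' =>
      exact absurd (h'.perm.mem_iff.1 (by simp)) (List.nodup_cons.1 hL).1
  | there y h ih =>
    cases h' with
    | here => exact absurd (h.perm.mem_iff.1 (by simp)) (List.nodup_cons.1 hL).1
    | there _ h' =>
      obtain ⟨rfl, e⟩ := ih (List.nodup_cons.1 hL).2 h'
      obtain rfl := eq_of_heq e
      exact ⟨rfl, HEq.rfl⟩

/-- If the labels are distinct, the normal form is unique: the places of the insertions can be read
off from the target. -/
theorem Normal.unique {l L : List I} {f f' : lsum A l ⟶ lsum A L} (h : Normal A l L f)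
    (h' : Normal A l L f') (hL : L.Nodup) : f = f' := by
  induction h with
  | nil => cases h'; rfl
  | cons h hi ih =>
    cases h' with
    | cons h' hi' =>
      obtain ⟨rfl, e⟩ := hi.unique hL hi'
      obtain rfl := eq_of_heq e
      rw [ih h' (List.nodup_cons.1 (hi.perm.nodup_iff.2 hL)).2]

theorem Normal.id (A : I → C.Obj) (l : List I) : Normal A l l (𝟙 _) := by
  induction l with
  | nil => exact .nil
  | cons x l ih =>
    have h := Normal.cons ih (.here x l)
    rw [C.addMap_id] at h
    exact (Category.comp_id (𝟙 (C.add (A x) (lsum A l)))) ▸ h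

theorem exchange_here {a b m m' : C.Obj} (s : C.add a (C.add b m) ⟶ C.add b (C.add a m))
    (f : C.add a m ⟶ m') :
    s ≫ C.addMap (𝟙 b) f ≫ 𝟙 _ = C.addMap (𝟙 a) (𝟙 (C.add b m)) ≫ s ≫ C.addMap (𝟙 b) f := by
  rw [C.addMap_id, Category.id_comp, Category.comp_id]

theorem exchange_there_here {a b m m' : C.Obj} (f : C.add b m ⟶ m') :
    C.swap a b m ≫ C.addMap (𝟙 b) (𝟙 (C.add a m)) ≫ C.swap b a m ≫ C.addMap (𝟙 a) f =
      C.addMap (𝟙 a) f ≫ 𝟙 _ := by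
  rw [C.addMap_id, Category.id_comp, reassoc_of% C.swap_swap, Category.comp_id]

/-- The braid relation lets two insertions past a common summand `c` be exchanged if the remaining
parts of them can. -/
theorem exchange_there {a b c m m' n k : C.Obj} (f : C.add a m ⟶ m') (g : C.add b m' ⟶ k)
    (f' : C.add b m ⟶ n) (g' : C.add a n ⟶ k)
    (h : C.swap a b m ≫ C.addMap (𝟙 b) f ≫ g = C.addMap (𝟙 a) f' ≫ g') :
    C.swap a b (C.add c m) ≫ C.addMap (𝟙 b) (C.swap a c m ≫ C.addMap (𝟙 c) f) ≫ C.swap b c m' ≫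
        C.addMap (𝟙 c) g =
      C.addMap (𝟙 a) (C.swap b c m ≫ C.addMap (𝟙 c) f') ≫ C.swap a c n ≫ C.addMap (𝟙 c) g' := by
  have n₁ := swap_naturality (𝟙 b) (𝟙 c) f
  have n₂ := swap_naturality (𝟙 a) (𝟙 c) f'
  have b := C.swap_braid a b c m
  simp only [id_addMap_comp, Category.assoc]
  rw [reassoc_of% n₁, reassoc_of% n₂, ← id_addMap_comp, ← id_addMap_comp, ← h]
  simp only [id_addMap_comp]
  rw [reassoc_of% b]

theorem exchange_cons {a b m m' l n k : C.Obj} (f₀ : l ⟶ m) (f : C.add a m ⟶ m')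
    (g : C.add b m' ⟶ k) (f' : C.add b m ⟶ n) (g' : C.add a n ⟶ k)
    (h : C.swap a b m ≫ C.addMap (𝟙 b) f ≫ g = C.addMap (𝟙 a) f' ≫ g') :
    C.addMap (𝟙 a) (C.addMap (𝟙 b) f₀ ≫ f') ≫ g' =
      C.swap a b l ≫ C.addMap (𝟙 b) (C.addMap (𝟙 a) f₀ ≫ f) ≫ g := by
  have n₁ := swap_naturality (𝟙 a) (𝟙 b) f₀
  simp only [id_addMap_comp, Category.assoc]
  rw [← h, reassoc_of% n₁]

/-- Two successive insertions can be done in either order. -/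
theorem Insertion.exchange {x y : I} {M' M L : List I} {g' : C.add (A x) (lsum A M') ⟶ lsum A M}
    {g : C.add (A y) (lsum A M) ⟶ lsum A L} (hx : Insertion A x M' M g')
    (hy : Insertion A y M L g) : ∃ (N : List I) (h' : C.add (A y) (lsum A M') ⟶ lsum A N)
      (h : C.add (A x) (lsum A N) ⟶ lsum A L), Insertion A y M' N h' ∧ Insertion A x N L h ∧
      C.swap (A x) (A y) (lsum A M') ≫ C.addMap (𝟙 (A y)) g' ≫ g =
        C.addMap (𝟙 (A x)) h' ≫ h := by
  induction hy generalizing M' with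
  | here M =>
    refine ⟨_, _, _, .here y M', .there y hx, ?_⟩
    exact exchange_here _ _
  | @there z M L g₀ hy ih =>
    cases hx with
    | here =>
      refine ⟨_, _, _, hy, .here _ _, ?_⟩
      exact exchange_there_here _
    | @there _ M₁ _ g₁ hx =>
      obtain ⟨N, h', h, hi', hi, e⟩ := ih hx
      exact ⟨_, _, _, .there z hi', .there z hi, exchange_there _ _ _ _ e⟩

/-- Normal forms are closed under precomposition with rearrangements. -/
theorem Normal.real_comp {l l' L : List I} (p : Rearr l l') {f : lsum A l' ⟶ lsum A L}
    (h : Normal A l' L f) : Normal A l L (real A p ≫ f) := by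
  induction p generalizing L with
  | refl => rwa [real, Category.id_comp]
  | swap x y l =>
    cases h with
    | cons h hy =>
      cases h with
      | cons h hx =>
        obtain ⟨N, h', k, hi', hi, e⟩ := hx.exchange hy
        exact exchange_cons _ _ _ _ _ e ▸ Normal.cons (Normal.cons h hi') hi
  | cons x p ih =>
    cases h with
    | cons h hi =>
      have := Normal.cons (ih h) hi
      rw [id_addMap_comp] at this
      exact Category.assoc (C.addMap (𝟙 (A x)) (real A p)) _ _ ▸ this
  | trans p q ih ih' =>
    rw [real, Category.assoc]
    exact ih (ih' h)

/-- Coherence: a rearrangement of distinct labels determines a unique morphism between the iterated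
sums. -/
theorem real_unique (A : I → C.Obj) {l l' : List I} (hl : l.Nodup) (p q : Rearr l l') :
    real A p = real A q := by
  have hp := Normal.real_comp p (.id A l')
  have hq := Normal.real_comp q (.id A l')
  rw [Category.comp_id] at hp hq
  exact hp.unique hq (p.perm.nodup_iff.1 hl)

end PermCat

/-! ### Canonical morphisms of a permutative category -/

section Labels

variable {I : Type w}

/-- A rearrangement of the labels in front of a fixed list. -/
def Rearr.append {l l' : List I} (p : Rearr l l') (m : List I) : Rearr (l ++ m) (l' ++ m) :=
  match p with
  | .refl _ => .refl _
  | .swap x y l => .swap x y (l ++ m)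
  | .cons x p => .cons x (p.append m)
  | .trans p q => .trans (p.append m) (q.append m)

/-- A rearrangement of the labels behind a fixed list. -/
def Rearr.prepend (m : List I) {l l' : List I} (p : Rearr l l') : Rearr (m ++ l) (m ++ l') :=
  match m with
  | [] => p
  | x :: m => .cons x (p.prepend m)

theorem flatten_ofFn_succ {n : ℕ} (L : Fin (n + 1) → List I) :
    (List.ofFn L).flatten = L 0 ++ (List.ofFn fun i => L i.succ).flatten := by
  rw [List.ofFn_succ, List.flatten_cons]

theorem flatten_ofFn_singleton {n : ℕ} (a : Fin n → I) :
    (List.ofFn fun i => [a i]).flatten = List.ofFn a := by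
  induction n with
  | zero => simp
  | succ n ih => rw [flatten_ofFn_succ, ih, List.ofFn_succ]; rfl

/-- A monoid as the permutative category with a unique morphism between any two objects. Its
iterated sums are the iterated sums of the monoid. -/
def indiscrete {X : Type u} (add : X → X → X) (zero : X)
    (add_assoc : ∀ a b c, add (add a b) c = add a (add b c)) (add_zero : ∀ a, add a zero = a)
    (zero_add : ∀ a, add zero a = a) : PermCat.{0, u} where
  Obj := X
  cat := { Hom := fun _ _ => PUnit, id := fun _ => ⟨⟩, comp := fun _ _ => ⟨⟩ }
  add := add
  addMap _ _ := ⟨⟩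
  addMap_id _ _ := rfl
  addMap_comp _ _ _ _ := rfl
  zero := zero
  add_assoc := add_assoc
  add_zero := add_zero
  zero_add := zero_add
  addMap_assoc _ _ _ := rfl
  addMap_zero _ := rfl
  zero_addMap _ := rfl
  γ _ _ := ⟨⟩
  γ_naturality _ _ := rfl
  γ_zero _ := rfl
  γ_γ _ _ := rfl
  γ_add _ _ _ := rfl

variable (I) in
/-- Lists with concatenation, as a permutative category. -/
def listCat : PermCat.{0, w} :=
  indiscrete (X := List I) (· ++ ·) [] List.append_assoc List.append_nil List.nil_append

theorem listCat_sum {n : ℕ} (L : Fin n → List I) : (listCat I).sum L = (List.ofFn L).flatten := by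
  induction n with
  | zero => simp; rfl
  | succ n ih => rw [flatten_ofFn_succ, ← ih]; rfl

/-- Concatenation of lists is associative for families, by the corresponding fact for the sum of a
permutative category, applied to lists. -/
theorem flatten_ofFn_flat {n : ℕ} {k : Fin n → ℕ} (L : ∀ i, Fin (k i) → List I) :
    (List.ofFn (flat L)).flatten = (List.ofFn fun i => (List.ofFn (L i)).flatten).flatten := by
  refine (listCat_sum _).symm.trans (((listCat I).sum_flat L).trans ((listCat_sum _).trans ?_))
  exact congrArg (fun L => (List.ofFn L).flatten) (funext fun i => listCat_sum _)

theorem ofFn_flat {n : ℕ} {k : Fin n → ℕ} (a : ∀ i, Fin (k i) → I) :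
    List.ofFn (flat a) = (List.ofFn fun i => List.ofFn (a i)).flatten := by
  have := flatten_ofFn_flat fun i j => [a i j]
  simpa only [flatten_ofFn_singleton] using this

theorem ofFn_equiv_perm {m n : ℕ} (e : Fin m ≃ Fin n) (a : Fin n → I) :
    (List.ofFn fun i => a (e i)).Perm (List.ofFn a) := by
  obtain rfl : m = n := by simpa using Fintype.card_congr e
  exact Equiv.Perm.ofFn_comp_perm e a

end Labels

namespace PermCat

variable {C : PermCat.{v, u}} {I : Type w}

theorem lsum_append (A : I → C.Obj) (l m : List I) :
    lsum A (l ++ m) = C.add (lsum A l) (lsum A m) := by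
  induction l with
  | nil => exact (C.zero_add _).symm
  | cons x l ih => exact (congrArg (C.add (A x)) ih).trans (C.add_assoc ..).symm

theorem lsum_flatten_ofFn (A : I → C.Obj) {n : ℕ} (L : Fin n → List I) :
    lsum A (List.ofFn L).flatten = C.sum fun i => lsum A (L i) := by
  induction n with
  | zero => simp; rfl
  | succ n ih => rw [flatten_ofFn_succ, lsum_append, ih]; rfl

theorem lsum_ofFn (A : I → C.Obj) {n : ℕ} (a : Fin n → I) :
    lsum A (List.ofFn a) = C.sum fun i => A (a i) := by
  induction n with
  | zero => simp; rfl
  | succ n ih => rw [List.ofFn_succ]; exact congrArg (C.add _) (ih _)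

theorem same_real_append (A : I → C.Obj) {l l' : List I} (p : Rearr l l') (m : List I) :
    Same (real A (p.append m)) (C.addMap (real A p) (𝟙 (lsum A m))) := by
  induction p with
  | refl l =>
    refine Same.trans ?_ (.of_eq (C.addMap_id _ _).symm)
    exact .id (lsum_append A l m)
  | swap x y l =>
    have h : ∀ s t : C.Obj, s = C.add t (lsum A m) → Same (C.swap (A x) (A y) s)
        (C.addMap (C.swap (A x) (A y) t) (𝟙 (lsum A m))) := by
      rintro _ t rfl
      refine (C.same_swap _ _ _).trans (Same.trans ?_
        (same_addMap (C.same_swap _ _ _) (.refl _)).symm)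
      rw [← C.addMap_id]
      exact (same_assoc _ _ _).symm
    exact h _ _ (lsum_append A l m)
  | cons x p ih => exact (same_addMap (.refl _) ih).trans (same_assoc _ _ _).symm
  | trans p q ih ih' =>
    rw [real, addMap_comp_id]
    exact ih.comp ih'

theorem same_real_prepend (A : I → C.Obj) (m : List I) {l l' : List I} (p : Rearr l l') :
    Same (real A (p.prepend m)) (C.addMap (𝟙 (lsum A m)) (real A p)) := by
  induction m with
  | nil => exact (same_zero_addMap _).symm
  | cons x m ih =>
    refine (same_addMap (.refl _) ih).trans ((same_assoc _ _ _).symm.trans ?_)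
    exact same_addMap (.of_eq (C.addMap_id _ _)) (.refl _)

/-- A morphism is, up to equalities of source and target, given by a rearrangement of labels. -/
def Realizes (A : I → C.Obj) (l l' : List I) {X Y : C.Obj} (f : X ⟶ Y) : Prop :=
  ∃ p : Rearr l l', Same f (real A p)

namespace Realizes

variable {A : I → C.Obj} {l l' l'' m m' : List I} {X Y Z X' Y' : C.Obj}

/-- Morphisms that realize rearrangements of the same distinct labels are equal. -/
theorem unique {f : X ⟶ Y} {g : X' ⟶ Y'} (h : Realizes A l l' f) (h' : Realizes A l l' g)
    (hl : l.Nodup) : Same f g := by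
  obtain ⟨p, hp⟩ := h
  obtain ⟨q, hq⟩ := h'
  rw [real_unique A hl q p] at hq
  exact hp.trans hq.symm

theorem same {f : X ⟶ Y} {g : X' ⟶ Y'} (h : Realizes A l l' f) (hg : Same g f) :
    Realizes A l l' g := by
  obtain ⟨p, hp⟩ := h
  exact ⟨p, hg.trans hp⟩

theorem comp {f : X ⟶ Y} {g : Y ⟶ Z} (h : Realizes A l l' f) (h' : Realizes A l' l'' g) :
    Realizes A l l'' (f ≫ g) := by
  obtain ⟨p, hp⟩ := h
  obtain ⟨q, hq⟩ := h'
  exact ⟨.trans p q, hp.comp hq⟩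

theorem of_isId {f : X ⟶ Y} (hf : IsId f) (hX : X = lsum A l) (hl : l = l') :
    Realizes A l l' f := by
  subst hl hX
  exact ⟨.refl _, hf.same⟩

theorem eqToHom (h : X = Y) (hX : X = lsum A l) (hl : l = l') :
    Realizes A l l' (eqToHom h) :=
  of_isId ⟨h, rfl⟩ hX hl

theorem id (hX : X = lsum A l) : Realizes A l l (𝟙 X) :=
  of_isId ⟨rfl, rfl⟩ hX rfl

theorem addMap {f : X ⟶ Y} {g : X' ⟶ Y'} (h : Realizes A l l' f) (h' : Realizes A m m' g) :
    Realizes A (l ++ m) (l' ++ m') (C.addMap f g) := by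
  obtain ⟨p, hp⟩ := h
  obtain ⟨q, hq⟩ := h'
  refine ⟨.trans (p.append m) (q.prepend l'), (same_addMap hp hq).trans ?_⟩
  refine Same.trans (.of_eq ?_) ((same_real_append A p m).symm.comp (same_real_prepend A l' q).symm)
  rw [← C.addMap_comp, Category.comp_id, Category.id_comp]

end Realizes

theorem zero_γ (a : C.Obj) : IsId (C.γ C.zero a) := by
  have h := C.γ_γ a C.zero
  rw [C.γ_zero] at h
  refine ⟨(C.zero_add a).trans (C.add_zero a).symm, ?_⟩
  have := congrArg (fun t => CategoryTheory.eqToHom ((C.zero_add a).trans (C.add_zero a).symm) ≫ t) h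
  simpa using this

/-- The hexagon for moving `a` past `b ⊕ c`, from the one for `γ_{b ⊕ c, a}` by inverting both
sides. -/
theorem same_add_γ (a b c : C.Obj) : Same (C.γ a (C.add b c))
    (C.swap a b c ≫ C.addMap (𝟙 b) (C.γ a c)) := by
  have h : ∀ {X Y Z : C.Obj} {f : X ⟶ Y} {g k : Y ⟶ X}, f ≫ g = 𝟙 X → k ≫ f = 𝟙 Y → g = k := by
    intro X Y Z f g k h h'
    rw [← Category.id_comp g, ← h', Category.assoc, h, Category.comp_id]
  have e : C.γ a (C.add b c) = CategoryTheory.eqToHom (C.add_assoc a b c).symm ≫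
      C.addMap (C.γ a b) (𝟙 c) ≫ CategoryTheory.eqToHom (C.add_assoc b a c) ≫
      C.addMap (𝟙 b) (C.γ a c) ≫ CategoryTheory.eqToHom (C.add_assoc b c a).symm := by
    refine h (Z := a) (C.γ_γ (C.add b c) a) ?_
    rw [C.γ_add]
    simp only [Category.assoc, eqToHom_trans_assoc, eqToHom_refl, Category.id_comp]
    rw [← Category.assoc (C.addMap (𝟙 b) (C.γ a c)), ← C.addMap_comp, C.γ_γ, Category.comp_id,
      C.addMap_id, Category.id_comp]
    simp only [eqToHom_trans_assoc, eqToHom_refl, Category.id_comp]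
    rw [← Category.assoc (C.addMap (C.γ a b) (𝟙 c)), ← C.addMap_comp, C.γ_γ, Category.comp_id,
      C.addMap_id, Category.id_comp]
    simp
  rw [e, swap]
  simp only [← Category.assoc]
  exact .comp_eqToHom _ _

theorem same_γ {a b a' b' : C.Obj} (h : a = a') (h' : b = b') : Same (C.γ a b) (C.γ a' b') := by
  subst h h'
  exact .refl _

namespace Realizes

variable {A : I → C.Obj} {l l' l'' m m' : List I} {X Y Z X' Y' : C.Obj}

theorem γ_cons (A : I → C.Obj) (x : I) (m : List I) :
    Realizes A ([x] ++ m) (m ++ [x]) (C.γ (A x) (lsum A m)) := by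
  induction m with
  | nil => exact of_isId ⟨_, C.γ_zero _⟩ rfl rfl
  | cons y m ih =>
    refine same ?_ (C.same_add_γ _ _ _)
    exact comp ⟨.swap x y m, .refl _⟩ (addMap (l := [y]) (l' := [y]) (id (C.add_zero _).symm) ih)

theorem γ_lsum (A : I → C.Obj) (l m : List I) :
    Realizes A (l ++ m) (m ++ l) (C.γ (lsum A l) (lsum A m)) := by
  induction l with
  | nil => exact of_isId (zero_γ _) (C.zero_add _) (by simp)
  | cons x l ih =>
    refine same ?_ (.of_eq (C.γ_add _ _ _))
    refine comp (l' := [x] ++ (l ++ m)) (eqToHom _ ?_ (by simp)) ?_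
    · rw [lsum_append]
    refine comp (addMap (id (C.add_zero _).symm) ih) ?_
    refine comp (l' := ([x] ++ m) ++ l) (eqToHom _ ?_ (by simp)) ?_
    · rw [lsum_append, lsum_append]
      exact congrArg (fun t => C.add t _) (C.add_zero _).symm
    refine comp (addMap (γ_cons A x m) (id rfl)) ?_
    refine eqToHom _ ?_ (by simp)
    rw [lsum_append, lsum_append]
    exact congrArg (fun t => C.add (C.add _ t) _) (C.add_zero _).symm

theorem γ (hX : X = lsum A l) (hY : Y = lsum A m) : Realizes A (l ++ m) (m ++ l) (C.γ X Y) :=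
  (γ_lsum A l m).same (same_γ hX hY)

theorem sumMap {n : ℕ} {a b : Fin n → C.Obj} {f : ∀ i, a i ⟶ b i} {L L' : Fin n → List I}
    (h : ∀ i, Realizes A (L i) (L' i) (f i)) :
    Realizes A (List.ofFn L).flatten (List.ofFn L').flatten (C.sumMap f) := by
  induction n with
  | zero => exact of_isId ⟨rfl, rfl⟩ (by simp; rfl) (by simp)
  | succ n ih =>
    rw [flatten_ofFn_succ, flatten_ofFn_succ]
    exact addMap (h 0) (ih fun i => h i.succ)

theorem insert {n : ℕ} (p : Fin (n + 1)) {a : Fin (n + 1) → C.Obj} {L : Fin (n + 1) → List I}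
    (h : ∀ i, a i = lsum A (L i)) :
    Realizes A (L p ++ (List.ofFn fun i => L (p.succAbove i)).flatten) (List.ofFn L).flatten
      (C.insert p a) := by
  have hs : ∀ {m : ℕ} (q : Fin m → Fin (n + 1)),
      (C.sum fun i => a (q i)) = lsum A (List.ofFn fun i => L (q i)).flatten := fun q => by
    rw [lsum_flatten_ofFn]
    exact congrArg C.sum (funext fun i => h _)
  induction n with
  | zero =>
    obtain rfl : p = 0 := Fin.fin_one_eq_zero p
    refine eqToHom _ ?_ (by simp)
    rw [lsum_append, ← hs, h]
  | succ n ih =>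
    refine Fin.cases ?_ (fun q => ?_) p
    · refine eqToHom (C.sum_succAbove_zero a) ?_ ?_
      · rw [lsum_append, ← hs, h]
      · rw [flatten_ofFn_succ L]
        simp only [Fin.zero_succAbove]
    · have e₁ := C.sum_succAbove_succ a q
      have hr : (List.ofFn fun i => L (q.succ.succAbove i)).flatten =
          L 0 ++ (List.ofFn fun i => L (q.succAbove i).succ).flatten := by
        rw [flatten_ofFn_succ]
        simp only [Fin.succ_succAbove_zero, Fin.succ_succAbove_succ]
      rw [hr]
      refine comp (l' := (L q.succ ++ L 0) ++ (List.ofFn fun i => L (q.succAbove i).succ).flatten)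
        (eqToHom _ ?_ (by simp)) ?_
      · rw [lsum_append, lsum_append, ← h, ← h, ← hs (fun i => (q.succAbove i).succ)]
        exact e₁.trans (C.add_assoc ..)
      refine comp (addMap (γ (h _) (h _)) (id (hs (fun i => (q.succAbove i).succ)))) ?_
      refine comp (l' := L 0 ++ (L q.succ ++ (List.ofFn fun i => L (q.succAbove i).succ).flatten))
        (eqToHom _ ?_ (by simp)) ?_
      · rw [lsum_append, lsum_append, ← h, ← h, ← hs (fun i => (q.succAbove i).succ)]
      · rw [flatten_ofFn_succ]
        exact addMap (id (h 0)) (ih q (fun i => h i.succ) fun r => hs fun i => (r i).succ)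

/-- The permutation of summands that are themselves iterated sums. -/
theorem perm {m n : ℕ} (e : Fin m ≃ Fin n) {a : Fin n → C.Obj} {L : Fin n → List I}
    (h : ∀ i, a i = lsum A (L i)) :
    Realizes A (List.ofFn fun i => L (e i)).flatten (List.ofFn L).flatten (C.perm e a) := by
  induction m generalizing n with
  | zero =>
    cases n with
    | zero => exact of_isId ⟨rfl, rfl⟩ (by simp; rfl) (by simp)
    | succ n => exact (e.symm 0).elim0
  | succ m ih =>
    cases n with
    | zero => exact (e 0).elim0
    | succ n =>
      have hs : (List.ofFn fun i => L (e i)).flatten = L (e 0) ++ (List.ofFn fun i =>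
          L ((e 0).succAbove (tailEquiv e i))).flatten := by
        rw [flatten_ofFn_succ]
        simp only [succAbove_tailEquiv]
      refine comp (l' := L (e 0) ++ (List.ofFn fun i =>
        L ((e 0).succAbove (tailEquiv e i))).flatten) (eqToHom _ ?_ hs) ?_
      · rw [lsum_flatten_ofFn]
        exact congrArg C.sum (funext fun i => h _)
      exact comp (addMap (id (h _)) (ih (tailEquiv e) fun i => h _)) (insert (e 0) h)

theorem perm_ofFn {m n : ℕ} (e : Fin m ≃ Fin n) {a : Fin n → C.Obj} {s : Fin n → I}
    (h : ∀ i, a i = A (s i)) :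
    Realizes A (List.ofFn fun i => s (e i)) (List.ofFn s) (C.perm e a) := by
  have := perm (A := A) e (a := a) (L := fun i => [s i])
    fun i => (h i).trans (C.add_zero _).symm
  simpa only [flatten_ofFn_singleton] using this

theorem perm_self {m n : ℕ} (e : Fin m ≃ Fin n) (a : Fin n → C.Obj) :
    Realizes a (List.ofFn e) (List.ofFn fun i => i) (C.perm e a) :=
  perm_ofFn e fun _ => rfl

end Realizes
end PermCat

/-! ### The underlying based multicategory satisfies the axioms -/

namespace PermCat

variable (C : PermCat.{v, u})

theorem sumMap_id {n : ℕ} (a : Fin n → C.Obj) : C.sumMap (fun i => 𝟙 (a i)) = 𝟙 (C.sum a) := by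
  induction n with
  | zero => rfl
  | succ n ih => exact (congrArg (C.addMap _) (ih _)).trans (C.addMap_id _ _)

theorem sumMap_comp {n : ℕ} {a b c : Fin n → C.Obj} (f : ∀ i, a i ⟶ b i) (g : ∀ i, b i ⟶ c i) :
    C.sumMap (fun i => f i ≫ g i) = C.sumMap f ≫ C.sumMap g := by
  induction n with
  | zero => exact (Category.comp_id _).symm
  | succ n ih => exact (congrArg (C.addMap _) (ih _ _)).trans (C.addMap_comp _ _ _ _)

variable {C}

theorem same_sumMap {n : ℕ} {a b a' b' : Fin n → C.Obj} {f : ∀ i, a i ⟶ b i}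
    {f' : ∀ i, a' i ⟶ b' i} (h : ∀ i, Same (f i) (f' i)) : Same (C.sumMap f) (C.sumMap f') := by
  induction n with
  | zero => exact .refl _
  | succ n ih => exact same_addMap (h 0) (ih fun i => h i.succ)

theorem isId_sumMap {n : ℕ} {a b : Fin n → C.Obj} {f : ∀ i, a i ⟶ b i} (h : ∀ i, IsId (f i)) :
    IsId (C.sumMap f) :=
  (same_sumMap fun i => (h i).same).isId ⟨rfl, C.sumMap_id a⟩

theorem _root_.PermMult.Same.sigma {A : Type u} [Category.{v} A] {a b a' b' : A} {f : a ⟶ b} {g : a' ⟶ b'}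
    (h : Same f g) : (⟨a, b, f⟩ : (a : A) × (b : A) × (a ⟶ b)) = ⟨a', b', g⟩ := by
  obtain ⟨rfl, rfl, rfl⟩ := h
  simp

theorem _root_.PermMult.Same.of_sigma {A : Type u} [Category.{v} A] {f g : (a : A) × (b : A) × (a ⟶ b)}
    (h : f = g) : Same f.2.2 g.2.2 := by
  subst h
  exact .refl _

variable (C) in
/-- The morphisms of a permutative category with the operation `⊕`, as a permutative category. -/
def arrowCat : PermCat.{0, max u v} :=
  indiscrete (X := (a : C.Obj) × (b : C.Obj) × (a ⟶ b))
    (fun f g => ⟨C.add f.1 g.1, C.add f.2.1 g.2.1, C.addMap f.2.2 g.2.2⟩)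
    ⟨C.zero, C.zero, 𝟙 C.zero⟩ (fun _ _ _ => (same_assoc _ _ _).sigma)
    (fun _ => (same_addMap_zero _).sigma) (fun _ => (same_zero_addMap _).sigma)

theorem arrowCat_sum {n : ℕ} {a b : Fin n → C.Obj} (f : ∀ i, a i ⟶ b i) :
    (C.arrowCat).sum (fun i => ⟨a i, b i, f i⟩) = ⟨C.sum a, C.sum b, C.sumMap f⟩ := by
  induction n with
  | zero => rfl
  | succ n ih => exact congrArg (C.arrowCat.add ⟨a 0, b 0, f 0⟩) (ih fun i => f i.succ)

/-- Iterated sums of morphisms are associative, because iterated sums of objects are: apply the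
latter in the permutative category of arrows. -/
theorem same_sumMap_flat {n : ℕ} {k : Fin n → ℕ} {a b : ∀ i, Fin (k i) → C.Obj}
    (f : ∀ i j, a i j ⟶ b i j) :
    Same (C.sumMap (a := flat a) (b := flat b) (flat f))
      (C.sumMap fun i => C.sumMap (f i)) := by
  have h := C.arrowCat.sum_flat fun i j =>
    (⟨a i j, b i j, f i j⟩ : (a : C.Obj) × (b : C.Obj) × (a ⟶ b))
  refine Same.of_sigma (((arrowCat_sum (a := flat a) (b := flat b) (flat f)).symm.trans
    (h.trans ?_)).trans (arrowCat_sum fun i => C.sumMap (f i)))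
  exact congrArg C.arrowCat.sum (funext fun i => arrowCat_sum _)

theorem isId_insert_zero {n : ℕ} (a : Fin (n + 1) → C.Obj) : IsId (C.insert 0 a) := by
  cases n with
  | zero => exact ⟨rfl, rfl⟩
  | succ n => exact ⟨C.sum_succAbove_zero a, rfl⟩

theorem same_insert_succ {n : ℕ} (q : Fin (n + 1)) (a : Fin (n + 2) → C.Obj) :
    Same (C.insert q.succ a) (C.swap (a q.succ) (a 0) (C.sum fun i => a (q.succAbove i).succ) ≫
      C.addMap (𝟙 (a 0)) (C.insert q fun i => a i.succ)) := by
  refine Same.trans (b' := C.sum a) (Same.eqToHom_comp (C.sum_succAbove_succ a q)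
    (C.addMap (C.γ (a q.succ) (a 0)) (𝟙 (C.sum fun i => a (q.succAbove i).succ)) ≫
      eqToHom (C.add_assoc (a 0) (a q.succ) (C.sum fun i => a (q.succAbove i).succ)) ≫
      C.addMap (𝟙 (a 0)) (C.insert q fun i => a i.succ))) (Same.symm ?_)
  rw [swap, Category.assoc, Category.assoc]
  exact Same.eqToHom_comp _ _

theorem same_of_index_eq {ι : Type w} {a b : ι → C.Obj} (f : ∀ i, a i ⟶ b i) {i j : ι}
    (h : i = j) : Same (f i) (f j) := by
  subst h
  exact .refl _

theorem insert_naturality_zero {n : ℕ} {a b : Fin (n + 1) → C.Obj} (f : ∀ i, a i ⟶ b i) :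
    C.addMap (f 0) (C.sumMap fun i => f ((0 : Fin (n + 1)).succAbove i)) ≫ C.insert 0 b =
      C.insert 0 a ≫ C.sumMap f := by
  refine Same.eq ((Same.comp_id ?_ (isId_insert_zero b).same).trans
    (Same.id_comp (.refl _) (isId_insert_zero a).same').symm)
  exact same_addMap (.refl _) (same_sumMap fun i => same_of_index_eq f (by rw [Fin.zero_succAbove]))

theorem insert_naturality {n : ℕ} (p : Fin (n + 1)) {a b : Fin (n + 1) → C.Obj}
    (f : ∀ i, a i ⟶ b i) :
    C.addMap (f p) (C.sumMap fun i => f (p.succAbove i)) ≫ C.insert p b =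
      C.insert p a ≫ C.sumMap f := by
  induction n with
  | zero =>
    obtain rfl : p = 0 := Fin.fin_one_eq_zero p
    exact insert_naturality_zero f
  | succ n ih =>
    refine Fin.cases (insert_naturality_zero f) (fun q => ?_) p
    have h := ih q (fun i => f i.succ)
    have e₁ : Same (C.addMap (f q.succ) (C.sumMap fun i => f (q.succ.succAbove i)))
        (C.addMap (f q.succ) (C.addMap (f 0) (C.sumMap fun i => f (q.succAbove i).succ))) :=
      same_addMap (.refl _) (same_addMap (same_of_index_eq f (by simp))
        (same_sumMap fun i => same_of_index_eq f (by simp)))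
    refine Same.eq ((e₁.comp (same_insert_succ q b)).trans (Same.trans (.of_eq ?_)
      ((same_insert_succ q a).comp (.refl (C.sumMap f))).symm))
    rw [reassoc_of% swap_naturality]
    refine Eq.trans ?_ (Category.assoc _ _ (C.addMap (f 0) (C.sumMap fun i => f i.succ))).symm
    refine congrArg _ ((C.addMap_comp _ _ _ _).symm.trans (Eq.trans ?_ (C.addMap_comp _ _ _ _)))
    rw [h, Category.comp_id, Category.id_comp]

theorem same_perm_succ {m n : ℕ} (e : Fin (m + 1) ≃ Fin (n + 1)) (a : Fin (n + 1) → C.Obj) :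
    Same (C.perm e a)
      (C.addMap (𝟙 (a (e 0))) (C.perm (tailEquiv e) fun i => a ((e 0).succAbove i)) ≫
        C.insert (e 0) a) :=
  Same.eqToHom_comp _ _

/-- The morphisms given by permutations of the summands are natural. Coherence does not give this,
as the morphisms `f i` are arbitrary. -/
theorem perm_naturality {m n : ℕ} (e : Fin m ≃ Fin n) {a b : Fin n → C.Obj} (f : ∀ i, a i ⟶ b i) :
    C.sumMap (fun i => f (e i)) ≫ C.perm e b = C.perm e a ≫ C.sumMap f := by
  induction m generalizing n with
  | zero =>
    cases n with
    | zero => rfl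
    | succ n => exact (e.symm 0).elim0
  | succ m ih =>
    cases n with
    | zero => exact (e 0).elim0
    | succ n =>
      have h := ih (tailEquiv e) fun i => f ((e 0).succAbove i)
      have e₁ : Same (C.sumMap fun i => f (e i))
          (C.addMap (f (e 0)) (C.sumMap fun i => f ((e 0).succAbove (tailEquiv e i)))) :=
        same_addMap (.refl _)
          (same_sumMap fun i => same_of_index_eq f (succAbove_tailEquiv e i).symm)
      refine Same.eq ((e₁.comp (same_perm_succ e b)).trans (Same.trans (.of_eq ?_)
        ((same_perm_succ e a).comp (.refl (C.sumMap f))).symm))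
      rw [Category.assoc, ← insert_naturality, ← reassoc_of% C.addMap_comp,
        ← reassoc_of% C.addMap_comp, h, Category.comp_id, Category.id_comp]

/-- A permutation that leaves a list of distinct labels unchanged acts as an identity. -/
theorem isId_perm_of_ofFn_eq {I : Type w} {m n : ℕ} (e : Fin m ≃ Fin n) (a : Fin n → C.Obj)
    (s : Fin n → I) (hs : s.Injective) (h : (List.ofFn fun i => s (e i)) = List.ofFn s) :
    IsId (C.perm e a) := by
  have h₀ : List.ofFn e = List.ofFn fun i : Fin n => i := by
    refine List.map_injective_iff.2 hs ?_
    rwa [List.map_ofFn, List.map_ofFn]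
  have h₂ : Realizes a (List.ofFn e) (List.ofFn fun i => i) (𝟙 (C.sum a)) :=
    Realizes.of_isId ⟨rfl, rfl⟩ (by rw [h₀, lsum_ofFn]) h₀
  exact ((Realizes.perm_self e a).unique h₂ (List.nodup_ofFn.2 e.injective)).isId ⟨rfl, rfl⟩

theorem ofFn_flat_assoc {I : Type w} {n : ℕ} {k : Fin n → ℕ} {l : ∀ i, Fin (k i) → ℕ}
    (t : ∀ i j, Fin (l i j) → I) :
    List.ofFn (flat fun x : Fin (∑ i, k i) => t (blk x) (pos x)) =
      List.ofFn (flat fun i => flat (t i)) := by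
  rw [ofFn_flat, ofFn_flat]
  refine (flatten_ofFn_flat fun i j => List.ofFn (t i j)).trans ?_
  exact congrArg (fun L => (List.ofFn L).flatten) (funext fun i => (ofFn_flat (t i)).symm)

theorem flat_pair_injective {n : ℕ} (k : Fin n → ℕ) :
    (flat fun i (j : Fin (k i)) => (⟨i, j⟩ : (i : Fin n) × Fin (k i))).Injective :=
  finSigmaFinEquiv.symm.injective

theorem flat_triple_injective {n : ℕ} {k : Fin n → ℕ} (l : ∀ i, Fin (k i) → ℕ) :
    (flat fun i => flat fun j (r : Fin (l i j)) =>
      (⟨i, j, r⟩ : (i : Fin n) × (j : Fin (k i)) × Fin (l i j))).Injective :=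
  (finSigmaFinEquiv.symm.trans
    (Equiv.sigmaCongrRight fun i => (finSigmaFinEquiv (n := l i)).symm)).injective

theorem isId_perm_refl {n : ℕ} (a : Fin n → C.Obj) : IsId (C.perm (Equiv.refl _) a) :=
  isId_perm_of_ofFn_eq _ a id Function.injective_id rfl

theorem isId_perm_unitR {n : ℕ} (a : Fin n → C.Obj) : IsId (C.perm (unitR n) a) := by
  refine isId_perm_of_ofFn_eq _ a (fun i => i) Function.injective_id ?_
  refine (ofFn_flat fun i (_ : Fin 1) => i).trans ?_
  simpa using (flatten_ofFn_singleton fun i : Fin n => i)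

theorem isId_perm_unitL {k : ℕ} (a : Fin k → C.Obj) : IsId (C.perm (unitL k) a) := by
  refine isId_perm_of_ofFn_eq _ a id Function.injective_id ?_
  refine (ofFn_flat fun (_ : Fin 1) (j : Fin k) => j).trans ?_
  simp
  rfl

theorem isId_perm_assocEquiv {n : ℕ} {k : Fin n → ℕ} (l : ∀ i, Fin (k i) → ℕ)
    (a : Fin (∑ i, ∑ j, l i j) → C.Obj) : IsId (C.perm (assocEquiv l) a) := by
  refine isId_perm_of_ofFn_eq _ a _ (flat_triple_injective l) ?_
  rw [← ofFn_flat_assoc]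
  exact congrArg List.ofFn (funext fun z => (flat_assocEquiv _ z).symm)

theorem perm_trans {l m n : ℕ} (e : Fin l ≃ Fin m) (e' : Fin m ≃ Fin n) (a : Fin n → C.Obj) :
    C.perm (e.trans e') a = (C.perm e fun i => a (e' i)) ≫ C.perm e' a :=
  Same.eq (Realizes.unique (A := a) (l := List.ofFn fun i => e' (e i))
    (l' := List.ofFn fun i => i) (Realizes.perm_self (e.trans e') a)
    ((Realizes.perm_ofFn e (s := e') fun _ => rfl).comp (Realizes.perm_self e' a))
    (List.nodup_ofFn.2 (e.trans e').injective))

/-- Permuting sums of blocks is the block permutation. -/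
theorem same_perm_outerEquiv {m n : ℕ} (e : Fin m ≃ Fin n) {k : Fin n → ℕ}
    (a : ∀ i, Fin (k i) → C.Obj) :
    Same (C.perm e fun i => C.sum (a i)) (C.perm (outerEquiv e k) (flat a)) := by
  let A : ((j : Fin n) × Fin (k j)) → C.Obj := fun p => a p.1 p.2
  have h₁ := Realizes.perm_ofFn (A := A) (outerEquiv e k) (a := flat a)
    (s := flat fun i (j : Fin (k i)) => (⟨i, j⟩ : (i : Fin n) × Fin (k i))) fun i => rfl
  have h₂ := Realizes.perm (A := A) e (a := fun i => C.sum (a i))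
    (L := fun i => List.ofFn fun j => ⟨i, j⟩) fun i =>
      (lsum_ofFn A fun j : Fin (k i) => (⟨i, j⟩ : (i : Fin n) × Fin (k i))).symm
  have h₃ := funext fun z =>
    flat_outerEquiv e (fun i j => (⟨i, j⟩ : (j : Fin n) × Fin (k j))) z
  rw [← ofFn_flat (fun i j => (⟨i, j⟩ : (j : Fin n) × Fin (k j))),
    ← ofFn_flat fun i j => (⟨e i, j⟩ : (j : Fin n) × Fin (k j))] at h₂
  rw [← h₃] at h₁
  exact h₂.unique h₁ (h₃ ▸ List.nodup_ofFn.2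
    ((flat_pair_injective k).comp (outerEquiv e k).injective))

/-- The sum of permutations of blocks is the block sum of the permutations. -/
theorem same_perm_innerEquiv {n : ℕ} {k l : Fin n → ℕ} (e : ∀ i, Fin (k i) ≃ Fin (l i))
    (a : ∀ i, Fin (l i) → C.Obj) :
    Same (C.sumMap fun i => C.perm (e i) (a i)) (C.perm (innerEquiv e) (flat a)) := by
  let A : ((j : Fin n) × Fin (l j)) → C.Obj := fun p => a p.1 p.2
  have h₁ := Realizes.perm_ofFn (A := A) (innerEquiv e) (a := flat a)
    (s := flat fun i (j : Fin (l i)) => (⟨i, j⟩ : (i : Fin n) × Fin (l i))) fun i => rfl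
  have h₂ := Realizes.sumMap (A := A) fun i => Realizes.perm_ofFn (A := A) (e i) (a := a i)
    (s := fun j => ⟨i, j⟩) fun _ => rfl
  have h₃ := funext fun z => flat_innerEquiv e
    (a := fun i j => (⟨i, j⟩ : (j : Fin n) × Fin (l j)))
    (a' := fun i j => (⟨i, e i j⟩ : (j : Fin n) × Fin (l j))) (fun _ _ => rfl) z
  rw [← ofFn_flat (fun i j => (⟨i, j⟩ : (j : Fin n) × Fin (l j))),
    ← ofFn_flat fun i j => (⟨i, e i j⟩ : (j : Fin n) × Fin (l j))] at h₂
  rw [← h₃] at h₁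
  exact h₂.unique h₁ (h₃ ▸ List.nodup_ofFn.2
    ((flat_pair_injective l).comp (innerEquiv e).injective))

/-- The permutations of a sum of zero objects are identities. As the summands are equal, this is not
a case of coherence; it holds because `γ` is an identity at the zero object. -/
theorem isId_perm_zero {m n : ℕ} (e : Fin m ≃ Fin n) : IsId (C.perm e fun _ => C.zero) := by
  have hi : ∀ {n : ℕ} (p : Fin (n + 1)), IsId (C.insert p fun _ => C.zero) := by
    intro n
    induction n with
    | zero =>
      intro p
      obtain rfl : p = 0 := Fin.fin_one_eq_zero p
      exact isId_insert_zero _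
    | succ n ih =>
      refine Fin.cases (isId_insert_zero _) fun q => (same_insert_succ q _).isId ?_
      exact ((C.same_swap _ _ _).isId (isId_addMap ⟨_, C.γ_zero _⟩ ⟨rfl, rfl⟩)).comp
        (isId_addMap ⟨rfl, rfl⟩ (ih q))
  induction m generalizing n with
  | zero =>
    cases n with
    | zero => exact ⟨rfl, rfl⟩
    | succ n => exact (e.symm 0).elim0
  | succ m ih =>
    cases n with
    | zero => exact (e 0).elim0
    | succ n =>
      exact (same_perm_succ e _).isId ((isId_addMap ⟨rfl, rfl⟩ (ih _)).comp (hi _))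

theorem same_reindex {m n : ℕ} (e : Fin m ≃ Fin n) {a : Fin n → C.Obj} {a' : Fin m → C.Obj}
    {b : C.Obj} (h : ∀ i, a' i = a (e i)) (f : C.sum a ⟶ b) :
    Same (A := C.Obj) (C.underlyingData.reindex e h f) (C.perm e a ≫ f) :=
  Same.eqToHom_comp _ _

theorem same_comp {n : ℕ} {b : Fin n → C.Obj} {c : C.Obj} {k : Fin n → ℕ}
    {a : ∀ i, Fin (k i) → C.Obj} (g : C.sum b ⟶ c) (f : ∀ i, C.sum (a i) ⟶ b i) :
    Same (A := C.Obj) (C.underlyingData.comp (b := b) g f) (C.sumMap f ≫ g) :=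
  Same.eqToHom_comp _ _

theorem same_sumMap_sumMap_flat {n : ℕ} {c : Fin n → C.Obj} {d : C.Obj} {k : Fin n → ℕ}
    {b : ∀ i, Fin (k i) → C.Obj} {l : ∀ i, Fin (k i) → ℕ} {a : ∀ i j, Fin (l i j) → C.Obj}
    (h : C.sum c ⟶ d) (g : ∀ i, C.sum (b i) ⟶ c i) (f : ∀ i j, C.sum (a i j) ⟶ b i j) :
    Same (C.sumMap (a := fun x : Fin (∑ i, k i) => C.sum (a (blk x) (pos x))) (b := flat b)
      (fun x => f (blk x) (pos x)) ≫ C.underlyingData.comp (b := c) h g)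
      ((C.sumMap fun i => C.underlyingData.comp (b := b i) (g i) (f i)) ≫ h) := by
  refine ((same_sumMap_flat f).comp (same_comp h g)).trans ?_
  rw [← Category.assoc]
  refine Same.comp (Same.trans (.of_eq (sumMap_comp ..).symm) ?_) (.refl h)
  exact same_sumMap fun i => (same_comp (g i) (f i)).symm

theorem same_sumMap_perm {m n : ℕ} (e : Fin m ≃ Fin n) {b : Fin n → C.Obj} {c : C.Obj}
    {k : Fin n → ℕ} {a : ∀ j, Fin (k j) → C.Obj} (g : C.sum b ⟶ c)
    (f : ∀ j, C.sum (a j) ⟶ b j) :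
    Same ((C.sumMap fun i => f (e i)) ≫ C.perm e b ≫ g)
      (C.perm (outerEquiv e k) (flat a) ≫ C.underlyingData.comp (b := b) g f) := by
  rw [← Category.assoc, perm_naturality, Category.assoc]
  exact (same_perm_outerEquiv e a).comp (same_comp g f).symm

theorem same_perm_sumMap {n : ℕ} {b : Fin n → C.Obj} {c : C.Obj} {k l : Fin n → ℕ}
    (e : ∀ i, Fin (k i) ≃ Fin (l i)) {a : ∀ i, Fin (l i) → C.Obj} (g : C.sum b ⟶ c)
    (f : ∀ i, C.sum (a i) ⟶ b i) :
    Same ((C.sumMap fun i => C.perm (e i) (a i) ≫ f i) ≫ g)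
      (C.perm (innerEquiv e) (flat a) ≫ C.underlyingData.comp (b := b) g f) := by
  rw [sumMap_comp, Category.assoc]
  exact (same_perm_innerEquiv e a).comp (same_comp g f).symm

theorem isId_id (a : C.Obj) : IsId (A := C.Obj) (C.underlyingData.id a) :=
  ⟨C.sum_one fun _ => a, rfl⟩

theorem isId_ptHom (n : ℕ) : IsId (A := C.Obj) (C.underlyingData.ptHom n) :=
  ⟨C.sum_zero n, rfl⟩

variable (C)

theorem isBased_underlyingData : C.underlyingData.IsBased where
  reindex_refl {n a b} f :=
    Same.eq (((same_reindex _ _ f).trans (Same.id_comp (.refl _) (isId_perm_refl a).same')))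
  reindex_trans {l m n} e e' {a a' a'' b} h h' f := by
    obtain rfl : a' = fun i => a (e' i) := funext h'
    refine Same.eq (((same_reindex _ _ _).trans ((Same.refl _).comp (same_reindex _ _ _))).trans
      (Same.trans (.of_eq ?_) (same_reindex (e.trans e') _ f).symm))
    exact (Category.assoc _ _ _).symm.trans (congrArg (fun t => t ≫ f) (perm_trans e e' a).symm)
  comp_id {n b c} g :=
    Same.eq (((same_comp _ _).trans (Same.id_comp (.refl _)
      (isId_sumMap fun i => isId_id (b i)).same')).trans (Same.trans
        (Same.id_comp (.refl _) (isId_perm_unitR b).same').symm (same_reindex _ _ g).symm))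
  id_comp {k a b} f :=
    Same.eq (((same_comp (b := fun _ => b) _ _).trans (Same.comp_id
      (f := C.sumMap fun _ : Fin 1 => f) (same_addMap_zero f) (isId_id b).same)).trans (Same.trans
        (Same.id_comp (.refl _) (isId_perm_unitL a).same').symm (same_reindex _ _ f).symm))
  assoc {n c d k b l a} h g f :=
    Same.eq (((same_comp _ _).trans (same_sumMap_sumMap_flat h g f)).trans
      (Same.trans (Same.id_comp (same_comp _ _) (isId_perm_assocEquiv l _).same').symm
        (same_reindex _ _ _).symm))
  comp_reindex_outer {m n} e {b c k a} g f :=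
    Same.eq (((same_comp _ _).trans ((Same.refl (C.sumMap fun i => f (e i))).comp
      (same_reindex e _ g))).trans ((same_sumMap_perm e g f).trans (same_reindex _ _ _).symm))
  comp_reindex_inner {n b c k l} e {a a'} h g f :=
    Same.eq (((same_comp _ _).trans ((same_sumMap fun i => same_reindex (e i) (h i) (f i)).comp
      (.refl g))).trans ((same_perm_sumMap e g f).trans (same_reindex _ _ _).symm))
  reindex_ptHom {m n} e :=
    Same.eq ((same_reindex _ _ _).trans (Same.of_isId ((isId_perm_zero e).comp (isId_ptHom n))
      (isId_ptHom m) rfl))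
  ptHom_one := rfl
  comp_ptHom {n} k :=
    Same.eq ((same_comp _ _).trans (Same.of_isId ((isId_sumMap fun i => isId_ptHom (k i)).comp
      (isId_ptHom n)) (isId_ptHom _) (C.sum_flat (k := k) fun _ _ => C.zero).symm))

end PermCat

/-! ### Tuples of objects and morphisms -/

section Tuples

variable {ι : Type w} {X : ι → Type u} [∀ i, Category.{v} (X i)]

theorem pi_hom_ext {x y : ∀ i, X i} {f g : x ⟶ y} (h : ∀ i, Same (f i) (g i)) : f = g :=
  funext fun i => (h i).eq

theorem same_map_of_same {D : Type u'} [Category.{v'} D] (F : (∀ i, X i) ⥤ D) {x y x' y' : ∀ i, X i}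
    {f : x ⟶ y} {g : x' ⟶ y'} (h : ∀ i, Same (f i) (g i)) : Same (F.map f) (F.map g) := by
  obtain rfl : x = x' := funext fun i => (h i).1
  obtain rfl : y = y' := funext fun i => (h i).2.1
  rw [pi_hom_ext h]
  exact .refl _

variable [DecidableEq ι]

/-- The morphism of tuples that is a given one in the place `j` and an identity in the other
places. -/
def upd (t : ∀ i, X i) (j : ι) {c d : X j} (g : c ⟶ d) :
    Function.update t j c ⟶ Function.update t j d := fun i =>
  if h : i = j then
    eqToHom (by subst h; simp) ≫ (h ▸ g : (h ▸ c : X i) ⟶ h ▸ d) ≫ eqToHom (by subst h; simp)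
  else eqToHom (by rw [Function.update_of_ne h, Function.update_of_ne h])

theorem same_upd_self (t : ∀ i, X i) (j : ι) {c d : X j} (g : c ⟶ d) : Same (upd t j g j) g := by
  rw [upd, dif_pos rfl]
  exact ⟨Function.update_self .., Function.update_self .., rfl⟩

theorem isId_upd_of_ne (t : ∀ i, X i) {i j : ι} (h : i ≠ j) {c d : X j} (g : c ⟶ d) :
    IsId (upd t j g i) := by
  rw [upd, dif_neg h]
  exact .eqToHom _

theorem same_upd_of_ne (t : ∀ i, X i) {i j : ι} (h : i ≠ j) {c d : X j} (g : c ⟶ d) :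
    Same (upd t j g i) (𝟙 (t i)) :=
  (isId_upd_of_ne t h g).same.trans (.id (Function.update_of_ne h ..))

theorem upd_id (t : ∀ i, X i) (j : ι) (c : X j) : upd t j (𝟙 c) = 𝟙 _ := by
  refine pi_hom_ext fun i => ?_
  by_cases h : i = j
  · subst h
    exact (same_upd_self t i _).trans (.id (Function.update_self ..).symm)
  · exact (isId_upd_of_ne t h _).same

theorem upd_comp (t : ∀ i, X i) (j : ι) {c d e : X j} (f : c ⟶ d) (g : d ⟶ e) :
    upd t j (f ≫ g) = upd t j f ≫ upd t j g := by
  refine pi_hom_ext fun i => ?_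
  by_cases h : i = j
  · subst h
    exact (same_upd_self t i _).trans ((same_upd_self t i f).comp (same_upd_self t i g)).symm
  · exact .of_isId (isId_upd_of_ne t h _) ((isId_upd_of_ne t h f).comp (isId_upd_of_ne t h g)) rfl

end Tuples

/-! ### Iterated distributivity maps -/

namespace PermLin

variable {k : ℕ} {C : Fin k → PermCat.{v, u}} {D : PermCat.{v', u'}} (f : PermLin C D)

variable {f} in
theorem same_δ {i : Fin k} {x y z x' y' z' : ∀ i, (C i).Obj} (hx : x = x') (hy : y = y')
    (hz : z = z') (h : AddAt i x y z) (h' : AddAt i x' y' z') :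
    Same (f.δ i x y z h) (f.δ i x' y' z' h') := by
  subst hx hy hz
  exact .refl _

theorem addAt_update (t : ∀ i, (C i).Obj) (j : Fin k) (a b : (C j).Obj) :
    AddAt j (Function.update t j a) (Function.update t j b)
      (Function.update t j ((C j).add a b)) := by
  refine ⟨by simp, fun l hl => ?_⟩
  simp [Function.update_of_ne hl]

/-- The distributivity map `f(a) ⊕ f(b) ⟶ f(a ⊕ b)` in the variable `j`, with the values of the other
variables given by a tuple. -/
def dist (t : ∀ i, (C i).Obj) (j : Fin k) (a b : (C j).Obj) :
    D.add (f.F.obj (Function.update t j a)) (f.F.obj (Function.update t j b)) ⟶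
      f.F.obj (Function.update t j ((C j).add a b)) :=
  f.δ j _ _ _ (addAt_update t j a b)

theorem dist_naturality (t : ∀ i, (C i).Obj) (j : Fin k) {a b a' b' : (C j).Obj} (g : a ⟶ a')
    (h : b ⟶ b') :
    D.addMap (f.F.map (upd t j g)) (f.F.map (upd t j h)) ≫ f.dist t j a' b' =
      f.dist t j a b ≫ f.F.map (upd t j ((C j).addMap g h)) := by
  refine f.δ_naturality j _ _ _ _ _ ?_ fun l hl => ⟨?_, ?_⟩
  · exact ((same_upd_self t j _).trans (PermCat.same_addMap (same_upd_self t j g).symm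
      (same_upd_self t j h).symm)).heq
  · exact ((same_upd_of_ne t hl _).trans (same_upd_of_ne t hl _).symm).heq
  · exact ((same_upd_of_ne t hl _).trans (same_upd_of_ne t hl _).symm).heq

theorem isId_dist_zero_left (t : ∀ i, (C i).Obj) (j : Fin k) (b : (C j).Obj) :
    IsId (f.dist t j (C j).zero b) :=
  f.δ_zero _ _ _ _ _ (.inl (Function.update_self ..))

theorem isId_dist_zero_right (t : ∀ i, (C i).Obj) (j : Fin k) (a : (C j).Obj) :
    IsId (f.dist t j a (C j).zero) :=
  f.δ_zero _ _ _ _ _ (.inr (.inl (Function.update_self ..)))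

theorem isId_map_upd_of_zero (t : ∀ i, (C i).Obj) (j : Fin k) {a b : (C j).Obj} (g : a ⟶ b)
    (h : (∃ l, l ≠ j ∧ t l = (C l).zero) ∨ (a = (C j).zero ∧ IsId g)) :
    IsId (f.F.map (upd t j g)) := by
  obtain ⟨l, hl, h⟩ | ⟨h, hg⟩ := h
  · exact f.map_zero _ ⟨l, (Function.update_of_ne hl ..).trans h, isId_upd_of_ne t hl g⟩
  · exact f.map_zero _ ⟨j, (Function.update_self ..).trans h, (same_upd_self t j g).isId hg⟩

theorem dist_assoc (t : ∀ i, (C i).Obj) (j : Fin k) (a b c : (C j).Obj) :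
    Same (D.addMap (f.dist t j a b) (𝟙 _) ≫ f.dist t j ((C j).add a b) c)
      (D.addMap (𝟙 (f.F.obj (Function.update t j a))) (f.dist t j b c) ≫
        f.dist t j a ((C j).add b c)) := by
  have h₂ := addAt_update t j ((C j).add a b) c
  have e := (C j).add_assoc a b c
  have := f.δ_assoc j _ _ _ _ _ _ (addAt_update t j a b) h₂ (addAt_update t j b c)
    (e ▸ addAt_update t j a ((C j).add b c))
  refine (Same.of_eq this).trans ((Same.eqToHom_comp _ _).trans ((Same.refl _).comp ?_))
  exact same_δ rfl rfl (congrArg _ e) _ _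

theorem dist_symm (t : ∀ i, (C i).Obj) (j : Fin k) (a b : (C j).Obj) :
    f.dist t j a b ≫ f.F.map (upd t j ((C j).γ a b)) = D.γ _ _ ≫ f.dist t j b a := by
  refine f.δ_symm j _ _ _ _ _ _ _ ?_ fun l hl => isId_upd_of_ne t hl _
  exact ((same_upd_self t j _).trans (PermCat.same_γ (Function.update_self j a t).symm
    (Function.update_self j b t).symm)).heq

/-- Distributivity maps are compatible with the transposition of the first two of three summands. -/
theorem dist_swap (t : ∀ i, (C i).Obj) (j : Fin k) (a b c : (C j).Obj) :
    (D.addMap (𝟙 (f.F.obj (Function.update t j a))) (f.dist t j b c) ≫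
        f.dist t j a ((C j).add b c)) ≫ f.F.map (upd t j ((C j).swap a b c)) =
      D.swap _ _ _ ≫ D.addMap (𝟙 (f.F.obj (Function.update t j b))) (f.dist t j a c) ≫
        f.dist t j b ((C j).add a c) := by
  have h₀ : Same (f.F.map (upd t j ((C j).swap a b c)))
      (f.F.map (upd t j ((C j).addMap ((C j).γ a b) (𝟙 c)))) := by
    refine same_map_of_same _ fun i => ?_
    by_cases hi : i = j
    · subst hi
      exact (same_upd_self t i _).trans (((C i).same_swap a b c).trans (same_upd_self t i _).symm)
    · exact (same_upd_of_ne t hi _).trans (same_upd_of_ne t hi _).symm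
  refine Same.eq ((((f.dist_assoc t j a b c).symm).comp h₀).trans (Same.trans ?_
    ((D.same_swap _ _ _).comp (f.dist_assoc t j b a c).symm).symm))
  refine .of_eq ?_
  rw [Category.assoc, ← dist_naturality, upd_id, f.F.map_id, ← reassoc_of% PermCat.addMap_comp,
    ← reassoc_of% PermCat.addMap_comp, dist_symm]

/-- The iterated distributivity map in the variable `j`, for the values of this variable that are
labelled by the entries of a list. -/
def ldist {I : Type w} (t : ∀ i, (C i).Obj) (j : Fin k) (a : I → (C j).Obj) : ∀ l : List I,
    PermCat.lsum (fun i => f.F.obj (Function.update t j (a i))) l ⟶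
      f.F.obj (Function.update t j (PermCat.lsum a l))
  | [] => eqToHom (f.obj_zero _ ⟨j, Function.update_self ..⟩).symm
  | x :: l => D.addMap (𝟙 (f.F.obj (Function.update t j (a x)))) (ldist t j a l) ≫
      f.dist t j (a x) (PermCat.lsum a l)

variable {I : Type w} (t : ∀ i, (C i).Obj) (j : Fin k) (a : I → (C j).Obj)

theorem same_dist {t : ∀ i, (C i).Obj} {j : Fin k} {a b a' b' : (C j).Obj} (ha : a = a')
    (hb : b = b') : Same (f.dist t j a b) (f.dist t j a' b') := by
  subst ha hb
  exact .refl _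

theorem isId_ldist_nil : IsId (f.ldist t j a []) :=
  ⟨(f.obj_zero _ ⟨j, Function.update_self ..⟩).symm, rfl⟩

theorem ldist_append (l m : List I) :
    Same (f.ldist t j a (l ++ m)) (D.addMap (f.ldist t j a l) (f.ldist t j a m) ≫
      f.dist t j (PermCat.lsum a l) (PermCat.lsum a m)) := by
  induction l with
  | nil =>
    refine Same.symm (Same.comp_id ?_ (f.isId_dist_zero_left t j _).same)
    exact (PermCat.same_addMap (f.isId_ldist_nil t j a).same (.refl _)).trans (PermCat.same_zero_addMap _)
  | cons x l ih =>
    have h₁ := (PermCat.same_addMap (Same.refl (𝟙 (f.F.obj (Function.update t j (a x))))) ih).comp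
      (f.same_dist (t := t) (j := j) (Eq.refl (a x)) (PermCat.lsum_append a l m))
    refine h₁.trans ?_
    rw [PermCat.id_addMap_comp, Category.assoc]
    refine ((PermCat.same_assoc _ _ _).symm.comp (f.dist_assoc _ _ _ _ _).symm).trans (.of_eq ?_)
    rw [← Category.assoc, ← PermCat.addMap_comp, Category.comp_id]
    rfl

theorem ldist_cons_cons (b c : (C j).Obj) {d : (C j).Obj} {e : D.Obj}
    (g : e ⟶ f.F.obj (Function.update t j d)) :
    (D.addMap (𝟙 (f.F.obj (Function.update t j b))) (D.addMap (𝟙 _) g ≫ f.dist t j c d) ≫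
        f.dist t j b ((C j).add c d)) ≫ f.F.map (upd t j ((C j).swap b c d)) =
      D.swap _ _ _ ≫ D.addMap (𝟙 (f.F.obj (Function.update t j c))) (D.addMap (𝟙 _) g ≫
        f.dist t j b d) ≫ f.dist t j c ((C j).add b d) := by
  have h := f.dist_swap t j b c d
  have n := PermCat.swap_naturality (𝟙 (f.F.obj (Function.update t j b)))
    (𝟙 (f.F.obj (Function.update t j c))) g
  simp only [PermCat.id_addMap_comp, Category.assoc] at h ⊢
  rw [h, reassoc_of% n]

theorem ldist_cons (b : (C j).Obj) {c d : (C j).Obj} {e e' : D.Obj} {h : c ⟶ d} {h' : e ⟶ e'}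
    {g : e ⟶ f.F.obj (Function.update t j c)} {g' : e' ⟶ f.F.obj (Function.update t j d)}
    (w : g ≫ f.F.map (upd t j h) = h' ≫ g') :
    (D.addMap (𝟙 (f.F.obj (Function.update t j b))) g ≫ f.dist t j b c) ≫
        f.F.map (upd t j ((C j).addMap (𝟙 b) h)) =
      D.addMap (𝟙 _) h' ≫ D.addMap (𝟙 _) g' ≫ f.dist t j b d := by
  rw [Category.assoc, ← dist_naturality, upd_id, f.F.map_id, ← reassoc_of% PermCat.addMap_comp,
    ← reassoc_of% PermCat.addMap_comp, w, Category.comp_id]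

/-- Iterated distributivity maps commute with rearrangements. -/
theorem ldist_real {l l' : List I} (p : Rearr l l') :
    f.ldist t j a l ≫ f.F.map (upd t j (PermCat.real a p)) =
      PermCat.real (fun i => f.F.obj (Function.update t j (a i))) p ≫ f.ldist t j a l' := by
  induction p with
  | refl l =>
    rw [PermCat.real, PermCat.real, upd_id, f.F.map_id, Category.id_comp, Category.comp_id]
  | swap x y l => exact f.ldist_cons_cons t j (a x) (a y) (f.ldist t j a l)
  | cons x p ih => exact f.ldist_cons t j (a x) ih
  | trans p q ih ih' =>
    rw [PermCat.real, PermCat.real, upd_comp, f.F.map_comp, reassoc_of% ih, ih', Category.assoc]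

/-- The iterated distributivity map of a tuple of values of the variable `j`. -/
def tdist {m : ℕ} (a : Fin m → (C j).Obj) :
    D.sum (fun r => f.F.obj (Function.update t j (a r))) ⟶
      f.F.obj (Function.update t j ((C j).sum a)) :=
  f.lam j _ _ ⟨by simp, fun l hl r => by simp [Function.update_of_ne hl]⟩

theorem same_lam {m : ℕ} {x y : Fin m → ∀ i, (C i).Obj} {z w : ∀ i, (C i).Obj} (hx : x = y)
    (hz : z = w) (h : SumAt j x z) (h' : SumAt j y w) : Same (f.lam j x z h) (f.lam j y w h') := by
  subst hx hz
  exact .refl _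

theorem isId_tdist_zero (a : Fin 0 → (C j).Obj) : IsId (f.tdist t j a) :=
  ⟨(f.obj_zero _ ⟨j, Function.update_self ..⟩).symm, rfl⟩

theorem same_tdist_succ {m : ℕ} (a : Fin (m + 1) → (C j).Obj) :
    Same (f.tdist t j a) (D.addMap (𝟙 (f.F.obj (Function.update t j (a 0))))
      (f.tdist t j fun r => a r.succ) ≫ f.dist t j (a 0) ((C j).sum fun r => a r.succ)) := by
  have e : Function.update (Function.update t j ((C j).sum a)) j
      ((C j).sum fun r => Function.update t j (a r.succ) j) =
        Function.update t j ((C j).sum fun r => a r.succ) := by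
    simp
  exact (PermCat.same_addMap (.refl _) (f.same_lam j rfl e _ _)).comp
    (same_δ rfl e rfl _ _)

theorem tdist_succ {m : ℕ} (a : Fin (m + 1) → (C j).Obj) :
    f.tdist t j a = D.addMap (𝟙 (f.F.obj (Function.update t j (a 0))))
      (f.tdist t j fun r => a r.succ) ≫ f.dist t j (a 0) ((C j).sum fun r => a r.succ) :=
  (f.same_tdist_succ t j a).eq

/-- Iterated distributivity maps in the language of `tdist`. -/
theorem same_lam_tdist {m : ℕ} {x : Fin m → ∀ i, (C i).Obj} {z : ∀ i, (C i).Obj}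
    (h : SumAt j x z) {a : Fin m → (C j).Obj} (hx : ∀ r, x r = Function.update t j (a r))
    (hz : ∀ l, l ≠ j → z l = t l) : Same (f.lam j x z h) (f.tdist t j a) := by
  refine f.same_lam j (funext hx) (funext fun l => ?_) _ _
  by_cases hl : l = j
  · subst hl
    rw [h.1, Function.update_self]
    exact congrArg _ (funext fun r => by rw [hx, Function.update_self])
  · rw [hz l hl, Function.update_of_ne hl]

theorem same_tdist_ofFn {m : ℕ} (s : Fin m → I) :
    Same (f.tdist t j fun r => a (s r)) (f.ldist t j a (List.ofFn s)) := by
  induction m with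
  | zero =>
    rw [List.ofFn_zero]
    exact .of_isId (f.isId_tdist_zero t j _) (f.isId_ldist_nil t j a) rfl
  | succ m ih =>
    rw [List.ofFn_succ, tdist_succ]
    exact (PermCat.same_addMap (.refl _) (ih _)).comp (f.same_dist rfl (PermCat.lsum_ofFn a _).symm)

theorem dist_cons_naturality {b b' : (C j).Obj} {s : b ⟶ b'} {c d : (C j).Obj} {e e' : D.Obj}
    {h : c ⟶ d} {h' : e ⟶ e'} {g : e ⟶ f.F.obj (Function.update t j c)}
    {g' : e' ⟶ f.F.obj (Function.update t j d)} (w : h' ≫ g' = g ≫ f.F.map (upd t j h)) :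
    D.addMap (f.F.map (upd t j s)) h' ≫ D.addMap (𝟙 _) g' ≫ f.dist t j b' d =
      (D.addMap (𝟙 (f.F.obj (Function.update t j b))) g ≫ f.dist t j b c) ≫
        f.F.map (upd t j ((C j).addMap s h)) := by
  rw [Category.assoc, ← dist_naturality, ← reassoc_of% PermCat.addMap_comp,
    ← reassoc_of% PermCat.addMap_comp, w, Category.comp_id, Category.id_comp]

theorem tdist_naturality {m : ℕ} {a b : Fin m → (C j).Obj} (g : ∀ r, a r ⟶ b r) :
    D.sumMap (fun r => f.F.map (upd t j (g r))) ≫ f.tdist t j b =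
      f.tdist t j a ≫ f.F.map (upd t j ((C j).sumMap g)) := by
  induction m with
  | zero =>
    refine Same.eq (.of_isId (IsId.comp ⟨rfl, rfl⟩ (f.isId_tdist_zero t j b))
      ((f.isId_tdist_zero t j a).comp (f.isId_map_upd_of_zero t j _ (.inr ⟨rfl, rfl, rfl⟩))) rfl)
  | succ m ih =>
    rw [tdist_succ, tdist_succ]
    exact f.dist_cons_naturality t j (ih fun r => g r.succ)

/-- Iterated distributivity maps of permuted summands. -/
theorem tdist_perm {m n : ℕ} (e : Fin m ≃ Fin n) (b : Fin n → (C j).Obj) :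
    f.tdist t j (fun r => b (e r)) ≫ f.F.map (upd t j ((C j).perm e b)) =
      D.perm e (fun r => f.F.obj (Function.update t j (b r))) ≫ f.tdist t j b := by
  obtain ⟨p⟩ := Rearr.nonempty (ofFn_equiv_perm e fun i => i)
  have hn : (List.ofFn fun i => e i).Nodup := List.nodup_ofFn.2 e.injective
  have h₁ := (PermCat.Realizes.perm_self e b).unique ⟨p, .refl _⟩ hn
  have h₂ := (PermCat.Realizes.perm_self e
    (fun r => f.F.obj (Function.update t j (b r)))).unique ⟨p, .refl _⟩ hn
  have h₃ := f.same_tdist_ofFn t j b e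
  have h₄ := f.same_tdist_ofFn t j b fun i => i
  refine Same.eq ((h₃.comp ?_).trans ((Same.of_eq (f.ldist_real t j b p)).trans (h₂.comp h₄).symm))
  refine same_map_of_same _ fun i => ?_
  by_cases hi : i = j
  · subst hi
    exact (same_upd_self t i _).trans (h₁.trans (same_upd_self t i _).symm)
  · exact (same_upd_of_ne t hi _).trans (same_upd_of_ne t hi _).symm

theorem tdist_flatten {n : ℕ} (L : Fin n → List I) :
    Same (f.ldist t j a (List.ofFn L).flatten) (D.sumMap (fun i => f.ldist t j a (L i)) ≫
      f.tdist t j fun i => PermCat.lsum a (L i)) := by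
  induction n with
  | zero =>
    rw [List.ofFn_zero]
    exact .of_isId (f.isId_ldist_nil t j a) (IsId.comp ⟨rfl, rfl⟩ (f.isId_tdist_zero t j _)) rfl
  | succ n ih =>
    rw [flatten_ofFn_succ, tdist_succ]
    refine (f.ldist_append t j a _ _).trans ?_
    refine Same.trans ((PermCat.same_addMap (.refl _) (ih fun i => L i.succ)).comp
      (f.same_dist rfl (PermCat.lsum_flatten_ofFn a _))) (.of_eq ?_)
    refine Eq.trans ?_ (Category.assoc _ _ _)
    refine congrArg (fun s => s ≫ _) (Eq.trans ?_ (D.addMap_comp _ _ _ _))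
    rw [Category.comp_id]

/-- Iterated distributivity maps of a concatenation. -/
theorem tdist_flat {n : ℕ} {l : Fin n → ℕ} (b : ∀ i, Fin (l i) → (C j).Obj) :
    Same (f.tdist t j (flat b)) (D.sumMap (fun i => f.tdist t j (b i)) ≫
      f.tdist t j fun i => (C j).sum (b i)) := by
  let a : ((i : Fin n) × Fin (l i)) → (C j).Obj := fun p => b p.1 p.2
  have h := f.same_tdist_ofFn t j a
    (flat fun i (r : Fin (l i)) => (⟨i, r⟩ : (i : Fin n) × Fin (l i)))
  rw [ofFn_flat fun i j => (⟨i, j⟩ : (i : Fin n) × Fin (l i))] at h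
  refine h.trans ((f.tdist_flatten t j a _).trans ?_)
  have hs := fun i => (f.same_tdist_ofFn t j a fun r : Fin (l i) => ⟨i, r⟩).symm
  refine (PermCat.same_sumMap hs).comp ?_
  have hl := fun i => PermCat.lsum_ofFn a fun r : Fin (l i) => (⟨i, r⟩ : (i : Fin n) × Fin (l i))
  exact f.same_lam j (funext fun i => congrArg (Function.update t j) (hl i))
    (congrArg (fun b => Function.update t j ((C j).sum b)) (funext hl)) _ _

end PermLin

/-! ### Interchanging the order of summation -/

namespace PermCat

variable {C : PermCat.{v, u}}

theorem same_interchange (a b c d : C.Obj) :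
    Same (C.interchange a b c d) (C.addMap (𝟙 a) (C.addMap (C.γ b c) (𝟙 d))) :=
  (Same.eqToHom_comp _ _).trans (Same.comp_eqToHom _ _)

theorem same_add_add {a b c d a' b' c' d' : C.Obj} (f : a ⟶ a') (g : b ⟶ b') (h : c ⟶ c')
    (k : d ⟶ d') : Same (C.addMap (C.addMap f g) (C.addMap h k))
      (C.addMap f (C.addMap (C.addMap g h) k)) :=
  (same_assoc f g _).trans (same_addMap (.refl _) (same_assoc g h k).symm)

theorem interchange_naturality {a b c d a' b' c' d' : C.Obj} (f : a ⟶ a') (g : b ⟶ b')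
    (h : c ⟶ c') (k : d ⟶ d') :
    C.addMap (C.addMap f g) (C.addMap h k) ≫ C.interchange a' b' c' d' =
      C.interchange a b c d ≫ C.addMap (C.addMap f h) (C.addMap g k) := by
  refine Same.eq (((same_add_add f g h k).comp (same_interchange _ _ _ _)).trans
    (Same.trans (.of_eq ?_) ((same_interchange _ _ _ _).comp (same_add_add f h g k)).symm))
  rw [← C.addMap_comp, ← C.addMap_comp, ← C.addMap_comp, ← C.addMap_comp, C.γ_naturality,
    Category.comp_id, Category.comp_id, Category.id_comp, Category.id_comp]

theorem Realizes.interchange {I : Type w} {A : I → C.Obj} {a b c d : C.Obj} {l₁ l₂ l₃ l₄ : List I}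
    (h₁ : a = lsum A l₁) (h₂ : b = lsum A l₂) (h₃ : c = lsum A l₃) (h₄ : d = lsum A l₄) :
    Realizes A ((l₁ ++ l₂) ++ (l₃ ++ l₄)) ((l₁ ++ l₃) ++ (l₂ ++ l₄)) (C.interchange a b c d) := by
  have h := Realizes.addMap (Realizes.id h₁)
    (Realizes.addMap (Realizes.γ (A := A) h₂ h₃) (Realizes.id h₄))
  simpa only [List.append_assoc] using h.same (same_interchange a b c d)

/-- The canonical map `(a_1 ⊕ ⋯ ⊕ a_m) ⊕ (b_1 ⊕ ⋯ ⊕ b_m) ⟶ (a_1 ⊕ b_1) ⊕ ⋯ ⊕ (a_m ⊕ b_m)`. -/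
def zipSum : ∀ {m : ℕ} (a b : Fin m → C.Obj),
    C.add (C.sum a) (C.sum b) ⟶ C.sum fun r => C.add (a r) (b r)
  | 0, _, _ => eqToHom (C.add_zero C.zero)
  | _ + 1, a, b => C.interchange (a 0) (C.sum fun r => a r.succ) (b 0) (C.sum fun r => b r.succ) ≫
      C.addMap (𝟙 (C.add (a 0) (b 0))) (zipSum (fun r => a r.succ) fun r => b r.succ)

theorem zipSum_naturality {m : ℕ} {a b a' b' : Fin m → C.Obj} (f : ∀ r, a r ⟶ a' r)
    (g : ∀ r, b r ⟶ b' r) : C.addMap (C.sumMap f) (C.sumMap g) ≫ zipSum a' b' =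
      zipSum a b ≫ C.sumMap fun r => C.addMap (f r) (g r) := by
  induction m with
  | zero =>
    exact Same.eq (.of_isId ((isId_addMap ⟨rfl, rfl⟩ ⟨rfl, rfl⟩).comp ⟨C.add_zero _, rfl⟩)
      (IsId.comp ⟨C.add_zero _, rfl⟩ ⟨rfl, rfl⟩) rfl)
  | succ m ih =>
    have h := ih (fun r => f r.succ) fun r => g r.succ
    have n := interchange_naturality (f 0) (C.sumMap fun r => f r.succ) (g 0)
      (C.sumMap fun r => g r.succ)
    have aux : ∀ {x y z x' y' z' w w' : C.Obj} (p : x ⟶ y) (q : y ⟶ C.add z w)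
        (r : w ⟶ w') (p' : x ⟶ C.add x' y') (s : x' ⟶ z) (t : y' ⟶ w) (r' : y' ⟶ z')
        (t' : z' ⟶ w'), p ≫ q = p' ≫ C.addMap s t → t ≫ r = r' ≫ t' →
        p ≫ q ≫ C.addMap (𝟙 z) r = (p' ≫ C.addMap (𝟙 x') r') ≫ C.addMap s t' := by
      intro x y z x' y' z' w w' p q r p' s t r' t' h h'
      rw [reassoc_of% h, ← C.addMap_comp, h', Category.assoc, ← C.addMap_comp, Category.comp_id,
        Category.id_comp]
    exact aux _ _ _ _ _ _ _ _ n h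

theorem Realizes.zipSum {I : Type w} {A : I → C.Obj} {m : ℕ} {a b : Fin m → C.Obj}
    {L L' : Fin m → List I} (h : ∀ r, a r = lsum A (L r)) (h' : ∀ r, b r = lsum A (L' r)) :
    Realizes A ((List.ofFn L).flatten ++ (List.ofFn L').flatten)
      (List.ofFn fun r => L r ++ L' r).flatten (zipSum a b) := by
  have hs : ∀ {m : ℕ} {a : Fin m → C.Obj} {L : Fin m → List I}, (∀ r, a r = lsum A (L r)) →
      C.sum a = lsum A (List.ofFn L).flatten := fun h => by
    rw [lsum_flatten_ofFn]
    exact congrArg C.sum (funext h)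
  induction m with
  | zero => exact .of_isId ⟨C.add_zero _, rfl⟩ (by simp; exact C.add_zero _) (by simp)
  | succ m ih =>
    rw [flatten_ofFn_succ, flatten_ofFn_succ, flatten_ofFn_succ]
    refine Realizes.comp (Realizes.interchange (h 0) (hs fun r => h r.succ) (h' 0)
      (hs fun r => h' r.succ)) ?_
    exact Realizes.addMap (.id (by rw [lsum_append, h, h']))
      (ih (fun r => h r.succ) fun r => h' r.succ)

/-- The canonical map that interchanges the order of summation. -/
def transposeSum : ∀ {n m : ℕ} (x : Fin n → Fin m → C.Obj),
    (C.sum fun s => C.sum (x s)) ⟶ C.sum fun r => C.sum fun s => x s r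
  | 0, m, _ => eqToHom (C.sum_zero m).symm
  | _ + 1, _, x => C.addMap (𝟙 (C.sum (x 0))) (transposeSum fun s => x s.succ) ≫
      zipSum (x 0) fun r => C.sum fun s => x s.succ r

theorem Realizes.transposeSum {I : Type w} (A : I → C.Obj) {n m : ℕ} (t : Fin n → Fin m → I) :
    Realizes A (List.ofFn fun s => List.ofFn (t s)).flatten
      (List.ofFn fun r => List.ofFn fun s => t s r).flatten
      (transposeSum fun s r => A (t s r)) := by
  induction n with
  | zero =>
    refine .of_isId ⟨(C.sum_zero m).symm, rfl⟩ (by simp; rfl) ?_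
    simp
  | succ n ih =>
    rw [flatten_ofFn_succ]
    refine Realizes.comp (Realizes.addMap (.id (lsum_ofFn A (t 0)).symm) (ih fun s => t s.succ)) ?_
    have h := Realizes.zipSum (A := A) (a := fun r => A (t 0 r))
      (b := fun r => C.sum fun s => A (t s.succ r)) (L := fun r => [t 0 r])
      (L' := fun r => List.ofFn fun s => t s.succ r) (fun r => (C.add_zero _).symm)
      fun r => (lsum_ofFn A _).symm
    rw [flatten_ofFn_singleton] at h
    have e : (fun r => List.ofFn fun s => t s r) =
        fun r => [t 0 r] ++ List.ofFn fun s => t s.succ r := by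
      funext r
      rw [List.ofFn_succ]
      rfl
    rw [e]
    exact h

theorem same_transposeSum {n m : ℕ} (x : Fin n → Fin m → C.Obj) :
    Same (transposeSum x) (C.perm (swapEquiv m n) (flat fun r s => x s r)) := by
  let A : Fin n × Fin m → C.Obj := fun p => x p.1 p.2
  have h₁ := Realizes.perm_ofFn (A := A) (swapEquiv m n) (a := flat fun r s => x s r)
    (s := flat fun r s => (s, r)) fun i => rfl
  have h₂ := Realizes.transposeSum A fun s r => (s, r)
  have h₃ := funext fun z => flat_swapEquiv (fun (s : Fin n) (r : Fin m) => (s, r)) z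
  rw [← ofFn_flat fun s r => (s, r), ← ofFn_flat fun (r : Fin m) (s : Fin n) => (s, r)] at h₂
  rw [← h₃] at h₁
  exact h₂.unique h₁ (List.nodup_ofFn.2
    (finSigmaFinEquiv.symm.trans (Equiv.sigmaEquivProd _ _)).injective)

end PermCat

namespace PermLin

variable {k : ℕ} {C : Fin k → PermCat.{v, u}} {D : PermCat.{v', u'}} (f : PermLin C D)

/-- A morphism of tuples with one component replaced by another morphism. -/
theorem exists_update_hom {ι : Type w} [DecidableEq ι] {X : ι → Type u} [∀ i, Category.{v} (X i)]
    {z y : ∀ i, X i} (s : z ⟶ y) (j : ι) {c d : X j} (g : c ⟶ d) :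
    ∃ t : Function.update z j c ⟶ Function.update y j d,
      Same (t j) g ∧ ∀ l, l ≠ j → Same (t l) (s l) := by
  have : ∀ l, ∃ t : Function.update z j c l ⟶ Function.update y j d l,
      (∀ h : l = j, Same t (h ▸ g : (h ▸ c : X l) ⟶ h ▸ d)) ∧ (l ≠ j → Same t (s l)) := by
    intro l
    by_cases h : l = j
    · subst h
      exact ⟨eqToHom (Function.update_self ..) ≫ g ≫ eqToHom (Function.update_self ..).symm,
        fun _ => (Same.eqToHom_comp _ _).trans (.comp_eqToHom _ _), fun h => absurd rfl h⟩
    · exact ⟨eqToHom (Function.update_of_ne h ..) ≫ s l ≫ eqToHom (Function.update_of_ne h ..).symm,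
        fun h' => absurd h' h, fun _ => (Same.eqToHom_comp _ _).trans (.comp_eqToHom _ _)⟩
  choose t ht ht' using this
  exact ⟨t, ht j rfl, ht'⟩

/-- The iterated distributivity maps are natural in all variables. -/
theorem lam_naturality (j : Fin k) {m : ℕ} {x y : Fin m → ∀ i, (C i).Obj} {z w : ∀ i, (C i).Obj}
    (h : SumAt j x z) (h' : SumAt j y w) (g : ∀ r, x r ⟶ y r) (s : z ⟶ w)
    (hj : Same (s j) ((C j).sumMap fun r => g r j)) (hs : ∀ l, l ≠ j → ∀ r, Same (g r l) (s l)) :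
    D.sumMap (fun r => f.F.map (g r)) ≫ f.lam j y w h' = f.lam j x z h ≫ f.F.map s := by
  induction m generalizing z w with
  | zero =>
    exact Same.eq (.of_isId (IsId.comp ⟨rfl, rfl⟩ ⟨(f.obj_zero w ⟨j, h'.1⟩).symm, rfl⟩)
      (IsId.comp ⟨(f.obj_zero z ⟨j, h.1⟩).symm, rfl⟩
        (f.map_zero s ⟨j, h.1, hj.isId ⟨rfl, rfl⟩⟩)) rfl)
  | succ m ih =>
    obtain ⟨t, ht, ht'⟩ := exists_update_hom s j ((C j).sumMap fun r => g r.succ j)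
    have e := ih h.tail h'.tail (fun r => g r.succ) t ht
      fun l hl r => (hs l hl r.succ).trans (ht' l hl).symm
    have n := f.δ_naturality j h.head h'.head (g 0) t s
      (hj.trans (PermCat.same_addMap (.refl _) ht.symm)).heq
      fun l hl => ⟨(hs l hl 0).heq, (ht' l hl).heq⟩
    have aux : ∀ {a b a' b' c d c' : D.Obj} (p : a ⟶ a') (q : b ⟶ b') (r : b' ⟶ c)
        (u : D.add a' c ⟶ d) (p' : b ⟶ c') (v : D.add a c' ⟶ d) (q' : c' ⟶ c),
        q ≫ r = p' ≫ q' → D.addMap p q' ≫ u = v →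
        D.addMap p q ≫ D.addMap (𝟙 a') r ≫ u = D.addMap (𝟙 a) p' ≫ v := by
      intro a b a' b' c d c' p q r u p' v q' h h'
      rw [← h', ← reassoc_of% D.addMap_comp, ← reassoc_of% D.addMap_comp, h, Category.comp_id,
        Category.id_comp]
    exact (aux _ _ _ _ _ _ _ e n).trans (Category.assoc _ _ _).symm

theorem isId_lam (j : Fin k) {m : ℕ} {x : Fin m → ∀ i, (C i).Obj} {z : ∀ i, (C i).Obj}
    (h : SumAt j x z) (h' : (∃ l, l ≠ j ∧ z l = (C l).zero) ∨ ∀ r, x r j = (C j).zero) :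
    IsId (f.lam j x z h) := by
  induction m generalizing z with
  | zero => exact ⟨(f.obj_zero z ⟨j, h.1⟩).symm, rfl⟩
  | succ m ih =>
    refine IsId.comp (PermCat.isId_addMap ⟨rfl, rfl⟩ (ih h.tail ?_)) (f.δ_zero _ _ _ _ _ ?_)
    · obtain ⟨l, hl, h'⟩ | h' := h'
      · exact .inl ⟨l, hl, (Function.update_of_ne hl ..).trans h'⟩
      · exact .inr fun r => h' r.succ
    · obtain h' | h' := h'
      · exact .inr (.inr h')
      · exact .inl (h' 0)

/-- The induction step of `lam_add`, as a statement about morphisms of a permutative category. -/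
theorem zip_pentagon {a b c d b' d' e e' x x' y y' z : D.Obj} (p : b ⟶ b') (q : d ⟶ d')
    (δ₁ : D.add a b' ⟶ e) (δ₂ : D.add c d' ⟶ e') (δ₃ : D.add e e' ⟶ z) (δ₄ : D.add a c ⟶ x)
    (δ₅ : D.add b' d' ⟶ y) (δ₆ : D.add x y ⟶ z) (s : D.add b d ⟶ x') (t : x' ⟶ y')
    (l : y' ⟶ y)
    (h : D.addMap δ₁ δ₂ ≫ δ₃ = D.interchange a b' c d' ≫ D.addMap δ₄ δ₅ ≫ δ₆)
    (h' : D.addMap p q ≫ δ₅ = s ≫ t ≫ l) :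
    D.addMap (D.addMap (𝟙 a) p ≫ δ₁) (D.addMap (𝟙 c) q ≫ δ₂) ≫ δ₃ =
      (D.interchange a b c d ≫ D.addMap (𝟙 (D.add a c)) s) ≫ D.addMap δ₄ t ≫
        D.addMap (𝟙 x) l ≫ δ₆ := by
  have n := PermCat.interchange_naturality (𝟙 a) p (𝟙 c) q
  rw [D.addMap_comp, Category.assoc, h, reassoc_of% n, Category.assoc,
    ← reassoc_of% D.addMap_comp, ← reassoc_of% D.addMap_comp, ← reassoc_of% D.addMap_comp,
    h', D.addMap_id]
  simp only [Category.id_comp, Category.comp_id, Category.assoc]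

/-- The pentagon for two variables, with one of the two distributivity maps iterated. -/
theorem lam_add (i j : Fin k) (hij : i ≠ j) {m : ℕ} {a b c : Fin m → ∀ i, (C i).Obj}
    {x y z : ∀ i, (C i).Obj} (ha : SumAt i a x) (hb : SumAt i b y) (hc : SumAt i c z)
    (h : ∀ r, AddAt j (a r) (b r) (c r)) (h' : AddAt j x y z) :
    D.addMap (f.lam i a x ha) (f.lam i b y hb) ≫ f.δ j x y z h' =
      PermCat.zipSum (fun r => f.F.obj (a r)) (fun r => f.F.obj (b r)) ≫
        D.sumMap (fun r => f.δ j (a r) (b r) (c r) (h r)) ≫ f.lam i c z hc := by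
  induction m generalizing x y z with
  | zero =>
    have hz := hc.1
    refine Same.eq (.of_isId ((PermCat.isId_addMap (f.isId_lam i ha (.inr fun r => r.elim0))
      (f.isId_lam i hb (.inr fun r => r.elim0))).comp (f.δ_zero _ _ _ _ _
        (.inr (.inr ⟨i, hij, hc.1⟩)))) ?_ rfl)
    exact IsId.comp ⟨D.add_zero _, rfl⟩ (IsId.comp ⟨rfl, rfl⟩
      (f.isId_lam i hc (.inr fun r => r.elim0)))
  | succ m ih =>
    have h₀ : AddAt j (Function.update x i ((C i).sum fun r => a r.succ i))
        (Function.update y i ((C i).sum fun r => b r.succ i))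
        (Function.update z i ((C i).sum fun r => c r.succ i)) := by
      refine ⟨?_, fun l hl => ?_⟩
      · rw [Function.update_of_ne hij.symm, Function.update_of_ne hij.symm,
          Function.update_of_ne hij.symm, h'.1]
      · by_cases hli : l = i
        · subst hli
          rw [Function.update_self, Function.update_self, Function.update_self]
          exact ⟨congrArg _ (funext fun r => ((h r.succ).2 l hl).1),
            congrArg _ (funext fun r => ((h r.succ).2 l hl).2)⟩
        · rw [Function.update_of_ne hli, Function.update_of_ne hli, Function.update_of_ne hli]
          exact h'.2 l hl
    exact zip_pentagon _ _ _ _ _ _ _ _ _ _ _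
      (f.δ_pentagon i j hij _ _ _ _ _ _ _ _ _ ha.head hb.head h' (h 0) h₀ hc.head)
      (ih ha.tail hb.tail hc.tail (fun r => h r.succ) h₀)

/-- The induction step of `lam_lam`, as a statement about morphisms of a permutative category. -/
theorem lam_lam_step {a b b' x x' y y' z e w v : D.Obj} (l₀ : a ⟶ x) (l₁ : b ⟶ y) (l₂ : y ⟶ x')
    (δ : D.add x x' ⟶ z) (t : b ⟶ b') (l₃ : b' ⟶ y') (l₄ : y' ⟶ x') (q : D.add a b' ⟶ e)
    (q' : D.add a y' ⟶ w) (s : e ⟶ w) (s' : w ⟶ v) (l : v ⟶ z)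
    (h : l₁ ≫ l₂ = t ≫ l₃ ≫ l₄) (h' : D.addMap l₀ l₄ ≫ δ = q' ≫ s' ≫ l)
    (h'' : D.addMap (𝟙 a) l₃ ≫ q' = q ≫ s) :
    D.addMap l₀ l₁ ≫ D.addMap (𝟙 x) l₂ ≫ δ = (D.addMap (𝟙 a) t ≫ q) ≫ (s ≫ s') ≫ l := by
  rw [← reassoc_of% D.addMap_comp, h, Category.comp_id]
  have : D.addMap l₀ (t ≫ l₃ ≫ l₄) = D.addMap (𝟙 a) t ≫ D.addMap (𝟙 a) l₃ ≫ D.addMap l₀ l₄ := by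
    rw [← D.addMap_comp, ← D.addMap_comp, Category.id_comp, Category.id_comp]
  rw [this]
  simp only [Category.assoc]
  rw [h', reassoc_of% h'']

/-- The iterated distributivity maps in two variables commute up to interchange of the order of
summation. -/
theorem lam_lam (i j : Fin k) (hij : i ≠ j) {m n : ℕ} {x : Fin m → Fin n → ∀ i, (C i).Obj}
    {p : Fin n → ∀ i, (C i).Obj} {q : Fin m → ∀ i, (C i).Obj} {t : ∀ i, (C i).Obj}
    (hp : ∀ s, SumAt i (fun r => x r s) (p s)) (hq : ∀ r, SumAt j (x r) (q r))
    (hpt : SumAt j p t) (hqt : SumAt i q t) :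
    D.sumMap (fun s => f.lam i (fun r => x r s) (p s) (hp s)) ≫ f.lam j p t hpt =
      PermCat.transposeSum (fun s r => f.F.obj (x r s)) ≫
        D.sumMap (fun r => f.lam j (x r) (q r) (hq r)) ≫ f.lam i q t hqt := by
  induction n generalizing q t with
  | zero =>
    refine Same.eq (.of_isId (IsId.comp ⟨rfl, rfl⟩ (f.isId_lam j hpt (.inr fun s => s.elim0)))
      (IsId.comp ⟨(D.sum_zero m).symm, rfl⟩ (IsId.comp (PermCat.isId_sumMap fun r =>
        f.isId_lam j (hq r) (.inr fun s => s.elim0)) (f.isId_lam i hqt (.inl ⟨j, hij.symm, hpt.1⟩))))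
      rfl)
  | succ n ih =>
    have hT : SumAt i (fun r => Function.update (q r) j ((C j).sum fun s => x r s.succ j))
        (Function.update t j ((C j).sum fun s => p s.succ j)) := by
      refine ⟨?_, fun l hl r => ?_⟩
      · rw [Function.update_of_ne hij, hqt.1]
        exact congrArg _ (funext fun r => (Function.update_of_ne hij ..).symm)
      · by_cases hlj : l = j
        · subst hlj
          exact (Function.update_self ..).trans ((congrArg (C l).sum (funext fun s : Fin n =>
            (hp s.succ).2 l hl r)).trans (Function.update_self l ((C l).sum _) t).symm)
        · exact (Function.update_of_ne hlj ..).trans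
            ((hqt.2 l hl r).trans (Function.update_of_ne hlj ..).symm)
    -- The first summand of the variable `j` is split off.
    have e := ih (fun s => hp s.succ) (fun r => (hq r).tail) hpt.tail hT
    have e' := f.lam_add i j hij (hp 0) hT hqt (fun r => (hq r).head) hpt.head
    have e'' := PermCat.zipSum_naturality (fun r => 𝟙 (f.F.obj (x r 0)))
      fun r => f.lam j (fun s => x r s.succ) _ (hq r).tail
    rw [PermCat.sumMap_id] at e''
    refine (lam_lam_step _ _ _ _ _ _ _ _ _ _ _ _ e e' e'').trans ?_
    rw [← PermCat.sumMap_comp]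
    rfl

end PermLin

/-! ### The underlying multicategory on multilinear maps -/

section Steps

variable {ι : Type w} {X : ι → Type u} [∀ i, Category.{v} (X i)]

/-- A given morphism in the place `j` is the component of a morphism between tuples that agree in
the other places. -/
theorem exists_step {x y : ∀ i, X i} (j : ι) {c d : X j} (g : c ⟶ d) (hc : x j = c) (hd : y j = d)
    (h : ∀ i, i ≠ j → x i = y i) :
    ∃ s : x ⟶ y, Same (s j) g ∧ ∀ i, i ≠ j → IsId (s i) := by
  subst hc hd
  have : ∀ i, ∃ s : x i ⟶ y i, (∀ e : j = i, Same s (e ▸ g : x i ⟶ y i)) ∧ (i ≠ j → IsId s) := by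
    intro i
    by_cases hi : j = i
    · subst hi
      exact ⟨g, fun _ => .refl _, fun h => absurd rfl h⟩
    · exact ⟨eqToHom (h i (Ne.symm hi)), fun h => absurd h hi, fun _ => ⟨h i (Ne.symm hi), rfl⟩⟩
  choose s hs hs' using this
  exact ⟨s, hs j rfl, hs'⟩

end Steps

theorem BasedMulticategory.FromBase.source {M : BasedMulticategory.{v, u}} {n : ℕ}
    {a : Fin n → M.Obj} {b : M.Obj} {f : M.Hom n a b} (h : M.FromBase f) : a = fun _ => M.pt := by
  cases h
  rfl

namespace PermCat

/-- The underlying based multicategory of a permutative category. -/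
abbrev multicat (C : PermCat.{v, u}) : BasedMulticategory.{v, u} :=
  C.underlying C.isBased_underlyingData

variable {C : PermCat.{v, u}}

theorem isId_perm_symm {m n : ℕ} {e : Fin m ≃ Fin n} (h : ∀ a : Fin n → C.Obj, IsId (C.perm e a))
    (b : Fin m → C.Obj) : IsId (C.perm e.symm b) := by
  obtain ⟨a, rfl⟩ : ∃ a : Fin n → C.Obj, b = fun i => a (e i) :=
    ⟨fun i => b (e.symm i), by simp⟩
  obtain ⟨h₁, h₂⟩ := h a
  have h₃ := perm_trans e.symm e a
  rw [h₂] at h₃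
  refine (Same.comp_eqToHom _ h₁).symm.isId ((Same.of_eq h₃).symm.isId ?_)
  have h₄ : ∀ e' : Fin n ≃ Fin n, e' = Equiv.refl _ → IsId (C.perm e' a) := by
    rintro _ rfl
    exact isId_perm_refl a
  exact h₄ _ (by simp)

theorem same_post {m : ℕ} {a : Fin m → C.Obj} {b c : C.Obj} {g : b ⟶ c}
    {h : C.multicat.Hom 1 (fun _ => b) c} (hg : Same (A := C.Obj) h g) (f : C.sum a ⟶ b) :
    Same (A := C.Obj) (BasedMulticategory.post (M := C.multicat) h f) (f ≫ g) := by
  refine (same_reindex _ _ _).trans (Same.id_comp ?_ (isId_perm_symm isId_perm_unitL _).same')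
  refine (same_comp (b := fun _ => b) h fun _ => f).trans (Same.comp ?_ hg)
  exact same_addMap_zero f

theorem same_pre {m : ℕ} {a b : Fin m → C.Obj} {c : C.Obj} (f : C.sum b ⟶ c)
    {h : ∀ i, C.multicat.Hom 1 (fun _ => a i) (b i)} {g : ∀ i, a i ⟶ b i}
    (hg : ∀ i, Same (A := C.Obj) (h i) (g i)) :
    Same (A := C.Obj) (BasedMulticategory.pre (M := C.multicat) f h) (C.sumMap g ≫ f) := by
  refine (same_reindex _ _ _).trans (Same.id_comp ?_ (isId_perm_symm isId_perm_unitR _).same')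
  exact (same_comp f h).trans ((same_sumMap hg).comp (.refl f))

theorem fromBase_of_isId {n : ℕ} {a : Fin n → C.Obj} {b : C.Obj} {f : C.sum a ⟶ b} (h : IsId f)
    (ha : ∀ i, a i = C.zero) (hb : b = C.zero) : C.multicat.FromBase f := by
  obtain rfl : a = fun _ => C.zero := funext ha
  subst hb
  obtain ⟨_, rfl⟩ := h
  exact .mk n

theorem isId_of_fromBase {n : ℕ} {a : Fin n → C.Obj} {b : C.Obj} {f : C.sum a ⟶ b}
    (h : C.multicat.FromBase f) : IsId f ∧ (∀ i, a i = C.zero) ∧ b = C.zero := by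
  have hb : b = C.zero := h.target
  have ha : a = fun _ => C.zero := h.source
  subst ha hb
  obtain rfl := eq_of_heq h.heq
  exact ⟨isId_ptHom n, fun _ => rfl, rfl⟩

end PermCat

namespace PermLin

variable {k : ℕ} {C : Fin k → PermCat.{v, u}} {D : PermCat.{v', u'}} (f : PermLin C D)

theorem sumAt_update {m : ℕ} (j : Fin k) {a : Fin m → (C j).Obj} {x : Fin m → ∀ i, (C i).Obj}
    {x' : ∀ i, (C i).Obj} (hx : ∀ r, x r = Function.update x' j (a r)) :
    SumAt j x (Function.update x' j ((C j).sum a)) := by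
  obtain rfl : x = fun r => Function.update x' j (a r) := funext hx
  refine ⟨by simp, fun l hl r => by simp [Function.update_of_ne hl]⟩

/-- The composite `f(a_1) ⊕ ⋯ ⊕ f(a_m) ⟶ f(a_1 ⊕ ⋯ ⊕ a_m) ⟶ f(a')` of the iterated distributivity
map in the variable `j` and of `f(φ)`. -/
def lmap (j : Fin k) {m : ℕ} {a : Fin m → (C j).Obj} {a' : (C j).Obj} (φ : (C j).sum a ⟶ a')
    (x : Fin m → ∀ i, (C i).Obj) (x' : ∀ i, (C i).Obj)
    (hx : ∀ r, x r = Function.update x' j (a r)) (hx' : x' j = a') :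
    D.sum (fun r => f.F.obj (x r)) ⟶ f.F.obj x' :=
  f.lam j x _ (sumAt_update j hx) ≫
    f.F.map (upd x' j φ ≫ eqToHom (by rw [← hx', Function.update_eq_self]))

variable {m : ℕ} {j : Fin k} {a : Fin m → (C j).Obj} {a' : (C j).Obj} (φ : (C j).sum a ⟶ a')
    (x : Fin m → ∀ i, (C i).Obj) (x' : ∀ i, (C i).Obj)
    (hx : ∀ r, x r = Function.update x' j (a r)) (hx' : x' j = a')

theorem same_comp_eqToHom_apply {ι : Type w} {X : ι → Type u} [∀ i, Category.{v} (X i)]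
    {x y z : ∀ i, X i} (s : x ⟶ y) (h : y = z) (i : ι) : Same ((s ≫ eqToHom h) i) (s i) := by
  subst h
  rw [eqToHom_refl, Category.comp_id]
  exact .refl _

/-- The map `lmap` computed with any morphism of tuples that is `φ` in the place `j` and an identity
in the other places. -/
theorem same_lmap {z : ∀ i, (C i).Obj} (hz : SumAt j x z) (s : z ⟶ x') (hj : Same (s j) φ)
    (hs : ∀ l, l ≠ j → IsId (s l)) :
    Same (f.lmap j φ x x' hx hx') (f.lam j x z hz ≫ f.F.map s) := by
  refine Same.comp (f.same_lam j rfl (funext fun l => ?_) _ _) (same_map_of_same _ fun l => ?_)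
  · by_cases hl : l = j
    · subst hl
      rw [Function.update_self, hj.1]
    · rw [Function.update_of_ne hl, (hs l hl).1]
  · refine (same_comp_eqToHom_apply _ _ l).trans ?_
    by_cases hl : l = j
    · subst hl
      exact (same_upd_self _ _ _).trans hj.symm
    · exact (same_upd_of_ne _ hl _).trans (hs l hl).same'.symm

theorem lmap_eq {z : ∀ i, (C i).Obj} (hz : SumAt j x z) (s : z ⟶ x') (hj : Same (s j) φ)
    (hs : ∀ l, l ≠ j → IsId (s l)) : f.lmap j φ x x' hx hx' = f.lam j x z hz ≫ f.F.map s :=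
  (f.same_lmap φ x x' hx hx' hz s hj hs).eq

theorem same_map_upd (t : ∀ i, (C i).Obj) (j : Fin k) {c d c' d' : (C j).Obj} {g : c ⟶ d}
    {g' : c' ⟶ d'} (h : Same g g') : Same (f.F.map (upd t j g)) (f.F.map (upd t j g')) := by
  obtain ⟨rfl, rfl, rfl⟩ := h
  simp only [eqToHom_refl, Category.id_comp, Category.comp_id]
  exact .refl _

theorem same_lmap_tdist (t : ∀ i, (C i).Obj) (ht : ∀ l, l ≠ j → x' l = t l) :
    Same (f.lmap j φ x x' hx hx') (f.tdist t j a ≫ f.F.map (upd t j φ)) := by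
  have e : ∀ c, Function.update x' j c = Function.update t j c := by
    intro c
    funext l
    by_cases hl : l = j
    · subst hl; simp
    · rw [Function.update_of_ne hl, Function.update_of_ne hl, ht l hl]
  refine Same.comp (f.same_lam_tdist t j _ (fun r => (hx r).trans (e _)) fun l hl => ?_)
    (same_map_of_same _ fun l => ?_)
  · rw [Function.update_of_ne hl, ht l hl]
  · refine (same_comp_eqToHom_apply _ _ l).trans ?_
    by_cases hl : l = j
    · subst hl
      exact (same_upd_self _ _ _).trans (same_upd_self t l φ).symm
    · exact (same_upd_of_ne _ hl _).trans ((Same.id (ht l hl)).trans (same_upd_of_ne t hl φ).symm)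

theorem isId_tdist_one (t : ∀ i, (C i).Obj) (j : Fin k) (a : Fin 1 → (C j).Obj) :
    IsId (f.tdist t j a) := by
  rw [tdist_succ]
  exact (PermCat.isId_addMap ⟨rfl, rfl⟩ (f.isId_tdist_zero t j _)).comp
    (f.isId_dist_zero_right t j _)

theorem isId_map_upd (t : ∀ i, (C i).Obj) (j : Fin k) {c d : (C j).Obj} {g : c ⟶ d} (h : IsId g) :
    IsId (f.F.map (upd t j g)) := by
  obtain ⟨rfl, rfl⟩ := h
  rw [eqToHom_refl, upd_id, f.F.map_id]
  exact ⟨rfl, rfl⟩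

/-- The maps `lmap` are identities if `φ` or one of the other variables comes from the basepoint. -/
theorem isId_lmap (h : (∃ l, l ≠ j ∧ x' l = (C l).zero) ∨ ((∀ r, a r = (C j).zero) ∧ IsId φ)) :
    IsId (f.lmap j φ x x' hx hx') := by
  refine (f.isId_lam j _ ?_).comp ((same_map_of_same f.F fun l =>
    same_comp_eqToHom_apply _ _ l).isId ?_)
  · refine h.imp (fun ⟨l, hl, h⟩ => ⟨l, hl, (Function.update_of_ne hl ..).trans h⟩) fun h r => ?_
    rw [hx, Function.update_self, h.1]
  · obtain ⟨l, hl, h⟩ | h := h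
    · exact f.map_zero _ ⟨l, (Function.update_of_ne hl ..).trans h, isId_upd_of_ne _ hl _⟩
    · exact f.isId_map_upd _ _ h.2

/-- Morphisms of multilinear maps commute with iterated distributivity maps. -/
theorem lam_trans {f g : PermLin C D} (ξ : f ⟶ g) (j : Fin k) {m : ℕ}
    {x : Fin m → ∀ i, (C i).Obj} {z : ∀ i, (C i).Obj} (h : SumAt j x z) :
    D.sumMap (fun r => ξ.τ.app (x r)) ≫ g.lam j x z h = f.lam j x z h ≫ ξ.τ.app z := by
  induction m generalizing z with
  | zero =>
    exact Same.eq (.of_isId (IsId.comp ⟨rfl, rfl⟩ ⟨(g.obj_zero z ⟨j, h.1⟩).symm, rfl⟩)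
      (IsId.comp ⟨(f.obj_zero z ⟨j, h.1⟩).symm, rfl⟩ (ξ.app_zero z ⟨j, h.1⟩)) rfl)
  | succ m ih =>
    have aux : ∀ {a b a' b' c c' d d' : D.Obj} (p : a ⟶ a') (q : b ⟶ b') (l : b ⟶ c)
        (l' : b' ⟶ c') (t : c ⟶ c') (δ : D.add a c ⟶ d) (δ' : D.add a' c' ⟶ d') (s : d ⟶ d'),
        q ≫ l' = l ≫ t → δ ≫ s = D.addMap p t ≫ δ' →
        D.addMap p q ≫ D.addMap (𝟙 a') l' ≫ δ' = (D.addMap (𝟙 a) l ≫ δ) ≫ s := by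
      intro a b a' b' c c' d d' p q l l' t δ δ' s h h'
      rw [Category.assoc, h', ← reassoc_of% D.addMap_comp, ← reassoc_of% D.addMap_comp, h,
        Category.comp_id, Category.id_comp]
    exact aux _ _ _ _ _ _ _ _ (ih h.tail) (ξ.δ_comm _ _ _ _ _)

end PermLin

namespace PermLin

variable {k : ℕ} {C : Fin k → PermCat.{v, u}} {D : PermCat.{v', u'}} (f : PermLin C D)

theorem lmap_id (j : Fin k) (x : ∀ i, (C i).Obj) (h : ∀ _ : Fin 1, x = Function.update x j (x j)) :
    IsId (f.lmap j ((C j).underlyingData.id (x j)) (fun _ => x) x h rfl) := by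
  refine (f.same_lmap_tdist _ _ _ _ _ x fun _ _ => rfl).isId ?_
  exact (f.isId_tdist_one x j _).comp (f.isId_map_upd _ _ (PermCat.isId_id _))

theorem lmap_comp (j : Fin k) {n : ℕ} {b : Fin n → (C j).Obj} {c : (C j).Obj} {l : Fin n → ℕ}
    {a : ∀ i, Fin (l i) → (C j).Obj} (ψ : (C j).sum b ⟶ c) (φ : ∀ i, (C j).sum (a i) ⟶ b i)
    (x : ∀ i, Fin (l i) → ∀ i, (C i).Obj) (y : Fin n → ∀ i, (C i).Obj) (z : ∀ i, (C i).Obj)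
    (hx : ∀ i r, x i r = Function.update (y i) j (a i r)) (hy : ∀ i, y i j = b i)
    (hy' : ∀ i, y i = Function.update z j (b i)) (hz : z j = c)
    (hxz : ∀ s, flat x s = Function.update z j (flat a s)) :
    f.lmap j ((C j).underlyingData.comp (b := b) ψ φ) (flat x) z hxz hz =
      D.underlyingData.comp (b := fun i => f.F.obj (y i)) (f.lmap j ψ y z hy' hz)
        (fun i => f.lmap j (φ i) (x i) (y i) (hx i) (hy i)) := by
  have h₁ := f.same_lmap_tdist ψ y z hy' hz z fun _ _ => rfl
  have h₂ := fun i => f.same_lmap_tdist (φ i) (x i) (y i) (hx i) (hy i) z fun l hl => by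
    rw [hy' i, Function.update_of_ne hl]
  refine Same.eq ((f.same_lmap_tdist _ _ _ hxz hz z fun _ _ => rfl).trans ?_)
  refine Same.trans ?_ ((PermCat.same_comp (f.lmap j ψ y z hy' hz) fun i =>
    f.lmap j (φ i) (x i) (y i) (hx i) (hy i)).trans ((PermCat.same_sumMap h₂).comp h₁)).symm
  refine ((f.tdist_flat z j a).comp (f.same_map_upd z j (PermCat.same_comp ψ φ))).trans ?_
  refine .of_eq ?_
  rw [PermCat.sumMap_comp, upd_comp, f.F.map_comp]
  simp only [Category.assoc]
  rw [reassoc_of% f.tdist_naturality]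

theorem lmap_reindex (j : Fin k) {m n : ℕ} (e : Fin m ≃ Fin n) {a : Fin n → (C j).Obj}
    {a' : Fin m → (C j).Obj} {b : (C j).Obj} (h : ∀ i, a' i = a (e i)) (φ : (C j).sum a ⟶ b)
    (x : Fin n → ∀ i, (C i).Obj) (y : ∀ i, (C i).Obj)
    (hx : ∀ r, x r = Function.update y j (a r)) (hy : y j = b)
    (hx' : ∀ r, x (e r) = Function.update y j (a' r)) :
    f.lmap j ((C j).underlyingData.reindex e h φ) (fun r => x (e r)) y hx' hy =
      D.underlyingData.reindex e (fun _ => rfl) (f.lmap j φ x y hx hy) := by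
  obtain rfl : a' = fun i => a (e i) := funext h
  obtain rfl : x = fun r => Function.update y j (a r) := funext hx
  have h₁ := f.same_lmap_tdist φ _ y hx hy y fun _ _ => rfl
  refine Same.eq ((f.same_lmap_tdist _ _ _ hx' hy y fun _ _ => rfl).trans ?_)
  refine Same.trans ?_ ((PermCat.same_reindex e _ _).trans ((Same.refl _).comp h₁)).symm
  refine ((Same.refl _).comp (f.same_map_upd y j (PermCat.same_reindex e _ φ))).trans (.of_eq ?_)
  rw [upd_comp, f.F.map_comp, reassoc_of% f.tdist_perm]

/-- The actions on an `m`-morphism in the variable `i` and an `n`-morphism in the variable `j`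
commute up to the interchange of the order of summation. -/
theorem lmap_lmap (i j : Fin k) (hij : i ≠ j) {m n : ℕ} {a : Fin m → (C i).Obj} {a' : (C i).Obj}
    {b : Fin n → (C j).Obj} {b' : (C j).Obj} (φ : (C i).sum a ⟶ a') (ψ : (C j).sum b ⟶ b')
    (x : Fin m → Fin n → ∀ i, (C i).Obj) (p : Fin n → ∀ i, (C i).Obj)
    (q : Fin m → ∀ i, (C i).Obj) (t : ∀ i, (C i).Obj)
    (hi : t i = a') (hj : t j = b') (hp : ∀ s, p s = Function.update t j (b s))
    (hq : ∀ r, q r = Function.update t i (a r))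
    (hpx : ∀ s r, x r s = Function.update (p s) i (a r))
    (hqx : ∀ r s, x r s = Function.update (q r) j (b s))
    (hpi : ∀ s, p s i = a') (hqj : ∀ r, q r j = b') :
    D.sumMap (fun s => f.lmap i φ (fun r => x r s) (p s) (hpx s) (hpi s)) ≫ f.lmap j ψ p t hp hj =
      PermCat.transposeSum (fun s r => f.F.obj (x r s)) ≫
        D.sumMap (fun r => f.lmap j ψ (x r) (q r) (hqx r) (hqj r)) ≫ f.lmap i φ q t hq hi := by
  -- `P`, `Q` and `T` are the tuples with the sum of the `a r` in the place `i`, the sum of the `b s`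
  -- in the place `j`, or both. The morphisms `S s`, `S₀`, `R₁` are `φ` in the place `i`, and `R r`,
  -- `R₀`, `S₁` are `ψ` in the place `j`.
  let P : Fin n → ∀ i, (C i).Obj := fun s => Function.update (p s) i ((C i).sum a)
  let Q : Fin m → ∀ i, (C i).Obj := fun r => Function.update (q r) j ((C j).sum b)
  let T : ∀ i, (C i).Obj := Function.update (Function.update t i ((C i).sum a)) j ((C j).sum b)
  have Tj : T j = (C j).sum b := Function.update_self ..
  have Ti : T i = (C i).sum a := (Function.update_of_ne hij ..).trans (Function.update_self ..)
  have Tl : ∀ l, l ≠ i → l ≠ j → T l = t l := fun l h h' =>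
    (Function.update_of_ne h' ..).trans (Function.update_of_ne h ..)
  have Pj : ∀ s, P s j = b s := fun s => (Function.update_of_ne hij.symm ..).trans
    (by rw [hp, Function.update_self])
  have Pi : ∀ s, P s i = (C i).sum a := fun s => Function.update_self ..
  have Pl : ∀ s l, l ≠ i → l ≠ j → P s l = t l := fun s l h h' =>
    (Function.update_of_ne h ..).trans (by rw [hp, Function.update_of_ne h'])
  have Qi : ∀ r, Q r i = a r := fun s => (Function.update_of_ne hij ..).trans
    (by rw [hq, Function.update_self])
  have Qj : ∀ r, Q r j = (C j).sum b := fun s => Function.update_self ..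
  have Ql : ∀ r l, l ≠ i → l ≠ j → Q r l = t l := fun s l h h' =>
    (Function.update_of_ne h' ..).trans (by rw [hq, Function.update_of_ne h])
  have hpt : SumAt j P T := by
    refine ⟨Tj.trans (congrArg _ (funext fun s => (Pj s).symm)), fun l hl s => ?_⟩
    by_cases h : l = i
    · subst h; rw [Pi, Ti]
    · rw [Pl s l h hl, Tl l h hl]
  have hqt : SumAt i Q T := by
    refine ⟨Ti.trans (congrArg _ (funext fun s => (Qi s).symm)), fun l hl s => ?_⟩
    by_cases h : l = j
    · subst h; rw [Qj, Tj]
    · rw [Ql s l hl h, Tl l hl h]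
  have hp' : SumAt j p (Function.update t j ((C j).sum b)) := sumAt_update j hp
  have hq' : SumAt i q (Function.update t i ((C i).sum a)) := sumAt_update i hq
  have pi : ∀ s, p s i = a' := hpi
  have pj : ∀ s, p s j = b s := fun s => by rw [hp, Function.update_self]
  have qi : ∀ r, q r i = a r := fun s => by rw [hq, Function.update_self]
  choose S hS hS' using fun s => exists_step (x := P s) (y := p s) i φ (Pi s) (pi s)
    fun l hl => Function.update_of_ne hl ..
  choose R hR hR' using fun r => exists_step (x := Q r) (y := q r) j ψ (Qj r) (hqj r)
    fun l hl => Function.update_of_ne hl ..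
  obtain ⟨S₀, hS₀, hS₀'⟩ := exists_step (x := T) (y := Function.update t j ((C j).sum b)) i φ Ti
    ((Function.update_of_ne hij ..).trans hi) fun l hl => by
      by_cases h : l = j
      · subst h; rw [Tj, Function.update_self]
      · rw [Tl l hl h, Function.update_of_ne h]
  obtain ⟨R₀, hR₀, hR₀'⟩ := exists_step (x := T) (y := Function.update t i ((C i).sum a)) j ψ Tj
    ((Function.update_of_ne hij.symm ..).trans hj) fun l hl => by
      by_cases h : l = i
      · subst h; rw [Ti, Function.update_self]
      · rw [Tl l h hl, Function.update_of_ne h]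
  obtain ⟨S₁, hS₁, hS₁'⟩ := exists_step (x := Function.update t j ((C j).sum b)) (y := t) j ψ
    (Function.update_self ..) hj fun l hl => Function.update_of_ne hl ..
  obtain ⟨R₁, hR₁, hR₁'⟩ := exists_step (x := Function.update t i ((C i).sum a)) (y := t) i φ
    (Function.update_self ..) hi fun l hl => Function.update_of_ne hl ..
  have e : S₀ ≫ S₁ = R₀ ≫ R₁ := by
    refine pi_hom_ext fun l => ?_
    by_cases h : l = i
    · subst h
      exact (hS₀.comp_id (hS₁' l hij).same).trans (hR₁.id_comp (hR₀' l hij).same').symm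
    · by_cases h' : l = j
      · subst h'
        exact (hS₁.id_comp (hS₀' l hij.symm).same').trans (hR₀.comp_id (hR₁' l hij.symm).same).symm
      · exact .of_isId ((hS₀' l h).comp (hS₁' l h')) ((hR₀' l h').comp (hR₁' l h)) rfl
  have hx₁ : ∀ s, SumAt i (fun r => x r s) (P s) := fun s => sumAt_update i (hpx s)
  have hx₂ : ∀ r, SumAt j (x r) (Q r) := fun r => sumAt_update j (hqx r)
  rw [f.lmap_eq ψ p t hp hj hp' S₁ hS₁ hS₁', f.lmap_eq φ q t hq hi hq' R₁ hR₁ hR₁',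
    funext fun s => f.lmap_eq φ (fun r => x r s) (p s) (hpx s) (hpi s) (hx₁ s) (S s) (hS s) (hS' s),
    funext fun r => f.lmap_eq ψ (x r) (q r) (hqx r) (hqj r) (hx₂ r) (R r) (hR r) (hR' r),
    PermCat.sumMap_comp, PermCat.sumMap_comp]
  have n₁ := f.lam_naturality j hpt hp' S S₀ ((hS₀' j hij.symm).same.trans
    ((Same.id hpt.1).trans ?_)) fun l hl s => ?_
  have n₂ := f.lam_naturality i hqt hq' R R₀ ((hR₀' i hij).same.trans
    ((Same.id hqt.1).trans ?_)) fun l hl s => ?_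
  · simp only [Category.assoc]
    rw [reassoc_of% n₁, reassoc_of% n₂, ← f.F.map_comp, ← f.F.map_comp, e]
    have := f.lam_lam i j hij hx₁ hx₂ hpt hqt
    rw [reassoc_of% this]
  · exact (PermCat.isId_sumMap fun r => hR' r i hij).same.symm
  · by_cases h : l = j
    · subst h
      exact (hR s).trans hR₀.symm
    · exact .of_isId (hR' s l h) (hR₀' l h) (hqt.2 l hl s)
  · exact (PermCat.isId_sumMap fun r => hS' r j hij.symm).same.symm
  · by_cases h : l = i
    · subst h
      exact (hS s).trans hS₀.symm
    · exact .of_isId (hS' s l h) (hS₀' l h) (hpt.2 l hl s)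

/-- The multilinear map of the underlying based multicategories given by a multilinear map of
permutative categories. -/
def toMultiLin : MultiLin (fun i => (C i).multicat) D.multicat where
  obj := f.F.obj
  map j {m a a'} φ x x' hx hx' := f.lmap j (a := a) φ x x' hx hx'
  map_id j x h := Same.eq (.of_isId (f.lmap_id j x h) (PermCat.isId_id _) rfl)
  map_comp j n b c l a ψ φ x y z hx hy hy' hz hxz := f.lmap_comp j ψ φ x y z hx hy hy' hz hxz
  map_reindex j m n e a a' b h φ x y hx hy hx' := f.lmap_reindex j e h φ x y hx hy hx'
  bilinear i j hij {m n a a' b b'} φ ψ x p q t hi hj hp hq hpx hqx hpi hqj := by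
    refine Same.eq ((PermCat.same_comp (b := fun s => f.F.obj (p s))
      (f.lmap j (a := b) ψ p t hp hj)
      fun s => f.lmap i (a := a) φ (fun r => x r s) (p s) (hpx s) (hpi s)).trans ?_)
    refine Same.trans ?_ (PermCat.same_reindex (swapEquiv m n) _ _).symm
    rw [f.lmap_lmap i j hij φ ψ x p q t hi hj hp hq hpx hqx hpi hqj]
    exact (PermCat.same_transposeSum _).comp (PermCat.same_comp (b := fun r => f.F.obj (q r))
      (f.lmap i (a := a) φ q t hq hi) fun r => f.lmap j (a := b) ψ (x r) (q r) (hqx r) (hqj r)).symm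
  obj_base x h := f.obj_zero x h
  map_base j m a a' φ x x' hx hx' h := by
    rcases h with h | h
    · obtain ⟨h₁, h₂, h₃⟩ := PermCat.isId_of_fromBase h
      refine PermCat.fromBase_of_isId (f.isId_lmap φ x x' hx hx' (.inr ⟨h₂, h₁⟩)) (fun r => ?_)
        (f.obj_zero x' ⟨j, hx'.trans h₃⟩)
      exact f.obj_zero _ ⟨j, by rw [hx, Function.update_self]; exact h₂ r⟩
    · obtain ⟨i, hi, h⟩ := h
      refine PermCat.fromBase_of_isId (f.isId_lmap φ x x' hx hx' (.inl ⟨i, hi, h⟩)) (fun r => ?_)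
        (f.obj_zero x' ⟨i, h⟩)
      exact f.obj_zero _ ⟨i, by rw [hx, Function.update_of_ne hi]; exact h⟩

theorem lmap_trans {f g : PermLin C D} (ξ : f ⟶ g) {m : ℕ} {j : Fin k} {a : Fin m → (C j).Obj}
    {a' : (C j).Obj} (φ : (C j).sum a ⟶ a') (x : Fin m → ∀ i, (C i).Obj) (x' : ∀ i, (C i).Obj)
    (hx : ∀ r, x r = Function.update x' j (a r)) (hx' : x' j = a') :
    D.sumMap (fun r => ξ.τ.app (x r)) ≫ g.lmap j φ x x' hx hx' =
      f.lmap j φ x x' hx hx' ≫ ξ.τ.app x' := by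
  unfold lmap
  rw [← Category.assoc, lam_trans ξ, Category.assoc, Category.assoc, ξ.τ.naturality]

/-- The functor that takes a multilinear map of permutative categories to a multilinear map of the
underlying based multicategories. -/
def toMultiLinFunctor (C : Fin k → PermCat.{v, u}) (D : PermCat.{v', u'}) :
    PermLin C D ⥤ MultiLin (fun i => (C i).multicat) D.multicat where
  obj f := f.toMultiLin
  map {f g} ξ :=
    { app x := eqToHom (D.sum_one fun _ => f.F.obj x) ≫ ξ.τ.app x
      naturality j m a a' φ x x' hx hx' := by
        refine Same.eq ((PermCat.same_pre (C := D) (g.lmap j (a := a) φ x x' hx hx')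
          fun r => Same.eqToHom_comp _ (ξ.τ.app (x r))).trans (Same.trans (.of_eq ?_)
            (PermCat.same_post (C := D) (Same.eqToHom_comp _ (ξ.τ.app x'))
              (f.lmap j (a := a) φ x x' hx hx')).symm))
        exact lmap_trans ξ (a := a) φ x x' hx hx'
      app_base x hx := PermCat.fromBase_of_isId ((IsId.eqToHom _).comp (ξ.app_zero x hx))
        (fun _ => f.obj_zero x hx) (g.obj_zero x hx) }
  map_id f := MultiLin.Trans.ext (funext fun x => Category.comp_id _)
  map_comp {f g h} ξ η := MultiLin.Trans.ext (funext fun x => Same.eq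
    (((Same.eqToHom_comp _ _).trans ((Same.eqToHom_comp _ (ξ.τ.app x)).symm.comp (.refl _))).trans
      (PermCat.same_post (C := D) (Same.eqToHom_comp _ (η.τ.app x)) _).symm))

end PermLin

/-! ### Functors on a product of categories from functors in each variable -/

section Moves

variable {ι : Type w} {X : ι → Type u} [∀ i, Category.{v} (X i)]

/-- A morphism of tuples is its component in the place `j`, followed by the components in the other
places. -/
theorem exists_split {x y : ∀ i, X i} (u : x ⟶ y) (j : ι) :
    ∃ (w : ∀ i, X i) (s : x ⟶ w) (t : w ⟶ y), u = s ≫ t ∧ (∀ i, i ≠ j → IsId (s i)) ∧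
      IsId (t j) ∧ ∀ i, i ≠ j → Same (t i) (u i) := by
  have : ∀ i, ∃ (w : X i) (s : x i ⟶ w) (t : w ⟶ y i), u i = s ≫ t ∧ (i ≠ j → IsId s) ∧
      (i = j → IsId t) ∧ (i ≠ j → Same t (u i)) := by
    intro i
    by_cases h : i = j
    · exact ⟨y i, u i, 𝟙 _, by simp, fun h' => absurd h h', fun _ => ⟨rfl, rfl⟩,
        fun h' => absurd h h'⟩
    · exact ⟨x i, 𝟙 _, u i, by simp, fun _ => ⟨rfl, rfl⟩, fun h' => absurd h' h, fun _ => .refl _⟩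
  choose w s t h₁ h₂ h₃ h₄ using this
  exact ⟨w, s, t, funext h₁, h₂, h₃ j rfl, h₄⟩

theorem exists_hom_update [DecidableEq ι] {x y x₀ y₀ : ∀ i, X i} {j : ι} (u : x₀ ⟶ y₀) {c d : X j}
    (g : c ⟶ d) (hx : x = Function.update x₀ j c) (hy : y = Function.update y₀ j d) :
    ∃ s : x ⟶ y, Same (s j) g ∧ ∀ i, i ≠ j → Same (s i) (u i) := by
  subst hx hy
  exact PermLin.exists_update_hom u j g

theorem eq_update_of_isId [DecidableEq ι] {x y : ∀ i, X i} (s : x ⟶ y) {j : ι}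
    (h : ∀ i, i ≠ j → IsId (s i)) : x = Function.update y j (x j) := by
  funext i
  by_cases hi : i = j
  · subst hi
    exact (Function.update_self i (x i) y).symm
  · exact ((h i hi).1).trans (Function.update_of_ne hi (x j) y).symm

theorem isId_id_apply (x : ∀ i, X i) (i : ι) : IsId ((𝟙 x : x ⟶ x) i) := ⟨rfl, rfl⟩

/-- Induction on the number of places in which a morphism of tuples is not an identity. -/
theorem hom_step_induction {R : ∀ x y : (∀ i, X i), (x ⟶ y) → Prop} (S : Finset ι)
    (h₀ : ∀ (x y : ∀ i, X i) (u : x ⟶ y), (∀ i, IsId (u i)) → R x y u)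
    (h₁ : ∀ (x w y : ∀ i, X i) (s : x ⟶ w) (t : w ⟶ y), ∀ j ∈ S, (∀ i, i ≠ j → IsId (s i)) → R w y t →
      R x y (s ≫ t)) {x y : ∀ i, X i} (u : x ⟶ y) (h : ∀ i, i ∉ S → IsId (u i)) : R x y u := by
  classical
  induction S using Finset.induction_on generalizing x y with
  | empty => exact h₀ x y u fun i => h i (by simp)
  | insert j S hj ih =>
    obtain ⟨w, s, t, rfl, hs, ht, ht'⟩ := exists_split u j
    refine h₁ x w y s t j (by simp) hs (ih (fun x w y s t j hj => h₁ x w y s t j (by simp [hj])) t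
      fun i hi => ?_)
    by_cases hij : i = j
    · subst hij
      exact ht
    · exact (ht' i hij).isId (h i (by simp [hi, hij]))

variable (X) in
/-- A function on the objects of a product of categories that is a functor in each variable
separately, such that the functors for two variables commute. The action in the variable `j` is
defined on the morphisms of tuples that are identities in the other places. -/
structure Moves (E : Type u') [Category.{v'} E] where
  obj : (∀ i, X i) → E
  map : ∀ (j : ι) {x y : ∀ i, X i} (s : x ⟶ y), (∀ i, i ≠ j → IsId (s i)) → (obj x ⟶ obj y)
  map_isId : ∀ (j : ι) {x y : ∀ i, X i} (s : x ⟶ y) (h : ∀ i, i ≠ j → IsId (s i)), IsId (s j) →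
    IsId (map j s h)
  map_comp : ∀ (j : ι) {x y z : ∀ i, X i} (s : x ⟶ y) (t : y ⟶ z) (h : ∀ i, i ≠ j → IsId (s i))
    (h' : ∀ i, i ≠ j → IsId (t i)) (h'' : ∀ i, i ≠ j → IsId ((s ≫ t) i)),
    map j (s ≫ t) h'' = map j s h ≫ map j t h'
  map_swap : ∀ (i j : ι), i ≠ j → ∀ {x y y' z : ∀ i, X i} (s : x ⟶ y) (t : y ⟶ z) (t' : x ⟶ y')
    (s' : y' ⟶ z) (hs : ∀ l, l ≠ i → IsId (s l)) (ht : ∀ l, l ≠ j → IsId (t l))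
    (ht' : ∀ l, l ≠ j → IsId (t' l)) (hs' : ∀ l, l ≠ i → IsId (s' l)), s ≫ t = t' ≫ s' →
    map i s hs ≫ map j t ht = map j t' ht' ≫ map i s' hs'

namespace Moves

variable {E : Type u'} [Category.{v'} E] (F : Moves X E)

/-- The relation between a morphism of tuples, supported in the places of a list, and the composite
of the actions of its components in the order of the list. -/
def Fac : List ι → ∀ {x y : ∀ i, X i}, (x ⟶ y) → (F.obj x ⟶ F.obj y) → Prop
  | [], _, _, u, m => (∀ i, IsId (u i)) ∧ IsId m
  | j :: l, x, y, u, m => ∃ (w : ∀ i, X i) (s : x ⟶ w) (hs : ∀ i, i ≠ j → IsId (s i)) (t : w ⟶ y)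
      (n : F.obj w ⟶ F.obj y), u = s ≫ t ∧ IsId (t j) ∧ Fac l t n ∧ m = F.map j s hs ≫ n

theorem exists_fac (l : List ι) {x y : ∀ i, X i} (u : x ⟶ y) (h : ∀ i, i ∉ l → IsId (u i)) :
    ∃ m, F.Fac l u m := by
  induction l generalizing x with
  | nil =>
    have h' : ∀ i, IsId (u i) := fun i => h i (by simp)
    exact ⟨eqToHom (congrArg F.obj (funext fun i => (h' i).1)), h', _, rfl⟩
  | cons j l ih =>
    obtain ⟨w, s, t, hu, hs, ht, ht'⟩ := exists_split u j
    obtain ⟨n, hn⟩ := ih t fun i hi => by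
      by_cases hij : i = j
      · subst hij
        exact ht
      · exact (ht' i hij).isId (h i (by simp [hi, hij]))
    exact ⟨_, w, s, hs, t, n, hu, ht, hn, rfl⟩

variable {F}

/-- The relation `Fac` determines the composite. -/
theorem Fac.unique {l : List ι} {x y : ∀ i, X i} {u : x ⟶ y} {m m' : F.obj x ⟶ F.obj y}
    (h : F.Fac l u m) (h' : F.Fac l u m') : m = m' := by
  induction l generalizing x with
  | nil => exact Same.eq (.of_isId h.2 h'.2 rfl)
  | cons j l ih =>
    obtain ⟨w, s, hs, t, n, rfl, ht, hn, rfl⟩ := h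
    obtain ⟨w', s', hs', t', n', hu, ht', hn', rfl⟩ := h'
    have e : ∀ i, Same (s i) (s' i) ∧ Same (t i) (t' i) := by
      intro i
      have hi := congrFun hu i
      have hi' : s i ≫ t i = s' i ≫ t' i := hi
      by_cases hij : i = j
      · subst hij
        exact ⟨((Same.refl _).comp_id ht.same).symm.trans ((Same.of_eq hi').trans
          ((Same.refl _).comp_id ht'.same)), .of_isId ht ht' (ht.1.trans ht'.1.symm)⟩
      · exact ⟨.of_isId (hs i hij) (hs' i hij) rfl,
          ((Same.refl _).id_comp (hs i hij).same').symm.trans ((Same.of_eq hi').trans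
            ((Same.refl _).id_comp (hs' i hij).same'))⟩
    obtain rfl : w = w' := funext fun i => (e i).1.2.1
    obtain rfl : s = s' := pi_hom_ext fun i => (e i).1
    obtain rfl : t = t' := pi_hom_ext fun i => (e i).2
    rw [ih hn hn']

theorem map_id (j : ι) (x : ∀ i, X i) (h : ∀ i, i ≠ j → IsId ((𝟙 x : x ⟶ x) i)) :
    F.map j (𝟙 x) h = 𝟙 _ :=
  (F.map_isId j (𝟙 x) h (isId_id_apply x j)).same.eq

theorem fac_id (l : List ι) (x : ∀ i, X i) : F.Fac l (𝟙 x) (𝟙 _) := by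
  induction l with
  | nil => exact ⟨fun i => ⟨rfl, rfl⟩, rfl, rfl⟩
  | cons j l ih =>
    exact ⟨x, 𝟙 x, fun i _ => isId_id_apply x i, 𝟙 x, 𝟙 _, by simp, ⟨rfl, rfl⟩, ih, by rw [map_id]; simp⟩

theorem fac_map {l : List ι} {j : ι} (hj : j ∈ l) {x y : ∀ i, X i} (s : x ⟶ y)
    (hs : ∀ i, i ≠ j → IsId (s i)) : F.Fac l s (F.map j s hs) := by
  induction l with
  | nil => simp at hj
  | cons i l ih =>
    by_cases h : j = i
    · subst h
      exact ⟨y, s, hs, 𝟙 y, 𝟙 _, by simp, ⟨rfl, rfl⟩, fac_id l y, by simp⟩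
    · refine ⟨x, 𝟙 x, fun i _ => isId_id_apply x i, s, _, by simp, hs i (Ne.symm h), ih ?_, ?_⟩
      · simpa [h] using hj
      · rw [map_id, Category.id_comp]

/-- The action in a new variable can be moved to the front. -/
theorem Fac.comp_map {l : List ι} {x y z : ∀ i, X i} {t : x ⟶ y} {m : F.obj x ⟶ F.obj y}
    (h : F.Fac l t m) {i : ι} (hi : i ∉ l) (hti : IsId (t i)) (s : y ⟶ z)
    (hs : ∀ c, c ≠ i → IsId (s c)) :
    ∃ (w : ∀ i, X i) (s' : x ⟶ w) (hs' : ∀ c, c ≠ i → IsId (s' c)) (t' : w ⟶ z)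
      (m' : F.obj w ⟶ F.obj z), t ≫ s = s' ≫ t' ∧ IsId (t' i) ∧ (∀ c, c ≠ i → Same (t' c) (t c)) ∧
        F.Fac l t' m' ∧ m ≫ F.map i s hs = F.map i s' hs' ≫ m' := by
  induction l generalizing x with
  | nil =>
    obtain ⟨h, hm⟩ := h
    obtain rfl : x = y := funext fun i => (h i).1
    obtain rfl : t = 𝟙 x := pi_hom_ext fun i => (h i).same
    obtain rfl : m = 𝟙 _ := hm.same.eq
    exact ⟨z, s, hs, 𝟙 z, 𝟙 _, by simp, ⟨rfl, rfl⟩, fun c hc => (hs c hc).same'.symm.trans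
      (hs c hc).same, fac_id [] z, by simp⟩
  | cons j l ih =>
    obtain ⟨w, a, ha, b, n, rfl, hb, hn, rfl⟩ := h
    have hij : i ≠ j := fun h => hi (by simp [h])
    have hbi : IsId (b i) := ((Same.refl (b i)).id_comp (ha i hij).same').symm.isId hti
    obtain ⟨w₁, s₁, hs₁, b₁, n₁, e₁, hb₁, hb₁', hn₁, e₁'⟩ :=
      ih hn (fun h => hi (by simp [h])) hbi
    obtain ⟨w₂, s₂, a₁, e₂, hs₂, ha₁, ha₁'⟩ := exists_split (a ≫ s₁) i
    have ha₂ : ∀ c, c ≠ j → IsId (a₁ c) := by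
      intro c hc
      by_cases h : c = i
      · subst h; exact ha₁
      · exact (ha₁' c h).isId ((ha c hc).comp (hs₁ c h))
    have e : (a ≫ b) ≫ s = s₂ ≫ a₁ ≫ b₁ := by
      rw [Category.assoc, e₁, ← Category.assoc, e₂, Category.assoc]
    refine ⟨w₂, s₂, hs₂, a₁ ≫ b₁, F.map j a₁ ha₂ ≫ n₁, e, ha₁.comp hb₁, fun c hc =>
      ((ha₁' c hc).trans ((Same.refl _).comp_id (hs₁ c hc).same)).comp (hb₁' c hc),
      ⟨w₁, a₁, ha₂, b₁, n₁, rfl, (hb₁' j hij.symm).isId hb, hn₁, rfl⟩, ?_⟩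
    have e' := F.map_swap j i hij.symm a s₁ s₂ a₁ ha hs₁ hs₂ ha₂ e₂
    rw [Category.assoc, e₁', reassoc_of% e']

theorem Fac.comp {l : List ι} (hl : l.Nodup) {x y z : ∀ i, X i} {t : x ⟶ y} {t' : y ⟶ z}
    {m : F.obj x ⟶ F.obj y} {m' : F.obj y ⟶ F.obj z} (h : F.Fac l t m) (h' : F.Fac l t' m') :
    F.Fac l (t ≫ t') (m ≫ m') := by
  induction l generalizing x y with
  | nil => exact ⟨fun i => (h.1 i).comp (h'.1 i), h.2.comp h'.2⟩
  | cons j l ih =>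
    obtain ⟨w, a, ha, b, n, rfl, hb, hn, rfl⟩ := h
    obtain ⟨w', a', ha', b', n', rfl, hb', hn', rfl⟩ := h'
    obtain ⟨hj, hl⟩ := List.nodup_cons.1 hl
    obtain ⟨w₁, s₁, hs₁, b₁, n₁, e₁, hb₁, -, hn₁, e₁'⟩ := hn.comp_map hj hb a' ha'
    refine ⟨w₁, a ≫ s₁, fun i hi => (ha i hi).comp (hs₁ i hi), b₁ ≫ b', n₁ ≫ n', ?_, hb₁.comp hb',
      ih hl hn₁ hn', ?_⟩
    · simp only [Category.assoc]
      rw [reassoc_of% e₁]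
    · rw [F.map_comp j a s₁ ha hs₁]
      simp only [Category.assoc]
      rw [reassoc_of% e₁']

variable (F) [Fintype ι]

/-- The functor on the product category given by commuting functors in each variable. A morphism acts
by its components one after the other, in an order that does not matter. -/
noncomputable def functor : (∀ i, X i) ⥤ E where
  obj := F.obj
  map u := (F.exists_fac Finset.univ.toList u (by simp)).choose
  map_id x := (F.exists_fac Finset.univ.toList (𝟙 x) (by simp)).choose_spec.unique (fac_id _ x)
  map_comp u v := (F.exists_fac Finset.univ.toList (u ≫ v) (by simp)).choose_spec.unique
    ((F.exists_fac Finset.univ.toList u (by simp)).choose_spec.comp (Finset.nodup_toList _)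
      (F.exists_fac Finset.univ.toList v (by simp)).choose_spec)

theorem functor_map_eq (j : ι) {x y : ∀ i, X i} (s : x ⟶ y) (hs : ∀ i, i ≠ j → IsId (s i)) :
    F.functor.map s = F.map j s hs :=
  (F.exists_fac Finset.univ.toList s (by simp)).choose_spec.unique (fac_map (by simp) s hs)

end Moves

end Moves

/-! ### The action of a multilinear map on `1`-morphisms -/

namespace BasedMulticategory

variable {M : BasedMulticategory.{v, u}}

variable (M) in
/-- The category of objects and `1`-morphisms of a based multicategory. -/
def One : Type u := M.Obj

instance : Category.{v} M.One where
  Hom a b := M.Hom 1 (fun _ => a) b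
  id a := M.id a
  comp f g := post g f
  id_comp f := post_id_right f
  comp_id f := post_id f
  assoc f g h := post_post h g f

theorem pre_eq_post {a b c : M.Obj} (f : M.Hom 1 (fun _ => b) c) (u : M.Hom 1 (fun _ => a) b) :
    pre f (fun _ => u) = post f u := by
  refine reindex_congr (Equiv.ext fun i => ?_) _ _
  rw [unitL_symm, unitR_symm, Subsingleton.elim i 0]

/-- Commutative squares of `1`-morphisms and `m`-morphisms can be pasted along an `m`-morphism. -/
theorem square_comp {m : ℕ} {a b c : Fin m → M.Obj} {a' b' c' : M.Obj} {φ : M.Hom m a a'}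
    {χ : M.Hom m b b'} {ψ : M.Hom m c c'} {s : ∀ r, M.Hom 1 (fun _ => a r) (b r)}
    {t : ∀ r, M.Hom 1 (fun _ => b r) (c r)} {s' : M.Hom 1 (fun _ => a') b'}
    {t' : M.Hom 1 (fun _ => b') c'} (h : pre χ s = post s' φ) (h' : pre ψ t = post t' χ) :
    pre ψ (fun r => post (t r) (s r)) = post (post t' s') φ := by
  rw [← pre_pre, h', ← post_pre, h, post_post]

end BasedMulticategory

namespace MultiLin

open BasedMulticategory

variable {k : ℕ} {M : Fin k → BasedMulticategory.{v, u}} {N : BasedMulticategory.{v', u'}}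
  (g : MultiLin M N)

theorem map_congr {j : Fin k} {m : ℕ} {a b : Fin m → (M j).Obj} {a' b' : (M j).Obj}
    {φ : (M j).Hom m a a'} {ψ : (M j).Hom m b b'} (ha : a = b) (ha' : a' = b') (h : HEq φ ψ)
    {x y : Fin m → ∀ i, (M i).Obj} {x' y' : ∀ i, (M i).Obj} (hxy : x = y) (hxy' : x' = y')
    (hx : ∀ r, x r = Function.update x' j (a r)) (hx' : x' j = a')
    (hy : ∀ r, y r = Function.update y' j (b r)) (hy' : y' j = b') :
    HEq (g.map j φ x x' hx hx') (g.map j ψ y y' hy hy') := by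
  subst ha ha' hxy hxy'
  obtain rfl := eq_of_heq h
  rfl

theorem map_reindex_of_eq (j : Fin k) {m n : ℕ} (e : Fin m ≃ Fin n) {a : Fin n → (M j).Obj}
    {a' : Fin m → (M j).Obj} {b : (M j).Obj} (h : ∀ i, a' i = a (e i)) (φ : (M j).Hom n a b)
    (x : Fin n → ∀ i, (M i).Obj) (x' : Fin m → ∀ i, (M i).Obj) (y : ∀ i, (M i).Obj)
    (hx : ∀ r, x r = Function.update y j (a r)) (hy : y j = b)
    (hx' : ∀ r, x' r = Function.update y j (a' r)) (hxx : ∀ r, x' r = x (e r)) :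
    g.map j ((M j).reindex e h φ) x' y hx' hy =
      N.reindex e (fun r => congrArg g.obj (hxx r)) (g.map j φ x y hx hy) := by
  obtain rfl : x' = fun r => x (e r) := funext hxx
  exact g.map_reindex j e h φ x y hx hy hx'

theorem map_post (j : Fin k) {m : ℕ} {a : Fin m → (M j).Obj} {b c : (M j).Obj}
    (u : (M j).Hom 1 (fun _ => b) c) (φ : (M j).Hom m a b) (x : Fin m → ∀ i, (M i).Obj)
    (y z : ∀ i, (M i).Obj) (hx : ∀ r, x r = Function.update y j (a r)) (hy : y j = b)
    (hyz : ∀ _ : Fin 1, y = Function.update z j b) (hz : z j = c)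
    (hxz : ∀ r, x r = Function.update z j (a r)) :
    g.map j (post u φ) x z hxz hz = post (g.map j u (fun _ => y) z hyz hz) (g.map j φ x y hx hy) := by
  have h := fun s => (hxz _).trans (congrArg (Function.update z j) rfl :
    _ = Function.update z j (flat (fun _ : Fin 1 => a) s))
  refine (g.map_reindex_of_eq j _ _ _ (flat fun _ : Fin 1 => x) x z h hz hxz
    fun r => flat_unitL_symm x r).trans ?_
  rw [g.map_comp j u (fun _ => φ) (fun _ => x) (fun _ => y) z (fun _ => hx) (fun _ => hy) hyz hz h]
  rfl

theorem map_pre (j : Fin k) {m : ℕ} {a b : Fin m → (M j).Obj} {c : (M j).Obj}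
    (φ : (M j).Hom m b c) (u : ∀ r, (M j).Hom 1 (fun _ => a r) (b r)) (x y : Fin m → ∀ i, (M i).Obj)
    (z : ∀ i, (M i).Obj) (hx : ∀ r, ∀ _ : Fin 1, x r = Function.update (y r) j (a r))
    (hy : ∀ r, y r j = b r) (hyz : ∀ r, y r = Function.update z j (b r)) (hz : z j = c)
    (hxz : ∀ r, x r = Function.update z j (a r)) :
    g.map j (pre φ u) x z hxz hz =
      pre (g.map j φ y z hyz hz) fun r => g.map j (u r) (fun _ => x r) (y r) (hx r) (hy r) := by
  have h : ∀ s, flat (fun r (_ : Fin 1) => x r) s =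
    Function.update z j (flat (fun r (_ : Fin 1) => a r) s) := fun s => hxz _
  refine (g.map_reindex_of_eq j _ _ _ (flat fun r (_ : Fin 1) => x r) x z h hz hxz
    fun r => flat_unitR_symm x r).trans ?_
  rw [g.map_comp j φ u (fun r _ => x r) y z hx hy hyz hz h]
  rfl

theorem map_pre_post (j : Fin k) {m : ℕ} {a b : Fin m → (M j).Obj} {a' b' : (M j).Obj}
    (φ : (M j).Hom m a a') (ψ : (M j).Hom m b b') (u : ∀ r, (M j).Hom 1 (fun _ => a r) (b r))
    (u' : (M j).Hom 1 (fun _ => a') b') (h : pre ψ u = post u' φ) (y w : Fin m → ∀ i, (M i).Obj)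
    (y' w' : ∀ i, (M i).Obj) (hy : ∀ r, y r = Function.update y' j (a r)) (hy' : y' j = a')
    (hw : ∀ r, w r = Function.update w' j (b r)) (hw' : w' j = b')
    (hyw : ∀ r, ∀ _ : Fin 1, y r = Function.update (w r) j (a r)) (hwj : ∀ r, w r j = b r)
    (hyw' : ∀ _ : Fin 1, y' = Function.update w' j a') :
    pre (g.map j ψ w w' hw hw') (fun r => g.map j (u r) (fun _ => y r) (w r) (hyw r) (hwj r)) =
      post (g.map j u' (fun _ => y') w' hyw' hw') (g.map j φ y y' hy hy') := by
  have hyw₁ : ∀ r, y r = Function.update w' j (a r) := fun r => by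
    rw [hy, hyw' 0, Function.update_idem]
  rw [← g.map_pre j ψ u y w w' hyw hwj hw hw' hyw₁, ← g.map_post j u' φ y y' w' hy hy' hyw' hw' hyw₁]
  exact eq_of_heq (g.map_congr rfl rfl (heq_of_eq h) rfl rfl _ _ _ _)

/-- The action of a multilinear map on a `1`-morphism commutes with the action on an `n`-morphism in
a different variable. -/
theorem map_exchange {i j : Fin k} (hij : i ≠ j) {c c' : (M i).Obj}
    (u : (M i).Hom 1 (fun _ => c) c') {n : ℕ} {b : Fin n → (M j).Obj} {b' : (M j).Obj}
    (φ : (M j).Hom n b b') (x y : Fin n → ∀ i, (M i).Obj) (x' y' : ∀ i, (M i).Obj)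
    (hx : ∀ r, x r = Function.update x' j (b r)) (hx' : x' j = b')
    (hy : ∀ r, y r = Function.update y' j (b r)) (hy' : y' j = b')
    (hxy : ∀ r, ∀ _ : Fin 1, x r = Function.update (y r) i c) (hyi : ∀ r, y r i = c')
    (hxy' : ∀ _ : Fin 1, x' = Function.update y' i c) (hyi' : y' i = c') :
    pre (g.map j φ y y' hy hy') (fun r => g.map i u (fun _ => x r) (y r) (hxy r) (hyi r)) =
      post (g.map i u (fun _ => x') y' hxy' hyi') (g.map j φ x x' hx hx') := by
  have h := g.bilinear i j hij u φ (fun _ s => x s) y (fun _ => x') y' hyi' hy' hy hxy' hxy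
    (fun _ => hx) hyi (fun _ => hx')
  unfold pre
  rw [h, N.isBased.reindex_trans]
  refine reindex_congr (Equiv.ext fun r => ?_) _ _
  rw [Equiv.trans_apply, unitR_symm, unitL_symm]
  simp [swapEquiv]

/-- A multilinear map is a functor on `1`-morphisms in each variable. -/
def moves : Moves (fun i => (M i).One) N.One where
  obj := g.obj
  map j {x y} s h := g.map j (s j) (fun _ => x) y (fun _ => eq_update_of_isId s h) rfl
  map_isId j {x y} s h hj := by
    have hs : ∀ i, IsId (s i) := fun i => by
      by_cases hi : i = j
      · subst hi; exact hj
      · exact h i hi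
    obtain rfl : x = y := funext fun i => (hs i).1
    obtain rfl : s = 𝟙 x := pi_hom_ext fun i => (hs i).same
    exact ⟨rfl, g.map_id j x _⟩
  map_comp j x y z s t h h' h'' := g.map_post j (t j) (s j) (fun _ => x) y z _ _ _ _ _
  map_swap i j hij x y y' z s t t' s' hs ht ht' hs' e := by
    have e' : ∀ l, s l ≫ t l = t' l ≫ s' l := fun l => congrFun e l
    have h₁ : Same (s i) (s' i) := ((Same.refl _).comp_id (ht i hij).same).symm.trans
      ((Same.of_eq (e' i)).trans ((Same.refl _).id_comp (ht' i hij).same'))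
    have h₂ : Same (t j) (t' j) := ((Same.refl _).id_comp (hs j hij.symm).same').symm.trans
      ((Same.of_eq (e' j)).trans ((Same.refl _).comp_id (hs' j hij.symm).same))
    have hs₁ := eq_update_of_isId s hs
    have ht₁ := eq_update_of_isId t' ht'
    have ht₂ : y = Function.update z j (x j) := (eq_update_of_isId t ht).trans
      (congrArg (Function.update z j) h₂.1)
    have hs₂ : y' = Function.update z i (x i) := (eq_update_of_isId s' hs').trans
      (congrArg (Function.update z i) h₁.1.symm)
    have e₁ := eq_of_heq (g.map_congr (funext fun _ : Fin 1 => h₁.1) h₁.2.1 h₁.heq rfl rfl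
      (fun _ => hs₂) h₁.2.1.symm (fun _ => eq_update_of_isId s' hs') rfl)
    have e₂ := eq_of_heq (g.map_congr (funext fun _ : Fin 1 => h₂.1) h₂.2.1 h₂.heq rfl rfl
      (fun _ => eq_update_of_isId t ht) rfl (fun _ => ht₂) h₂.2.1)
    refine (congrArg₂ (fun a b => post a b) e₂ rfl).trans (Eq.trans ?_
      (congrArg₂ (fun a b => post a b) e₁ rfl))
    rw [← pre_eq_post]
    exact g.map_exchange hij (s i) (t' j) (fun _ => x) (fun _ => y) y' z (fun _ => ht₁) rfl
      (fun _ => ht₂) h₂.2.1 (fun _ _ => hs₁) (fun _ => rfl) (fun _ => hs₂) h₁.2.1.symm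

/-- The functor on `1`-morphisms given by a multilinear map. -/
noncomputable def onOne : (∀ i, (M i).One) ⥤ N.One := g.moves.functor

/-- On a `1`-morphism in one variable, the functor `onOne` is the action of the multilinear map. -/
theorem onOne_map_step (j : Fin k) {x y : ∀ i, (M i).One} (s : x ⟶ y)
    (hs : ∀ i, i ≠ j → IsId (s i)) {c d : (M j).One} {u : c ⟶ d} (hj : Same (s j) u)
    (hx : ∀ _ : Fin 1, x = Function.update y j c) (hy : y j = d) :
    g.onOne.map s = g.map j (m := 1) (a := fun _ => c) (a' := d) u (fun _ => x) y hx hy :=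
  (g.moves.functor_map_eq j s hs).trans (eq_of_heq (g.map_congr (funext fun _ => hj.1) hj.2.1
    hj.heq rfl rfl (fun _ => eq_update_of_isId s hs) rfl hx hy))

variable {g} in
/-- A morphism of multilinear maps is natural with respect to `1`-morphisms in all variables. -/
def Trans.onOne {g' : MultiLin M N} (σ : g ⟶ g') : g.onOne ⟶ g'.onOne where
  app x := σ.app x
  naturality x y u := by
    let τ : ∀ x, g.onOne.obj x ⟶ g'.onOne.obj x := fun x => σ.app x
    refine homFactor u (fun x y u => g.onOne.map u ≫ τ y = τ x ≫ g'.onOne.map u) ?_ ?_ ?_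
    · intro x
      rw [g.onOne.map_id, g'.onOne.map_id]
      exact (Category.id_comp (τ x)).trans (Category.comp_id (τ x)).symm
    · intro x y z s t h h'
      rw [Functor.map_comp, Functor.map_comp, Category.assoc, h', reassoc_of% h]
    · intro x y s j hs
      have hx := fun _ : Fin 1 => eq_update_of_isId s hs
      rw [g.onOne_map_step j s hs (.refl _) hx rfl, g'.onOne_map_step j s hs (.refl _) hx rfl]
      exact (σ.naturality j (s j) (fun _ => x) y hx rfl).symm.trans (pre_eq_post _ _)

theorem onOne_square_comp {m : ℕ} {x y z : Fin m → ∀ i, (M i).One} {x' y' z' : ∀ i, (M i).One}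
    (s : ∀ r, x r ⟶ y r) (t : ∀ r, y r ⟶ z r) (s' : x' ⟶ y') (t' : y' ⟶ z')
    {φ : N.Hom m (fun r => g.obj (x r)) (g.obj x')} {χ : N.Hom m (fun r => g.obj (y r)) (g.obj y')}
    {ψ : N.Hom m (fun r => g.obj (z r)) (g.obj z')}
    (h : pre χ (fun r => g.onOne.map (s r)) = post (g.onOne.map s') φ)
    (h' : pre ψ (fun r => g.onOne.map (t r)) = post (g.onOne.map t') χ) :
    pre ψ (fun r => g.onOne.map (s r ≫ t r)) = post (g.onOne.map (s' ≫ t')) φ := by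
  refine (congrArg (fun u => pre ψ u) (funext fun r => g.onOne.map_comp (s r) (t r))).trans ?_
  refine Eq.trans ?_ (congrArg (fun u => post u φ) (g.onOne.map_comp s' t').symm)
  exact square_comp h h'

/-- The naturality of a multilinear map with respect to `1`-morphisms in the variables other than
`j`, at an `n`-morphism in the variable `j`. -/
theorem onOne_naturality_of_ne (j : Fin k) {m : ℕ} {b : Fin m → (M j).One} {b' : (M j).One}
    (φ : (M j).Hom m b b') {w' z' : ∀ i, (M i).One} (U' : w' ⟶ z') (hU' : IsId (U' j))
    {w z : Fin m → ∀ i, (M i).One} (hw : ∀ r, w r = Function.update w' j (b r)) (hw' : w' j = b')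
    (hz : ∀ r, z r = Function.update z' j (b r)) (hz' : z' j = b') (U : ∀ r, w r ⟶ z r)
    (hU : ∀ r, IsId (U r j)) (hUU : ∀ r l, l ≠ j → Same (U r l) (U' l)) :
    pre (g.map j φ z z' hz hz') (fun r => g.onOne.map (U r)) =
      post (g.onOne.map U') (g.map j φ w w' hw hw') := by
  have key := hom_step_induction (Finset.univ.erase j) (X := fun i => (M i).One) (u := U')
    (R := fun w' z' U' => ∀ (w z : Fin m → ∀ i, (M i).One)
      (hw : ∀ r, w r = Function.update w' j (b r)) (hw' : w' j = b')
      (hz : ∀ r, z r = Function.update z' j (b r)) (hz' : z' j = b') (U : ∀ r, w r ⟶ z r)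
      (hU : ∀ r, IsId (U r j)) (hUU : ∀ r l, l ≠ j → Same (U r l) (U' l)),
    pre (g.map j φ z z' hz hz') (fun r => g.onOne.map (U r)) =
      post (g.onOne.map U') (g.map j φ w w' hw hw')) ?_ ?_ ?_
  · exact key w z hw hw' hz hz' U hU hUU
  · intro w' z' U' hU' w z hw hw' hz hz' U hU hUU
    obtain rfl : w' = z' := funext fun i => (hU' i).1
    obtain rfl : U' = 𝟙 w' := pi_hom_ext fun i => (hU' i).same
    have hU₁ : ∀ r i, IsId (U r i) := fun r i => by
      by_cases hi : i = j
      · subst hi; exact hU r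
      · exact (hUU r i hi).isId (hU' i)
    obtain rfl : w = z := funext fun r => funext fun i => (hU₁ r i).1
    obtain rfl : U = fun r => 𝟙 (w r) := funext fun r => pi_hom_ext fun i => (hU₁ r i).same
    exact (congrArg (fun u => pre (g.map j φ w w' hz hz') u) (funext fun r =>
      g.onOne.map_id (w r))).trans ((pre_id _).trans ((post_id _).symm.trans
        (congrArg (fun u => post u (g.map j φ w w' hw hw')) (g.onOne.map_id w').symm)))
  · intro w' v' z' s' t' i hi hs' ih w z hw hw' hz hz' U hU hUU
    have hij : i ≠ j := (Finset.mem_erase.1 hi).1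
    have hv' : v' j = b' := (hs' j hij.symm).1.symm.trans hw'
    let v : Fin m → ∀ i, (M i).One := fun r => Function.update v' j (b r)
    choose s hs hsl using fun r => exists_hom_update s' (𝟙 (b r)) (hw r) (rfl : v r = _)
    choose t ht htl using fun r => exists_hom_update t' (𝟙 (b r)) (rfl : v r = _) (hz r)
    have e : U = fun r => s r ≫ t r := funext fun r => pi_hom_ext fun l => by
      by_cases hl : l = j
      · subst hl
        exact .of_isId (hU r) ((IsId.of_same (hs r)).comp (.of_same (ht r))) rfl
      · exact (hUU r l hl).trans ((hsl r l hl).comp (htl r l hl)).symm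
    have hs₁ : ∀ r l, l ≠ i → IsId (s r l) := fun r l hl => by
      by_cases hlj : l = j
      · subst hlj; exact .of_same (hs r)
      · exact (hsl r l hlj).isId (hs' l hl)
    have hx := fun r (_ : Fin 1) => (eq_update_of_isId (s r) (hs₁ r)).trans
      (congrArg (Function.update (v r) i) (hsl r i hij).1)
    have hx' := fun _ : Fin 1 => eq_update_of_isId s' hs'
    have step := g.map_exchange hij (s' i) φ w v w' v' hw hw' (fun r => rfl) hv' hx
      (fun r => Function.update_of_ne hij ..) hx' rfl
    subst e
    have e₁ := ih v z (fun r => rfl) hv' hz hz' t (fun r => .of_same (ht r)) htl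
    have e₂ := g.onOne_map_step i s' hs' (.refl _) hx' rfl
    have e₃ := funext fun r => g.onOne_map_step i (s r) (hs₁ r) (hsl r i hij) (hx r)
      (Function.update_of_ne hij ..)
    exact g.onOne_square_comp s t s' t' (((congrArg (fun u => pre _ u) e₃).trans step).trans
      (congrArg (fun u => post u _) e₂.symm)) e₁
  · intro i hi
    obtain rfl : i = j := by simpa using hi
    exact hU'

/-- A multilinear map takes commutative squares of `1`-morphisms and `n`-morphisms, in the variable
`j`, to such squares. -/
theorem onOne_naturality (j : Fin k) {m : ℕ} {a b : Fin m → (M j).One} {a' b' : (M j).One}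
    (φ : (M j).Hom m a a') (ψ : (M j).Hom m b b') (u : ∀ r, a r ⟶ b r) (u' : a' ⟶ b')
    (h : pre ψ u = post u' φ) {y' z' : ∀ i, (M i).One} {y z : Fin m → ∀ i, (M i).One}
    (hy : ∀ r, y r = Function.update y' j (a r)) (hy' : y' j = a')
    (hz : ∀ r, z r = Function.update z' j (b r)) (hz' : z' j = b') (U : ∀ r, y r ⟶ z r)
    (U' : y' ⟶ z') (hU : ∀ r, Same (U r j) (u r)) (hU' : Same (U' j) u')
    (hUU : ∀ r l, l ≠ j → Same (U r l) (U' l)) :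
    pre (g.map j ψ z z' hz hz') (fun r => g.onOne.map (U r)) =
      post (g.onOne.map U') (g.map j φ y y' hy hy') := by
  have hy₁ : y' = Function.update y' j a' := by rw [← hy', Function.update_eq_self]
  have hz₁ : z' = Function.update z' j b' := by rw [← hz', Function.update_eq_self]
  -- The morphisms are factored into a step in the variable `j`, which is treated by the functoriality
  -- in this variable, and a morphism that is an identity there.
  let w' : ∀ i, (M i).One := Function.update y' j b'
  let w : Fin m → ∀ i, (M i).One := fun r => Function.update y' j (b r)
  have idem : ∀ c d : (M j).One, Function.update (Function.update y' j c) j d =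
    Function.update y' j d := fun c d => Function.update_idem (β := fun i => (M i).One) c d y'
  have hw : ∀ r, w r = Function.update w' j (b r) := fun r => (idem b' (b r)).symm
  have hw' : w' j = b' := Function.update_self ..
  obtain ⟨s', hs', hsl'⟩ := exists_hom_update (𝟙 y') u' hy₁ (rfl : w' = _)
  obtain ⟨t', ht', htl'⟩ := exists_hom_update U' (𝟙 b') (rfl : w' = _) hz₁
  choose s hs hsl using fun r => exists_hom_update (𝟙 y') (u r) (hy r) (rfl : w r = _)
  choose t ht htl using fun r => exists_hom_update U' (𝟙 (b r)) (rfl : w r = _) (hz r)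
  have e' : U' = s' ≫ t' := pi_hom_ext fun l => by
    by_cases hl : l = j
    · subst hl
      exact hU'.trans (hs'.comp_id (IsId.of_same ht').same).symm
    · exact (htl' l hl).symm.trans ((Same.refl _).id_comp ((hsl' l hl).isId
        (isId_id_apply y' l)).same').symm
  have e : U = fun r => s r ≫ t r := funext fun r => pi_hom_ext fun l => by
    by_cases hl : l = j
    · subst hl
      exact (hU r).trans ((hs r).comp_id (IsId.of_same (ht r)).same).symm
    · exact (hUU r l hl).trans ((htl r l hl).symm.trans ((Same.refl _).id_comp ((hsl r l hl).isId
        (isId_id_apply y' l)).same').symm)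
  subst e e'
  have e₁ := g.onOne_naturality_of_ne j ψ t' (.of_same ht') hw hw' hz hz' t
    (fun r => .of_same (ht r)) fun r l hl => (htl r l hl).trans (htl' l hl).symm
  have step := g.map_pre_post j φ ψ u u' h y w y' w' hy hy' hw hw'
    (fun r _ => (hy r).trans (idem (b r) (a r)).symm) (fun r => Function.update_self ..)
    (fun _ => hy₁.trans (idem b' a').symm)
  have e₂ := g.onOne_map_step j s' (fun l hl => (hsl' l hl).isId (isId_id_apply y' l)) hs'
    (fun _ => hy₁.trans (idem b' a').symm) hw'
  have e₃ := funext fun r => g.onOne_map_step j (s r)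
    (fun l hl => (hsl r l hl).isId (isId_id_apply y' l)) (hs r)
    (fun _ => (hy r).trans (idem (b r) (a r)).symm) (Function.update_self ..)
  exact g.onOne_square_comp s t s' t' (((congrArg (fun u => pre _ u) e₃).trans step).trans
    (congrArg (fun u => post u _) e₂.symm)) e₁

end MultiLin

/-! ### Composition of multilinear maps -/

section Unflat

variable {n : ℕ} {k : Fin n → ℕ} {α : ∀ i, Fin (k i) → Type u}

/-- The family of tuples whose concatenation is a given tuple. -/
noncomputable def unflatten (x : ∀ s : Fin (∑ i, k i), α (blk s) (pos s)) : ∀ i j, α i j :=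
  (unflat x).choose

theorem flat_unflatten (x : ∀ s : Fin (∑ i, k i), α (blk s) (pos s)) : flat (unflatten x) = x :=
  (unflat x).choose_spec.symm

theorem of_flat {P : ∀ i (_ : Fin (k i)), Prop} (h : ∀ s : Fin (∑ i, k i), P (blk s) (pos s))
    (i : Fin n) (j : Fin (k i)) : P i j := by
  have e := finSigmaFinEquiv.symm_apply_apply (⟨i, j⟩ : (i : Fin n) × Fin (k i))
  have : (fun p : (i : Fin n) × Fin (k i) => P p.1 p.2)
    (finSigmaFinEquiv.symm (finSigmaFinEquiv ⟨i, j⟩)) := h _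
  rw [e] at this
  exact this

theorem flat_injective {x y : ∀ i j, α i j} (h : flat x = flat y) : x = y :=
  funext fun i => funext fun j => of_flat (P := fun i j => x i j = y i j) (congrFun h) i j

theorem unflatten_flat (x : ∀ i j, α i j) : unflatten (flat x) = x :=
  flat_injective (flat_unflatten _)

theorem unflatten_apply (x : ∀ s : Fin (∑ i, k i), α (blk s) (pos s)) (s : Fin (∑ i, k i)) :
    unflatten x (blk s) (pos s) = x s :=
  congrFun (flat_unflatten x) s

/-- The family of tuples `x` is obtained from `x'` by putting `c` in a given place. -/
def UpdAt (p : (i : Fin n) × Fin (k i)) (x x' : ∀ i j, α i j) (c : α p.1 p.2) : Prop :=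
  x p.1 = Function.update (x' p.1) p.2 c ∧ ∀ i, i ≠ p.1 → x i = x' i

theorem updAt_of_flat {s : Fin (∑ i, k i)} {x x' : ∀ i j, α i j} {c : α (blk s) (pos s)}
    (h : flat x = Function.update (β := fun s => α (blk s) (pos s)) (flat x') s c) :
    UpdAt (finSigmaFinEquiv.symm s) x x' c := by
  have key : ∀ i (j : Fin (k i)), (⟨i, j⟩ : (i : Fin n) × Fin (k i)) ≠ finSigmaFinEquiv.symm s →
      x i j = x' i j := by
    refine of_flat fun t ht => ?_
    refine (congrFun h t).trans (Function.update_of_ne ?_ ..)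
    rintro rfl
    exact ht rfl
  refine ⟨funext fun j => ?_, fun i hi => funext fun j => key i j fun h => hi (congrArg (·.1) h)⟩
  by_cases hj : j = pos s
  · subst hj
    exact ((congrFun h s).trans (Function.update_self ..)).trans (Function.update_self ..).symm
  · refine (key _ j fun h => hj ?_).trans (Function.update_of_ne hj ..).symm
    exact eq_of_heq (Sigma.mk.inj_iff.1 h).2

theorem updAt_unflatten {s : Fin (∑ i, k i)} {x x' : ∀ s : Fin (∑ i, k i), α (blk s) (pos s)}
    {c : α (blk s) (pos s)} (h : x = Function.update x' s c) :
    UpdAt (finSigmaFinEquiv.symm s) (unflatten x) (unflatten x') c :=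
  updAt_of_flat (by rw [flat_unflatten, flat_unflatten]; exact h)

end Unflat

namespace MultiLin

open BasedMulticategory

variable {n : ℕ} {k : Fin n → ℕ} {M : ∀ i, Fin (k i) → BasedMulticategory.{v, u}}
  {N : Fin n → BasedMulticategory.{v, u}} {L : BasedMulticategory.{v, u}} (g : MultiLin N L)
  (f : ∀ i, MultiLin (M i) (N i))

section Cmap

variable {p : (i : Fin n) × Fin (k i)}

variable {f} in
/-- The inner maps take tuples that differ in one place to tuples that differ in the block of this
place. -/
theorem _root_.PermMult.UpdAt.obj_eq {x x' : ∀ i j, (M i j).Obj} {c : (M p.1 p.2).Obj}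
    (h : UpdAt p x x' c) :
    (fun i => (f i).obj (x i)) =
      Function.update (fun i => (f i).obj (x' i)) p.1 ((f p.1).obj (x p.1)) := by
  funext i
  by_cases hi : i = p.1
  · subst hi
    rw [Function.update_self]
  · rw [Function.update_of_ne hi, h.2 i hi]

/-- The action of the composite of multilinear maps on a morphism in the place `p.2` of the block
`p.1`. -/
def cmap (p : (i : Fin n) × Fin (k i)) {m : ℕ} {a : Fin m → (M p.1 p.2).Obj}
    {a' : (M p.1 p.2).Obj} (φ : (M p.1 p.2).Hom m a a') (x : Fin m → ∀ i j, (M i j).Obj)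
    (x' : ∀ i j, (M i j).Obj) (hx : ∀ r, UpdAt p (x r) x' (a r)) (hx' : x' p.1 p.2 = a') :
    L.Hom m (fun r => g.obj fun i => (f i).obj (x r i)) (g.obj fun i => (f i).obj (x' i)) :=
  g.map p.1 ((f p.1).map p.2 φ (fun r => x r p.1) (x' p.1) (fun r => (hx r).1) hx')
    (fun r i => (f i).obj (x r i)) (fun i => (f i).obj (x' i)) (fun r => (hx r).obj_eq) rfl

theorem cmap_congr {p q : (i : Fin n) × Fin (k i)} (hpq : p = q) {m : ℕ}
    {a : Fin m → (M p.1 p.2).Obj} {a' : (M p.1 p.2).Obj} {b : Fin m → (M q.1 q.2).Obj}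
    {b' : (M q.1 q.2).Obj} {φ : (M p.1 p.2).Hom m a a'} {ψ : (M q.1 q.2).Hom m b b'}
    (ha : HEq a b) (ha' : HEq a' b') (h : HEq φ ψ) {x y : Fin m → ∀ i j, (M i j).Obj}
    {x' y' : ∀ i j, (M i j).Obj} (hxy : x = y) (hxy' : x' = y') (hx : ∀ r, UpdAt p (x r) x' (a r))
    (hx' : x' p.1 p.2 = a') (hy : ∀ r, UpdAt q (y r) y' (b r)) (hy' : y' q.1 q.2 = b') :
    HEq (cmap g f p φ x x' hx hx') (cmap g f q ψ y y' hy hy') := by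
  subst hpq
  obtain rfl := eq_of_heq ha
  obtain rfl := eq_of_heq ha'
  obtain rfl := eq_of_heq h
  subst hxy hxy'
  rfl

theorem cmap_id {c : (M p.1 p.2).Obj} (x : ∀ i j, (M i j).Obj) (h : ∀ _ : Fin 1, UpdAt p x x c)
    (hc : x p.1 p.2 = c) : cmap g f p ((M p.1 p.2).id c) (fun _ => x) x h hc = L.id _ := by
  subst hc
  have e := (f p.1).map_id p.2 (x p.1) fun r => (h r).1
  unfold cmap
  rw [e]
  exact g.map_id p.1 (fun i => (f i).obj (x i)) fun r => (h r).obj_eq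

theorem cmap_comp {m : ℕ} {b : Fin m → (M p.1 p.2).Obj} {c : (M p.1 p.2).Obj} {l : Fin m → ℕ}
    {a : ∀ i, Fin (l i) → (M p.1 p.2).Obj} (ψ : (M p.1 p.2).Hom m b c)
    (φ : ∀ i, (M p.1 p.2).Hom (l i) (a i) (b i))
    (x : ∀ i, Fin (l i) → ∀ i j, (M i j).Obj) (y : Fin m → ∀ i j, (M i j).Obj)
    (z : ∀ i j, (M i j).Obj) (hx : ∀ i r, UpdAt p (x i r) (y i) (a i r))
    (hy : ∀ i, y i p.1 p.2 = b i) (hyz : ∀ i, UpdAt p (y i) z (b i)) (hz : z p.1 p.2 = c)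
    (hxz : ∀ s, UpdAt p (flat x s) z (flat a s)) :
    cmap g f p ((M p.1 p.2).comp ψ φ) (flat x) z hxz hz =
      L.comp (cmap g f p ψ y z hyz hz) (fun i => cmap g f p (φ i) (x i) (y i) (hx i) (hy i)) := by
  have e := (f p.1).map_comp p.2 ψ φ (fun i r => x i r p.1) (fun i => y i p.1) (z p.1)
    (fun i r => (hx i r).1) hy (fun i => (hyz i).1) hz fun s => (hxz s).1
  have e' := g.map_comp p.1 ((f p.1).map p.2 ψ (fun i => y i p.1) (z p.1) (fun i => (hyz i).1) hz)
    (fun i => (f p.1).map p.2 (φ i) (fun r => x i r p.1) (y i p.1) (fun r => (hx i r).1) (hy i))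
    (fun i r l => (f l).obj (x i r l)) (fun i l => (f l).obj (y i l)) (fun l => (f l).obj (z l))
    (fun i r => (hx i r).obj_eq) (fun i => rfl) (fun i => (hyz i).obj_eq) rfl
    fun s => (hxz s).obj_eq
  refine Eq.trans ?_ e'
  exact eq_of_heq (g.map_congr rfl rfl (heq_of_eq e) rfl rfl _ _ _ _)

theorem cmap_reindex {m l : ℕ} (e : Fin m ≃ Fin l) {a : Fin l → (M p.1 p.2).Obj}
    {a' : Fin m → (M p.1 p.2).Obj} {b : (M p.1 p.2).Obj} (h : ∀ i, a' i = a (e i))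
    (φ : (M p.1 p.2).Hom l a b) (x : Fin l → ∀ i j, (M i j).Obj) (y : ∀ i j, (M i j).Obj)
    (hx : ∀ r, UpdAt p (x r) y (a r)) (hy : y p.1 p.2 = b)
    (hx' : ∀ r, UpdAt p (x (e r)) y (a' r)) :
    cmap g f p ((M p.1 p.2).reindex e h φ) (fun r => x (e r)) y hx' hy =
      L.reindex e (fun _ => rfl) (cmap g f p φ x y hx hy) := by
  have e₁ := (f p.1).map_reindex p.2 e h φ (fun r => x r p.1) (y p.1) (fun r => (hx r).1) hy
    fun r => (hx' r).1
  have e₂ := g.map_reindex p.1 e (fun _ => rfl) ((f p.1).map p.2 φ (fun r => x r p.1) (y p.1)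
    (fun r => (hx r).1) hy) (fun r l => (f l).obj (x r l)) (fun l => (f l).obj (y l))
    (fun r => (hx r).obj_eq) rfl fun r => (hx' r).obj_eq
  refine Eq.trans ?_ e₂
  exact eq_of_heq (g.map_congr rfl rfl (heq_of_eq e₁) rfl rfl _ _ _ _)

/-- Two places in the same block are interchanged by the multilinearity of the inner map `f`, and
two places in different blocks by that of the outer map `g`. -/
theorem cmap_bilinear {p q : (i : Fin n) × Fin (k i)} (hpq : p ≠ q) {m l : ℕ}
    {a : Fin m → (M p.1 p.2).Obj} {a' : (M p.1 p.2).Obj} {b : Fin l → (M q.1 q.2).Obj}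
    {b' : (M q.1 q.2).Obj} (φ : (M p.1 p.2).Hom m a a') (ψ : (M q.1 q.2).Hom l b b')
    (x : Fin m → Fin l → ∀ i j, (M i j).Obj) (y : Fin l → ∀ i j, (M i j).Obj)
    (z : Fin m → ∀ i j, (M i j).Obj) (t : ∀ i j, (M i j).Obj) (hp : t p.1 p.2 = a')
    (hq : t q.1 q.2 = b') (hy : ∀ s, UpdAt q (y s) t (b s)) (hz : ∀ r, UpdAt p (z r) t (a r))
    (hyx : ∀ s r, UpdAt p (x r s) (y s) (a r)) (hzx : ∀ r s, UpdAt q (x r s) (z r) (b s))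
    (hyp : ∀ s, y s p.1 p.2 = a') (hzq : ∀ r, z r q.1 q.2 = b') :
    L.comp (cmap g f q ψ y t hy hq) (fun s => cmap g f p φ (fun r => x r s) (y s) (hyx s) (hyp s)) =
      L.reindex (swapEquiv m l) (flat_swapEquiv (fun s r => g.obj fun i => (f i).obj (x r s i)))
        (L.comp (cmap g f p φ z t hz hp)
          (fun r => cmap g f q ψ (x r) (z r) (hzx r) (hzq r))) := by
  obtain ⟨i, j⟩ := p
  obtain ⟨i', j'⟩ := q
  by_cases hi : i = i'
  · subst hi
    have hj : j ≠ j' := fun h => hpq (by rw [h])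
    have ho : ∀ {v : ∀ i j, (M i j).Obj}, (∀ l, l ≠ i → v l = t l) → (fun l => (f l).obj (v l)) =
        Function.update (fun l => (f l).obj (t l)) i ((f i).obj (v i)) := by
      intro v hv
      funext l
      by_cases hl : l = i
      · subst hl
        rw [Function.update_self]
      · rw [Function.update_of_ne hl, hv l hl]
    have hx₀ : ∀ r s l, l ≠ i → x r s l = t l := fun r s l hl =>
      ((hyx s r).2 l hl).trans ((hy s).2 l hl)
    have e := (f i).bilinear j j' hj φ ψ (fun r s => x r s i) (fun s => y s i) (fun r => z r i) (t i)
      hp hq (fun s => (hy s).1) (fun r => (hz r).1) (fun s r => (hyx s r).1)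
      (fun r s => (hzx r s).1) hyp hzq
    have e₁ := g.map_comp i
      ((f i).map j' ψ (fun s => y s i) (t i) (fun s => (hy s).1) hq)
      (fun s => (f i).map j φ (fun r => x r s i) (y s i) (fun r => (hyx s r).1) (hyp s))
      (fun s r l => (f l).obj (x r s l)) (fun s l => (f l).obj (y s l)) (fun l => (f l).obj (t l))
      (fun s r => (hyx s r).obj_eq) (fun s => rfl) (fun s => (hy s).obj_eq) rfl
      fun _ => ho (hx₀ _ _)
    have e₂ := g.map_comp i
      ((f i).map j φ (fun r => z r i) (t i) (fun r => (hz r).1) hp)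
      (fun r => (f i).map j' ψ (fun s => x r s i) (z r i) (fun s => (hzx r s).1) (hzq r))
      (fun r s l => (f l).obj (x r s l)) (fun r l => (f l).obj (z r l)) (fun l => (f l).obj (t l))
      (fun r s => (hzx r s).obj_eq) (fun r => rfl) (fun r => (hz r).obj_eq) rfl
      fun _ => ho (hx₀ _ _)
    refine e₁.symm.trans (Eq.trans ?_ (congrArg (L.reindex (swapEquiv m l) _) e₂))
    refine Eq.trans (eq_of_heq (g.map_congr rfl rfl (heq_of_eq e) rfl rfl _ _
      (fun _ => ho (hx₀ _ _)) rfl)) ?_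
    exact g.map_reindex_of_eq i (swapEquiv m l) _ _ _ _ _ _ _ _
      (flat_swapEquiv fun s r l => (f l).obj (x r s l))
  · have h₁ : ∀ s, y s i = t i := fun s => (hy s).2 i hi
    have h₂ : ∀ r, z r i' = t i' := fun r => (hz r).2 i' (Ne.symm hi)
    have h₃ : ∀ r s, x r s i = z r i := fun r s => (hzx r s).2 i hi
    have h₄ : ∀ r s, x r s i' = y s i' := fun r s => (hyx s r).2 i' (Ne.symm hi)
    have e := g.bilinear i i' hi
      ((f i).map j φ (fun r => z r i) (t i) (fun r => (hz r).1) hp)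
      ((f i').map j' ψ (fun s => y s i') (t i') (fun s => (hy s).1) hq)
      (fun r s l => (f l).obj (x r s l)) (fun s l => (f l).obj (y s l))
      (fun r l => (f l).obj (z r l)) (fun l => (f l).obj (t l)) rfl rfl (fun s => (hy s).obj_eq)
      (fun r => (hz r).obj_eq)
      (fun s r => (hyx s r).obj_eq.trans (congrArg
        (fun c => Function.update (fun l => (f l).obj (y s l)) i ((f i).obj c)) (h₃ r s)))
      (fun r s => (hzx r s).obj_eq.trans (congrArg
        (fun c => Function.update (fun l => (f l).obj (z r l)) i' ((f i').obj c)) (h₄ r s)))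
      (fun s => congrArg (f i).obj (h₁ s)) (fun r => congrArg (f i').obj (h₂ r))
    refine Eq.trans ?_ (e.trans ?_)
    · refine congrArg (L.comp _) (funext fun s => eq_of_heq (g.map_congr ?_ ?_ ?_ rfl rfl _ _ _ _))
      · exact funext fun r => congrArg (f i).obj (h₃ r s)
      · exact congrArg (f i).obj (h₁ s)
      · exact (f i).map_congr rfl rfl HEq.rfl (funext fun r => h₃ r s) (h₁ s) _ _ _ _
    · refine congrArg (fun c => L.reindex _ _ (L.comp _ c)) (funext fun r =>
        eq_of_heq (g.map_congr ?_ ?_ ?_ rfl rfl _ _ _ _))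
      · exact funext fun s => congrArg (f i').obj (h₄ r s).symm
      · exact congrArg (f i').obj (h₂ r).symm
      · exact (f i').map_congr rfl rfl HEq.rfl (funext fun s => (h₄ r s).symm) (h₂ r).symm _ _ _ _

theorem cmap_base {m : ℕ} {a : Fin m → (M p.1 p.2).Obj} {a' : (M p.1 p.2).Obj}
    (φ : (M p.1 p.2).Hom m a a') (x : Fin m → ∀ i j, (M i j).Obj) (x' : ∀ i j, (M i j).Obj)
    (hx : ∀ r, UpdAt p (x r) x' (a r)) (hx' : x' p.1 p.2 = a')
    (h : (M p.1 p.2).FromBase φ ∨ ∃ q : (i : Fin n) × Fin (k i), q ≠ p ∧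
      x' q.1 q.2 = (M q.1 q.2).pt) : L.FromBase (cmap g f p φ x x' hx hx') := by
  refine g.map_base _ _ _ _ _ _ ?_
  obtain h | ⟨⟨i, j⟩, hq, h⟩ := h
  · exact .inl ((f p.1).map_base _ _ _ _ _ _ (.inl h))
  · obtain ⟨i', j'⟩ := p
    by_cases hi : i = i'
    · subst hi
      exact .inl ((f i).map_base _ _ _ _ _ _ (.inr ⟨j, fun h => hq (by rw [h]), h⟩))
    · exact .inr ⟨i, hi, (f i).obj_base _ ⟨j, h⟩⟩

end Cmap

theorem symm_ne {s t : Fin (∑ i, k i)} (h : s ≠ t) :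
    finSigmaFinEquiv.symm s ≠ finSigmaFinEquiv.symm t :=
  finSigmaFinEquiv.symm.injective.ne h

/-- The composite of multilinear maps. -/
noncomputable def comp : MultiLin (flat M) L where
  obj x := g.obj fun i => (f i).obj (unflatten (α := fun i j => (M i j).Obj) x i)
  map s {m a a'} φ x x' hx hx' :=
    cmap g f (finSigmaFinEquiv.symm s) φ (fun r => unflatten (α := fun i j => (M i j).Obj) (x r))
      (unflatten (α := fun i j => (M i j).Obj) x')
      (fun r => updAt_unflatten (α := fun i j => (M i j).Obj) (hx r))
      ((unflatten_apply (α := fun i j => (M i j).Obj) x' s).trans hx')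
  map_id s x h := cmap_id g f _ _ _
  map_comp s m b c l a ψ φ x y z hx hy hy' hz hxz := cmap_comp g f ψ φ
    (fun i r => unflatten (α := fun i j => (M i j).Obj) (x i r)) _ _ _ _ _ _ _
  map_reindex s m l e a a' b h φ x y hx hy hx' := cmap_reindex g f e h φ
    (fun r => unflatten (α := fun i j => (M i j).Obj) (x r)) _ _ _ _
  bilinear s t hst m l a a' b b' φ ψ x p q z hi hj hp hq hpx hqx hpi hqj :=
    cmap_bilinear g f (symm_ne hst) φ ψ _ _ _ _ _ _ _ _ _ _ _ _
  obj_base x h := by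
    obtain ⟨s, h⟩ := h
    exact g.obj_base _ ⟨blk s, (f _).obj_base _ ⟨pos s, (unflatten_apply _ s).trans h⟩⟩
  map_base s m a a' φ x x' hx hx' h := cmap_base g f φ _ _ _ _ (h.imp id fun ⟨t, ht, h⟩ =>
    ⟨finSigmaFinEquiv.symm t, symm_ne ht, (unflatten_apply _ t).trans h⟩)

end MultiLin

/-! ### Horizontal composition -/

namespace MultiLin

open BasedMulticategory

section

variable {k : ℕ} {M : Fin k → BasedMulticategory.{v, u}} {N : BasedMulticategory.{v', u'}}
  (g : MultiLin M N)

/-- A multilinear map takes a tuple of `1`-morphisms to one from the basepoint if one of them comes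
from the basepoint. -/
theorem fromBase_onOne {i : Fin k} {x y : ∀ i, (M i).One} (u : x ⟶ y)
    (h : (M i).FromBase (u i)) : N.FromBase (g.onOne.map u) := by
  -- The step `s` in the variable `i` comes from the basepoint. The other steps do so because their
  -- `i`-th variable is the basepoint.
  obtain ⟨w, s, t, rfl, hs, ht, -⟩ := exists_split u i
  rw [g.onOne.map_comp]
  have hy : y i = (M i).pt := h.target
  have hu : Same (s i) ((s ≫ t) i) := ((Same.refl (s i)).comp_id ht.same).symm
  refine FromBase.post ?_ ?_
  · have key := hom_step_induction (Finset.univ.erase i) (X := fun i => (M i).One) (u := t)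
      (R := fun w y t => w i = (M i).pt → N.FromBase (g.onOne.map t)) ?_ ?_ ?_
    · exact key (ht.1.trans hy)
    · intro w y t ht hw
      obtain rfl : w = y := funext fun i => (ht i).1
      obtain rfl : t = 𝟙 w := pi_hom_ext fun i => (ht i).same
      rw [g.onOne.map_id]
      exact .id (g.obj_base w ⟨i, hw⟩)
    · intro x w y s t j hj hs ih hx
      have hij : i ≠ j := Ne.symm (Finset.mem_erase.1 hj).1
      rw [g.onOne.map_comp]
      have hw := (hs i hij).1.symm.trans hx
      refine FromBase.post (ih hw) ?_
      rw [g.onOne_map_step j s hs (.refl _) (fun _ => eq_update_of_isId s hs) rfl]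
      exact g.map_base _ _ _ _ _ _ (.inr ⟨i, hij, hw⟩)
    · intro j hj
      obtain rfl : j = i := by simpa using hj
      exact ht
  · rw [g.onOne_map_step i s hs hu (fun _ => (eq_update_of_isId s hs).trans rfl)
      (ht.1)]
    exact g.map_base _ _ _ _ _ _ (.inl h)

end

variable {n : ℕ} {k : Fin n → ℕ} {M : ∀ i, Fin (k i) → BasedMulticategory.{v, u}}
  {N : Fin n → BasedMulticategory.{v, u}} {L : BasedMulticategory.{v, u}}

section

variable {g g' : MultiLin N L} {f f' : ∀ i, MultiLin (M i) (N i)}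

/-- The component of the horizontal composite of `2`-cells at a family of tuples. -/
noncomputable def hcompApp (σ : g ⟶ g') (ξ : ∀ i, f i ⟶ f' i) (x : ∀ i j, (M i j).One) :
    g.onOne.obj (fun i => (f i).obj (x i)) ⟶ g'.onOne.obj fun i => (f' i).obj (x i) :=
  g.onOne.map (X := fun i => (f i).obj (x i)) (Y := fun i => (f' i).obj (x i))
    (fun i => (ξ i).app (x i)) ≫ (Trans.onOne σ).app fun i => (f' i).obj (x i)

theorem hcompApp_naturality (σ : g ⟶ g') (ξ : ∀ i, f i ⟶ f' i) {p : (i : Fin n) × Fin (k i)}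
    {m : ℕ} {a : Fin m → (M p.1 p.2).Obj} {a' : (M p.1 p.2).Obj} (φ : (M p.1 p.2).Hom m a a')
    (x : Fin m → ∀ i j, (M i j).Obj) (x' : ∀ i j, (M i j).Obj) (hx : ∀ r, UpdAt p (x r) x' (a r))
    (hx' : x' p.1 p.2 = a') :
    pre (cmap g' f' p φ x x' hx hx') (fun r => hcompApp σ ξ (x r)) =
      post (hcompApp σ ξ x') (cmap g f p φ x x' hx hx') := by
  have h := (ξ p.1).naturality p.2 φ (fun r => x r p.1) (x' p.1) (fun r => (hx r).1) hx'
  have e₁ := g.onOne_naturality p.1 _ _ _ _ h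
    (y' := fun i => (f i).obj (x' i)) (z' := fun i => (f' i).obj (x' i))
    (y := fun r i => (f i).obj (x r i)) (z := fun r i => (f' i).obj (x r i))
    (fun r => (hx r).obj_eq) rfl (fun r => (hx r).obj_eq) rfl (fun r i => (ξ i).app (x r i))
    (fun i => (ξ i).app (x' i)) (fun r => .refl _) (.refl _) (fun r l hl => by rw [(hx r).2 l hl]; exact .refl _)
  have e₂ := σ.naturality p.1 ((f' p.1).map p.2 φ (fun r => x r p.1) (x' p.1)
    (fun r => (hx r).1) hx') (fun r i => (f' i).obj (x r i)) (fun i => (f' i).obj (x' i))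
    (fun r => (hx r).obj_eq) rfl
  exact square_comp e₁ e₂

theorem fromBase_hcompApp (σ : g ⟶ g') (ξ : ∀ i, f i ⟶ f' i) (x : ∀ i j, (M i j).Obj) {i : Fin n}
    {j : Fin (k i)} (h : x i j = (M i j).pt) : L.FromBase (hcompApp σ ξ x) :=
  (σ.app_base _ ⟨i, (f' i).obj_base _ ⟨j, h⟩⟩).post
    (g.fromBase_onOne (i := i) (x := fun i => (f i).obj (x i)) (y := fun i => (f' i).obj (x i))
      (fun i => (ξ i).app (x i)) ((ξ i).app_base _ ⟨j, h⟩))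

/-- The horizontal composite of `2`-cells. -/
noncomputable def hcomp (σ : g ⟶ g') (ξ : ∀ i, f i ⟶ f' i) : g.comp f ⟶ g'.comp f' where
  app x := hcompApp σ ξ (unflatten (α := fun i j => (M i j).Obj) x)
  naturality s m a a' φ x x' hx hx' := hcompApp_naturality σ ξ φ _ _
    (fun r => updAt_unflatten (α := fun i j => (M i j).Obj) (hx r))
    ((unflatten_apply (α := fun i j => (M i j).Obj) x' s).trans hx')
  app_base x h := by
    obtain ⟨s, h⟩ := h
    exact fromBase_hcompApp σ ξ _ ((unflatten_apply _ s).trans h)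

theorem hcompApp_id (g : MultiLin N L) (f : ∀ i, MultiLin (M i) (N i)) (x : ∀ i j, (M i j).One) :
    hcompApp (𝟙 g) (fun i => 𝟙 (f i)) x = 𝟙 _ :=
  (Category.comp_id _).trans (g.onOne.map_id _)

theorem hcompApp_comp {g'' : MultiLin N L} {f'' : ∀ i, MultiLin (M i) (N i)} (σ : g ⟶ g')
    (σ' : g' ⟶ g'') (ξ : ∀ i, f i ⟶ f' i) (ξ' : ∀ i, f' i ⟶ f'' i) (x : ∀ i j, (M i j).One) :
    hcompApp (σ ≫ σ') (fun i => ξ i ≫ ξ' i) x = hcompApp σ ξ x ≫ hcompApp σ' ξ' x := by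
  have e := g.onOne.map_comp (X := fun i => (f i).obj (x i)) (Y := fun i => (f' i).obj (x i))
    (Z := fun i => (f'' i).obj (x i)) (fun i => (ξ i).app (x i)) (fun i => (ξ' i).app (x i))
  have e' := (Trans.onOne σ).naturality (X := fun i => (f' i).obj (x i))
    (Y := fun i => (f'' i).obj (x i)) (fun i => (ξ' i).app (x i))
  have aux : ∀ {a b c d e p : L.One} {u : a ⟶ c} {s : a ⟶ b} {t : b ⟶ c} {p' : c ⟶ d} {q : d ⟶ e}
      {p'' : b ⟶ p} {t' : p ⟶ d}, u = s ≫ t → t ≫ p' = p'' ≫ t' →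
      u ≫ p' ≫ q = (s ≫ p'') ≫ t' ≫ q := by
    intro a b c d e p u s t p' q p'' t' h h'
    rw [h, Category.assoc, Category.assoc, reassoc_of% h']
  exact aux e e'

end

/-- The composition of multilinear maps and of `2`-cells, as a functor. -/
noncomputable def compFunctor (M : ∀ i, Fin (k i) → BasedMulticategory.{v, u})
    (N : Fin n → BasedMulticategory.{v, u}) (L : BasedMulticategory.{v, u}) :
    (MultiLin N L × ∀ i, MultiLin (M i) (N i)) ⥤ MultiLin (flat M) L where
  obj p := p.1.comp p.2
  map σ := hcomp σ.1 σ.2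
  map_id p := Trans.ext (funext fun x => hcompApp_id p.1 p.2 (unflatten x))
  map_comp σ τ := Trans.ext (funext fun x => hcompApp_comp σ.1 τ.1 σ.2 τ.2 (unflatten x))

/-! ### Permutation of the variables -/

section Reindex

variable {m n : ℕ} (e : Fin m ≃ Fin n)

/-- The tuple with given permuted entries. -/
noncomputable def unpermute {α : Fin n → Type u} (x : ∀ i, α (e i)) : ∀ j, α j :=
  (unperm e x).choose

variable {e}

theorem unpermute_spec {α : Fin n → Type u} (x : ∀ i, α (e i)) :
    (fun i => unpermute e x (e i)) = x :=
  (unperm e x).choose_spec.symm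

theorem unpermute_apply {α : Fin n → Type u} (x : ∀ i, α (e i)) (i : Fin m) :
    unpermute e x (e i) = x i :=
  congrFun (unpermute_spec x) i

theorem permute_injective {α : Fin n → Type u} {x y : ∀ i, α i} (h : ∀ i, x (e i) = y (e i)) :
    x = y := by
  funext j
  obtain ⟨i, rfl⟩ := e.surjective j
  exact h i

theorem unpermute_permute {α : Fin n → Type u} (x : ∀ i, α i) : unpermute e (fun i => x (e i)) = x :=
  permute_injective (e := e) (unpermute_apply _)

theorem unpermute_update {α : Fin n → Type u} {x x' : ∀ i, α (e i)} {j : Fin m} {c : α (e j)}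
    (h : x = Function.update x' j c) :
    unpermute e x = Function.update (unpermute e x') (e j) c := by
  refine permute_injective (e := e) fun i => ?_
  rw [unpermute_apply, h]
  by_cases hi : i = j
  · subst hi
    rw [Function.update_self, Function.update_self]
  · rw [Function.update_of_ne hi, Function.update_of_ne (e.injective.ne hi), unpermute_apply]

variable (e) {M : Fin n → BasedMulticategory.{v, u}} {N : BasedMulticategory.{v', u'}}

/-- A multilinear map with permuted variables. -/
noncomputable def permute (f : MultiLin M N) : MultiLin (fun i => M (e i)) N where
  obj x := f.obj (unpermute (α := fun i => (M i).Obj) e x)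
  map j {m a a'} φ x x' hx hx' := f.map (e j) φ (fun r => unpermute (α := fun i => (M i).Obj) e (x r))
    (unpermute (α := fun i => (M i).Obj) e x') (fun r => unpermute_update (hx r))
    ((unpermute_apply (e := e) (α := fun i => (M i).Obj) x' j).trans hx')
  map_id j x h := by
    have hj := unpermute_apply (e := e) (α := fun i => (M i).Obj) x j
    refine Eq.trans (eq_of_heq ?_) (f.map_id (e j) (unpermute (α := fun i => (M i).Obj) e x)
      fun _ => (Function.update_eq_self _ _).symm)
    refine f.map_congr (funext fun _ => hj.symm) hj.symm ?_ rfl rfl _ _ _ _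
    rw [hj]
  map_comp j n b c l a ψ φ x y z hx hy hy' hz hxz := f.map_comp (e j) ψ φ
    (fun i r => unpermute (α := fun i => (M i).Obj) e (x i r)) _ _
    (fun i r => unpermute_update (hx i r)) (fun i => (unpermute_apply _ j).trans (hy i)) _ _ _
  map_reindex j m n e' a a' b h φ x y hx hy hx' := f.map_reindex (e j) e' h φ
    (fun r => unpermute (α := fun i => (M i).Obj) e (x r)) _ _ _ _
  bilinear i j hij m n a a' b b' φ ψ x p q t hi hj hp hq hpx hqx hpi hqj :=
    f.bilinear (e i) (e j) (e.injective.ne hij) φ ψ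
      (fun r s => unpermute (α := fun i => (M i).Obj) e (x r s)) _ _ _ _ _ _ _
      (fun s r => unpermute_update (hpx s r)) (fun r s => unpermute_update (hqx r s)) _ _
  obj_base x h := by
    obtain ⟨i, h⟩ := h
    exact f.obj_base _ ⟨e i, (unpermute_apply (e := e) (α := fun i => (M i).Obj) x i).trans h⟩
  map_base j m a a' φ x x' hx hx' h := f.map_base _ _ _ _ _ _ (h.imp id fun ⟨i, hi, h⟩ =>
    ⟨e i, e.injective.ne hi, (unpermute_apply (e := e) (α := fun i => (M i).Obj) x' i).trans h⟩)

/-- The functor that permutes the variables of multilinear maps. -/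
noncomputable def permuteFunctor (M : Fin n → BasedMulticategory.{v, u})
    (N : BasedMulticategory.{v', u'}) : MultiLin M N ⥤ MultiLin (fun i => M (e i)) N where
  obj f := f.permute e
  map ξ :=
    { app x := ξ.app (unpermute (α := fun i => (M i).Obj) e x)
      naturality j m a a' φ x x' hx hx' := ξ.naturality (e j) φ _ _ _ _
      app_base x h := by
        obtain ⟨i, h⟩ := h
        exact ξ.app_base _ ⟨e i, (unpermute_apply (e := e) (α := fun i => (M i).Obj) x i).trans h⟩ }
  map_id f := rfl
  map_comp ξ η := rfl

/-- The action of a bijection on multilinear maps, for a flexible presentation of the permuted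
tuple. -/
noncomputable def reindexFunctor {M : Fin n → BasedMulticategory.{v, u}}
    {M' : Fin m → BasedMulticategory.{v, u}} {N : BasedMulticategory.{v', u'}}
    (h : ∀ i, M' i = M (e i)) : MultiLin M N ⥤ MultiLin M' N :=
  Eq.rec (motive := fun M' _ => MultiLin M N ⥤ MultiLin M' N) (permuteFunctor e M N)
    (funext h : M' = fun i => M (e i)).symm

end Reindex

theorem update_zero {α : Type u} {x x' : Fin 1 → α} {j : Fin 1} {c : α}
    (h : x = Function.update x' j c) : x 0 = c := by
  obtain rfl : j = 0 := Subsingleton.elim _ _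
  rw [h, Function.update_self]

/-- The unit of the multicategory of based multicategories. -/
def unit (M : BasedMulticategory.{v, u}) : MultiLin (fun _ : Fin 1 => M) M where
  obj x := x 0
  map j {m a a'} φ x x' hx hx' :=
    cast (congrArg₂ (M.Hom m) (funext fun r => (update_zero (hx r)).symm)
      ((Subsingleton.elim j 0 ▸ hx' : x' 0 = a').symm)) φ
  map_id j x h := by
    obtain rfl : j = 0 := Subsingleton.elim _ _
    rfl
  map_comp j n b c l a ψ φ x y z hx hy hy' hz hxz := by
    obtain rfl : j = 0 := Subsingleton.elim _ _
    obtain rfl : (fun i => y i 0) = b := funext hy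
    obtain rfl : (fun i r => x i r 0) = a := funext fun i => funext fun r => update_zero (hx i r)
    obtain rfl : z 0 = c := hz
    rfl
  map_reindex j m n e a a' b h φ x y hx hy hx' := by
    obtain rfl : j = 0 := Subsingleton.elim _ _
    obtain rfl : (fun r => x r 0) = a := funext fun r => update_zero (hx r)
    obtain rfl : (fun r => x (e r) 0) = a' := funext fun r => update_zero (hx' r)
    obtain rfl : y 0 = b := hy
    rfl
  bilinear i j hij := absurd (Subsingleton.elim i j) hij
  obj_base x h := by
    obtain ⟨i, h⟩ := h
    obtain rfl : i = 0 := Subsingleton.elim _ _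
    exact h
  map_base j m a a' φ x x' hx hx' h := by
    obtain rfl : j = 0 := Subsingleton.elim _ _
    obtain rfl : (fun r => x r 0) = a := funext fun r => update_zero (hx r)
    obtain rfl : x' 0 = a' := hx'
    obtain h | ⟨i, hi, -⟩ := h
    · exact h
    · exact absurd (Subsingleton.elim i 0) hi

theorem unit_map (M : BasedMulticategory.{v, u}) (j : Fin 1) {m : ℕ} {a : Fin m → M.Obj}
    {a' : M.Obj} (φ : M.Hom m a a') (x : Fin m → Fin 1 → M.Obj) (x' : Fin 1 → M.Obj)
    (hx : ∀ r, x r = Function.update x' j (a r)) (hx' : x' j = a') :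
    HEq ((unit M).map j φ x x' hx hx') φ :=
  cast_heq _ _

end MultiLin

namespace MultiLin

open BasedMulticategory

/-! ### The functors on `1`-morphisms of composites, permutations and units -/

theorem isId_onOne_map {n : ℕ} {M : Fin n → BasedMulticategory.{v, u}}
    {N : BasedMulticategory.{v', u'}} (g : MultiLin M N) {x y : ∀ i, (M i).One} (u : x ⟶ y)
    (h : ∀ i, IsId (u i)) : IsId (g.onOne.map u) := by
  obtain rfl : x = y := funext fun i => (h i).1
  obtain rfl : u = 𝟙 x := pi_hom_ext fun i => (h i).same
  exact ⟨rfl, g.onOne.map_id x⟩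

section Comp

variable {n : ℕ} {k : Fin n → ℕ} {M : ∀ i, Fin (k i) → BasedMulticategory.{v, u}}
  {N : Fin n → BasedMulticategory.{v, u}} {L : BasedMulticategory.{v, u}} (g : MultiLin N L)
  (f : ∀ i, MultiLin (M i) (N i))

theorem comp_obj_flat (x : ∀ i j, (M i j).Obj) :
    (g.comp f).obj (flat x) = g.obj fun i => (f i).obj (x i) :=
  congrArg (fun x : ∀ i j, (M i j).Obj => g.obj fun i => (f i).obj (x i))
    (unflatten_flat (α := fun i j => (M i j).Obj) x)

/-- The action of a composite at the concatenation of tuples. -/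
theorem comp_map_flat (s : Fin (∑ i, k i)) {m : ℕ} {a : Fin m → (M (blk s) (pos s)).Obj}
    {a' : (M (blk s) (pos s)).Obj} (φ : (M (blk s) (pos s)).Hom m a a')
    (x : Fin m → ∀ i j, (M i j).Obj) (x' : ∀ i j, (M i j).Obj)
    (h : ∀ r, flat (x r) = Function.update (β := fun s => (flat M s).Obj) (flat x') s (a r))
    (hx' : x' (blk s) (pos s) = a') :
    HEq ((g.comp f).map s φ (fun r => flat (x r)) (flat x') h hx')
      (cmap g f (finSigmaFinEquiv.symm s) φ x x'
        (fun r => updAt_of_flat (α := fun i j => (M i j).Obj) (h r)) hx') :=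
  cmap_congr g f rfl .rfl .rfl .rfl
    (funext fun r => unflatten_flat (α := fun i j => (M i j).Obj) (x r))
    (unflatten_flat (α := fun i j => (M i j).Obj) x')
    (fun r => updAt_unflatten (α := fun i j => (M i j).Obj) (h r))
    ((unflatten_apply (α := fun i j => (M i j).Obj) (flat x') s).trans hx') _ _

/-- The functor on `1`-morphisms of a composite is the composite of the functors. -/
theorem comp_onOne {X Y : ∀ i j, (M i j).One} (V : ∀ i j, X i j ⟶ Y i j) :
    Same ((g.comp f).onOne.map (X := flat X) (Y := flat Y) (flat V))
      (g.onOne.map (X := fun i => (f i).obj (X i)) (Y := fun i => (f i).obj (Y i))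
        fun i => (f i).onOne.map (X := X i) (Y := Y i) (V i)) := by
  have key := homFactor (X := fun s => (flat M s).One) (x := flat X) (y := flat Y) (flat V)
    (fun x y u => ∀ (X Y : ∀ i j, (M i j).One) (V : ∀ i j, X i j ⟶ Y i j), flat X = x →
      flat Y = y → (∀ s, Same (V (blk s) (pos s)) (u s)) → Same ((g.comp f).onOne.map u)
      (g.onOne.map (X := fun i => (f i).obj (X i)) (Y := fun i => (f i).obj (Y i))
        fun i => (f i).onOne.map (X := X i) (Y := Y i) (V i))) ?_ ?_ ?_
  · exact key X Y V rfl rfl fun s => .refl _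
  · rintro _ X Y V rfl hY hV
    obtain rfl := flat_injective hY
    obtain rfl : V = fun i j => 𝟙 (Y i j) := funext fun i => funext fun j =>
      of_flat (P := fun i j => V i j = 𝟙 (Y i j)) (fun s => (hV s).eq) i j
    refine Same.trans ?_ (Same.of_eq (congrArg (fun V => g.onOne.map
      (X := fun i => (f i).obj (Y i)) (Y := fun i => (f i).obj (Y i)) V)
      (funext fun i => (f i).onOne.map_id (Y i)))).symm
    refine (Same.of_eq ((g.comp f).onOne.map_id _)).trans (Same.trans ?_
      (Same.of_eq (g.onOne.map_id fun i => (f i).obj (Y i))).symm)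
    exact .id (comp_obj_flat g f Y)
  · rintro _ y _ u u' h h' X Z V rfl rfl hV
    obtain ⟨Y, rfl⟩ := unflat (α := fun i j => (M i j).One) y
    obtain ⟨S, rfl⟩ := unflat (α := fun i j => X i j ⟶ Y i j) u
    obtain ⟨T, rfl⟩ := unflat (α := fun i j => Y i j ⟶ Z i j) u'
    obtain rfl : V = fun i j => S i j ≫ T i j := funext fun i => funext fun j =>
      of_flat (P := fun i j => V i j = S i j ≫ T i j) (fun s => (hV s).eq) i j
    refine Same.trans ?_ (Same.of_eq (congrArg (fun V => g.onOne.map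
      (X := fun i => (f i).obj (X i)) (Y := fun i => (f i).obj (Z i)) V)
      (funext fun i => (f i).onOne.map_comp (X := X i) (Y := Y i) (Z := Z i) (S i) (T i)))).symm
    refine (Same.of_eq ((g.comp f).onOne.map_comp _ _)).trans (Same.trans ?_
      (Same.of_eq (g.onOne.map_comp (X := fun i => (f i).obj (X i))
        (Y := fun i => (f i).obj (Y i)) (Z := fun i => (f i).obj (Z i))
        (fun i => (f i).onOne.map (X := X i) (Y := Y i) (S i))
        (fun i => (f i).onOne.map (X := Y i) (Y := Z i) (T i)))).symm)
    exact (h X Y S rfl rfl fun s => .refl _).comp (h' Y Z T rfl rfl fun s => .refl _)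
  · rintro _ _ u s hs X Y V rfl rfl hV
    obtain ⟨V', rfl⟩ := unflat (α := fun i j => X i j ⟶ Y i j) u
    obtain rfl : V = V' := funext fun i => funext fun j =>
      of_flat (P := fun i j => V i j = V' i j) (fun s => (hV s).eq) i j
    have hV' : ∀ i (j : Fin (k i)), (⟨i, j⟩ : (i : Fin n) × Fin (k i)) ≠ finSigmaFinEquiv.symm s →
        IsId (V i j) := of_flat fun t ht => hs t fun h => ht (by rw [h])
    have hblk : ∀ j, j ≠ pos s → IsId (V (blk s) j) := fun j hj =>
      hV' _ j fun h => hj (eq_of_heq (Sigma.mk.inj_iff.1 h).2)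
    have hx := fun _ : Fin 1 => eq_update_of_isId (X := fun s => (flat M s).One) (x := flat X)
      (y := flat Y) (flat V) hs
    have hup : ∀ _ : Fin 1, UpdAt (finSigmaFinEquiv.symm s) X Y (X (blk s) (pos s)) := fun r =>
      updAt_of_flat (α := fun i j => (M i j).Obj) (hx r)
    refine (Same.of_eq ((g.comp f).onOne_map_step s (x := flat X) (y := flat Y) (flat V) hs
      (.refl _) hx rfl)).trans ((Same.of_heq (A := L.One) (comp_obj_flat g f X) (comp_obj_flat g f Y)
      (comp_map_flat g f s (V (blk s) (pos s)) (fun _ => X) Y hx rfl)).trans (Same.of_eq ?_).symm)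
    exact g.onOne_map_step (blk s) (x := fun i => (f i).obj (X i)) (y := fun i => (f i).obj (Y i))
      _ (fun i hi => (f i).isId_onOne_map (V i) fun j => hV' i j fun h => hi (congrArg (·.1) h))
      (.of_eq ((f _).onOne_map_step (pos s) (V (blk s)) hblk (.refl _) (fun r => (hup r).1) rfl))
      (fun r => (hup r).obj_eq) rfl

end Comp

section Permute

variable {m n : ℕ} (e : Fin m ≃ Fin n) {M : Fin n → BasedMulticategory.{v, u}}
  {N : BasedMulticategory.{v', u'}} (f : MultiLin M N)

theorem permute_obj (x : ∀ i, (M i).Obj) : (f.permute e).obj (fun i => x (e i)) = f.obj x :=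
  congrArg f.obj (unpermute_permute (α := fun i => (M i).Obj) x)

theorem permute_map (j : Fin m) {l : ℕ} {a : Fin l → (M (e j)).Obj} {a' : (M (e j)).Obj}
    (φ : (M (e j)).Hom l a a') (x : Fin l → ∀ i, (M i).Obj) (x' : ∀ i, (M i).Obj)
    (hx : ∀ r, x r = Function.update x' (e j) (a r)) (hx' : x' (e j) = a')
    (h : ∀ r, (fun i => x r (e i)) =
      Function.update (β := fun i => (M (e i)).Obj) (fun i => x' (e i)) j (a r)) :
    HEq ((f.permute e).map j φ (fun r i => x r (e i)) (fun i => x' (e i)) h hx')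
      (f.map (e j) φ x x' hx hx') :=
  f.map_congr rfl rfl .rfl (funext fun r => unpermute_permute (α := fun i => (M i).Obj) (x r))
    (unpermute_permute (α := fun i => (M i).Obj) x') _ _ _ _

theorem permute_onOne {X Y : ∀ i, (M i).One} (V : X ⟶ Y) :
    Same ((f.permute e).onOne.map (X := fun i => X (e i)) (Y := fun i => Y (e i)) fun i => V (e i))
      (f.onOne.map V) := by
  refine homFactor V (fun X Y V => Same ((f.permute e).onOne.map (X := fun i => X (e i))
    (Y := fun i => Y (e i)) fun i => V (e i)) (f.onOne.map V)) ?_ ?_ ?_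
  · intro X
    rw [f.onOne.map_id]
    exact (Same.of_eq ((f.permute e).onOne.map_id _)).trans (.id (permute_obj e f X))
  · intro X Y Z V W h h'
    rw [f.onOne.map_comp]
    exact (Same.of_eq ((f.permute e).onOne.map_comp _ _)).trans (h.comp h')
  · intro X Y V j hj
    obtain ⟨i, rfl⟩ := e.surjective j
    have hx := fun _ : Fin 1 => eq_update_of_isId V hj
    have hj' : ∀ l, l ≠ i → IsId (V (e l)) := fun l hl => hj _ (e.injective.ne hl)
    refine (Same.of_eq ((f.permute e).onOne_map_step i _ hj' (.refl _)
      (fun _ => eq_update_of_isId _ hj') rfl)).trans (Same.trans ?_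
      (Same.of_eq (f.onOne_map_step (e i) V hj (.refl _) hx rfl)).symm)
    exact .of_heq (permute_obj e f X) (permute_obj e f Y)
      (permute_map e f i (V (e i)) (fun _ => X) Y hx rfl _)

end Permute

theorem unit_onOne (M : BasedMulticategory.{v, u}) {X Y : Fin 1 → M.One} (V : X ⟶ Y) :
    (unit M).onOne.map V = V 0 := by
  refine ((unit M).onOne_map_step 0 V (fun i hi => absurd (Subsingleton.elim i 0) hi) (.refl _)
    (fun _ => funext fun i => ?_) rfl).trans (eq_of_heq (unit_map M 0 (V 0) (fun _ => X) Y _ rfl))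
  obtain rfl : i = 0 := Subsingleton.elim _ _
  exact (Function.update_self 0 (X 0) Y).symm

end MultiLin

namespace MultiLin

open BasedMulticategory

/-! ### Permuted multilinear maps and the unit laws -/

section Reindex

variable {m n : ℕ} {e : Fin m ≃ Fin n} {M : Fin n → BasedMulticategory.{v, u}}
  {M' : Fin m → BasedMulticategory.{v, u}} {N : BasedMulticategory.{v', u'}}

/-- The tuple `x` consists of the permuted entries of the tuple `y`. The entries are compared
together with the multicategories in which they lie. -/
def IsPerm (e : Fin m ≃ Fin n) (x : ∀ i, (M' i).Obj) (y : ∀ i, (M i).Obj) : Prop :=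
  ∀ i, (⟨M' i, x i⟩ : (M : BasedMulticategory.{v, u}) × M.Obj) = ⟨M (e i), y (e i)⟩

theorem IsPerm.unique {x : ∀ i, (M' i).Obj} {y y' : ∀ i, (M i).Obj} (h : IsPerm e x y)
    (h' : IsPerm e x y') : y = y' :=
  permute_injective (e := e) (α := fun i => (M i).Obj) fun i =>
    eq_of_heq (Sigma.mk.inj_iff.1 ((h i).symm.trans (h' i))).2

/-- A criterion for a multilinear map to be obtained from another one by a permutation of the
variables. The sources are only required to be equal after the permutation, so that it applies to
the permutations in the axioms of a multicategory. -/
theorem eq_reindexFunctor_obj (h : ∀ i, M' i = M (e i)) {F : MultiLin M' N} {G : MultiLin M N}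
    (h₁ : ∀ x y, IsPerm e x y → F.obj x = G.obj y)
    (h₂ : ∀ (j : Fin m) {l : ℕ} {a : Fin l → (M' j).Obj} {a' : (M' j).Obj}
      {b : Fin l → (M (e j)).Obj} {b' : (M (e j)).Obj} (φ : (M' j).Hom l a a')
      (ψ : (M (e j)).Hom l b b') (x : Fin l → ∀ i, (M' i).Obj) (x' : ∀ i, (M' i).Obj)
      (y : Fin l → ∀ i, (M i).Obj) (y' : ∀ i, (M i).Obj)
      (hx : ∀ r, x r = Function.update x' j (a r)) (hx' : x' j = a')
      (hy : ∀ r, y r = Function.update y' (e j) (b r)) (hy' : y' (e j) = b'), HEq a b → HEq a' b' →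
      HEq φ ψ → (∀ r, IsPerm e (x r) (y r)) → IsPerm e x' y' →
      HEq (F.map j φ x x' hx hx') (G.map (e j) ψ y y' hy hy')) :
    F = (reindexFunctor e h).obj G := by
  obtain rfl : M' = fun i => M (e i) := funext h
  have hp : ∀ x : ∀ i, (M (e i)).Obj, IsPerm e x (unpermute (α := fun i => (M i).Obj) e x) :=
    fun x i => by rw [unpermute_apply (e := e) (α := fun i => (M i).Obj)]
  exact MultiLin.ext' (fun x => h₁ _ _ (hp x)) fun j {l a a'} φ x x' hx hx' =>
    h₂ j φ φ x x' _ _ hx hx' (fun r => unpermute_update (α := fun i => (M i).Obj) (hx r))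
      ((unpermute_apply (e := e) (α := fun i => (M i).Obj) x' j).trans hx') .rfl .rfl .rfl
      (fun r => hp (x r)) (hp x')

/-- The criterion `eq_reindexFunctor_obj` for morphisms of multilinear maps. -/
theorem heq_reindexFunctor_map (h : ∀ i, M' i = M (e i)) {F F' : MultiLin M' N}
    {G G' : MultiLin M N} (hF : F = (reindexFunctor e h).obj G)
    (hF' : F' = (reindexFunctor e h).obj G') {ξ : F ⟶ F'} {η : G ⟶ G'}
    (H : ∀ x y, IsPerm e x y → HEq (ξ.app x) (η.app y)) : HEq ξ ((reindexFunctor e h).map η) := by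
  obtain rfl : M' = fun i => M (e i) := funext h
  refine MultiLin.hom_ext' hF hF' fun x => H _ _ fun i => ?_
  rw [unpermute_apply (e := e) (α := fun i => (M i).Obj)]

theorem reindexFunctor_refl : reindexFunctor (Equiv.refl (Fin n)) (fun _ => rfl) =
    𝟭 (MultiLin M N) := by
  have hp : ∀ x : ∀ i, (M i).Obj, IsPerm (Equiv.refl (Fin n)) x x := fun x i => rfl
  have ho : ∀ f : MultiLin M N, f = (reindexFunctor (Equiv.refl (Fin n)) fun _ => rfl).obj f := by
    refine fun f => eq_reindexFunctor_obj _ (fun x y h => congrArg f.obj ((hp x).unique h))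
      fun j l a a' b b' φ ψ x x' y y' hx hx' hy hy' ha ha' h hxy hxy' => ?_
    obtain rfl : x = y := funext fun r => (hp _).unique (hxy r)
    obtain rfl : x' = y' := (hp _).unique hxy'
    exact f.map_congr (eq_of_heq ha) (eq_of_heq ha') h rfl rfl _ _ _ _
  refine (CategoryTheory.Functor.hext ho fun f g ξ => ?_).symm
  refine heq_reindexFunctor_map _ (ho f) (ho g) fun x y h => ?_
  rw [(hp x).unique h]
  rfl

theorem reindexFunctor_trans {l : ℕ} (e' : Fin l ≃ Fin m) (e : Fin m ≃ Fin n)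
    {M'' : Fin l → BasedMulticategory.{v, u}} (h' : ∀ i, M'' i = M' (e' i))
    (h : ∀ i, M' i = M (e i)) :
    reindexFunctor e h ⋙ reindexFunctor e' h' =
      reindexFunctor (N := N) (e'.trans e) (fun i => (h' i).trans (h (e' i))) := by
  obtain rfl : M' = fun i => M (e i) := funext h
  obtain rfl : M'' = fun i => M (e (e' i)) := funext h'
  have hp : ∀ y : ∀ i, (M i).Obj, IsPerm (M' := fun i => M (e (e' i))) (e'.trans e)
    (fun i => y (e (e' i))) y := fun _ _ => rfl
  have ho : ∀ f : MultiLin M N, (reindexFunctor e' (M' := fun i => M (e (e' i)))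
      (M := fun i => M (e i)) fun _ => rfl).obj ((reindexFunctor e fun _ => rfl).obj f) =
      (reindexFunctor (M' := fun i => M (e (e' i))) (e'.trans e) fun _ => rfl).obj f := by
    refine fun f => eq_reindexFunctor_obj _ (fun x y h => ?_)
      fun j l a a' b b' φ ψ x x' y y' hx hx' hy hy' ha ha' h hxy hxy' => ?_
    · obtain ⟨x, rfl⟩ := unperm e' (α := fun i => (M (e i)).Obj) x
      obtain ⟨x, rfl⟩ := unperm e (α := fun i => (M i).Obj) x
      obtain rfl := (hp x).unique h
      exact (permute_obj e' (f.permute e) _).trans (permute_obj e f x)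
    · obtain ⟨x', rfl⟩ := unperm e' (α := fun i => (M (e i)).Obj) x'
      obtain ⟨x', rfl⟩ := unperm e (α := fun i => (M i).Obj) x'
      obtain rfl := (hp x').unique hxy'
      choose x₁ hx₁ using fun r => unperm e' (α := fun i => (M (e i)).Obj) (x r)
      obtain rfl := funext hx₁
      choose x₂ hx₂ using fun r => unperm e (α := fun i => (M i).Obj) (x₁ r)
      obtain rfl := funext hx₂
      obtain rfl : x₂ = y := funext fun r => (hp _).unique (hxy r)
      obtain rfl := eq_of_heq ha
      obtain rfl := eq_of_heq ha'
      obtain rfl := eq_of_heq h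
      have hm : ∀ r, (fun i => x₂ r (e i)) = Function.update (β := fun i => (M (e i)).Obj)
          (fun i => x' (e i)) (e' j) (a r) := by
        intro r
        rw [hy r]
        funext i
        by_cases hi : i = e' j
        · subst hi
          rw [Function.update_self]
          exact Function.update_self ..
        · rw [Function.update_of_ne hi]
          exact Function.update_of_ne (e.injective.ne hi) ..
      exact (permute_map e' (f.permute e) j φ (fun r i => x₂ r (e i)) (fun i => x' (e i)) hm hx'
        hx).trans (permute_map e f (e' j) φ x₂ x' hy hx' hm)
  refine CategoryTheory.Functor.hext ho fun f g ξ => ?_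
  refine heq_reindexFunctor_map _ (ho f) (ho g) fun x y h => ?_
  obtain ⟨x, rfl⟩ := unperm e' (α := fun i => (M (e i)).Obj) x
  obtain ⟨x, rfl⟩ := unperm e (α := fun i => (M i).Obj) x
  obtain rfl := (hp x).unique h
  have key : ∀ z, z = x → HEq (ξ.app z) (ξ.app x) := by
    rintro _ rfl
    rfl
  exact key _ ((congrArg _ (unpermute_permute (e := e') (α := fun i => (M (e i)).Obj) _)).trans
    (unpermute_permute (e := e) (α := fun i => (M i).Obj) x))

end Reindex

section IsPerm

theorem isPerm_unitR {n : ℕ} {M : Fin n → BasedMulticategory.{v, u}}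
    (B : ∀ i, Fin 1 → (M i).Obj) :
    IsPerm (M' := flat fun i (_ : Fin 1) => M i) (M := M) (unitR n) (flat B) fun i => B i 0 := by
  intro i
  rw [Subsingleton.elim (0 : Fin 1) (pos i)]
  rfl

theorem isPerm_unitL {n : ℕ} {M : Fin n → BasedMulticategory.{v, u}}
    (B : ∀ (_ : Fin 1) i, (M i).Obj) :
    IsPerm (M' := flat fun (_ : Fin 1) i => M i) (M := M) (unitL n) (flat B) (B 0) := by
  intro i
  rw [Subsingleton.elim (0 : Fin 1) (blk i)]
  rfl

end IsPerm

section CompApp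

variable {n : ℕ} {k : Fin n → ℕ} {M : ∀ i, Fin (k i) → BasedMulticategory.{v, u}}
  {N : Fin n → BasedMulticategory.{v, u}} {L : BasedMulticategory.{v, u}}
  {g g' : MultiLin N L} {f f' : ∀ i, MultiLin (M i) (N i)}

theorem hcomp_app_flat (σ : g ⟶ g') (ξ : ∀ i, f i ⟶ f' i) (x : ∀ i j, (M i j).One) :
    HEq ((hcomp σ ξ).app (flat x)) (hcompApp σ ξ x) := by
  have key : ∀ z, z = x → HEq (hcompApp σ ξ z) (hcompApp σ ξ x) := by
    rintro _ rfl
    rfl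
  exact key _ (unflatten_flat (α := fun i j => (M i j).One) x)

theorem hcompApp_id_right (σ : g ⟶ g') (f : ∀ i, MultiLin (M i) (N i)) (x : ∀ i j, (M i j).One) :
    hcompApp σ (fun i => 𝟙 (f i)) x = σ.app fun i => (f i).obj (x i) := by
  have h : (g.onOne.map (X := fun i => (f i).obj (x i)) (Y := fun i => (f i).obj (x i))
      fun i => (𝟙 (f i) : f i ⟶ f i).app (x i)) = 𝟙 _ := g.onOne.map_id _
  have aux : ∀ {a b : L.One} {s : a ⟶ a} {t : a ⟶ b}, s = 𝟙 a → s ≫ t = t := by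
    rintro a b s t rfl
    exact Category.id_comp t
  exact aux h

theorem hcompApp_id_left (g : MultiLin N L) (ξ : ∀ i, f i ⟶ f' i) (x : ∀ i j, (M i j).One) :
    hcompApp (𝟙 g) ξ x = g.onOne.map (X := fun i => (f i).obj (x i))
      (Y := fun i => (f' i).obj (x i)) fun i => (ξ i).app (x i) :=
  Category.comp_id _

end CompApp

section Units

theorem comp_unit {n : ℕ} {N : Fin n → BasedMulticategory.{v, u}} {L : BasedMulticategory.{v, u}}
    (g : MultiLin N L) :
    g.comp (fun i => unit (N i)) = (reindexFunctor (unitR n) (flat_unitR N)).obj g := by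
  refine eq_reindexFunctor_obj _ (fun x y h => ?_)
      fun j l a a' b b' φ ψ x x' y y' hx hx' hy hy' ha ha' h hxy hxy' => ?_
  · obtain ⟨B, rfl⟩ := unflat (α := fun i (_ : Fin 1) => (N i).Obj) x
    obtain rfl := (isPerm_unitR B).unique h
    exact comp_obj_flat g _ B
  · obtain ⟨B', rfl⟩ := unflat (α := fun i (_ : Fin 1) => (N i).Obj) x'
    choose B hB using fun r => unflat (α := fun i (_ : Fin 1) => (N i).Obj) (x r)
    obtain rfl := funext hB
    obtain rfl := (isPerm_unitR B').unique hxy'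
    obtain rfl : (fun r i => B r i 0) = y := funext fun r => (isPerm_unitR (B r)).unique (hxy r)
    refine (comp_map_flat g (fun i => unit (N i)) j φ B B' hx hx').trans ?_
    refine g.map_congr (funext fun r => ?_) ?_ ((unit_map _ _ _ _ _ _ _).trans h) rfl rfl _ _ _ _
    · exact (congrFun (hy r) (blk j)).trans (Function.update_self ..)
    · exact hy'

theorem heq_hcomp_unit {n : ℕ} {N : Fin n → BasedMulticategory.{v, u}}
    {L : BasedMulticategory.{v, u}} {g g' : MultiLin N L} (σ : g ⟶ g') :
    HEq (hcomp σ fun i => 𝟙 (unit (N i))) ((reindexFunctor (unitR n) (flat_unitR N)).map σ) := by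
  refine heq_reindexFunctor_map _ (comp_unit g) (comp_unit g') fun x y h => ?_
  obtain ⟨B, rfl⟩ := unflat (α := fun i (_ : Fin 1) => (N i).Obj) x
  obtain rfl := (isPerm_unitR B).unique h
  refine (hcomp_app_flat σ _ B).trans (heq_of_eq ?_)
  exact hcompApp_id_right σ (fun i => unit (N i)) B

theorem unit_comp {k : ℕ} {M : Fin k → BasedMulticategory.{v, u}} {N : BasedMulticategory.{v, u}}
    (f : MultiLin M N) :
    (unit N).comp (fun _ => f) = (reindexFunctor (unitL k) (flat_unitL M)).obj f := by
  refine eq_reindexFunctor_obj _ (fun x y h => ?_)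
      fun j l a a' b b' φ ψ x x' y y' hx hx' hy hy' ha ha' h hxy hxy' => ?_
  · obtain ⟨B, rfl⟩ := unflat (α := fun (_ : Fin 1) i => (M i).Obj) x
    obtain rfl := (isPerm_unitL B).unique h
    exact comp_obj_flat (unit N) (fun _ => f) B
  · obtain ⟨B', rfl⟩ := unflat (α := fun (_ : Fin 1) i => (M i).Obj) x'
    choose B hB using fun r => unflat (α := fun (_ : Fin 1) i => (M i).Obj) (x r)
    obtain rfl := funext hB
    obtain rfl := (isPerm_unitL B').unique hxy'
    obtain rfl : (fun r => B r 0) = y := funext fun r => (isPerm_unitL (B r)).unique (hxy r)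
    refine (comp_map_flat (unit N) (fun _ => f) j φ B B' hx hx').trans ?_
    refine (unit_map _ _ _ _ _ _ _).trans ?_
    have e := Subsingleton.elim (blk j) 0
    exact f.map_congr (eq_of_heq ha) (eq_of_heq ha') h (congrArg (fun i r => B r i) e)
      (congrArg B' e) _ _ _ _

theorem heq_unit_hcomp {k : ℕ} {M : Fin k → BasedMulticategory.{v, u}}
    {N : BasedMulticategory.{v, u}} {f f' : MultiLin M N} (ξ : f ⟶ f') :
    HEq (hcomp (𝟙 (unit N)) fun _ => ξ) ((reindexFunctor (unitL k) (flat_unitL M)).map ξ) := by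
  refine heq_reindexFunctor_map _ (unit_comp f) (unit_comp f') fun x y h => ?_
  obtain ⟨B, rfl⟩ := unflat (α := fun (_ : Fin 1) i => (M i).Obj) x
  obtain rfl := (isPerm_unitL B).unique h
  refine (hcomp_app_flat (𝟙 (unit N)) (fun _ => ξ) B).trans (heq_of_eq ?_)
  exact (Category.comp_id _).trans (unit_onOne N (X := fun i => f.obj (B i))
    (Y := fun i => f'.obj (B i)) fun i => ξ.app (B i))

end Units

end MultiLin

/-! ### Equivariance and associativity of the composition -/

namespace MultiLin

open BasedMulticategory

theorem Trans.same_onOne_app {k : ℕ} {M : Fin k → BasedMulticategory.{v, u}}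
    {N : BasedMulticategory.{v', u'}} {g g' : MultiLin M N} (σ : g ⟶ g') {x y : ∀ i, (M i).One}
    (h : x = y) : Same ((Trans.onOne σ).app x) ((Trans.onOne σ).app y) := by
  subst h
  exact .refl _

theorem update_of_permute {m n : ℕ} {e : Fin m ≃ Fin n} {α : Fin n → Type u} {x x' : ∀ i, α i}
    {j : Fin m} {c : α (e j)}
    (h : (fun i => x (e i)) = Function.update (fun i => x' (e i)) j c) :
    x = Function.update x' (e j) c := by
  have := unpermute_update (e := e) (α := α) h
  rwa [unpermute_permute, unpermute_permute] at this

theorem same_hcomp_app {n : ℕ} {k : Fin n → ℕ} {M : ∀ i, Fin (k i) → BasedMulticategory.{v, u}}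
    {N : Fin n → BasedMulticategory.{v, u}} {L : BasedMulticategory.{v, u}}
    {g g' : MultiLin N L} {f f' : ∀ i, MultiLin (M i) (N i)} (σ : g ⟶ g') (ξ : ∀ i, f i ⟶ f' i)
    (x : ∀ i j, (M i j).One) :
    Same ((Trans.onOne (hcomp σ ξ)).app (flat x)) (hcompApp σ ξ x) :=
  .of_heq (comp_obj_flat g f x) (comp_obj_flat g' f' x) (hcomp_app_flat σ ξ x)

section Outer

variable {m n : ℕ} (e : Fin m ≃ Fin n) {k : Fin n → ℕ}
  {M : ∀ i, Fin (k i) → BasedMulticategory.{v, u}} {N : Fin n → BasedMulticategory.{v, u}}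
  {L : BasedMulticategory.{v, u}}

theorem isPerm_outerEquiv (B : ∀ i j, (M i j).Obj) :
    IsPerm (M' := flat fun i => M (e i)) (M := flat M) (outerEquiv e k) (flat fun i => B (e i))
      (flat B) :=
  flat_outerEquiv e (a := fun i j => (⟨M i j, B i j⟩ : (M : BasedMulticategory.{v, u}) × M.Obj))

/-- Composition is equivariant in the outer variables. -/
theorem permute_comp (g : MultiLin N L) (f : ∀ i, MultiLin (M i) (N i)) :
    (g.permute e).comp (fun i => f (e i)) =
      (reindexFunctor (outerEquiv e k) (flat_outerEquiv e M)).obj (g.comp f) := by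
  refine eq_reindexFunctor_obj _ (fun x y h => ?_)
      fun j l a a' b b' φ ψ x x' y y' hx hx' hy hy' ha ha' h hxy hxy' => ?_
  · obtain ⟨B, rfl⟩ := unflat (α := fun i j => (M (e i) j).Obj) x
    obtain ⟨B, rfl⟩ := unperm e (α := fun i => ∀ j, (M i j).Obj) B
    obtain rfl := (isPerm_outerEquiv e B).unique h
    exact ((comp_obj_flat (g.permute e) (fun i => f (e i)) fun i => B (e i)).trans
      (permute_obj e g fun i => (f i).obj (B i))).trans (comp_obj_flat g f B).symm
  · obtain ⟨B', rfl⟩ := unflat (α := fun i j => (M (e i) j).Obj) x'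
    obtain ⟨B', rfl⟩ := unperm e (α := fun i => ∀ j, (M i j).Obj) B'
    choose C hC using fun r => unflat (α := fun i j => (M (e i) j).Obj) (x r)
    obtain rfl := funext hC
    choose B hB using fun r => unperm e (α := fun i => ∀ j, (M i j).Obj) (C r)
    obtain rfl := funext hB
    obtain rfl := (isPerm_outerEquiv e B').unique hxy'
    obtain rfl : (fun r => flat (B r)) = y := funext fun r => (isPerm_outerEquiv e (B r)).unique (hxy r)
    have hp : (⟨e (blk j), pos j⟩ : (i : Fin n) × Fin (k i)) =
        finSigmaFinEquiv.symm (outerEquiv e k j) := (finSigmaFinEquiv.symm_apply_apply _).symm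
    have hu : ∀ r, UpdAt (α := fun i j => (M (e i) j).Obj) (finSigmaFinEquiv.symm j)
      (fun i => B r (e i)) (fun i => B' (e i)) (a r) := fun r => updAt_of_flat (hx r)
    have hv : ∀ r, UpdAt (α := fun i j => (M i j).Obj) ⟨e (blk j), pos j⟩ (B r) B' (a r) := by
      refine fun r => ⟨(hu r).1, fun i hi => ?_⟩
      obtain ⟨i, rfl⟩ := e.surjective i
      exact (hu r).2 i fun h => hi (congrArg e h)
    refine (comp_map_flat (g.permute e) (fun i => f (e i)) j φ (fun r i => B r (e i))
      (fun i => B' (e i)) hx hx').trans ?_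
    refine HEq.trans ?_ (comp_map_flat g f (outerEquiv e k j) ψ B B' hy hy').symm
    refine HEq.trans ?_ (cmap_congr g f hp ha ha' h rfl rfl hv hx' _ _)
    exact permute_map e g (blk j) _ (fun r i => (f i).obj (B r i)) (fun i => (f i).obj (B' i))
      (fun r => (hv r).obj_eq) rfl fun r => (hu r).obj_eq (f := fun i => f (e i))

theorem heq_permute_hcomp {g g' : MultiLin N L} {f f' : ∀ i, MultiLin (M i) (N i)} (σ : g ⟶ g')
    (ξ : ∀ i, f i ⟶ f' i) :
    HEq (hcomp ((permuteFunctor e N L).map σ) fun i => ξ (e i))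
      ((reindexFunctor (outerEquiv e k) (flat_outerEquiv e M)).map (hcomp σ ξ)) := by
  refine heq_reindexFunctor_map _ (permute_comp e g f) (permute_comp e g' f') fun x y h => ?_
  obtain ⟨B, rfl⟩ := unflat (α := fun i j => (M (e i) j).Obj) x
  obtain ⟨B, rfl⟩ := unperm e (α := fun i => ∀ j, (M i j).Obj) B
  obtain rfl := (isPerm_outerEquiv e B).unique h
  refine (hcomp_app_flat ((permuteFunctor e N L).map σ) (fun i => ξ (e i))
    fun i => B (e i)).trans (HEq.trans ?_ (hcomp_app_flat σ ξ B).symm)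
  refine Same.heq (A := L.One) (Same.comp ?_ ?_)
  · exact permute_onOne e g (X := fun i => (f i).obj (B i)) (Y := fun i => (f' i).obj (B i))
      fun i => (ξ i).app (B i)
  · exact (Trans.same_onOne_app σ
      (unpermute_permute (e := e) (α := fun i => (N i).Obj) fun i => (f' i).obj (B i)))

end Outer

section Inner

variable {n : ℕ} {k l : Fin n → ℕ} (e : ∀ i, Fin (k i) ≃ Fin (l i))
  {M : ∀ i, Fin (l i) → BasedMulticategory.{v, u}} {N : Fin n → BasedMulticategory.{v, u}}
  {L : BasedMulticategory.{v, u}}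

theorem isPerm_innerEquiv (B : ∀ i j, (M i j).Obj) :
    IsPerm (M' := flat fun i j => M i (e i j)) (M := flat M) (innerEquiv e)
      (flat fun i j => B i (e i j)) (flat B) :=
  flat_innerEquiv e (a := fun i j => (⟨M i j, B i j⟩ : (M : BasedMulticategory.{v, u}) × M.Obj))
    fun _ _ => rfl

theorem exists_inner {M : ∀ i, Fin (l i) → Type u} (B : ∀ i j, M i (e i j)) :
    ∃ C : ∀ i j, M i j, B = fun i j => C i (e i j) := by
  choose C hC using fun i => unperm (e i) (α := M i) (B i)
  exact ⟨C, funext hC⟩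

/-- Composition is equivariant in the inner variables. -/
theorem comp_permute (g : MultiLin N L) (f : ∀ i, MultiLin (M i) (N i)) :
    g.comp (fun i => (f i).permute (e i)) = (reindexFunctor (innerEquiv e)
      (flat_innerEquiv e fun _ _ => rfl)).obj (g.comp f) := by
  refine eq_reindexFunctor_obj _ (fun x y h => ?_)
      fun j r a a' b b' φ ψ x x' y y' hx hx' hy hy' ha ha' h hxy hxy' => ?_
  · obtain ⟨B, rfl⟩ := unflat (α := fun i j => (M i (e i j)).Obj) x
    obtain ⟨B, rfl⟩ := exists_inner e (M := fun i j => (M i j).Obj) B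
    obtain rfl := (isPerm_innerEquiv e B).unique h
    exact ((comp_obj_flat g (fun i => (f i).permute (e i)) fun i j => B i (e i j)).trans
      (congrArg g.obj (funext fun i => permute_obj (e i) (f i) (B i)))).trans
      (comp_obj_flat g f B).symm
  · obtain ⟨B', rfl⟩ := unflat (α := fun i j => (M i (e i j)).Obj) x'
    obtain ⟨B', rfl⟩ := exists_inner e (M := fun i j => (M i j).Obj) B'
    choose C hC using fun r => unflat (α := fun i j => (M i (e i j)).Obj) (x r)
    obtain rfl := funext hC
    choose B hB using fun r => exists_inner e (M := fun i j => (M i j).Obj) (C r)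
    obtain rfl := funext hB
    obtain rfl := (isPerm_innerEquiv e B').unique hxy'
    obtain rfl : (fun r => flat (B r)) = y :=
      funext fun r => (isPerm_innerEquiv e (B r)).unique (hxy r)
    have hp : (⟨blk j, e (blk j) (pos j)⟩ : (i : Fin n) × Fin (l i)) =
        finSigmaFinEquiv.symm (innerEquiv e j) := (finSigmaFinEquiv.symm_apply_apply _).symm
    have hu : ∀ r, UpdAt (α := fun i j => (M i (e i j)).Obj) (finSigmaFinEquiv.symm j)
      (fun i j => B r i (e i j)) (fun i j => B' i (e i j)) (a r) := fun r => updAt_of_flat (hx r)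
    have hv : ∀ r, UpdAt (α := fun i j => (M i j).Obj) ⟨blk j, e (blk j) (pos j)⟩ (B r) B' (a r) :=
      fun r => ⟨update_of_permute (hu r).1, fun i hi => permute_injective (e := e i)
        (α := fun j => (M i j).Obj) fun j => congrFun ((hu r).2 i hi) j⟩
    refine (comp_map_flat g (fun i => (f i).permute (e i)) j φ (fun r i j => B r i (e i j))
      (fun i j => B' i (e i j)) hx hx').trans ?_
    refine HEq.trans ?_ (comp_map_flat g f (innerEquiv e j) ψ B B' hy hy').symm
    refine HEq.trans ?_ (cmap_congr g f hp ha ha' h rfl rfl hv hx' _ _)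
    refine g.map_congr (funext fun r => permute_obj _ (f _) (B r _)) (permute_obj _ (f _) (B' _)) ?_
      (funext fun r => funext fun i => permute_obj (e i) (f i) (B r i))
      (funext fun i => permute_obj (e i) (f i) (B' i)) _ _ _ _
    exact permute_map (e (blk j)) (f (blk j)) (pos j) φ (fun r => B r (blk j)) (B' (blk j))
      (fun r => (hv r).1) hx' fun r => (hu r).1

theorem heq_hcomp_permute {g g' : MultiLin N L} {f f' : ∀ i, MultiLin (M i) (N i)} (σ : g ⟶ g')
    (ξ : ∀ i, f i ⟶ f' i) :
    HEq (hcomp σ fun i => (permuteFunctor (e i) (M i) (N i)).map (ξ i))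
      ((reindexFunctor (innerEquiv e) (flat_innerEquiv e fun _ _ => rfl)).map (hcomp σ ξ)) := by
  refine heq_reindexFunctor_map _ (comp_permute e g f) (comp_permute e g' f') fun x y h => ?_
  obtain ⟨B, rfl⟩ := unflat (α := fun i j => (M i (e i j)).Obj) x
  obtain ⟨B, rfl⟩ := exists_inner e (M := fun i j => (M i j).Obj) B
  obtain rfl := (isPerm_innerEquiv e B).unique h
  refine (hcomp_app_flat σ (fun i => (permuteFunctor (e i) (M i) (N i)).map (ξ i))
    fun i j => B i (e i j)).trans (HEq.trans ?_ (hcomp_app_flat σ ξ B).symm)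
  refine Same.heq (A := L.One) (Same.comp ?_ ?_)
  · exact same_map_of_same g.onOne fun i => Trans.same_onOne_app (ξ i)
      (unpermute_permute (e := e i) (α := fun j => (M i j).Obj) (B i))
  · exact Trans.same_onOne_app σ (funext fun i => permute_obj (e i) (f' i) (B i))

end Inner

section Assoc

variable {n : ℕ} {k : Fin n → ℕ} {l : ∀ i, Fin (k i) → ℕ}
  {M : ∀ i j, Fin (l i j) → BasedMulticategory.{v, u}}
  {N : ∀ i, Fin (k i) → BasedMulticategory.{v, u}} {L : Fin n → BasedMulticategory.{v, u}}
  {K : BasedMulticategory.{v, u}}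

theorem isPerm_assocEquiv (B : ∀ i j p, (M i j p).Obj) :
    IsPerm (M' := flat fun x : Fin (∑ i, k i) => M (blk x) (pos x)) (M := flat fun i => flat (M i))
      (assocEquiv l) (flat fun x : Fin (∑ i, k i) => B (blk x) (pos x)) (flat fun i => flat (B i)) :=
  flat_assocEquiv (a := fun i j p =>
    (⟨M i j p, B i j p⟩ : (M : BasedMulticategory.{v, u}) × M.Obj))

theorem exists_flat_flat {M : ∀ i j, Fin (l i j) → Type u}
    (x : ∀ s : Fin (∑ x : Fin (∑ i, k i), l (blk x) (pos x)),
      M (blk (blk s)) (pos (blk s)) (pos s)) :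
    ∃ B : ∀ i j p, M i j p, x = flat fun x : Fin (∑ i, k i) => B (blk x) (pos x) := by
  obtain ⟨C, rfl⟩ := unflat (α := fun x : Fin (∑ i, k i) => M (blk x) (pos x)) x
  obtain ⟨B, rfl⟩ := unflat (α := fun i j => ∀ p, M i j p) C
  exact ⟨B, rfl⟩

variable (h : MultiLin L K) (g : ∀ i, MultiLin (N i) (L i)) (f : ∀ i j, MultiLin (M i j) (N i j))

theorem comp_assoc_obj (B : ∀ i j p, (M i j p).Obj) :
    ((h.comp g).comp fun x => f (blk x) (pos x)).obj
        (flat fun x : Fin (∑ i, k i) => B (blk x) (pos x)) =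
      h.obj fun i => (g i).obj fun j => (f i j).obj (B i j) :=
  (comp_obj_flat (h.comp g) (fun x => f (blk x) (pos x)) _).trans
    (comp_obj_flat h g fun i j => (f i j).obj (B i j))

theorem comp_assoc_obj' (B : ∀ i j p, (M i j p).Obj) :
    (h.comp fun i => (g i).comp (f i)).obj (flat fun i => flat (B i)) =
      h.obj fun i => (g i).obj fun j => (f i j).obj (B i j) :=
  (comp_obj_flat h (fun i => (g i).comp (f i)) _).trans
    (congrArg h.obj (funext fun i => comp_obj_flat (g i) (f i) (B i)))

variable (l) in
/-- The indices of a place in a concatenation of concatenations. -/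
def places (s : Fin (∑ i, ∑ j, l i j)) : (i : Fin n) × (j : Fin (k i)) × Fin (l i j) :=
  ⟨blk s, finSigmaFinEquiv.symm (pos s)⟩

theorem places_assocEquiv (z : Fin (∑ x : Fin (∑ i, k i), l (blk x) (pos x))) :
    places l (assocEquiv l z) = ⟨blk (blk z), pos (blk z), pos z⟩ := by
  have e : finSigmaFinEquiv.symm (assocEquiv l z) =
      ⟨blk (blk z), finSigmaFinEquiv ⟨pos (blk z), pos z⟩⟩ := finSigmaFinEquiv.symm_apply_apply _
  refine (congrArg (fun t : (i : Fin n) × Fin (∑ j, l i j) =>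
    (⟨t.1, finSigmaFinEquiv.symm t.2⟩ : (i : Fin n) × (j : Fin (k i)) × Fin (l i j))) e).trans ?_
  exact congrArg (fun t => (⟨blk (blk z), t⟩ : (i : Fin n) × (j : Fin (k i)) × Fin (l i j)))
    (finSigmaFinEquiv.symm_apply_apply _)

/-- The family `B` of families of tuples is obtained from `B'` by putting `c` in a given place. -/
def UpdAt₂ (p : (i : Fin n) × (j : Fin (k i)) × Fin (l i j)) {α : ∀ i j, Fin (l i j) → Type u}
    (B B' : ∀ i j p, α i j p) (c : α p.1 p.2.1 p.2.2) : Prop :=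
  UpdAt p.2 (B p.1) (B' p.1) c ∧ ∀ i, i ≠ p.1 → B i = B' i

/-- The action of the composite of three layers of multilinear maps on a morphism. -/
def cmap₂ (p : (i : Fin n) × (j : Fin (k i)) × Fin (l i j)) {m : ℕ}
    {a : Fin m → (M p.1 p.2.1 p.2.2).Obj} {a' : (M p.1 p.2.1 p.2.2).Obj}
    (φ : (M p.1 p.2.1 p.2.2).Hom m a a') (B : Fin m → ∀ i j p, (M i j p).Obj)
    (B' : ∀ i j p, (M i j p).Obj)
    (hB : ∀ r, UpdAt₂ (α := fun i j p => (M i j p).Obj) p (B r) B' (a r))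
    (hB' : B' p.1 p.2.1 p.2.2 = a') :
    K.Hom m (fun r => h.obj fun i => (g i).obj fun j => (f i j).obj (B r i j))
      (h.obj fun i => (g i).obj fun j => (f i j).obj (B' i j)) :=
  h.map p.1 (cmap (g p.1) (f p.1) p.2 φ (fun r => B r p.1) (B' p.1) (fun r => (hB r).1) hB')
    (fun r i => (g i).obj fun j => (f i j).obj (B r i j))
    (fun i => (g i).obj fun j => (f i j).obj (B' i j))
    (fun r => funext fun i => by
      by_cases hi : i = p.1
      · subst hi
        rw [Function.update_self]
      · rw [Function.update_of_ne hi, (hB r).2 i hi]) rfl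

theorem cmap₂_congr {p q : (i : Fin n) × (j : Fin (k i)) × Fin (l i j)} (hpq : p = q) {m : ℕ}
    {a : Fin m → (M p.1 p.2.1 p.2.2).Obj} {a' : (M p.1 p.2.1 p.2.2).Obj}
    {b : Fin m → (M q.1 q.2.1 q.2.2).Obj} {b' : (M q.1 q.2.1 q.2.2).Obj}
    {φ : (M p.1 p.2.1 p.2.2).Hom m a a'} {ψ : (M q.1 q.2.1 q.2.2).Hom m b b'}
    (ha : HEq a b) (ha' : HEq a' b') (hφ : HEq φ ψ) (B : Fin m → ∀ i j p, (M i j p).Obj)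
    (B' : ∀ i j p, (M i j p).Obj)
    (hB : ∀ r, UpdAt₂ (α := fun i j p => (M i j p).Obj) p (B r) B' (a r))
    (hB' : B' p.1 p.2.1 p.2.2 = a')
    (hC : ∀ r, UpdAt₂ (α := fun i j p => (M i j p).Obj) q (B r) B' (b r))
    (hC' : B' q.1 q.2.1 q.2.2 = b') :
    HEq (cmap₂ h g f p φ B B' hB hB') (cmap₂ h g f q ψ B B' hC hC') := by
  subst hpq
  obtain rfl := eq_of_heq ha
  obtain rfl := eq_of_heq ha'
  obtain rfl := eq_of_heq hφ
  rfl

/-- Composition is associative: both sides act on a morphism by `cmap₂`, after the two ways of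
finding a place in a concatenation of concatenations are identified. -/
theorem comp_assoc : (h.comp g).comp (fun x => f (blk x) (pos x)) =
    (reindexFunctor (assocEquiv l) (flat_assocEquiv M)).obj
      (h.comp fun i => (g i).comp (f i)) := by
  refine eq_reindexFunctor_obj _ (fun x y hxy => ?_)
      fun s m a a' b b' φ ψ x x' y y' hx hx' hy hy' ha ha' hφ hxy hxy' => ?_
  · obtain ⟨B, rfl⟩ := exists_flat_flat (M := fun i j p => (M i j p).Obj) x
    obtain rfl := (isPerm_assocEquiv B).unique hxy
    exact (comp_assoc_obj h g f B).trans (comp_assoc_obj' h g f B).symm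
  · obtain ⟨B', rfl⟩ := exists_flat_flat (M := fun i j p => (M i j p).Obj) x'
    choose B hB using fun r => exists_flat_flat (M := fun i j p => (M i j p).Obj) (x r)
    obtain rfl := funext hB
    obtain rfl := (isPerm_assocEquiv B').unique hxy'
    obtain rfl : (fun r => flat fun i => flat (B r i)) = y :=
      funext fun r => (isPerm_assocEquiv (B r)).unique (hxy r)
    have hu : ∀ r, UpdAt (α := fun (x : Fin (∑ i, k i)) p => (M (blk x) (pos x) p).Obj)
      (finSigmaFinEquiv.symm s) (fun x => B r (blk x) (pos x)) (fun x => B' (blk x) (pos x)) (a r) :=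
      fun r => updAt_of_flat (hx r)
    have hv : ∀ r, UpdAt (α := fun i j => ∀ p, (M i j p).Obj) (finSigmaFinEquiv.symm (blk s))
        (B r) B' (B r (blk (blk s)) (pos (blk s))) := fun r => updAt_of_flat (funext fun x => by
      by_cases hs : x = blk s
      · subst hs
        rw [Function.update_self]
      · rw [Function.update_of_ne hs]
        exact (hu r).2 x hs)
    have hw : ∀ r, UpdAt₂ (α := fun i j p => (M i j p).Obj) ⟨blk (blk s), pos (blk s), pos s⟩
        (B r) B' (a r) := by
      refine fun r => ⟨⟨(hu r).1, fun j hj => ?_⟩, (hv r).2⟩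
      rw [(hv r).1]
      exact Function.update_of_ne hj ..
    have ht : ∀ r, UpdAt (α := fun i j => (flat (M i) j).Obj)
        (finSigmaFinEquiv.symm (assocEquiv l s)) (fun i => flat (B r i)) (fun i => flat (B' i))
        (b r) := fun r => updAt_of_flat (hy r)
    have ht' : ∀ r, UpdAt₂ (α := fun i j p => (M i j p).Obj) (places l (assocEquiv l s))
        (B r) B' (b r) := fun r => ⟨updAt_of_flat (ht r).1, fun i hi => flat_injective ((ht r).2 i hi)⟩
    refine (comp_map_flat (h.comp g) (fun x => f (blk x) (pos x)) s φ
      (fun r x => B r (blk x) (pos x)) (fun x => B' (blk x) (pos x)) hx hx').trans ?_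
    refine HEq.trans ?_ (comp_map_flat h (fun i => (g i).comp (f i)) (assocEquiv l s) ψ
      (fun r i => flat (B r i)) (fun i => flat (B' i)) hy hy').symm
    refine (comp_map_flat h g (blk s) ((f _ _).map (pos s) φ
      (fun r => B r (blk (blk s)) (pos (blk s))) (B' (blk (blk s)) (pos (blk s)))
      (fun r => (hu r).1) hx') (fun r i j => (f i j).obj (B r i j))
      (fun i j => (f i j).obj (B' i j)) (fun r => (hu r).obj_eq (f := fun x => f (blk x) (pos x)))
      rfl).trans ?_
    refine (cmap₂_congr h g f (places_assocEquiv s).symm ha ha' hφ B B' hw hx' ht' hy').trans ?_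
    refine h.map_congr (funext fun r => (comp_obj_flat (g _) (f _) _).symm)
      (comp_obj_flat (g _) (f _) _).symm ?_
      (funext fun r => funext fun i => (comp_obj_flat (g i) (f i) (B r i)).symm)
      (funext fun i => (comp_obj_flat (g i) (f i) (B' i)).symm) _ _ _ _
    exact (comp_map_flat (g _) (f _) (pos (assocEquiv l s)) ψ (fun r => B r _) (B' _)
      (fun r => (ht r).1) hy').symm

variable {h g f} in
theorem heq_hcomp_assoc {h' : MultiLin L K} {g' : ∀ i, MultiLin (N i) (L i)}
    {f' : ∀ i j, MultiLin (M i j) (N i j)} (ρ : h ⟶ h') (σ : ∀ i, g i ⟶ g' i)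
    (τ : ∀ i j, f i j ⟶ f' i j) :
    HEq (hcomp (hcomp ρ σ) fun x => τ (blk x) (pos x))
      ((reindexFunctor (assocEquiv l) (flat_assocEquiv M)).map
        (hcomp ρ fun i => hcomp (σ i) (τ i))) := by
  refine heq_reindexFunctor_map _ (comp_assoc h g f) (comp_assoc h' g' f') fun x y hxy => ?_
  obtain ⟨B, rfl⟩ := exists_flat_flat (M := fun i j p => (M i j p).Obj) x
  obtain rfl := (isPerm_assocEquiv B).unique hxy
  refine (hcomp_app_flat (hcomp ρ σ) (fun x => τ (blk x) (pos x))
    fun x : Fin (∑ i, k i) => B (blk x) (pos x)).trans (HEq.trans ?_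
    (hcomp_app_flat ρ (fun i => hcomp (σ i) (τ i)) fun i => flat (B i)).symm)
  have e₁ := comp_onOne h g (X := fun i j => (f i j).obj (B i j))
    (Y := fun i j => (f' i j).obj (B i j)) fun i j => (τ i j).app (B i j)
  have e₂ := same_hcomp_app ρ σ fun i j => (f' i j).obj (B i j)
  have e₃ := h.onOne.map_comp (X := fun i => (g i).obj fun j => (f i j).obj (B i j))
    (Y := fun i => (g i).obj fun j => (f' i j).obj (B i j))
    (Z := fun i => (g' i).obj fun j => (f' i j).obj (B i j))
    (fun i => (g i).onOne.map (X := fun j => (f i j).obj (B i j))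
      (Y := fun j => (f' i j).obj (B i j)) fun j => (τ i j).app (B i j))
    (fun i => (σ i).app fun j => (f' i j).obj (B i j))
  have e₄ := same_map_of_same h.onOne fun i => same_hcomp_app (σ i) (τ i) (B i)
  have e₅ := Trans.same_onOne_app ρ (funext fun i => comp_obj_flat (g' i) (f' i) (B i))
  have aux : ∀ {a b c d a' c' d' : K.One} {A : a ⟶ b} {S : b ⟶ c} {R : c ⟶ d} {T : a ⟶ c}
      {T' : a' ⟶ c'} {R' : c' ⟶ d'}, T = A ≫ S → Same T' T → Same R' R →
      Same (A ≫ S ≫ R) (T' ≫ R') := by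
    intro a b c d a' c' d' A S R T T' R' h h' h''
    rw [← Category.assoc, ← h]
    exact (h'.comp h'').symm
  exact ((e₁.comp e₂).trans (aux e₃ e₄ e₅)).heq

end Assoc

end MultiLin

/-! ### The multicategory of based multicategories -/

open MultiLin

/-- The multicategory of based multicategories. -/
noncomputable def basedMulticategories :
    CatMulticategory BasedMulticategory.{v, u} (fun _ M N => MultiLin M N) where
  reindex := fun {_ _} e {_ _ _} h => reindexFunctor e h
  id := unit
  comp := compFunctor _ _ _
  reindex_refl := reindexFunctor_refl
  reindex_trans := fun {_ _ _} e e' {_ _ _ _} h h' => reindexFunctor_trans e e' h h'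
  comp_id₁ := comp_unit
  comp_id₂ := heq_hcomp_unit
  id_comp₁ := unit_comp
  id_comp₂ := heq_unit_hcomp
  assoc₁ := comp_assoc
  assoc₂ := heq_hcomp_assoc
  comp_reindex_outer₁ := fun {_ _} e {_ _ _ _} g f => permute_comp e g f
  comp_reindex_outer₂ := fun {_ _} e {_ _ _ _ _ _ _ _} σ τ => heq_permute_hcomp e σ τ
  comp_reindex_inner₁ := by
    intro n b c k l e a a' h g f
    obtain rfl : a' = fun i j => a i (e i j) := funext fun i => funext (h i)
    exact comp_permute e g f
  comp_reindex_inner₂ := by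
    intro n b c k l e a a' h g g' f f' σ τ
    obtain rfl : a' = fun i j => a i (e i j) := funext fun i => funext (h i)
    exact heq_hcomp_permute e σ τ

theorem isId_app {k : ℕ} {M : Fin k → BasedMulticategory.{v, u}} {N : BasedMulticategory.{v', u'}}
    {f g : MultiLin M N} {ξ : f ⟶ g} (h : IsId ξ) (x : ∀ i, (M i).One) :
    IsId ((Trans.onOne ξ).app x) := by
  obtain ⟨rfl, rfl⟩ := h
  exact ⟨rfl, rfl⟩

/-- The operations of the multicategory of based multicategories are given by the usual formulas. -/
theorem isMulticategoryOfBasedMulticategories :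
    IsMulticategoryOfBasedMulticategories basedMulticategories.{v, u} where
  id_obj := fun _ _ => rfl
  id_map := fun M {_ _ _} φ x x' hx hx' => unit_map M 0 φ x x' hx hx'
  reindex_obj := fun {_ _} e {_ _} f x => permute_obj e f x
  reindex_map := fun {_ _} e {_ _} f j {_ _ _} φ x x' hx hx' h => permute_map e f j φ x x' hx hx' h
  reindex_app := by
    intro m n e M N f g ξ x
    have key : ∀ z, z = x → HEq (ξ.app z) (ξ.app x) := by
      rintro _ rfl
      rfl
    exact key _ (unpermute_permute (e := e) (α := fun i => (M i).Obj) x)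
  comp_obj := fun g f x => comp_obj_flat g f x
  comp_map := fun {_ _ _ _ _} g f s {_ _ _} φ x x' h hf hx' hg => comp_map_flat g f s φ x x' h hx'
  comp_app_left := fun f σ x => (hcomp_app_flat σ (fun i => 𝟙 (f i)) x).trans
    (heq_of_eq (hcompApp_id_right σ f x))
  comp_app_right := by
    intro n N L k M g f f' ξ j hj x h
    refine (hcomp_app_flat (𝟙 g) ξ x).trans (heq_of_eq ((hcompApp_id_left g ξ x).trans ?_))
    exact g.onOne_map_step j (x := fun i => (f i).obj (x i)) (y := fun i => (f' i).obj (x i))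
      (fun i => (ξ i).app (x i)) (fun i hi => isId_app (hj i hi) (x i)) (.refl _) h rfl

/-! ### Multilinear maps of underlying multicategories -/

theorem Same.map {A : Type u} [Category.{v} A] {B : Type u'} [Category.{v'} B] (F : A ⥤ B)
    {a b a' b' : A} {f : a ⟶ b} {g : a' ⟶ b'} (h : Same f g) : Same (F.map f) (F.map g) := by
  obtain ⟨rfl, rfl, rfl⟩ := h
  exact .of_eq (by simp)

theorem IsId.map {A : Type u} [Category.{v} A] {B : Type u'} [Category.{v'} B] (F : A ⥤ B)
    {a b : A} {f : a ⟶ b} (h : IsId f) : IsId (F.map f) := by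
  obtain ⟨rfl, rfl⟩ := h
  exact ⟨rfl, by simp⟩

theorem IsId.of_comp {A : Type u} [Category.{v} A] {a b c : A} {f : a ⟶ b} {g : b ⟶ c}
    (h : IsId (f ≫ g)) (hf : IsId f) : IsId g := by
  obtain ⟨rfl, rfl⟩ := hf
  simpa using h

namespace PermCat

variable (C : PermCat.{v, u})

/-- The morphisms of a permutative category as `1`-morphisms of its underlying multicategory. -/
def toOne : C.Obj ⥤ C.multicat.One where
  obj a := a
  map {a b} u := (eqToHom (C.sum_one fun _ => a) ≫ u : C.sum (fun _ : Fin 1 => a) ⟶ b)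
  map_id a := Category.comp_id (eqToHom (C.sum_one fun _ => a))
  map_comp {a b _} u t := Same.eq (A := C.Obj) (((Same.eqToHom_comp (C.sum_one fun _ => a) (u ≫ t)).trans
    ((Same.eqToHom_comp (C.sum_one fun _ => a) u).symm.comp (.refl t))).trans
      (same_post (C := C) (Same.eqToHom_comp (C.sum_one fun _ => b) t)
        (eqToHom (C.sum_one fun _ => a) ≫ u)).symm)

/-- The `1`-morphisms of the underlying multicategory as morphisms of the permutative category. -/
def ofOne : C.multicat.One ⥤ C.Obj where
  obj a := a
  map {a b} u := eqToHom (C.sum_one fun _ => a).symm ≫ (show C.sum (fun _ : Fin 1 => a) ⟶ b from u)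
  map_id a := eqToHom_trans (C.sum_one fun _ => a).symm (C.sum_one fun _ => a)
  map_comp {a b c} u t := Same.eq (A := C.Obj) ((Same.eqToHom_comp (C.sum_one fun _ => a).symm _).trans
    ((same_post (C := C) (g := eqToHom (C.sum_one fun _ => b).symm ≫
      (show C.sum (fun _ : Fin 1 => b) ⟶ c from t))
        (Same.eqToHom_comp (C.sum_one fun _ => b).symm (show C.sum (fun _ : Fin 1 => b) ⟶ c from t)).symm
        (show C.sum (fun _ : Fin 1 => a) ⟶ b from u)).trans
      ((Same.eqToHom_comp (C.sum_one fun _ => a).symm (show C.sum (fun _ : Fin 1 => a) ⟶ b from u)).symm.comp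
        (.refl _))))

variable {C}

theorem same_toOne {a b : C.Obj} (u : a ⟶ b) :
    Same (A := C.Obj) (a := C.sum fun _ : Fin 1 => a) (b := b) (C.toOne.map u) u :=
  Same.eqToHom_comp (C.sum_one fun _ => a) u

theorem same_ofOne {a b : C.Obj} (u : C.sum (fun _ : Fin 1 => a) ⟶ b) :
    Same (C.ofOne.map (X := a) (Y := b) u) u :=
  Same.eqToHom_comp (C.sum_one fun _ => a).symm u

theorem same_perm_two {e : Fin 2 ≃ Fin 2} (h₀ : e 0 = 1) (h₁ : e 1 = 0) (a : Fin 2 → C.Obj) :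
    Same (C.perm e a) (C.γ (a 1) (a 0)) := by
  have h := Realizes.perm_self e a
  have hl : (List.ofFn fun i => e i) = [1, 0] := by simp [h₀, h₁]
  have hl' : (List.ofFn fun i : Fin 2 => i) = [0, 1] := by simp
  rw [hl, hl'] at h
  exact h.unique (Realizes.γ (A := a) (l := [1]) (m := [0]) (C.add_zero _).symm (C.add_zero _).symm)
    (by decide)

theorem same_transposeSum_two (x : Fin 2 → Fin 2 → C.Obj) :
    Same (transposeSum x) (C.interchange (x 0 0) (x 0 1) (x 1 0) (x 1 1)) :=
  (Realizes.transposeSum (fun p : Fin 2 × Fin 2 => x p.1 p.2) fun s r => (s, r)).unique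
    (Realizes.interchange (l₁ := [(0, 0)]) (l₂ := [(0, 1)]) (l₃ := [(1, 0)]) (l₄ := [(1, 1)])
      (C.add_zero _).symm (C.add_zero _).symm (C.add_zero _).symm (C.add_zero _).symm) (by decide)

theorem same_sumMap_two {a b : Fin 2 → C.Obj} (f : ∀ i, a i ⟶ b i) :
    Same (C.sumMap f) (C.addMap (f 0) (f 1)) :=
  same_addMap (.refl _) (same_addMap_zero (f 1))

theorem sum_two (a : Fin 2 → C.Obj) : C.sum a = C.add (a 0) (a 1) :=
  congrArg (C.add (a 0)) (C.add_zero (a 1))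

end PermCat

section SumAt

variable {k : ℕ} {C : Fin k → PermCat.{v, u}} {j : Fin k}

theorem SumAt.update {m : ℕ} {X : Fin m → ∀ i, (C i).Obj} {z : ∀ i, (C i).Obj} (h : SumAt j X z)
    (r : Fin m) : X r = Function.update z j (X r j) := by
  funext l
  by_cases hl : l = j
  · subst hl
    rw [Function.update_self]
  · rw [Function.update_of_ne hl, h.2 l hl r]

theorem AddAt.sumAt {x y z : ∀ i, (C i).Obj} (h : AddAt j x y z) : SumAt j ![x, y] z :=
  ⟨h.1.trans (PermCat.sum_two (C := C j) fun r => ![x, y] r j).symm, fun l hl r => by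
    fin_cases r
    · exact (h.2 l hl).1
    · exact (h.2 l hl).2⟩

theorem SumAt.congr {m m' : ℕ} {X : Fin m → ∀ i, (C i).Obj} {X' : Fin m' → ∀ i, (C i).Obj}
    {z : ∀ i, (C i).Obj} (hX : List.ofFn X = List.ofFn X') (h : SumAt j X z) : SumAt j X' z := by
  obtain rfl : m = m' := by simpa using congrArg List.length hX
  obtain rfl := List.ofFn_injective hX
  exact h

theorem sumAt_one (x : ∀ i, (C i).Obj) : SumAt j (fun _ : Fin 1 => x) x :=
  ⟨((C j).sum_one fun _ => x j).symm, fun _ _ _ => rfl⟩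

end SumAt

namespace MultiLin

open BasedMulticategory PermCat

variable {k : ℕ} {C : Fin k → PermCat.{v, u}} {D : PermCat.{v', u'}}
  (G : MultiLin (fun i => (C i).multicat) D.multicat)

/-- The functor given by a multilinear map of underlying multicategories. -/
noncomputable def toFunctor : (∀ i, (C i).Obj) ⥤ D.Obj :=
  Functor.pi (fun i => (C i).toOne) ⋙ G.onOne ⋙ D.ofOne

theorem same_toFunctor_map {x y : ∀ i, (C i).Obj} (s : x ⟶ y) :
    Same (A := D.Obj) (a' := D.sum fun _ : Fin 1 => G.obj x) (b' := G.obj y) (G.toFunctor.map s)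
      (G.onOne.map (X := x) (Y := y) fun i => (C i).toOne.map (s i)) :=
  same_ofOne _

theorem same_toFunctor_map_step (j : Fin k) {x y : ∀ i, (C i).Obj} (s : x ⟶ y)
    (hs : ∀ i, i ≠ j → IsId (s i)) (hx : ∀ _ : Fin 1, x = Function.update y j (x j)) :
    Same (A := D.Obj) (a := D.sum fun _ : Fin 1 => G.obj x) (b := G.obj y)
      (G.map j ((C j).toOne.map (s j)) (fun _ => x) y hx rfl) (G.toFunctor.map s) :=
  (Same.of_eq (A := D.Obj) (a := D.sum fun _ : Fin 1 => G.obj x) (b := G.obj y)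
    (G.onOne_map_step j (x := x) (y := y) (fun i => (C i).toOne.map (s i))
    (fun i hi => (hs i hi).map _) (.refl _) hx rfl).symm).trans (G.same_toFunctor_map s).symm

/-- The map `G(x_1) ⊕ ⋯ ⊕ G(x_m) ⟶ G(x_1 ⊕ ⋯ ⊕ x_m)` given by the identity of the sum, as an
`m`-morphism in the variable `j`. -/
def sdist (j : Fin k) {m : ℕ} (X : Fin m → ∀ i, (C i).Obj) (z : ∀ i, (C i).Obj) (h : SumAt j X z) :
    D.sum (fun r => G.obj (X r)) ⟶ G.obj z :=
  G.map j (m := m) (a := fun r => X r j) (a' := z j) (eqToHom h.1.symm) X z h.update rfl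

variable {G} in
theorem same_sdist {j : Fin k} {m m' : ℕ} {X : Fin m → ∀ i, (C i).Obj}
    {X' : Fin m' → ∀ i, (C i).Obj} {z z' : ∀ i, (C i).Obj} (hX : List.ofFn X = List.ofFn X')
    (hz : z = z') (h : SumAt j X z) (h' : SumAt j X' z') :
    Same (G.sdist j X z h) (G.sdist j X' z' h') := by
  obtain rfl : m = m' := by simpa using congrArg List.length hX
  obtain rfl := List.ofFn_injective hX
  subst hz
  exact .refl _

variable {j : Fin k}

/-- A multilinear map of underlying multicategories is determined by its functor and the maps
`sdist`. -/
theorem same_map {m : ℕ} {a : Fin m → (C j).Obj} {a' : (C j).Obj} (φ : (C j).sum a ⟶ a')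
    (X : Fin m → ∀ i, (C i).Obj) (x' : ∀ i, (C i).Obj)
    (hx : ∀ r, X r = Function.update x' j (a r)) (hx' : x' j = a') {z : ∀ i, (C i).Obj}
    (hz : SumAt j X z) (s : z ⟶ x') (hj : Same (s j) φ) (hs : ∀ l, l ≠ j → IsId (s l)) :
    Same (A := D.Obj) (a := D.sum fun r => G.obj (X r)) (b := G.obj x')
      (G.map j (m := m) (a := a) (a' := a') φ X x' hx hx')
      (G.sdist j X z hz ≫ G.toFunctor.map s) := by
  obtain rfl : a = fun r => X r j := funext fun r => by rw [hx, Function.update_self]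
  subst hx'
  have hup := fun _ : Fin 1 => eq_update_of_isId s hs
  have e : φ = post (M := (C j).multicat) ((C j).toOne.map (s j)) (eqToHom hz.1.symm) :=
    Same.eq (A := (C j).Obj) (hj.symm.trans ((Same.eqToHom_comp hz.1.symm (s j)).symm.trans
      (same_post (same_toOne (s j)) (eqToHom hz.1.symm)).symm))
  have e' := G.map_post j ((C j).toOne.map (s j)) (eqToHom hz.1.symm) X z x' hz.update rfl hup rfl hx
  refine (Same.of_eq (A := D.Obj) (a := D.sum fun r => G.obj (X r)) (b := G.obj x') (Eq.trans
    (eq_of_heq (G.map_congr rfl rfl (heq_of_eq e) rfl rfl _ _ _ _)) e')).trans ?_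
  exact same_post (G.same_toFunctor_map_step j s hs hup) _

/-- The maps `sdist` are natural in all variables. -/
theorem sdist_naturality {m : ℕ} {X Y : Fin m → ∀ i, (C i).Obj} {z w : ∀ i, (C i).Obj}
    (h : SumAt j X z) (h' : SumAt j Y w) (f : ∀ r, X r ⟶ Y r) (s : z ⟶ w)
    (hj : Same (s j) ((C j).sumMap fun r => f r j)) (hs : ∀ l, l ≠ j → ∀ r, Same (f r l) (s l)) :
    D.sumMap (fun r => G.toFunctor.map (f r)) ≫ G.sdist j Y w h' =
      G.sdist j X z h ≫ G.toFunctor.map s := by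
  have e : pre (M := (C j).multicat) (m := m) (eqToHom h'.1.symm) (fun r => (C j).toOne.map (f r j)) =
      post ((C j).toOne.map (s j)) (eqToHom h.1.symm) :=
    Same.eq (A := (C j).Obj) ((same_pre (eqToHom h'.1.symm) fun r => same_toOne (f r j)).trans
      (((Same.comp_eqToHom _ h'.1.symm).trans (hj.symm.trans
        (Same.eqToHom_comp h.1.symm (s j)).symm)).trans
        (same_post (same_toOne (s j)) (eqToHom h.1.symm)).symm))
  have e' := G.onOne_naturality j _ _ _ _ e (y := X) (y' := z) (z := Y) (z' := w) h.update rfl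
    h'.update rfl (fun r i => (C i).toOne.map (f r i)) (fun i => (C i).toOne.map (s i))
    (fun r => .refl _) (.refl _) fun r l hl => (hs l hl r).map _
  exact Same.eq ((same_pre (G.sdist j Y w h') fun r => (G.same_toFunctor_map (f r)).symm).symm.trans
    ((Same.of_eq (A := D.Obj) (a := D.sum fun r => G.obj (X r)) (b := G.obj w) e').trans
    (same_post (G.same_toFunctor_map s).symm (G.sdist j X z h))))

/-- Compatibility of the maps `sdist` with concatenation, from the functoriality in one variable and
the fact that an identity of a sum of sums is the composite of identities of sums. -/
theorem same_sdist_flat {n : ℕ} {l : Fin n → ℕ} {X : ∀ i, Fin (l i) → ∀ i, (C i).Obj}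
    {Y : Fin n → ∀ i, (C i).Obj} {z : ∀ i, (C i).Obj} (hX : ∀ i, SumAt j (X i) (Y i))
    (hY : SumAt j Y z) (h : SumAt j (flat X) z) :
    Same (G.sdist j (flat X) z h)
      (D.sumMap (fun i => G.sdist j (X i) (Y i) (hX i)) ≫ G.sdist j Y z hY) := by
  have e := G.map_comp j (b := fun i => Y i j) (a := fun i r => X i r j) (eqToHom hY.1.symm)
    (fun i => eqToHom (hX i).1.symm) X Y z (fun i => (hX i).update) (fun _ => rfl) hY.update rfl
    h.update
  have e' : eqToHom h.1.symm = (C j).multicat.comp (b := fun i => Y i j) (a := fun i r => X i r j)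
      (eqToHom hY.1.symm) (fun i => eqToHom (hX i).1.symm) :=
    Same.eq (.of_isId ⟨_, rfl⟩ ((same_comp (C := C j) (b := fun i => Y i j) (eqToHom hY.1.symm)
      fun i => eqToHom (hX i).1.symm).isId ((isId_sumMap fun i => ⟨_, rfl⟩).comp ⟨_, rfl⟩)) rfl)
  refine (Same.of_eq (A := D.Obj) (a := D.sum fun r => G.obj (flat X r)) (b := G.obj z) (Eq.trans
    (eq_of_heq (G.map_congr rfl rfl (heq_of_eq e') rfl rfl _ _ _ _)) e)).trans ?_
  exact same_comp (b := fun i => G.obj (Y i)) (G.sdist j Y z hY) fun i => G.sdist j (X i) (Y i) (hX i)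

/-- Compatibility of the maps `sdist` with permutations, from the equivariance in one variable. -/
theorem perm_sdist {m n : ℕ} (e : Fin m ≃ Fin n) {X : Fin n → ∀ i, (C i).Obj}
    {z z' : ∀ i, (C i).Obj} (h : SumAt j X z) (h' : SumAt j (fun r => X (e r)) z') (s : z' ⟶ z)
    (hj : Same (s j) ((C j).perm e fun r => X r j)) (hs : ∀ l, l ≠ j → IsId (s l)) :
    D.perm e (fun r => G.obj (X r)) ≫ G.sdist j X z h =
      G.sdist j (fun r => X (e r)) z' h' ≫ G.toFunctor.map s := by
  have e₁ := G.map_reindex j e (a := fun r => X r j) (a' := fun r => X (e r) j) (fun _ => rfl)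
    (eqToHom h.1.symm) X z h.update rfl fun r => h.update (e r)
  refine Same.eq ((same_reindex (C := D) e (fun _ => rfl) (G.sdist j X z h)).symm.trans ?_)
  refine (Same.of_eq (A := D.Obj) (a := D.sum fun r => G.obj (X (e r))) (b := G.obj z) e₁.symm).trans
    (G.same_map (a := fun r => X (e r) j) _ _ _ _ _ h' s (hj.trans ?_) hs)
  exact ((same_reindex (C := C j) e (fun _ => rfl) _).trans (Same.comp_eqToHom _ _)).symm

/-- The maps `sdist` in two variables commute up to interchange of the order of summation. -/
theorem sdist_sdist {i : Fin k} (hij : i ≠ j) {m n : ℕ} {x : Fin m → Fin n → ∀ i, (C i).Obj}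
    {p : Fin n → ∀ i, (C i).Obj} {q : Fin m → ∀ i, (C i).Obj} {t : ∀ i, (C i).Obj}
    (hp : ∀ s, SumAt i (fun r => x r s) (p s)) (hq : ∀ r, SumAt j (x r) (q r)) (hpt : SumAt j p t)
    (hqt : SumAt i q t) :
    D.sumMap (fun s => G.sdist i (fun r => x r s) (p s) (hp s)) ≫ G.sdist j p t hpt =
      transposeSum (fun s r => G.obj (x r s)) ≫
        D.sumMap (fun r => G.sdist j (x r) (q r) (hq r)) ≫ G.sdist i q t hqt := by
  have hx₁ : ∀ r s, x r s i = q r i := fun r s => (hq r).2 i hij s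
  have hx₂ : ∀ r s, x r s j = p s j := fun r s => (hp s).2 j hij.symm r
  have hpi : ∀ s, p s i = t i := fun s => hpt.2 i hij s
  have hqj : ∀ r, q r j = t j := fun r => hqt.2 j hij.symm r
  have e := G.bilinear i j hij (a := fun r => q r i) (b := fun s => p s j) (eqToHom hqt.1.symm)
    (eqToHom hpt.1.symm) x p q t rfl rfl hpt.update hqt.update
    (fun s r => by rw [← hx₁ r s]; exact (hp s).update r)
    (fun r s => by rw [← hx₂ r s]; exact (hq r).update s) hpi hqj
  have e₁ : ∀ s, G.sdist i (fun r => x r s) (p s) (hp s) = G.map i (m := m) (a := fun r => q r i)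
      (eqToHom hqt.1.symm) (fun r => x r s) (p s)
      (fun r => by rw [← hx₁ r s]; exact (hp s).update r) (hpi s) := fun s =>
    eq_of_heq (G.map_congr (funext fun r => hx₁ r s) (hpi s)
      (Same.of_isId (A := (C i).Obj) ⟨(hp s).1.symm, rfl⟩ ⟨hqt.1.symm, rfl⟩
        (congrArg (C i).sum (funext fun r => hx₁ r s))).heq rfl rfl _ _ _ _)
  have e₂ : ∀ r, G.sdist j (x r) (q r) (hq r) = G.map j (m := n) (a := fun s => p s j)
      (eqToHom hpt.1.symm) (x r) (q r)
      (fun s => by rw [← hx₂ r s]; exact (hq r).update s) (hqj r) := fun r =>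
    eq_of_heq (G.map_congr (funext fun s => hx₂ r s) (hqj r)
      (Same.of_isId (A := (C j).Obj) ⟨(hq r).1.symm, rfl⟩ ⟨hpt.1.symm, rfl⟩
        (congrArg (C j).sum (funext fun s => hx₂ r s))).heq rfl rfl _ _ _ _)
  rw [funext e₁, funext e₂]
  refine Same.eq ((same_comp (C := D) (b := fun s => G.obj (p s)) _ _).symm.trans
    ((Same.of_eq (A := D.Obj) e).trans ((same_reindex (C := D) (swapEquiv m n) _ _).trans ?_)))
  exact (same_transposeSum _).symm.comp (same_comp (C := D) (b := fun r => G.obj (q r)) _ _)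

theorem isId_sdist_of_zero {m : ℕ} {X : Fin m → ∀ i, (C i).Obj} {z : ∀ i, (C i).Obj}
    (h : SumAt j X z) (h' : (∃ l, l ≠ j ∧ z l = (C l).zero) ∨ ∀ r, X r j = (C j).zero) :
    IsId (G.sdist j X z h) := by
  refine (isId_of_fromBase (C := D) (G.map_base j _ X z h.update rfl ?_)).1
  refine h'.symm.imp (fun h' => ?_) id
  refine fromBase_of_isId (C := C j) ⟨h.1.symm, rfl⟩ h' (h.1.trans ?_)
  rw [funext h', sum_zero]

theorem isId_sdist_one {m : ℕ} (hm : m = 1) {X : Fin m → ∀ i, (C i).Obj} {z : ∀ i, (C i).Obj}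
    (h : SumAt j X z) : IsId (G.sdist j X z h) := by
  subst hm
  obtain rfl : X = fun _ => z := funext fun r => funext fun l => by
    by_cases hl : l = j
    · subst hl
      exact (congrArg (fun r => X r l) (Subsingleton.elim r 0)).trans
        ((sum_one _ _).symm.trans h.1.symm)
    · exact h.2 l hl r
  have e := G.map_id j z h.update
  refine (Same.of_eq (A := D.Obj) (a := D.sum fun _ : Fin 1 => G.obj z) (b := G.obj z) ?_).isId
    (isId_id (C := D) (G.obj z))
  exact e

end MultiLin

/-! ### Recovering multilinear maps of permutative categories -/

namespace MultiLin

open BasedMulticategory PermCat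

variable {k : ℕ} {C : Fin k → PermCat.{v, u}} {D : PermCat.{v', u'}}
  (G : MultiLin (fun i => (C i).multicat) D.multicat)

/-- The distributivity map of a multilinear map of underlying multicategories: its value at the
identity of the sum `x_j ⊕ y_j`, as a `2`-morphism `(x_j, y_j) ⟶ x_j ⊕ y_j`. -/
def δ (j : Fin k) (x y z : ∀ i, (C i).Obj) (h : AddAt j x y z) :
    D.add (G.obj x) (G.obj y) ⟶ G.obj z :=
  eqToHom (D.sum_two fun r => G.obj (![x, y] r)).symm ≫ G.sdist j ![x, y] z h.sumAt

variable {j : Fin k}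

theorem same_δ {x y z : ∀ i, (C i).Obj} (h : AddAt j x y z) :
    Same (G.δ j x y z h) (G.sdist j ![x, y] z h.sumAt) :=
  Same.eqToHom_comp (D.sum_two fun r => G.obj (![x, y] r)).symm _

/-- The map `sdist` of a concatenation of two tuples. With tuples of lengths zero, one and two, this
gives the unit and associativity laws for the maps `δ`. -/
theorem sdist_append {m p q : ℕ} {X : Fin m → ∀ i, (C i).Obj} {A : Fin p → ∀ i, (C i).Obj}
    {B : Fin q → ∀ i, (C i).Obj} (hX : List.ofFn X = List.ofFn A ++ List.ofFn B)
    {x y z : ∀ i, (C i).Obj} (h : SumAt j X z) (hA : SumAt j A x) (hB : SumAt j B y)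
    (hz : AddAt j x y z) :
    Same (G.sdist j X z h) (D.addMap (G.sdist j A x hA) (G.sdist j B y hB) ≫ G.δ j x y z hz) := by
  let L : Fin 2 → List (∀ i, (C i).Obj) := ![List.ofFn A, List.ofFn B]
  have hL : List.ofFn X = List.ofFn (flat fun i => (L i).get) := by
    rw [ofFn_flat, hX]
    simp [L]
  have hA' : SumAt j (L 0).get x := hA.congr (List.ofFn_get _).symm
  have hB' : SumAt j (L 1).get y := hB.congr (List.ofFn_get _).symm
  refine (same_sdist hL rfl h (h.congr hL)).trans ((G.same_sdist_flat (Y := ![x, y])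
    (fun i => match i with | 0 => hA' | 1 => hB') hz.sumAt (h.congr hL)).trans ?_)
  refine Same.comp ((same_sumMap_two (C := D) _).trans (same_addMap ?_ ?_)) (G.same_δ hz).symm
  · exact same_sdist (List.ofFn_get _) rfl hA' hA
  · exact same_sdist (List.ofFn_get _) rfl hB' hB

theorem isId_δ_of_zero {x y z : ∀ i, (C i).Obj} (h : AddAt j x y z)
    (h' : x j = (C j).zero ∨ y j = (C j).zero ∨ ∃ l, l ≠ j ∧ z l = (C l).zero) :
    IsId (G.δ j x y z h) := by
  have h₀ : ∀ {x : ∀ i, (C i).Obj}, x j = (C j).zero → SumAt j ![] x := fun hx =>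
    ⟨hx, fun _ _ r => r.elim0⟩
  have h₁ : ∀ x : ∀ i, (C i).Obj, SumAt j ![x] x := fun x =>
    (sumAt_one x).congr (by simp)
  rcases h' with hx | hy | hz
  · obtain rfl : z = y := funext fun l => by
      by_cases hl : l = j
      · subst hl
        rw [h.1, hx, (C l).zero_add]
      · exact (h.2 l hl).2.symm
    -- The tuple `(z)` is the concatenation of `()` and `(z)`.
    refine IsId.of_comp ((G.sdist_append (A := ![]) (B := ![z]) (by simp) (h₁ z) (h₀ hx) (h₁ z)
      h).symm.isId (G.isId_sdist_one rfl _)) (isId_addMap (G.isId_sdist_of_zero _ ?_)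
        (G.isId_sdist_one rfl _))
    exact .inr fun r => r.elim0
  · obtain rfl : z = x := funext fun l => by
      by_cases hl : l = j
      · subst hl
        rw [h.1, hy, (C l).add_zero]
      · exact (h.2 l hl).1.symm
    refine IsId.of_comp ((G.sdist_append (A := ![z]) (B := ![]) (by simp) (h₁ z) (h₁ z) (h₀ hy)
      h).symm.isId (G.isId_sdist_one rfl _)) (isId_addMap (G.isId_sdist_one rfl _)
        (G.isId_sdist_of_zero _ ?_))
    exact .inr fun r => r.elim0
  · exact (G.same_δ h).isId (G.isId_sdist_of_zero _ (.inl hz))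

theorem δ_assoc {x y w xy yw z : ∀ i, (C i).Obj} (h₁ : AddAt j x y xy)
    (h₂ : AddAt j xy w z) (h₃ : AddAt j y w yw) (h₄ : AddAt j x yw z) :
    Same (D.addMap (G.δ j x y xy h₁) (𝟙 (G.toFunctor.obj w)) ≫ G.δ j xy w z h₂)
      (D.addMap (𝟙 (G.toFunctor.obj x)) (G.δ j y w yw h₃) ≫ G.δ j x yw z h₄) := by
  have hs : ∀ x : ∀ i, (C i).Obj, SumAt j ![x] x := fun x => (sumAt_one x).congr (by simp)
  have h : SumAt j ![x, y, w] z := by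
    refine ⟨?_, fun l hl r => ?_⟩
    · rw [h₄.1, h₃.1]
      exact congrArg ((C j).add (x j)) (congrArg ((C j).add (y j)) ((C j).add_zero (w j)).symm)
    · fin_cases r
      · exact (h₄.2 l hl).1
      · exact (h₁.2 l hl).2.trans (h₂.2 l hl).1
      · exact (h₂.2 l hl).2
  have e₁ := G.sdist_append (A := ![x, y]) (B := ![w]) (by simp) h h₁.sumAt (hs w) h₂
  have e₂ := G.sdist_append (A := ![x]) (B := ![y, w]) (by simp) h (hs x) h₃.sumAt h₄
  refine Same.trans ?_ (e₁.symm.trans (e₂.trans ?_))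
  · exact (same_addMap (G.same_δ h₁) (G.isId_sdist_one rfl (hs w)).same'.symm).comp (.refl _)
  · exact (same_addMap (G.isId_sdist_one rfl (hs x)).same' (G.same_δ h₃).symm).comp (.refl _)

theorem δ_symm {x y z z' : ∀ i, (C i).Obj} (h : AddAt j x y z) (h' : AddAt j y x z') (s : z ⟶ z')
    (hj : Same (s j) ((C j).γ (x j) (y j))) (hs : ∀ l, l ≠ j → IsId (s l)) :
    G.δ j x y z h ≫ G.toFunctor.map s = D.γ (G.obj x) (G.obj y) ≫ G.δ j y x z' h' := by
  have hX : ![x, y] = fun r => ![y, x] (Equiv.swap 0 1 r) := by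
    funext r
    fin_cases r <;> simp
  have h'' : SumAt j (fun r => ![y, x] (Equiv.swap (0 : Fin 2) 1 r)) z := hX ▸ h.sumAt
  have e := G.perm_sdist (Equiv.swap 0 1) h'.sumAt h'' s
    (hj.trans (same_perm_two (C := C j) (by simp) (by simp) fun r => ![y, x] r j).symm) hs
  refine Same.eq (Same.trans ?_ ((Same.of_eq e.symm).trans ?_))
  · exact ((G.same_δ h).trans (same_sdist (by rw [hX]) rfl _ _)).comp (.refl _)
  · exact (same_perm_two (C := D) (by simp) (by simp) fun r => G.obj (![y, x] r)).comp
      (G.same_δ h').symm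

theorem δ_naturality {x y z x' y' z' : ∀ i, (C i).Obj} (h : AddAt j x y z)
    (h' : AddAt j x' y' z') (f : x ⟶ x') (g : y ⟶ y') (s : z ⟶ z')
    (hj : Same (s j) ((C j).addMap (f j) (g j)))
    (hs : ∀ l, l ≠ j → Same (f l) (s l) ∧ Same (g l) (s l)) :
    D.addMap (G.toFunctor.map f) (G.toFunctor.map g) ≫ G.δ j x' y' z' h' =
      G.δ j x y z h ≫ G.toFunctor.map s := by
  let u : ∀ r : Fin 2, ![x, y] r ⟶ ![x', y'] r := fun r => match r with | 0 => f | 1 => g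
  have e := G.sdist_naturality h.sumAt h'.sumAt u s
    (hj.trans (same_sumMap_two (C := C j) fun r => u r j).symm)
    fun l hl r => match r with | 0 => (hs l hl).1 | 1 => (hs l hl).2
  exact Same.eq (Same.trans ((same_sumMap_two (C := D) fun r => G.toFunctor.map (u r)).symm.comp
    (G.same_δ h')) ((Same.of_eq e).trans ((G.same_δ h).symm.comp (.refl _))))

theorem δ_pentagon {i : Fin k} (hij : i ≠ j) {x y x' y' xy xy' xx yy z : ∀ i, (C i).Obj}
    (h₁ : AddAt i x y xy) (h₂ : AddAt i x' y' xy') (h₃ : AddAt j xy xy' z)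
    (h₄ : AddAt j x x' xx) (h₅ : AddAt j y y' yy) (h₆ : AddAt i xx yy z) :
    D.addMap (G.δ i x y xy h₁) (G.δ i x' y' xy' h₂) ≫ G.δ j xy xy' z h₃ =
      D.interchange (G.obj x) (G.obj y) (G.obj x') (G.obj y') ≫
        D.addMap (G.δ j x x' xx h₄) (G.δ j y y' yy h₅) ≫ G.δ i xx yy z h₆ := by
  have hX₀ : ![x, y] = fun r => ![![x, x'], ![y, y']] r 0 := by
    funext r
    fin_cases r <;> rfl
  have hX₁ : ![x', y'] = fun r => ![![x, x'], ![y, y']] r 1 := by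
    funext r
    fin_cases r <;> rfl
  have hp : ∀ s, SumAt i (fun r => ![![x, x'], ![y, y']] r s) (![xy, xy'] s) := fun s =>
    match s with
    | 0 => h₁.sumAt.congr (by rw [hX₀])
    | 1 => h₂.sumAt.congr (by rw [hX₁])
  have hq : ∀ r, SumAt j (![![x, x'], ![y, y']] r) (![xx, yy] r) := fun r =>
    match r with
    | 0 => h₄.sumAt
    | 1 => h₅.sumAt
  have e := G.sdist_sdist hij hp hq h₃.sumAt h₆.sumAt
  refine Same.eq (Same.trans ?_ ((Same.of_eq e).trans ?_))
  · refine Same.comp (Same.trans ?_ (same_sumMap_two (C := D) _).symm) (G.same_δ h₃)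
    exact same_addMap ((G.same_δ h₁).trans (same_sdist (by rw [hX₀]) rfl _ _))
      ((G.same_δ h₂).trans (same_sdist (by rw [hX₁]) rfl _ _))
  · refine Same.comp (same_transposeSum_two _) (Same.comp ?_ (G.same_δ h₆).symm)
    exact (same_sumMap_two (C := D) _).trans
      (same_addMap (G.same_δ h₄).symm (G.same_δ h₅).symm)

/-- The multilinear map of permutative categories that is recovered from a multilinear map of the
underlying based multicategories. -/
noncomputable def toPermLin : PermLin C D where
  F := G.toFunctor
  obj_zero x h := G.obj_base x h
  map_zero {x y} s := fun ⟨i, hx, hi⟩ => (G.same_toFunctor_map s).isId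
    (isId_of_fromBase (C := D) (G.fromBase_onOne (i := i) (x := x) (y := y) _
      (fromBase_of_isId (C := C i) ((same_toOne (s i)).isId hi) (fun _ => hx)
        (hi.1.symm.trans hx)))).1
  δ := G.δ
  δ_naturality i {x y z x' y' z'} h h' f g s hi hs := by
    have hf : ∀ l, l ≠ i → Same (f l) (s l) ∧ Same (g l) (s l) := fun l hl =>
      ⟨.of_heq (h.2 l hl).1 (h'.2 l hl).1 (hs l hl).1, .of_heq (h.2 l hl).2 (h'.2 l hl).2 (hs l hl).2⟩
    exact G.δ_naturality h h' f g s (.of_heq h.1 h'.1 hi) hf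
  δ_zero i x y z h h' := G.isId_δ_of_zero h h'
  δ_assoc i x y w xy yw z h₁ h₂ h₃ h₄ :=
    Same.eq ((G.δ_assoc h₁ h₂ h₃ h₄).trans (Same.eqToHom_comp _ _).symm)
  δ_symm i x y z z' h h' s hi hs := G.δ_symm h h' s (.of_heq h.1 h'.1 hi) hs
  δ_pentagon i j hij x y x' y' xy xy' xx yy z h₁ h₂ h₃ h₄ h₅ h₆ :=
    G.δ_pentagon hij h₁ h₂ h₃ h₄ h₅ h₆

/-- The iterated distributivity maps of the recovered multilinear map are the values of the given
one at the identities of sums. -/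
theorem same_lam_toPermLin {m : ℕ} (X : Fin m → ∀ i, (C i).Obj) (z : ∀ i, (C i).Obj)
    (h : SumAt j X z) : Same (G.toPermLin.lam j X z h) (G.sdist j X z h) := by
  induction m generalizing z with
  | zero => exact .of_isId ⟨_, rfl⟩ (G.isId_sdist_of_zero h (.inr fun r => r.elim0)) rfl
  | succ m ih =>
    have h₀ : SumAt j ![X 0] (X 0) := (sumAt_one (X 0)).congr (by simp)
    refine Same.trans ?_ (G.sdist_append (A := ![X 0]) (B := fun r => X r.succ)
      (by simp [List.ofFn_succ]) h h₀ h.tail h.head).symm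
    exact (same_addMap (G.isId_sdist_one rfl h₀).same'.symm (ih _ _ h.tail)).comp (.refl _)

end MultiLin

/-! ### The isomorphisms of categories of multilinear maps -/

namespace PermLin

variable {k : ℕ} {C : Fin k → PermCat.{v, u}} {D : PermCat.{v', u'}} {j : Fin k}

/-- A morphism out of a sum in the variable `j` is the component of a morphism of tuples that is an
identity in the other places. -/
theorem exists_sumAt_hom {m : ℕ} {a : Fin m → (C j).Obj} {a' : (C j).Obj}
    (φ : (C j).sum a ⟶ a') {x : Fin m → ∀ i, (C i).Obj} {x' : ∀ i, (C i).Obj}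
    (hx : ∀ r, x r = Function.update x' j (a r)) (hx' : x' j = a') :
    ∃ (z : ∀ i, (C i).Obj) (_ : SumAt j x z) (s : z ⟶ x'), Same (s j) φ ∧
      ∀ l, l ≠ j → IsId (s l) := by
  obtain ⟨s, hj, hs⟩ := exists_hom_update (𝟙 x') φ rfl
    ((Function.update_eq_self j x').symm.trans (by rw [hx']))
  exact ⟨_, sumAt_update j hx, s, hj, fun l hl => (hs l hl).isId (isId_id_apply x' l)⟩

variable (f : PermLin C D)

theorem isId_lam_one (x : ∀ i, (C i).Obj) : IsId (f.lam j (fun _ : Fin 1 => x) x (sumAt_one x)) :=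
  (f.same_lam_tdist x j (sumAt_one x) (a := fun _ => x j)
    (fun _ => (Function.update_eq_self j x).symm) fun _ _ => rfl).isId (f.isId_tdist_one x j _)

theorem same_lam_two {x y z : ∀ i, (C i).Obj} (h : AddAt j x y z) :
    Same (f.lam j ![x, y] z h.sumAt) (f.δ j x y z h) := by
  refine Same.id_comp (f.same_δ rfl ?_ rfl _ _) ?_
  · funext l
    by_cases hl : l = j
    · subst hl
      exact (Function.update_self ..).trans ((C l).add_zero (y l))
    · exact (Function.update_of_ne hl ..).trans (h.2 l hl).2.symm
  · refine IsId.same' (PermCat.isId_addMap ⟨rfl, rfl⟩ (IsId.comp (PermCat.isId_addMap ⟨rfl, rfl⟩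
      (⟨_, rfl⟩)) (f.δ_zero _ _ _ _ _ (.inr (.inl ?_)))))
    exact Function.update_self ..

/-- The functor of a multilinear map of permutative categories is recovered from the induced
multilinear map of the underlying based multicategories. -/
theorem same_toFunctor_toMultiLin {x y : ∀ i, (C i).Obj} (s : x ⟶ y) :
    Same (f.toMultiLin.toFunctor.map s) (f.F.map s) := by
  refine homFactor s (fun x y s => Same (f.toMultiLin.toFunctor.map s) (f.F.map s)) ?_ ?_ ?_
  · intro x
    rw [CategoryTheory.Functor.map_id, CategoryTheory.Functor.map_id]
    exact .refl _
  · intro x y z s t h h'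
    rw [Functor.map_comp, Functor.map_comp]
    exact h.comp h'
  · intro x y s j hs
    have hx := fun _ : Fin 1 => eq_update_of_isId s hs
    refine (f.toMultiLin.same_toFunctor_map_step j s hs hx).symm.trans ?_
    refine (f.same_lmap ((C j).toOne.map (s j)) (fun _ => x) y hx rfl (sumAt_one x) s
      (PermCat.same_toOne (s j)).symm hs).trans ?_
    exact (Same.refl _).id_comp (f.isId_lam_one x).same'

/-- A multilinear map of permutative categories is determined by the induced multilinear map of the
underlying based multicategories. -/
theorem toPermLin_toMultiLin : f.toMultiLin.toPermLin = f := by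
  refine PermLin.ext' (fun x => rfl) (fun s => (f.same_toFunctor_toMultiLin s).heq)
    fun i x y z h => Same.heq ?_
  refine (f.toMultiLin.same_δ h).trans (Same.trans ?_ (f.same_lam_two h))
  refine (f.same_lmap (eqToHom h.sumAt.1.symm) ![x, y] z h.sumAt.update rfl h.sumAt (𝟙 z)
    (.of_isId ⟨rfl, rfl⟩ ⟨_, rfl⟩ h.sumAt.1) fun l _ => isId_id_apply z l).trans ?_
  rw [f.F.map_id, Category.comp_id]
  exact .refl _

end PermLin

namespace MultiLin

open BasedMulticategory PermCat

variable {k : ℕ} {C : Fin k → PermCat.{v, u}} {D : PermCat.{v', u'}}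
  (G : MultiLin (fun i => (C i).multicat) D.multicat)

/-- Every multilinear map of underlying based multicategories is induced by a multilinear map of
permutative categories. -/
theorem toMultiLin_toPermLin : G.toPermLin.toMultiLin = G := by
  refine MultiLin.ext' (fun x => rfl) fun j {m a a'} φ x x' hx hx' => ?_
  obtain ⟨z, hz, s, hj, hs⟩ := PermLin.exists_sumAt_hom (a := a) φ hx hx'
  refine Same.heq ((G.toPermLin.same_lmap φ x x' hx hx' hz s hj hs).trans ?_)
  exact ((G.same_lam_toPermLin x z hz).comp (.refl _)).trans (G.same_map φ x x' hx hx' hz s hj hs).symm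

variable {G} {G' : MultiLin (fun i => (C i).multicat) D.multicat}

/-- The natural transformation of functors given by a morphism of multilinear maps of underlying
multicategories. -/
noncomputable def toNatTrans (σ : G ⟶ G') : G.toFunctor ⟶ G'.toFunctor :=
  Functor.whiskerLeft (Functor.pi fun i => (C i).toOne)
    (Functor.whiskerRight (Trans.onOne σ) D.ofOne)

theorem same_toNatTrans_app (σ : G ⟶ G') (x : ∀ i, (C i).Obj) :
    Same (A := D.Obj) (a' := D.sum fun _ : Fin 1 => G.obj x) (b' := G'.obj x)
      ((toNatTrans σ).app x) (σ.app x) :=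
  same_ofOne (a := G.obj x) (b := G'.obj x) _

theorem δ_toNatTrans (σ : G ⟶ G') {i : Fin k} {x y z : ∀ i, (C i).Obj} (h : AddAt i x y z) :
    G.δ i x y z h ≫ (toNatTrans σ).app z =
      D.addMap ((toNatTrans σ).app x) ((toNatTrans σ).app y) ≫ G'.δ i x y z h := by
  have e := σ.naturality i (m := 2) (a := fun r => ![x, y] r i) (eqToHom h.sumAt.1.symm) ![x, y] z
    h.sumAt.update rfl
  refine Same.eq (Same.trans ((G.same_δ h).comp (.refl _)) ?_)
  refine (same_post (C := D) (same_toNatTrans_app σ z).symm (G.sdist i ![x, y] z h.sumAt)).symm.trans ?_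
  refine (Same.of_eq (A := D.Obj) e.symm).trans ?_
  refine (same_pre (C := D) (G'.sdist i ![x, y] z h.sumAt)
    fun r => (same_toNatTrans_app σ (![x, y] r)).symm).trans ?_
  exact Same.comp (same_sumMap_two (C := D) _) (G'.same_δ h).symm

/-- The morphism of multilinear maps of permutative categories that is recovered from one of
multilinear maps of the underlying based multicategories. -/
noncomputable def toPermLinMap (σ : G ⟶ G') : G.toPermLin ⟶ G'.toPermLin where
  τ := toNatTrans σ
  δ_comm _ _ _ _ h := δ_toNatTrans σ h
  app_zero x h := (same_toNatTrans_app σ x).isId (isId_of_fromBase (C := D) (σ.app_base x h)).1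

/-- The functor that takes a multilinear map of underlying based multicategories to the multilinear
map of permutative categories that induces it. -/
noncomputable def toPermLinFunctor (C : Fin k → PermCat.{v, u}) (D : PermCat.{v', u'}) :
    MultiLin (fun i => (C i).multicat) D.multicat ⥤ PermLin C D where
  obj G := G.toPermLin
  map σ := toPermLinMap σ
  map_id _ := PermLin.Trans.ext (NatTrans.ext (funext fun _ => D.ofOne.map_id _))
  map_comp _ _ := PermLin.Trans.ext (NatTrans.ext (funext fun _ => D.ofOne.map_comp _ _))

end MultiLin

/-- The multilinear maps of permutative categories and those of the underlying based multicategories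
form isomorphic categories. -/
noncomputable def PermLin.isoCat {k : ℕ} (C : Fin k → PermCat.{v, u}) (D : PermCat.{v', u'}) :
    IsoCat (PermLin C D) (MultiLin (fun i => (C i).multicat) D.multicat) where
  functor := PermLin.toMultiLinFunctor C D
  inverse := MultiLin.toPermLinFunctor C D
  unit_eq := CategoryTheory.Functor.hext (fun f => f.toPermLin_toMultiLin.symm) fun f g ξ =>
    PermLin.hom_ext' f.toPermLin_toMultiLin.symm g.toPermLin_toMultiLin.symm fun x =>
      Same.heq (Same.symm ((MultiLin.same_toNatTrans_app ((PermLin.toMultiLinFunctor C D).map ξ) x).trans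
        (Same.eqToHom_comp (D.sum_one fun _ => f.F.obj x) (ξ.τ.app x))))
  counit_eq := CategoryTheory.Functor.hext (fun G => G.toMultiLin_toPermLin) fun G G' σ =>
    MultiLin.hom_ext' G.toMultiLin_toPermLin G'.toMultiLin_toPermLin fun x =>
      Same.heq (A := D.Obj) ((Same.eqToHom_comp (D.sum_one fun _ => G.obj x) _).trans
        (MultiLin.same_toNatTrans_app σ x))

/-! ### Transport of a multicategory along isomorphisms of categories of multimorphisms -/

section IsoCat

variable {A : Type u} [Category.{v} A] {B : Type u'} [Category.{v'} B]

theorem heq_functor_map (F : A ⥤ B) {x y x' y' : A} {f : x ⟶ y} {f' : x' ⟶ y'} (hx : x = x')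
    (hy : y = y') (h : HEq f f') : HEq (F.map f) (F.map f') := by
  subst hx hy
  rw [eq_of_heq h]

theorem heq_map_of_eq {F G : A ⥤ B} (h : F = G) {x y : A} (f : x ⟶ y) :
    HEq (F.map f) (G.map f) := by
  rw [h]

variable (E : IsoCat A B)

theorem isoCat_counit_obj (y : B) : E.functor.obj (E.inverse.obj y) = y :=
  CategoryTheory.Functor.congr_obj E.counit_eq y

theorem isoCat_unit_obj (x : A) : E.inverse.obj (E.functor.obj x) = x :=
  (CategoryTheory.Functor.congr_obj E.unit_eq x).symm

theorem isoCat_counit_map {y y' : B} (g : y ⟶ y') : HEq (E.functor.map (E.inverse.map g)) g :=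
  heq_map_of_eq E.counit_eq g

theorem isoCat_unit_map {x x' : A} (f : x ⟶ x') : HEq (E.inverse.map (E.functor.map f)) f :=
  (heq_map_of_eq E.unit_eq f).symm

theorem isoCat_obj_injective {x x' : A} (h : E.functor.obj x = E.functor.obj x') : x = x' := by
  rw [← isoCat_unit_obj E x, h, isoCat_unit_obj]

theorem isoCat_heq_of_map {x y x' y' : A} {f : x ⟶ y} {f' : x' ⟶ y'} (hx : x = x') (hy : y = y')
    (h : HEq (E.functor.map f) (E.functor.map f')) : HEq f f' := by
  subst hx hy
  exact (isoCat_unit_map E f).symm.trans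
    ((heq_functor_map E.inverse rfl rfl h).trans (isoCat_unit_map E f'))

end IsoCat

namespace CatMulticategory

/-- Horizontal composition respects heterogeneous equality of `2`-cells. -/
theorem comp₂_congr {Obj : Type u} {Hom : (k : ℕ) → (Fin k → Obj) → Obj → Type w}
    [∀ k a b, Category.{w'} (Hom k a b)] (Q : CatMulticategoryData Obj Hom)
    {n : ℕ} {b : Fin n → Obj} {c : Obj} {k : Fin n → ℕ} {a : ∀ i, Fin (k i) → Obj}
    {g g' h h' : Hom n b c} {f f' e e' : ∀ i, Hom (k i) (a i) (b i)} {σ : g ⟶ g'} {ρ : h ⟶ h'}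
    {τ : ∀ i, f i ⟶ f' i} {θ : ∀ i, e i ⟶ e' i} (hg : g = h) (hg' : g' = h') (hf : f = e)
    (hf' : f' = e') (hσ : HEq σ ρ) (hτ : ∀ i, HEq (τ i) (θ i)) :
    HEq (Q.comp₂ σ τ) (Q.comp₂ ρ θ) := by
  subst hg hg' hf hf'
  obtain rfl := eq_of_heq hσ
  obtain rfl : τ = θ := funext fun i => eq_of_heq (hτ i)
  rfl

variable {Obj : Type u} {Hom : (k : ℕ) → (Fin k → Obj) → Obj → Type w}
  [∀ k a b, Category.{w'} (Hom k a b)] {Obj' : Type u'}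
  {Hom' : (k : ℕ) → (Fin k → Obj') → Obj' → Type v} [∀ k a b, Category.{v'} (Hom' k a b)]
  (Q : CatMulticategory Obj' Hom') {F : Obj → Obj'}
  (E : ∀ {k : ℕ} (a : Fin k → Obj) (b : Obj), IsoCat (Hom k a b) (Hom' k (fun i => F (a i)) (F b)))

/-- The operations on multimorphisms that are carried over along isomorphisms of categories to the
multimorphisms of a multicategory enriched over `Cat`. -/
def transportData : CatMulticategoryData Obj Hom where
  reindex := fun {_ _} e {a a' b} h =>
    (E a b).functor ⋙ Q.reindex e (fun i => congrArg F (h i)) ⋙ (E a' b).inverse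
  id a := (E (fun _ => a) a).inverse.obj (Q.id (F a))
  comp := fun {n b c k a} => (Functor.prod (E b c).functor
    (Functor.pi fun i => (E (a i) (b i)).functor)) ⋙
      Q.comp (n := n) (b := fun i => F (b i)) (c := F c) (k := k) (a := fun i j => F (a i j)) ⋙
      (E (flat a) c).inverse

section

variable {m n : ℕ} (e : Fin m ≃ Fin n) {a : Fin n → Obj} {a' : Fin m → Obj} {b : Obj}
  (h : ∀ i, a' i = a (e i))

theorem transport_reindex :
    (transportData Q E).reindex e h ⋙ (E a' b).functor =
      (E a b).functor ⋙ Q.reindex e fun i => congrArg F (h i) :=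
  congrArg (fun G => (E a b).functor ⋙ Q.reindex e (fun i => congrArg F (h i)) ⋙ G)
    (E a' b).counit_eq

theorem transport_reindex_obj (f : Hom n a b) :
    (E a' b).functor.obj (((transportData Q E).reindex e h).obj f) =
      (Q.reindex e fun i => congrArg F (h i)).obj ((E a b).functor.obj f) :=
  isoCat_counit_obj _ _

theorem transport_reindex_map {f g : Hom n a b} (σ : f ⟶ g) :
    HEq ((E a' b).functor.map (((transportData Q E).reindex e h).map σ))
      ((Q.reindex e fun i => congrArg F (h i)).map ((E a b).functor.map σ)) :=
  isoCat_counit_map _ _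

end

theorem transport_id (a : Obj) :
    (E (fun _ => a) a).functor.obj ((transportData Q E).id a) = Q.id (F a) :=
  isoCat_counit_obj _ _

section

variable {n : ℕ} {b : Fin n → Obj} {c : Obj} {k : Fin n → ℕ} {a : ∀ i, Fin (k i) → Obj}

theorem transport_comp₁ (g : Hom n b c) (f : ∀ i, Hom (k i) (a i) (b i)) :
    (E (flat a) c).functor.obj ((transportData Q E).comp₁ g f) =
      Q.comp₁ ((E b c).functor.obj g) fun i => (E (a i) (b i)).functor.obj (f i) :=
  isoCat_counit_obj _ _

theorem transport_comp₂ {g g' : Hom n b c} {f f' : ∀ i, Hom (k i) (a i) (b i)} (σ : g ⟶ g')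
    (τ : ∀ i, f i ⟶ f' i) :
    HEq ((E (flat a) c).functor.map ((transportData Q E).comp₂ σ τ))
      (Q.comp₂ ((E b c).functor.map σ) fun i => (E (a i) (b i)).functor.map (τ i)) :=
  isoCat_counit_map _ _

end

theorem transport_reindex_refl {n : ℕ} {a : Fin n → Obj} {b : Obj} :
    (transportData Q E).reindex (Equiv.refl _) (fun _ => rfl) = 𝟭 (Hom n a b) :=
  Eq.trans (congrArg (fun R => (E a b).functor ⋙ R ⋙ (E a b).inverse) Q.reindex_refl)
    (E a b).unit_eq.symm

theorem transport_reindex_trans {l m n : ℕ} (e : Fin l ≃ Fin m) (e' : Fin m ≃ Fin n)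
    {a : Fin n → Obj} {a' : Fin m → Obj} {a'' : Fin l → Obj} {b : Obj}
    (h : ∀ i, a'' i = a' (e i)) (h' : ∀ i, a' i = a (e' i)) :
    (transportData Q E).reindex e' h' ⋙ (transportData Q E).reindex e h =
      (transportData Q E).reindex (b := b) (e.trans e') (fun i => (h i).trans (h' (e i))) := by
  let R := Q.reindex (b := F b) (a := fun i => F (a' i)) (a' := fun i => F (a'' i)) e fun i => congrArg F (h i)
  let R' := Q.reindex (b := F b) (a := fun i => F (a i)) (a' := fun i => F (a' i)) e' fun i => congrArg F (h' i)
  have h₁ : (E a' b).inverse ⋙ (E a' b).functor ⋙ R ⋙ (E a'' b).inverse = R ⋙ (E a'' b).inverse :=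
    congrArg (fun G => G ⋙ R ⋙ (E a'' b).inverse) (E a' b).counit_eq
  refine Eq.trans (congrArg (fun G => (E a b).functor ⋙ R' ⋙ G) h₁) ?_
  exact congrArg (fun G => (E a b).functor ⋙ G ⋙ (E a'' b).inverse) (Q.reindex_trans e e' _ _)

theorem transport_comp_id₁ {n : ℕ} {b : Fin n → Obj} {c : Obj} (g : Hom n b c) :
    (transportData Q E).comp₁ g (fun i => (transportData Q E).id (b i)) =
      ((transportData Q E).reindex (unitR n) (flat_unitR b)).obj g := by
  refine isoCat_obj_injective (E _ _) ?_
  rw [transport_comp₁, transport_reindex_obj]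
  exact (congrArg (Q.comp₁ _) (funext fun i => transport_id Q E (b i))).trans (Q.comp_id₁ _)

theorem transport_id_comp₁ {k : ℕ} {a : Fin k → Obj} {b : Obj} (f : Hom k a b) :
    (transportData Q E).comp₁ ((transportData Q E).id b) (fun _ => f) =
      ((transportData Q E).reindex (unitL k) (flat_unitL a)).obj f := by
  refine isoCat_obj_injective (E _ _) ?_
  rw [transport_comp₁, transport_reindex_obj]
  exact (congrArg (fun u => Q.comp₁ u _) (transport_id Q E b)).trans (Q.id_comp₁ _)

theorem transport_assoc₁ {n : ℕ} {c : Fin n → Obj} {d : Obj} {k : Fin n → ℕ}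
    {b : ∀ i, Fin (k i) → Obj} {l : ∀ i, Fin (k i) → ℕ} {a : ∀ i j, Fin (l i j) → Obj}
    (h : Hom n c d) (g : ∀ i, Hom (k i) (b i) (c i)) (f : ∀ i j, Hom (l i j) (a i j) (b i j)) :
    (transportData Q E).comp₁ ((transportData Q E).comp₁ h g) (fun x => f (blk x) (pos x)) =
      ((transportData Q E).reindex (assocEquiv l) (flat_assocEquiv a)).obj
        ((transportData Q E).comp₁ h fun i => (transportData Q E).comp₁ (g i) (f i)) := by
  refine isoCat_obj_injective (E _ _) ?_
  rw [transport_comp₁, transport_reindex_obj, transport_comp₁, transport_comp₁]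
  refine Eq.trans (Q.assoc₁ (a := fun i j p => F (a i j p)) _ _ fun i j =>
    (E (a i j) (b i j)).functor.obj (f i j)) (congrArg _ (congrArg _ (funext fun i => ?_)))
  exact (transport_comp₁ Q E (g i) (f i)).symm

theorem transport_comp_reindex_outer₁ {m n : ℕ} (e : Fin m ≃ Fin n) {b : Fin n → Obj} {c : Obj}
    {k : Fin n → ℕ} {a : ∀ j, Fin (k j) → Obj} (g : Hom n b c)
    (f : ∀ j, Hom (k j) (a j) (b j)) :
    (transportData Q E).comp₁
        (((transportData Q E).reindex e (a' := fun i => b (e i)) (fun _ => rfl)).obj g)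
        (fun i => f (e i)) =
      ((transportData Q E).reindex (outerEquiv e k) (flat_outerEquiv e a)).obj
        ((transportData Q E).comp₁ g f) := by
  refine isoCat_obj_injective (E _ _) ?_
  rw [transport_comp₁, transport_reindex_obj, transport_reindex_obj, transport_comp₁]
  exact Q.comp_reindex_outer₁ e (a := fun j p => F (a j p)) _ fun j =>
    (E (a j) (b j)).functor.obj (f j)

theorem transport_comp_reindex_inner₁ {n : ℕ} {b : Fin n → Obj} {c : Obj} {k l : Fin n → ℕ}
    (e : ∀ i, Fin (k i) ≃ Fin (l i)) {a : ∀ i, Fin (l i) → Obj} {a' : ∀ i, Fin (k i) → Obj}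
    (h : ∀ i j, a' i j = a i (e i j)) (g : Hom n b c) (f : ∀ i, Hom (l i) (a i) (b i)) :
    (transportData Q E).comp₁ g (fun i => ((transportData Q E).reindex (e i) (h i)).obj (f i)) =
      ((transportData Q E).reindex (innerEquiv e) (flat_innerEquiv e h)).obj
        ((transportData Q E).comp₁ g f) := by
  refine isoCat_obj_injective (E _ _) ?_
  rw [transport_comp₁, transport_reindex_obj, transport_comp₁]
  refine Eq.trans (congrArg (Q.comp₁ _)
    (funext fun i => transport_reindex_obj Q E (e i) (h i) (f i))) ?_
  exact Q.comp_reindex_inner₁ e (fun i j => congrArg F (h i j)) _ _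

/-- A multicategory enriched over `Cat` is carried over along isomorphisms of categories of
multimorphisms. -/
def transport : CatMulticategory Obj Hom where
  toCatMulticategoryData := transportData Q E
  reindex_refl := transport_reindex_refl Q E
  reindex_trans := transport_reindex_trans Q E
  comp_id₁ := transport_comp_id₁ Q E
  comp_id₂ := by
    intro n b c g g' σ
    refine isoCat_heq_of_map (E _ _) (transport_comp_id₁ Q E g) (transport_comp_id₁ Q E g')
      ((transport_comp₂ Q E σ _).trans (HEq.trans ?_ (transport_reindex_map Q E _ _ σ).symm))
    have e := funext fun i => transport_id Q E (b i)
    refine HEq.trans (comp₂_congr Q.toCatMulticategoryData (θ := fun i => 𝟙 (Q.id (F (b i)))) rfl rfl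
      e e HEq.rfl fun i => ?_) (Q.comp_id₂ ((E b c).functor.map σ))
    rw [CategoryTheory.Functor.map_id, transport_id]
  id_comp₁ := transport_id_comp₁ Q E
  id_comp₂ := by
    intro k a b f f' τ
    refine isoCat_heq_of_map (E _ _) (transport_id_comp₁ Q E f) (transport_id_comp₁ Q E f')
      ((transport_comp₂ Q E _ _).trans (HEq.trans ?_ (transport_reindex_map Q E _ _ τ).symm))
    refine (comp₂_congr _ (transport_id Q E b) (transport_id Q E b) rfl rfl ?_
      fun i => HEq.rfl).trans (Q.id_comp₂ ((E a b).functor.map τ))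
    rw [CategoryTheory.Functor.map_id, transport_id]
  assoc₁ := transport_assoc₁ Q E
  assoc₂ := by
    intro n c d k b l a h h' g g' f f' ρ σ τ
    refine isoCat_heq_of_map (E _ _) (transport_assoc₁ Q E h g f) (transport_assoc₁ Q E h' g' f')
      ((transport_comp₂ Q E _ _).trans (HEq.trans ?_ (transport_reindex_map Q E _ _ _).symm))
    refine (comp₂_congr _ (transport_comp₁ Q E h g) (transport_comp₁ Q E h' g') rfl rfl
      (transport_comp₂ Q E ρ σ) fun i => HEq.rfl).trans ?_
    refine (Q.assoc₂ (a := fun i j p => F (a i j p)) ((E c d).functor.map ρ)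
      (fun i => (E (b i) (c i)).functor.map (σ i)) fun i j =>
        (E (a i j) (b i j)).functor.map (τ i j)).trans (heq_functor_map _ ?_ ?_ ?_)
    · exact ((transport_comp₁ Q E h _).trans
        (congrArg (Q.comp₁ _) (funext fun i => transport_comp₁ Q E (g i) (f i)))).symm
    · exact ((transport_comp₁ Q E h' _).trans
        (congrArg (Q.comp₁ _) (funext fun i => transport_comp₁ Q E (g' i) (f' i)))).symm
    · refine ((transport_comp₂ Q E ρ _).trans (comp₂_congr _ rfl rfl ?_ ?_ HEq.rfl fun i =>
        transport_comp₂ Q E (σ i) (τ i))).symm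
      · exact funext fun i => transport_comp₁ Q E (g i) (f i)
      · exact funext fun i => transport_comp₁ Q E (g' i) (f' i)
  comp_reindex_outer₁ := transport_comp_reindex_outer₁ Q E
  comp_reindex_outer₂ := by
    intro m n e b c k a g g' f f' σ τ
    refine isoCat_heq_of_map (E _ _) (transport_comp_reindex_outer₁ Q E e g f)
      (transport_comp_reindex_outer₁ Q E e g' f')
      ((transport_comp₂ Q E _ _).trans (HEq.trans ?_ (transport_reindex_map Q E _ _ _).symm))
    refine (comp₂_congr _ (transport_reindex_obj Q E e _ g) (transport_reindex_obj Q E e _ g') rfl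
      rfl (transport_reindex_map Q E e _ σ) fun i => HEq.rfl).trans ?_
    refine (Q.comp_reindex_outer₂ e (a := fun j p => F (a j p)) ((E b c).functor.map σ) fun j =>
      (E (a j) (b j)).functor.map (τ j)).trans (heq_functor_map _ ?_ ?_ ?_)
    · exact (transport_comp₁ Q E g f).symm
    · exact (transport_comp₁ Q E g' f').symm
    · exact (transport_comp₂ Q E σ τ).symm
  comp_reindex_inner₁ := transport_comp_reindex_inner₁ Q E
  comp_reindex_inner₂ := by
    intro n b c k l e a a' h g g' f f' σ τ
    refine isoCat_heq_of_map (E _ _) (transport_comp_reindex_inner₁ Q E e h g f)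
      (transport_comp_reindex_inner₁ Q E e h g' f')
      ((transport_comp₂ Q E _ _).trans (HEq.trans ?_ (transport_reindex_map Q E _ _ _).symm))
    have hf := funext fun i => transport_reindex_obj Q E (e i) (h i) (f i)
    have hf' := funext fun i => transport_reindex_obj Q E (e i) (h i) (f' i)
    have hτ := fun i => transport_reindex_map Q E (e i) (h i) (τ i)
    refine HEq.trans (comp₂_congr Q.toCatMulticategoryData rfl rfl hf hf' HEq.rfl hτ) ?_
    refine (Q.comp_reindex_inner₂ e (fun i j => congrArg F (h i j)) ((E b c).functor.map σ) fun i =>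
      (E (a i) (b i)).functor.map (τ i)).trans (heq_functor_map _ ?_ ?_ ?_)
    · exact (transport_comp₁ Q E g f).symm
    · exact (transport_comp₁ Q E g' f').symm
    · exact (transport_comp₂ Q E σ τ).symm

/-- The isomorphisms of categories along which a multicategory enriched over `Cat` is transported
form a multifunctor. -/
def transportMultifunctor : CatMultifunctor (transport Q E) Q F where
  map a b := (E a b).functor
  map_id := transport_id Q E
  map_reindex := transport_reindex Q E
  map_comp₁ := transport_comp₁ Q E
  map_comp₂ := transport_comp₂ Q E

end CatMulticategory

/-! ### The multicategory of permutative categories -/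

open BasedMulticategory PermCat MultiLin

theorem PermLin.same_δ_toMultiLin {k : ℕ} {C : Fin k → PermCat.{v, u}} {D : PermCat.{v', u'}}
    (f : PermLin C D) {j : Fin k} {x y z : ∀ i, (C i).Obj} (h : AddAt j x y z) :
    Same (A := D.Obj) (a := D.add (f.F.obj x) (f.F.obj y)) (b := f.F.obj z)
      (f.toMultiLin.δ j x y z h) (f.δ j x y z h) := by
  have key : ∀ g : PermLin C D, g = f → HEq (g.δ j x y z h) (f.δ j x y z h) := by
    rintro _ rfl
    rfl
  exact .of_heq rfl rfl (key _ f.toPermLin_toMultiLin)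

theorem PermLin.same_toNatTrans_toMultiLin {k : ℕ} {C : Fin k → PermCat.{v, u}}
    {D : PermCat.{v', u'}} {f g : PermLin C D} (ξ : f ⟶ g) (x : ∀ i, (C i).Obj) :
    Same (A := D.Obj) (a' := f.F.obj x) (b' := g.F.obj x)
      ((toNatTrans ((PermLin.toMultiLinFunctor C D).map ξ)).app x) (ξ.τ.app x) :=
  (same_toNatTrans_app ((PermLin.toMultiLinFunctor C D).map ξ) x).trans
    (Same.eqToHom_comp (D.sum_one fun _ => f.F.obj x) (ξ.τ.app x))

namespace MultiLin

variable {k : ℕ} {C : Fin k → PermCat.{v, u}} {D : PermCat.{v', u'}}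

theorem same_toFunctor_unit (C : PermCat.{v, u}) {x y : Fin 1 → C.Obj} (s : x ⟶ y) :
    Same (A := C.Obj) ((toFunctor (C := fun _ : Fin 1 => C) (D := C) (unit C.multicat)).map s) (s 0) :=
  (same_toFunctor_map (C := fun _ : Fin 1 => C) (D := C) (unit C.multicat) s).trans
    ((Same.of_eq (A := C.Obj) (a := C.sum fun _ : Fin 1 => x 0) (b := y 0)
      (unit_onOne C.multicat (X := x) (Y := y) fun i => C.toOne.map (s i))).trans (same_toOne (s 0)))

theorem isId_δ_unit (C : PermCat.{v, u}) {x y z : Fin 1 → C.Obj}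
    (h : AddAt (C := fun _ => C) 0 x y z) :
    IsId (A := C.Obj) (δ (C := fun _ : Fin 1 => C) (D := C) (unit C.multicat) 0 x y z h) := by
  refine (same_δ (C := fun _ : Fin 1 => C) (D := C) (unit C.multicat) h).isId ?_
  have e := unit_map C.multicat 0 (m := 2) (a := fun r => ![x, y] r 0) (eqToHom h.sumAt.1.symm)
    ![x, y] z h.sumAt.update rfl
  exact (Same.of_heq (A := C.Obj) rfl rfl e).isId ⟨_, rfl⟩

section Permute

variable {m : ℕ} (e : Fin m ≃ Fin k) (G : MultiLin (fun i => (C i).multicat) D.multicat)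

theorem same_toFunctor_permute {x y : ∀ i, (C i).Obj} (s : x ⟶ y) :
    Same (A := D.Obj) ((toFunctor (C := fun i => C (e i)) (G.permute e)).map
      (X := fun i => x (e i)) (Y := fun i => y (e i)) fun i => s (e i)) (G.toFunctor.map s) := by
  refine (same_toFunctor_map (C := fun i => C (e i)) (G.permute e) (x := fun i => x (e i))
    (y := fun i => y (e i)) fun i => s (e i)).trans (Same.trans ?_ (G.same_toFunctor_map s).symm)
  have h := permute_onOne e G (X := x) (Y := y) fun i => (C i).toOne.map (s i)
  exact .of_heq (congrArg (fun a => D.sum fun _ : Fin 1 => a) (permute_obj e G x))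
    (permute_obj e G y) h.heq

theorem same_δ_permute {i : Fin m} {x y z : ∀ i, (C i).Obj} (h : AddAt (e i) x y z)
    (h' : AddAt (C := fun i => C (e i)) i (fun i => x (e i)) (fun i => y (e i)) fun i => z (e i)) :
    Same (δ (C := fun i => C (e i)) (G.permute e) i _ _ _ h') (G.δ (e i) x y z h) := by
  have hX : ![fun i => x (e i), fun i => y (e i)] = fun r i => ![x, y] r (e i) := by
    funext r
    fin_cases r <;> rfl
  have hS : SumAt (C := fun i => C (e i)) i (fun r i => ![x, y] r (e i)) fun i => z (e i) :=
    hX ▸ h'.sumAt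
  refine (same_δ (C := fun i => C (e i)) (G.permute e) h').trans
    ((same_sdist (by rw [hX]) rfl _ hS).trans (Same.trans ?_ (G.same_δ h).symm))
  refine .of_heq (congrArg D.sum (funext fun r => permute_obj e G (![x, y] r))) (permute_obj e G z) ?_
  exact permute_map e G i (eqToHom hS.1.symm) ![x, y] z h.sumAt.update rfl _

theorem same_toNatTrans_permute {G' : MultiLin (fun i => (C i).multicat) D.multicat}
    {G : MultiLin (fun i => (C i).multicat) D.multicat} (σ : G ⟶ G') (x : ∀ i, (C i).Obj) :
    Same (A := D.Obj) (a := G.toFunctor.obj _) (b := G'.toFunctor.obj _)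
      ((toNatTrans (C := fun i => C (e i)) ((permuteFunctor e _ _).map σ)).app fun i => x (e i))
      ((toNatTrans σ).app x) := by
  have key : ∀ z : ∀ i, (C i).Obj, z = x → HEq (σ.app z) (σ.app x) := by
    rintro _ rfl
    rfl
  refine (same_toNatTrans_app (C := fun i => C (e i)) ((permuteFunctor e _ _).map σ)
    fun i => x (e i)).trans (Same.trans ?_ (same_toNatTrans_app σ x).symm)
  exact .of_heq (congrArg (fun a => D.sum fun _ : Fin 1 => a) (permute_obj e G x))
    (permute_obj e G' x) (key _ (unpermute_permute (e := e) (α := fun i => (C i).Obj) x))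

end Permute

section Comp

variable {n : ℕ} {l : Fin n → ℕ} {B : ∀ i, Fin (l i) → PermCat.{v, u}} {C : Fin n → PermCat.{v, u}}
  {D : PermCat.{v, u}} (G : MultiLin (fun i => (C i).multicat) D.multicat)
  (H : ∀ i, MultiLin (fun j => (B i j).multicat) (C i).multicat)

theorem same_toFunctor_comp {x y : ∀ i j, (B i j).Obj} (s : ∀ i j, x i j ⟶ y i j) :
    Same (A := D.Obj) ((toFunctor (C := flat B) (G.comp H)).map (X := flat x) (Y := flat y) (flat s))
      (G.toFunctor.map (X := fun i => (H i).toFunctor.obj (x i))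
        (Y := fun i => (H i).toFunctor.obj (y i))
        fun i => (H i).toFunctor.map (X := x i) (Y := y i) (s i)) := by
  refine (same_toFunctor_map (C := flat B) (G.comp H) (x := flat x) (y := flat y) (flat s)).trans
    (Same.trans ?_ (G.same_toFunctor_map _).symm)
  have h := comp_onOne G H (X := x) (Y := y) fun i j => (B i j).toOne.map (s i j)
  refine Same.trans (.of_heq (congrArg (fun a => D.sum fun _ : Fin 1 => a) (comp_obj_flat G H x))
    (comp_obj_flat G H y) h.heq) (.of_eq (A := D.Obj) (a := D.sum fun _ : Fin 1 => G.obj _)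
      (congrArg (G.onOne.map (X := fun i => (H i).obj (x i)) (Y := fun i => (H i).obj (y i)))
        (funext fun i => ?_)))
  exact Same.eq (A := (C i).Obj) (((H i).same_toFunctor_map (x := x i) (y := y i) (s i)).symm.trans
    (same_toOne ((H i).toFunctor.map (X := x i) (Y := y i) (s i))).symm)

theorem same_sdist_comp {s : Fin (∑ i, l i)} {m : ℕ} (X : Fin m → ∀ i j, (B i j).Obj)
    (z : ∀ i j, (B i j).Obj) (h : SumAt (C := flat B) s (fun r => flat (X r)) (flat z))
    (h' : SumAt (pos s) (fun r => X r (blk s)) (z (blk s)))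
    (hx : ∀ r, (fun i => (H i).obj (X r i)) =
      Function.update (β := fun i => (C i).Obj) (fun i => (H i).obj (z i)) (blk s)
        ((H (blk s)).obj (X r (blk s)))) :
    Same (A := D.Obj) (a' := D.sum fun r => G.obj fun i => (H i).obj (X r i))
      (b' := G.obj fun i => (H i).obj (z i))
      (sdist (C := flat B) (G.comp H) s (fun r => flat (X r)) (flat z) h)
      (G.map (blk s) (m := m) (a := fun r => (H (blk s)).obj (X r (blk s)))
        ((H (blk s)).sdist (pos s) (fun r => X r (blk s)) (z (blk s)) h')
        (fun r i => (H i).obj (X r i)) (fun i => (H i).obj (z i)) hx rfl) := by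
  refine .of_heq (congrArg D.sum (funext fun r => comp_obj_flat G H (X r))) (comp_obj_flat G H z) ?_
  exact comp_map_flat G H s (m := m) (a := fun r => X r (blk s) (pos s)) (eqToHom h'.1.symm) X z
    h.update rfl

theorem same_toNatTrans_hcomp {G G' : MultiLin (fun i => (C i).multicat) D.multicat}
    {H H' : ∀ i, MultiLin (fun j => (B i j).multicat) (C i).multicat} (σ : G ⟶ G')
    (ξ : ∀ i, H i ⟶ H' i) (x : ∀ i j, (B i j).Obj) :
    Same (A := D.Obj) ((toNatTrans (C := flat B) (hcomp σ ξ)).app (flat x))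
      (G.toFunctor.map (X := fun i => (H i).toFunctor.obj (x i))
        (Y := fun i => (H' i).toFunctor.obj (x i)) (fun i => (toNatTrans (ξ i)).app (x i)) ≫
        (toNatTrans σ).app fun i => (H' i).obj (x i)) := by
  refine (same_toNatTrans_app (C := flat B) (hcomp σ ξ) (flat x)).trans ?_
  refine (Same.of_heq (A := D.Obj) (congrArg (fun a => D.sum fun _ : Fin 1 => a)
    (comp_obj_flat G H x)) (comp_obj_flat G' H' x) (hcomp_app_flat σ ξ x)).trans ?_
  refine (same_post (C := D) (same_toNatTrans_app σ fun i => (H' i).obj (x i)).symm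
    (G.onOne.map (X := fun i => (H i).obj (x i)) (Y := fun i => (H' i).obj (x i))
      fun i => (ξ i).app (x i))).trans (Same.comp (Same.symm ?_) (.refl _))
  refine (G.same_toFunctor_map (x := fun i => (H i).obj (x i)) (y := fun i => (H' i).obj (x i))
    fun i => (toNatTrans (ξ i)).app (x i)).trans (.of_eq (A := D.Obj)
      (a := D.sum fun _ : Fin 1 => G.obj fun i => (H i).obj (x i)) (b := G.obj fun i => (H' i).obj (x i))
      (congrArg (G.onOne.map (X := fun i => (H i).obj (x i)) (Y := fun i => (H' i).obj (x i)))
        (funext fun i => ?_)))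
  exact Same.eq (A := (C i).Obj) ((same_toOne ((toNatTrans (ξ i)).app (x i))).trans
    (same_toNatTrans_app (ξ i) (x i)))

end Comp

end MultiLin

/-- The multicategory of permutative categories. -/
noncomputable def permutativeCategories :
    CatMulticategory PermCat.{v, u} (fun _ C D => PermLin C D) :=
  CatMulticategory.transport basedMulticategories (F := multicat) fun C D => PermLin.isoCat C D

/-- The multifunctor given by the underlying based multicategories. -/
noncomputable def underlyingMultifunctor :
    CatMultifunctor permutativeCategories.{v, u} basedMulticategories multicat :=
  CatMulticategory.transportMultifunctor basedMulticategories fun C D => PermLin.isoCat C D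

/-- The transported operations are the usual ones: the formulas hold for the induced multilinear
maps of based multicategories, and the functor and the maps `δ` of those are the given ones. -/
theorem isMulticategoryOfPermutativeCategories :
    IsMulticategoryOfPermutativeCategories permutativeCategories.{v, u} where
  id_obj _ _ := rfl
  id_map C _ _ s := (same_toFunctor_unit C s).heq
  id_δ C _ _ _ h := isId_δ_unit C h
  reindex_obj {_ _} e {_ _} f x := permute_obj e f.toMultiLin x
  reindex_map {_ _} e {_ _} f {_ _} s :=
    ((same_toFunctor_permute e f.toMultiLin s).trans (f.same_toFunctor_toMultiLin s)).heq
  reindex_δ {_ _} e {_ _} f _ _ _ _ h h' :=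
    ((same_δ_permute e f.toMultiLin h h').trans (f.same_δ_toMultiLin h)).heq
  reindex_app {_ _} e {_ _ _ _} ξ x :=
    ((same_toNatTrans_permute e ((PermLin.toMultiLinFunctor _ _).map ξ) x).trans
      (PermLin.same_toNatTrans_toMultiLin ξ x)).heq
  comp_obj g f x := comp_obj_flat g.toMultiLin (fun i => (f i).toMultiLin) x
  comp_map := by
    intro n D E k C g f x y s
    refine ((same_toFunctor_comp g.toMultiLin (fun i => (f i).toMultiLin) s).trans ?_).heq
    refine (g.same_toFunctor_toMultiLin _).trans (.of_eq (congrArg (g.F.map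
      (X := fun i => (f i).F.obj (x i)) (Y := fun i => (f i).F.obj (y i))) (funext fun i => ?_)))
    exact ((f i).same_toFunctor_toMultiLin (x := x i) (y := y i) (s i)).eq
  comp_δ := by
    intro n D E k C g f s x y z h h' w hw t ht ht'
    -- The pairs are written as families indexed by `Fin 2`, to which the description of `sdist` for a
    -- composite applies.
    have hX : ![flat x, flat y] = fun r => flat (![x, y] r) := by
      funext r
      fin_cases r <;> rfl
    have hX' : ![x (blk s), y (blk s)] = fun r => ![x, y] r (blk s) := by
      funext r
      fin_cases r <;> rfl
    have hY : ![fun i => (f i).F.obj (x i), fun i => (f i).F.obj (y i)] =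
        fun r i => (f i).F.obj (![x, y] r i) := by
      funext r
      fin_cases r <;> rfl
    have hS : SumAt (C := flat C) s (fun r => flat (![x, y] r)) (flat z) := hX ▸ h.sumAt
    have hS' : SumAt (pos s) (fun r => ![x, y] r (blk s)) (z (blk s)) := hX' ▸ h'.sumAt
    have hw' : SumAt (C := D) (blk s) (fun r i => (f i).F.obj (![x, y] r i)) w := hY ▸ hw.sumAt
    have hx : ∀ r, (fun i => (f i).F.obj (![x, y] r i)) = Function.update
        (β := fun i => (D i).Obj) (fun i => (f i).F.obj (z i)) (blk s)
          ((f (blk s)).F.obj (![x, y] r (blk s))) := by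
      intro r
      funext i
      by_cases hi : i = blk s
      · subst hi
        rw [Function.update_self]
      · rw [Function.update_of_ne hi]
        exact (hw'.2 i hi r).trans (ht' i hi).1
    refine Same.heq (((same_δ (C := flat C) (g.toMultiLin.comp fun i => (f i).toMultiLin) h).trans
      (same_sdist (by rw [hX]) rfl _ hS)).trans
      ((same_sdist_comp g.toMultiLin (fun i => (f i).toMultiLin) ![x, y] z hS hS' hx).trans ?_))
    refine (g.same_lmap _ _ _ hx rfl hw' t ?_ ht').trans (Same.comp ?_ (.refl _))
    · refine (Same.of_heq hw.1 rfl ht).trans ?_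
      refine ((f (blk s)).same_δ_toMultiLin h').symm.trans (((f (blk s)).toMultiLin.same_δ h').trans ?_)
      exact same_sdist (by rw [hX']) rfl _ _
    · exact (g.same_lam (blk s) hY.symm rfl _ _).trans (g.same_lam_two hw)
  comp_app := by
    intro n D E k C g g' f f' σ ξ x
    refine ((same_toNatTrans_hcomp ((PermLin.toMultiLinFunctor _ _).map σ)
      (fun i => (PermLin.toMultiLinFunctor _ _).map (ξ i)) x).trans (Same.comp ?_
        (PermLin.same_toNatTrans_toMultiLin σ _))).heq
    refine (g.same_toFunctor_toMultiLin _).trans (.of_eq (congrArg (g.F.map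
      (X := fun i => (f i).F.obj (x i)) (Y := fun i => (f' i).F.obj (x i))) (funext fun i => ?_)))
    exact (PermLin.same_toNatTrans_toMultiLin (ξ i) (x i)).eq

/-- The transported multifunctor is given by the maps `lmap`. -/
theorem isUnderlyingMultifunctor :
    IsUnderlyingMultifunctor (hU := fun C => C.isBased_underlyingData)
      underlyingMultifunctor.{v, u} where
  map_obj_obj _ _ := rfl
  map_obj_map {k C D} f j {m a a'} φ x x' hx hx' z hz s hj hs := by
    obtain rfl : a = fun r => x r j := funext fun r => by rw [hx, Function.update_self]
    exact heq_of_eq (f.lmap_eq φ x x' hx hx' hz s (.of_heq hz.1 hx' hj) hs)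
  map_map _ _ := HEq.rfl

end PermMult

theorem theorem1p1 :
    ∃ (P : CatMulticategory PermCat.{v, u} (fun _ C D => PermLin C D))
      (Q : CatMulticategory BasedMulticategory.{v, u} (fun _ M N => MultiLin M N))
      (hU : ∀ C : PermCat.{v, u}, C.underlyingData.IsBased)
      (U : CatMultifunctor P Q (fun C => C.underlying (hU C))),
      IsMulticategoryOfPermutativeCategories P ∧ IsMulticategoryOfBasedMulticategories Q ∧
        IsUnderlyingMultifunctor U ∧ U.IsFullyFaithful :=
  ⟨permutativeCategories, basedMulticategories, fun C => C.isBased_underlyingData,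
    underlyingMultifunctor, isMulticategoryOfPermutativeCategories,
    isMulticategoryOfBasedMulticategories, isUnderlyingMultifunctor,
    fun _ C D => ⟨PermLin.isoCat C D, rfl⟩⟩
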